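/- **Theorem 1.4.** Fix an integer $N\ge 0$. *Setting.* Let $a$ be a variable of bidegree $(2,0)$ ($a$-degree $2$, $x$-degree $0$); every variable marking a point of a diagram has bidegree $(0,2)$. All matrix factorizations are $\mathbb Z_2\oplus\mathbb Z^{2}$-graded, with differential $d_{mf}$ of $\mathbb{Z}_2$-degree $1$ and bidegree $(1,N+1)$ and $d_{mf}^2=w\cdot\mathrm{id}$ for a potential $w$ of bidegree $(2,2N+2)$; $\langle1\rangle$ shifts the $\mathbb Z_2$-grading, and $\{q,r\}$ shifts the $a$- and $x$-gradings: $(H\{q,r\})^{\varepsilon,i,j,k}=H^{\varepsilon,i,j-q,k-r}$. For $a_0,a_1$ in a ring $R$ with $\deg a_0=(p,q)$, $(a_0,a_1)_R$ is the Koszul factorization $R\xrightarrow{a_0}R\{1-p,N+1-q\}\xrightarrow{a_1}R$, and several rows mean the tensor product over $R$. An arc from a point marked $x_2$ to a point marked $x_1$ has the factorization $\left(a\frac{x_1^{N+1}-x_2^{N+1}}{x_1-x_2},\,x_1-x_2\right)$ (the fraction denotes the polynomial). For a crossing with incoming ends $y_2$ (left), $x_2$ (right) and outgoing ends $x_1$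 (left), $y_1$ (right), $\mathcal C_N(\Gamma_0)$ is the tensor product of the factorizations of the two arcs $x_2\to y_1$ and $y_2\to x_1$. Let $p(e_1,e_2)$ be the polynomial with $p(x+y,xy)=x^{N+1}+y^{N+1}$, and let $Z_1,Z_2$ be variables of bidegrees $(0,2)$, $(0,4)$. Then $$\mathcal C_N(\Gamma_1)=\begin{pmatrix} a\frac{p(x_1+y_1,\,x_1y_1)-p(Z_1,\,x_1y_1)}{x_1+y_1-Z_1} & x_1+y_1-Z_1\\ a\frac{p(Z_1,\,x_1y_1)-p(Z_1,Z_2)}{x_1y_1-Z_2} & x_1y_1-Z_2\\ a\frac{p(Z_1,Z_2)-p(x_2+y_2,Z_2)}{Z_1-x_2-y_2} & Z_1-x_2-y_2\\ a\frac{p(x_2+y_2,Z_2)-p(x_2+y_2,\,x_2y_2)}{Z_2-x_2y_2} & Z_2-x_2y_2\end{pmatrix}\{0,-1\}$$ over $\mathbb Q[a,x_1,y_1,x_2,y_2,Z_1,Z_2]$, regarded over $\mathbb Q[a,x_1,y_1,x_2,y_2]$. Let $\chi^0:\mathcal C_N(\Gamma_0)\to\mathcal C_N(\Gamma_1)$ and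 $\chi^1:\mathcal C_N(\Gamma_1)\to\mathcal C_N(\Gamma_0)$ be the standard morphisms: homogeneous of $\mathbb Z_2$-degree $0$ and bidegree $(0,1)$, homotopically non-trivial, with $\chi^1\chi^0\simeq(x_2-x_1)\,\mathrm{id}$ and $\chi^0\chi^1\simeq(x_2-x_1)\,\mathrm{id}$; they are unique up to homotopy and scaling. The complexes of a positive and of a negative crossing are $$0\to\underbrace{\mathcal C_N(\Gamma_1)\langle1\rangle\{1,N\}}_{-1}\xrightarrow{\chi^1}\underbrace{\mathcal C_N(\Gamma_0)\langle1\rangle\{1,N-1\}}_{0}\to0,\qquad 0\to\underbrace{\mathcal C_N(\Gamma_0)\langle1\rangle\{-1,-N+1\}}_{0}\xrightarrow{\chi^0}\underbrace{\mathcal C_N(\Gamma_1)\langle1\rangle\{-1,-N\}}_{1}\to0,$$ where under-braces give homological degrees. For a closed braid $L$, cut at marked points into crossings and arcs, $\mathcal C_N(L)$ is the tensor product of the complexes of all pieces over the polynomial ring over $\mathbb Q[a]$ in the marked points, with its differentials $d_{mf}$, $d_\chi$ (here $d_{mf}^2=0$) and its $\mathbb Z_2$-, homological, $a$- and $x$-gradings.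 Put $$\mathcal H_N(L)=H(H(\mathcal C_N(L),d_{mf}),d_\chi),\qquad \mathscr H_N(L)=H(H(\mathcal C_N(L)/a\,\mathcal C_N(L),d_{mf}),d_\chi),$$ and let $\pi_0$ denote the maps induced by the quotient map $\mathcal C_N(L)\to\mathcal C_N(L)/a\,\mathcal C_N(L)$. *Statement.* Let $L$ be a closed braid, the closure of a braid $\mu$ on $b\ge1$ strands, and let $L_-$ be obtained from $L$ by one negative stabilization, i.e. $L_-$ is the closure of the $(b+1)$-strand braid $\mu\sigma_b^{-1}$. Then the complex $(H(\mathcal C_N(L_-),d_{mf}),d_\chi)$ of graded $\mathbb Q[a]$-modules is homotopy equivalent (i.e. isomorphic in the homotopy category of complexes of graded $\mathbb Q[a]$-modules) to the total complex of $$0\to\underbrace{(H(\mathcal C_N(L),d_{mf}),d_\chi)\{-2,0\}}_{0}\xrightarrow{\ \pi_0\ }\underbrace{(H(\mathcal C_N(L)/a\,\mathcal C_N(L),d_{mf}),d_\chi)\{-2,0\}}_{1}\to0,$$ where the under-braces indicate the shift of the homological degree; the homotopy equivalence preserves the $\mathbb Z_2$-, homological, $a$- and $x$-gradings. Moreover,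 there is, for every $\varepsilon\in\mathbb Z_2$, a long exact sequence of $\mathbb Q[a]$-modules $$\cdots\to\mathcal H_N^{\varepsilon,i-1}(L)\{-2,0\}\xrightarrow{\pi_0}\mathscr H_N^{\varepsilon,i-1}(L)\{-2,0\}\to\mathcal H_N^{\varepsilon,i}(L_-)\to\mathcal H_N^{\varepsilon,i}(L)\{-2,0\}\xrightarrow{\pi_0}\mathscr H_N^{\varepsilon,i}(L)\{-2,0\}\to\cdots$$ preserving the $a$- and $x$-gradings. -/

import Mathlib

/-! Transverse Khovanov-Rozansky homology of closed braids with potential `a x ^ (N + 1)`. -/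

namespace TransverseKR

noncomputable section

open scoped Polynomial TensorProduct

/-! ### Graded matrix factorizations -/

section Rows

variable {R M : Type} [CommRing R] [AddCommGroup M] [Module R M]

/-- The differential of the tensor product of a matrix factorization, with differential `d` and
sign involution `s`, and the two-term factorization `R → R → R` with maps `a₀` and `a₁`.  The pair
`(m₀, m₁)` stands for `m₀ ⊗ 1₀ + m₁ ⊗ 1₁`, and the signed Leibniz rule holds. -/
def rowD (d s : M →ₗ[R] M) (a₀ a₁ : R) : M × M →ₗ[R] M × M :=
  LinearMap.prod (d ∘ₗ LinearMap.fst R M M + a₁ • (s ∘ₗ LinearMap.snd R M M))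
    (d ∘ₗ LinearMap.snd R M M + a₀ • (s ∘ₗ LinearMap.fst R M M))

/-- The sign involution of that tensor product. -/
def rowS (s : M →ₗ[R] M) : M × M →ₗ[R] M × M := s.prodMap (-s)

@[simp] theorem rowD_apply (d s : M →ₗ[R] M) (a₀ a₁ : R) (x y : M) :
    rowD d s a₀ a₁ (x, y) = (d x + a₁ • s y, d y + a₀ • s x) := rfl

@[simp] theorem rowS_apply (s : M →ₗ[R] M) (x y : M) : rowS s (x, y) = (s x, -s y) := rfl

end Rows

/-- A matrix factorization of `w` over `R`.  The two summands `M₀`, `M₁` are put into one module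
`M₀ ⊕ M₁`; `d` is the differential, `s` is the involution equal to `(-1) ^ ε` in `ℤ/2`-degree `ε`,
and `gr ε j k` is the group of homogeneous elements of `ℤ/2`-degree `ε`, `a`-degree `j` and
`x`-degree `k`. -/
structure MF (R : Type) [CommRing R] where
  carrier : Type
  [acg : AddCommGroup carrier]
  [mod : Module R carrier]
  w : R
  d : carrier →ₗ[R] carrier
  s : carrier →ₗ[R] carrier
  gr : ZMod 2 → ℤ → ℤ → AddSubgroup carrier
  d_d : ∀ x, d (d x) = w • x
  s_s : ∀ x, s (s x) = x
  s_d : ∀ x, s (d x) = -d (s x)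

attribute [instance] MF.acg MF.mod

namespace MF

variable {R : Type} [CommRing R]

/-- The ring `R` itself in `ℤ/2`-degree `0`, where `g` is the bigrading of `R`. -/
def base (g : ℤ → ℤ → AddSubgroup R) : MF R where
  carrier := R
  w := 0
  d := 0
  s := LinearMap.id
  gr ε j k := if ε = 0 then g j k else ⊥
  d_d := by simp
  s_s := by simp
  s_d := by simp

/-- The tensor product of `M` with the Koszul matrix factorization
`(a₀, a₁) = (R → R{1 - p, n + 1 - q} → R)`, where `(p, q)` is the degree of `a₀` and the potentials
have degree `(2, 2 n + 2)`. -/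
def row (n : ℕ) (M : MF R) (a₀ a₁ : R) (p q : ℤ) : MF R where
  carrier := M.carrier × M.carrier
  w := M.w + a₀ * a₁
  d := rowD M.d M.s a₀ a₁
  s := rowS M.s
  gr ε j k := (M.gr ε j k).prod (M.gr (ε + 1) (j - (1 - p)) (k - (n + 1 - q)))
  d_d := by
    rintro ⟨x, y⟩
    simp [M.d_d, M.s_s, M.s_d, add_smul, smul_smul, mul_comm]
  s_s := by
    rintro ⟨x, y⟩
    simp [M.s_s]
  s_d := by
    rintro ⟨x, y⟩
    ext
    · simp [M.s_d, M.s_s, add_comm]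
    · simp [M.s_d, M.s_s, add_comm]

/-- The shift `M⟨1⟩` of the `ℤ/2`-grading. -/
def susp (M : MF R) : MF R where
  carrier := M.carrier
  w := M.w
  d := M.d
  s := -M.s
  gr ε j k := M.gr (ε + 1) j k
  d_d := M.d_d
  s_s := by simp [M.s_s]
  s_d := by simp [M.s_d]

/-- The shift `M{p, q}` of the `a`- and `x`-gradings. -/
def shift (M : MF R) (p q : ℤ) : MF R where
  carrier := M.carrier
  w := M.w
  d := M.d
  s := M.s
  gr ε j k := M.gr ε (j - p) (k - q)
  d_d := M.d_d
  s_s := M.s_s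
  s_d := M.s_d

/-- A matrix factorization over an `R`-algebra `A`, regarded as one over `R`, when its potential
is the image of `w : R`. -/
def restrict {A : Type} [CommRing A] [Algebra R A] (M : MF A) (w : R)
    (h : algebraMap R A w = M.w) : MF R :=
  letI : Module R M.carrier := Module.compHom M.carrier (algebraMap R A)
  { carrier := M.carrier
    w := w
    d := { toFun := M.d, map_add' := M.d.map_add, map_smul' := fun c x => M.d.map_smul _ x }
    s := { toFun := M.s, map_add' := M.s.map_add, map_smul' := fun c x => M.s.map_smul _ x }
    gr := M.gr
    d_d := fun x => (M.d_d x).trans (by rw [← h]; rfl)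
    s_s := M.s_s
    s_d := M.s_d }

/-- Linear maps commuting with the differentials and preserving the `ℤ/2`-grading. -/
structure Hom (M M' : MF R) where
  f : M.carrier →ₗ[R] M'.carrier
  f_d : ∀ x, f (M.d x) = M'.d (f x)
  f_s : ∀ x, f (M.s x) = M'.s (f x)

/-- Composition. -/
def Hom.comp {M M' M'' : MF R} (φ : Hom M' M'') (ψ : Hom M M') : Hom M M'' where
  f := φ.f ∘ₗ ψ.f
  f_d x := by simp [ψ.f_d, φ.f_d]
  f_s x := by simp [ψ.f_s, φ.f_s]

/-- A morphism `M → M'`, regarded as a morphism `M⟨1⟩ → M'⟨1⟩`. -/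
def Hom.susp {M M' : MF R} (φ : Hom M M') : Hom M.susp M'.susp where
  f := φ.f
  f_d := φ.f_d
  f_s x := (map_neg φ.f _).trans (congrArg Neg.neg (φ.f_s x))

/-- A morphism `M → M'`, regarded as a morphism `M{p, q} → M'{p', q'}`. -/
def Hom.shift {M M' : MF R} (φ : Hom M M') (p q p' q' : ℤ) :
    Hom (M.shift p q) (M'.shift p' q') where
  f := φ.f
  f_d := φ.f_d
  f_s := φ.f_s

end MF

/-! ### Complexes of graded matrix factorizations -/

/-- A bounded complex of graded matrix factorizations of `w` over `R`, put into one module.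
`dmf` is the differential of the matrix factorizations, `dχ` the differential of the complex,
`s` and `t` are the involutions equal to `(-1) ^ ε` in `ℤ/2`-degree `ε` and to `(-1) ^ i` in
homological degree `i`, and `gr ε i j k` is the group of homogeneous elements of
`ℤ/2`-degree `ε`, homological degree `i`, `a`-degree `j` and `x`-degree `k`. -/
structure Cx (R : Type) [CommRing R] where
  carrier : Type
  [acg : AddCommGroup carrier]
  [mod : Module R carrier]
  w : R
  dmf : carrier →ₗ[R] carrier
  dχ : carrier →ₗ[R] carrier
  s : carrier →ₗ[R] carrier
  t : carrier →ₗ[R] carrier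
  gr : ZMod 2 → ℤ → ℤ → ℤ → AddSubgroup carrier
  dmf_dmf : ∀ x, dmf (dmf x) = w • x
  dχ_dχ : ∀ x, dχ (dχ x) = 0
  dmf_dχ : ∀ x, dmf (dχ x) = dχ (dmf x)
  s_s : ∀ x, s (s x) = x
  t_t : ∀ x, t (t x) = x
  s_t : ∀ x, s (t x) = t (s x)
  s_dmf : ∀ x, s (dmf x) = -dmf (s x)
  s_dχ : ∀ x, s (dχ x) = dχ (s x)
  t_dmf : ∀ x, t (dmf x) = dmf (t x)
  t_dχ : ∀ x, t (dχ x) = -dχ (t x)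

attribute [instance] Cx.acg Cx.mod

namespace Cx

variable {R : Type} [CommRing R]

/-- A matrix factorization as a complex concentrated in homological degree `0`. -/
def single (M : MF R) : Cx R where
  carrier := M.carrier
  w := M.w
  dmf := M.d
  dχ := 0
  s := M.s
  t := LinearMap.id
  gr ε i j k := if i = 0 then M.gr ε j k else ⊥
  dmf_dmf := M.d_d
  dχ_dχ := by simp
  dmf_dχ := by simp
  s_s := M.s_s
  t_t := by simp
  s_t := by simp
  s_dmf := M.s_d
  s_dχ := by simp
  t_dmf := by simp
  t_dχ := by simp

/-- The complex `0 → M₀ → M₁ → 0` with `M₀` in homological degree `i₀` and `M₁` in homological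
degree `i₀ + 1`. -/
def twoTerm (i₀ : ℤ) (M₀ M₁ : MF R) (f : MF.Hom M₀ M₁) (hw : M₁.w = M₀.w) : Cx R where
  carrier := M₀.carrier × M₁.carrier
  w := M₀.w
  dmf := M₀.d.prodMap M₁.d
  dχ := LinearMap.prod 0 (f.f ∘ₗ LinearMap.fst R _ _)
  s := M₀.s.prodMap M₁.s
  t := (i₀.negOnePow : ℤ) •
    (LinearMap.id : M₀.carrier →ₗ[R] M₀.carrier).prodMap (-LinearMap.id)
  gr ε i j k := (if i = i₀ then M₀.gr ε j k else ⊥).prod (if i = i₀ + 1 then M₁.gr ε j k else ⊥)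
  dmf_dmf := by
    rintro ⟨x, y⟩
    simp [M₀.d_d, M₁.d_d, hw]
  dχ_dχ := by
    rintro ⟨x, y⟩
    simp
  dmf_dχ := by
    rintro ⟨x, y⟩
    simp [f.f_d]
  s_s := by
    rintro ⟨x, y⟩
    simp [M₀.s_s, M₁.s_s]
  t_t := by
    rintro ⟨x, y⟩
    rcases Int.even_or_odd i₀ with h | h
    · simp [Int.negOnePow_even _ h]
    · simp [Int.negOnePow_odd _ h]
  s_t := by
    rintro ⟨x, y⟩
    rcases Int.even_or_odd i₀ with h | h
    · simp [Int.negOnePow_even _ h]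
    · simp [Int.negOnePow_odd _ h]
  s_dmf := by
    rintro ⟨x, y⟩
    simp [M₀.s_d, M₁.s_d]
  s_dχ := by
    rintro ⟨x, y⟩
    simp [f.f_s]
  t_dmf := by
    rintro ⟨x, y⟩
    rcases Int.even_or_odd i₀ with h | h
    · simp [Int.negOnePow_even _ h]
    · simp [Int.negOnePow_odd _ h]
  t_dχ := by
    rintro ⟨x, y⟩
    rcases Int.even_or_odd i₀ with h | h
    · simp [Int.negOnePow_even _ h]
    · simp [Int.negOnePow_odd _ h]

/-- The tensor product of two complexes over `R`: both differentials follow the signed Leibniz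
rule, each with respect to its own grading, and the gradings are additive. -/
def tens (C D : Cx R) : Cx R where
  carrier := C.carrier ⊗[R] D.carrier
  w := C.w + D.w
  dmf := TensorProduct.map C.dmf LinearMap.id + TensorProduct.map C.s D.dmf
  dχ := TensorProduct.map C.dχ LinearMap.id + TensorProduct.map C.t D.dχ
  s := TensorProduct.map C.s D.s
  t := TensorProduct.map C.t D.t
  gr ε i j k := AddSubgroup.closure
    {z | ∃ ε₁ i₁ j₁ k₁ ε₂ i₂ j₂ k₂, ε₁ + ε₂ = ε ∧ i₁ + i₂ = i ∧ j₁ + j₂ = j ∧ k₁ + k₂ = k ∧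
      ∃ x ∈ C.gr ε₁ i₁ j₁ k₁, ∃ y ∈ D.gr ε₂ i₂ j₂ k₂, z = x ⊗ₜ[R] y}
  dmf_dmf z := by
    induction z with
    | zero => simp
    | add x y hx hy => simp only [map_add, hx, hy, smul_add]
    | tmul x y =>
      simp [C.dmf_dmf, D.dmf_dmf, C.s_s, C.s_dmf, add_smul, TensorProduct.neg_tmul,
        TensorProduct.smul_tmul']
  dχ_dχ z := by
    induction z with
    | zero => simp
    | add x y hx hy => simp only [map_add, hx, hy, add_zero]
    | tmul x y => simp [C.dχ_dχ, D.dχ_dχ, C.t_dχ, TensorProduct.neg_tmul]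
  dmf_dχ z := by
    induction z with
    | zero => simp
    | add x y hx hy => simp only [map_add, hx, hy]
    | tmul x y =>
      simp [C.dmf_dχ, D.dmf_dχ, C.t_dmf, C.s_dχ, C.s_t]
      abel
  s_s z := by
    induction z with
    | zero => simp
    | add x y hx hy => simp only [map_add, hx, hy]
    | tmul x y => simp [C.s_s, D.s_s]
  t_t z := by
    induction z with
    | zero => simp
    | add x y hx hy => simp only [map_add, hx, hy]
    | tmul x y => simp [C.t_t, D.t_t]
  s_t z := by
    induction z with
    | zero => simp
    | add x y hx hy => simp only [map_add, hx, hy]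
    | tmul x y => simp [C.s_t, D.s_t]
  s_dmf z := by
    induction z with
    | zero => simp
    | add x y hx hy => simp only [map_add, hx, hy, neg_add]
    | tmul x y =>
      simp [C.s_dmf, D.s_dmf, C.s_s, TensorProduct.neg_tmul, TensorProduct.tmul_neg]
      abel
  s_dχ z := by
    induction z with
    | zero => simp
    | add x y hx hy => simp only [map_add, hx, hy]
    | tmul x y => simp [C.s_dχ, D.s_dχ, C.s_t]
  t_dmf z := by
    induction z with
    | zero => simp
    | add x y hx hy => simp only [map_add, hx, hy]
    | tmul x y => simp [C.t_dmf, D.t_dmf, C.s_t]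
  t_dχ z := by
    induction z with
    | zero => simp
    | add x y hx hy => simp only [map_add, hx, hy, neg_add]
    | tmul x y =>
      simp [C.t_dχ, D.t_dχ, C.t_t, TensorProduct.neg_tmul, TensorProduct.tmul_neg]
      abel

/-- The submodule `b C`. -/
def multiples (C : Cx R) (b : R) : Submodule R C.carrier :=
  LinearMap.range (LinearMap.lsmul R C.carrier b)

theorem multiples_le (C : Cx R) (b : R) (f : C.carrier →ₗ[R] C.carrier) :
    C.multiples b ≤ (C.multiples b).comap f := by
  rintro _ ⟨x, rfl⟩
  exact ⟨f x, by simp⟩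

/-- The quotient complex `C / b C`. -/
def quot (C : Cx R) (b : R) : Cx R where
  carrier := C.carrier ⧸ C.multiples b
  w := C.w
  dmf := Submodule.mapQ _ _ C.dmf (C.multiples_le b _)
  dχ := Submodule.mapQ _ _ C.dχ (C.multiples_le b _)
  s := Submodule.mapQ _ _ C.s (C.multiples_le b _)
  t := Submodule.mapQ _ _ C.t (C.multiples_le b _)
  gr ε i j k := (C.gr ε i j k).map (C.multiples b).mkQ.toAddMonoidHom
  dmf_dmf x := by
    obtain ⟨x, rfl⟩ := Submodule.mkQ_surjective _ x
    simp [C.dmf_dmf]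
  dχ_dχ x := by
    obtain ⟨x, rfl⟩ := Submodule.mkQ_surjective _ x
    simp [C.dχ_dχ]
  dmf_dχ x := by
    obtain ⟨x, rfl⟩ := Submodule.mkQ_surjective _ x
    simp [C.dmf_dχ]
  s_s x := by
    obtain ⟨x, rfl⟩ := Submodule.mkQ_surjective _ x
    simp [C.s_s]
  t_t x := by
    obtain ⟨x, rfl⟩ := Submodule.mkQ_surjective _ x
    simp [C.t_t]
  s_t x := by
    obtain ⟨x, rfl⟩ := Submodule.mkQ_surjective _ x
    simp [C.s_t]
  s_dmf x := by
    obtain ⟨x, rfl⟩ := Submodule.mkQ_surjective _ x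
    simp [C.s_dmf]
  s_dχ x := by
    obtain ⟨x, rfl⟩ := Submodule.mkQ_surjective _ x
    simp [C.s_dχ]
  t_dmf x := by
    obtain ⟨x, rfl⟩ := Submodule.mkQ_surjective _ x
    simp [C.t_dmf]
  t_dχ x := by
    obtain ⟨x, rfl⟩ := Submodule.mkQ_surjective _ x
    simp [C.t_dχ]

end Cx

/-! ### Graded complexes of `ℚ[a]`-modules and their homology -/

/-- A cochain complex of graded `ℚ[a]`-modules, put into one module; `gr ε i j k` is the group of
homogeneous elements of `ℤ/2`-degree `ε`, homological degree `i`, `a`-degree `j` and `x`-degree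
`k`. -/
structure GrCx where
  carrier : Type
  [acg : AddCommGroup carrier]
  [mod : Module ℚ[X] carrier]
  d : carrier →ₗ[ℚ[X]] carrier
  gr : ZMod 2 → ℤ → ℤ → ℤ → AddSubgroup carrier
  d_d : ∀ x, d (d x) = 0

attribute [instance] GrCx.acg GrCx.mod

namespace GrCx

/-- Chain maps. -/
structure Hom (X Y : GrCx) where
  f : X.carrier →ₗ[ℚ[X]] Y.carrier
  f_d : ∀ x, f (X.d x) = Y.d (f x)

/-- The shift `X{p, q}` of the `a`- and `x`-gradings. -/
def shift (X : GrCx) (p q : ℤ) : GrCx where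
  carrier := X.carrier
  d := X.d
  gr ε i j k := X.gr ε i (j - p) (k - q)
  d_d := X.d_d

/-- A chain map `X → Y`, regarded as a chain map `X{p, q} → Y{p, q}`. -/
def Hom.shift {X Y : GrCx} (f : Hom X Y) (p q : ℤ) : Hom (X.shift p q) (Y.shift p q) where
  f := f.f
  f_d := f.f_d

/-- The total complex of `0 → X → Y → 0`, where `X` is placed in position `0` and `Y` in
position `1` (so that homological degree `i - 1` of `Y` contributes to degree `i`). -/
def cone {X Y : GrCx} (f : Hom X Y) : GrCx where
  carrier := X.carrier × Y.carrier
  d := LinearMap.prod (X.d ∘ₗ LinearMap.fst _ _ _)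
    (f.f ∘ₗ LinearMap.fst _ _ _ - Y.d ∘ₗ LinearMap.snd _ _ _)
  gr ε i j k := (X.gr ε i j k).prod (Y.gr ε (i - 1) j k)
  d_d := by
    rintro ⟨x, y⟩
    simp [X.d_d, Y.d_d, f.f_d]

/-- The cycles of `X`. -/
abbrev cycles (X : GrCx) : Submodule ℚ[X] X.carrier := LinearMap.ker X.d

/-- The boundaries of `X`, as a submodule of the cycles. -/
abbrev boundaries (X : GrCx) : Submodule ℚ[X] X.cycles :=
  (LinearMap.range X.d).comap X.cycles.subtype

/-- The homology of `X`, in all degrees. -/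
abbrev Homology (X : GrCx) : Type := X.cycles ⧸ X.boundaries

/-- The homogeneous elements of `X.Homology` of the given degree: the classes of homogeneous
cycles. -/
def hgr (X : GrCx) (ε : ZMod 2) (i j k : ℤ) : AddSubgroup X.Homology :=
  ((X.gr ε i j k).comap X.cycles.subtype.toAddMonoidHom).map X.boundaries.mkQ.toAddMonoidHom

/-- The map induced on homology by a chain map. -/
def Hom.homology {X Y : GrCx} (f : Hom X Y) : X.Homology →ₗ[ℚ[X]] Y.Homology :=
  Submodule.mapQ _ _
    (f.f.restrict (p := X.cycles) (q := Y.cycles) fun x hx => by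
      rw [LinearMap.mem_ker] at hx ⊢
      rw [← f.f_d, hx, map_zero])
    (by
      rintro ⟨x, hx⟩ ⟨y, hy⟩
      exact ⟨f.f y, by rw [← f.f_d, hy]; rfl⟩)

/-- A homotopy equivalence of graded complexes of `ℚ[a]`-modules: chain maps in both directions
preserving all gradings, and homotopies lowering the homological degree by one and preserving the
other gradings. -/
structure HomotopyEquiv (X Y : GrCx) where
  hom : Hom X Y
  inv : Hom Y X
  hom_gr : ∀ ε i j k, ∀ x ∈ X.gr ε i j k, hom.f x ∈ Y.gr ε i j k
  inv_gr : ∀ ε i j k, ∀ y ∈ Y.gr ε i j k, inv.f y ∈ X.gr ε i j k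
  homotopyX : X.carrier →ₗ[ℚ[X]] X.carrier
  homotopyY : Y.carrier →ₗ[ℚ[X]] Y.carrier
  homotopyX_gr : ∀ ε i j k, ∀ x ∈ X.gr ε i j k, homotopyX x ∈ X.gr ε (i - 1) j k
  homotopyY_gr : ∀ ε i j k, ∀ y ∈ Y.gr ε i j k, homotopyY y ∈ Y.gr ε (i - 1) j k
  inv_hom : ∀ x, inv.f (hom.f x) - x = X.d (homotopyX x) + homotopyX (X.d x)
  hom_inv : ∀ y, hom.f (inv.f y) - y = Y.d (homotopyY y) + homotopyY (Y.d y)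

/-- For a chain map `π : X → Y` and a complex `W`, the statement that `δ` and `β` form, together
with the map induced by `π`, a long exact sequence
`⋯ → H^{i-1}(X) → H^{i-1}(Y) → H^i(W) → H^i(X) → H^i(Y) → ⋯` (maps `π, δ, β, π`)
for every `ℤ/2`-degree, preserving the `a`- and `x`-gradings. -/
structure IsLongExact {X Y W : GrCx} (π : Hom X Y) (δ : Y.Homology →ₗ[ℚ[X]] W.Homology)
    (β : W.Homology →ₗ[ℚ[X]] X.Homology) : Prop where
  π_gr : ∀ ε i j k, ∀ x ∈ X.hgr ε i j k, π.homology x ∈ Y.hgr ε i j k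
  δ_gr : ∀ ε i j k, ∀ y ∈ Y.hgr ε (i - 1) j k, δ y ∈ W.hgr ε i j k
  β_gr : ∀ ε i j k, ∀ w ∈ W.hgr ε i j k, β w ∈ X.hgr ε i j k
  exact_Y : ∀ ε i j k, ∀ y ∈ Y.hgr ε (i - 1) j k,
    δ y = 0 ↔ ∃ x ∈ X.hgr ε (i - 1) j k, π.homology x = y
  exact_W : ∀ ε i j k, ∀ w ∈ W.hgr ε i j k,
    β w = 0 ↔ ∃ y ∈ Y.hgr ε (i - 1) j k, δ y = w
  exact_X : ∀ ε i j k, ∀ x ∈ X.hgr ε i j k,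
    π.homology x = 0 ↔ ∃ w ∈ W.hgr ε i j k, β w = x

end GrCx

namespace Cx

variable {R : Type} [CommRing R]

/-- The elements killed by `dmf`. -/
abbrev cycles (C : Cx R) : Submodule R C.carrier := LinearMap.ker C.dmf

/-- The image of `dmf`, intersected with its kernel (it is contained in it if `C.w = 0`). -/
abbrev boundaries (C : Cx R) : Submodule R C.cycles :=
  (LinearMap.range C.dmf).comap C.cycles.subtype

/-- Linear maps commuting with both differentials. -/
structure Hom (C D : Cx R) where
  f : C.carrier →ₗ[R] D.carrier
  f_dmf : ∀ x, f (C.dmf x) = D.dmf (f x)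
  f_dχ : ∀ x, f (C.dχ x) = D.dχ (f x)

/-- The map induced on the homology with respect to `dmf`. -/
def Hom.onH {C D : Cx R} (f : Hom C D) :
    (C.cycles ⧸ C.boundaries) →ₗ[R] (D.cycles ⧸ D.boundaries) :=
  Submodule.mapQ _ _
    (f.f.restrict (p := C.cycles) (q := D.cycles) fun x hx => by
      rw [LinearMap.mem_ker] at hx ⊢
      rw [← f.f_dmf, hx, map_zero])
    (by
      rintro ⟨x, hx⟩ ⟨y, hy⟩
      exact ⟨f.f y, by rw [← f.f_dmf, hy]; rfl⟩)

/-- `dχ` as a morphism. -/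
def dχHom (C : Cx R) : Hom C C where
  f := C.dχ
  f_dmf x := (C.dmf_dχ x).symm
  f_dχ _ := rfl

variable [Algebra ℚ[X] R]

/-- The graded complex `(H(C, dmf), dχ)` of `ℚ[a]`-modules. -/
def H (C : Cx R) : GrCx :=
  letI : Module ℚ[X] (C.cycles ⧸ C.boundaries) := Module.compHom _ (algebraMap ℚ[X] R)
  { carrier := C.cycles ⧸ C.boundaries
    d := { toFun := C.dχHom.onH
           map_add' := map_add _
           map_smul' := fun c x => C.dχHom.onH.map_smul (algebraMap ℚ[X] R c) x }
    gr := fun ε i j k =>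
      ((C.gr ε i j k).comap C.cycles.subtype.toAddMonoidHom).map C.boundaries.mkQ.toAddMonoidHom
    d_d := fun x => by
      obtain ⟨x, rfl⟩ := Submodule.mkQ_surjective _ x
      change C.boundaries.mkQ ⟨C.dχ (C.dχ x), _⟩ = 0
      rw [Submodule.mkQ_apply, Submodule.Quotient.mk_eq_zero]
      simp [C.dχ_dχ] }

/-- The chain map `(H(C, dmf), dχ) → (H(D, dmf), dχ)` induced by a morphism. -/
def Hom.H {C D : Cx R} (f : Hom C D) : GrCx.Hom C.H D.H where
  f :=
    { toFun := f.onH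
      map_add' := map_add f.onH
      map_smul' := fun c x => f.onH.map_smul (algebraMap ℚ[X] R c) x }
  f_d x := by
    obtain ⟨x, rfl⟩ := Submodule.mkQ_surjective _ x
    change D.boundaries.mkQ ⟨f.f (C.dχ x), _⟩ = D.boundaries.mkQ ⟨D.dχ (f.f x), _⟩
    simp only [f.f_dχ]

/-- The quotient map `C → C / b C`. -/
def toQuot (C : Cx R) (b : R) : Hom C (C.quot b) where
  f := (C.multiples b).mkQ
  f_dmf _ := rfl
  f_dχ _ := rfl

end Cx

/-! ### The polynomials entering the matrix factorizations -/

section Polynomials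

variable {R : Type} [CommRing R]

/-- `(x ^ n - y ^ n) / (x - y)`, as a polynomial. -/
def powDiff (n : ℕ) (x y : R) : R := ∑ i ∈ Finset.range n, x ^ i * y ^ (n - 1 - i)

theorem powDiff_mul (n : ℕ) (x y : R) : powDiff n x y * (x - y) = x ^ n - y ^ n :=
  (Commute.all x y).geom_sum₂_mul n

theorem powDiff_succ (n : ℕ) (x y : R) : powDiff (n + 1) x y = x ^ n + y * powDiff n x y :=
  (Commute.all x y).geom_sum₂_succ_eq

/-- The `n`-th power sum in two variables as a polynomial in the elementary symmetric polynomials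
`e₁`, `e₂`. -/
def psum2 : ℕ → R → R → R
  | 0, _, _ => 2
  | 1, e₁, _ => e₁
  | n + 2, e₁, e₂ => e₁ * psum2 (n + 1) e₁ e₂ - e₂ * psum2 n e₁ e₂

theorem psum2_eq (x y : R) : ∀ n, psum2 n (x + y) (x * y) = x ^ n + y ^ n
  | 0 => by simp [psum2]; norm_num
  | 1 => by simp [psum2]
  | n + 2 => by
    rw [psum2, psum2_eq x y (n + 1), psum2_eq x y n]
    ring

/-- `(psum2 n X₁ X₂ - psum2 n Y₁ X₂) / (X₁ - Y₁)`, as a polynomial. -/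
def U₁ : ℕ → R → R → R → R
  | 0, _, _, _ => 0
  | 1, _, _, _ => 1
  | n + 2, X₁, Y₁, X₂ => psum2 (n + 1) X₁ X₂ + Y₁ * U₁ (n + 1) X₁ Y₁ X₂ - X₂ * U₁ n X₁ Y₁ X₂

theorem U₁_mul (X₁ Y₁ X₂ : R) :
    ∀ n, U₁ n X₁ Y₁ X₂ * (X₁ - Y₁) = psum2 n X₁ X₂ - psum2 n Y₁ X₂
  | 0 => by simp [psum2, U₁]
  | 1 => by simp [psum2, U₁]
  | n + 2 => by
    rw [U₁, psum2, psum2]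
    linear_combination Y₁ * U₁_mul X₁ Y₁ X₂ (n + 1) - X₂ * U₁_mul X₁ Y₁ X₂ n

/-- `(psum2 n Y₁ X₂ - psum2 n Y₁ Y₂) / (X₂ - Y₂)`, as a polynomial. -/
def U₂ : ℕ → R → R → R → R
  | 0, _, _, _ => 0
  | 1, _, _, _ => 0
  | n + 2, Y₁, X₂, Y₂ => Y₁ * U₂ (n + 1) Y₁ X₂ Y₂ - X₂ * U₂ n Y₁ X₂ Y₂ - psum2 n Y₁ Y₂

theorem U₂_mul (Y₁ X₂ Y₂ : R) :
    ∀ n, U₂ n Y₁ X₂ Y₂ * (X₂ - Y₂) = psum2 n Y₁ X₂ - psum2 n Y₁ Y₂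
  | 0 => by simp [psum2, U₂]
  | 1 => by simp [psum2, U₂]
  | n + 2 => by
    rw [U₂, psum2, psum2]
    linear_combination Y₁ * U₂_mul Y₁ X₂ Y₂ (n + 1) - X₂ * U₂_mul Y₁ X₂ Y₂ n

/-- The divided difference of `U₁` in its second argument. -/
def U₁₁ : ℕ → R → R → R → R → R
  | 0, _, _, _, _ => 0
  | 1, _, _, _, _ => 0
  | n + 2, X₁, Z₁, Y₁, X₂ =>
    U₁ (n + 1) X₁ Z₁ X₂ + Y₁ * U₁₁ (n + 1) X₁ Z₁ Y₁ X₂ - X₂ * U₁₁ n X₁ Z₁ Y₁ X₂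

theorem U₁₁_mul (X₁ Z₁ Y₁ X₂ : R) :
    ∀ n, U₁₁ n X₁ Z₁ Y₁ X₂ * (Z₁ - Y₁) = U₁ n X₁ Z₁ X₂ - U₁ n X₁ Y₁ X₂
  | 0 => by simp [U₁, U₁₁]
  | 1 => by simp [U₁, U₁₁]
  | n + 2 => by
    rw [U₁₁, U₁, U₁]
    linear_combination Y₁ * U₁₁_mul X₁ Z₁ Y₁ X₂ (n + 1) - X₂ * U₁₁_mul X₁ Z₁ Y₁ X₂ n

theorem U₁₁_mul' (X₁ Z₁ Y₁ X₂ : R) :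
    ∀ n, U₁₁ n X₁ Z₁ Y₁ X₂ * (X₁ - Z₁) = U₁ n X₁ Y₁ X₂ - U₁ n Z₁ Y₁ X₂
  | 0 => by simp [U₁, U₁₁]
  | 1 => by simp [U₁, U₁₁]
  | n + 2 => by
    rw [U₁₁, U₁, U₁]
    linear_combination Y₁ * U₁₁_mul' X₁ Z₁ Y₁ X₂ (n + 1) - X₂ * U₁₁_mul' X₁ Z₁ Y₁ X₂ n
      + U₁_mul X₁ Z₁ X₂ (n + 1)

/-- The divided difference of `U₂` in its second argument. -/
def U₂₂ : ℕ → R → R → R → R → R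
  | 0, _, _, _, _ => 0
  | 1, _, _, _, _ => 0
  | n + 2, Y₁, X₂, Z₂, Y₂ =>
    Y₁ * U₂₂ (n + 1) Y₁ X₂ Z₂ Y₂ - X₂ * U₂₂ n Y₁ X₂ Z₂ Y₂ - U₂ n Y₁ Z₂ Y₂

theorem U₂₂_mul (Y₁ X₂ Z₂ Y₂ : R) :
    ∀ n, U₂₂ n Y₁ X₂ Z₂ Y₂ * (X₂ - Z₂) = U₂ n Y₁ X₂ Y₂ - U₂ n Y₁ Z₂ Y₂
  | 0 => by simp [U₂, U₂₂]
  | 1 => by simp [U₂, U₂₂]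
  | n + 2 => by
    rw [U₂₂, U₂, U₂]
    linear_combination Y₁ * U₂₂_mul Y₁ X₂ Z₂ Y₂ (n + 1) - X₂ * U₂₂_mul Y₁ X₂ Z₂ Y₂ n

/-- The divided difference of `U₁` in its third argument. -/
def U₁₂ : ℕ → R → R → R → R → R
  | 0, _, _, _, _ => 0
  | 1, _, _, _, _ => 0
  | n + 2, Z₁, Y₁, X₂, Z₂ =>
    U₂ (n + 1) Z₁ X₂ Z₂ + Y₁ * U₁₂ (n + 1) Z₁ Y₁ X₂ Z₂ - X₂ * U₁₂ n Z₁ Y₁ X₂ Z₂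
      - U₁ n Z₁ Y₁ Z₂

theorem U₁₂_mul (Z₁ Y₁ X₂ Z₂ : R) :
    ∀ n, U₁₂ n Z₁ Y₁ X₂ Z₂ * (X₂ - Z₂) = U₁ n Z₁ Y₁ X₂ - U₁ n Z₁ Y₁ Z₂
  | 0 => by simp [U₁, U₁₂]
  | 1 => by simp [U₁, U₁₂]
  | n + 2 => by
    rw [U₁₂, U₁, U₁]
    linear_combination Y₁ * U₁₂_mul Z₁ Y₁ X₂ Z₂ (n + 1) - X₂ * U₁₂_mul Z₁ Y₁ X₂ Z₂ n
      + U₂_mul Z₁ X₂ Z₂ (n + 1)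

theorem U₁₂_mul' (Z₁ Y₁ X₂ Z₂ : R) :
    ∀ n, U₁₂ n Z₁ Y₁ X₂ Z₂ * (Z₁ - Y₁) = U₂ n Z₁ X₂ Z₂ - U₂ n Y₁ X₂ Z₂
  | 0 => by simp [U₂, U₁₂]
  | 1 => by simp [U₂, U₁₂]
  | n + 2 => by
    rw [U₁₂, U₂, U₂]
    linear_combination Y₁ * U₁₂_mul' Z₁ Y₁ X₂ Z₂ (n + 1) - X₂ * U₁₂_mul' Z₁ Y₁ X₂ Z₂ n
      - U₁_mul Z₁ Y₁ Z₂ n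

theorem U₂_sub (X₂ Z₁ Z₂ Y₁ Y₂ : R) : ∀ n, U₂ n Z₁ X₂ Z₂ - U₂ n Y₁ X₂ Y₂ =
    U₁₂ n Z₁ Y₁ X₂ Z₂ * (Z₁ - Y₁) + U₂₂ n Y₁ X₂ Z₂ Y₂ * (Z₂ - Y₂)
  | 0 => by simp [U₂, U₁₂, U₂₂]
  | 1 => by simp [U₂, U₁₂, U₂₂]
  | n + 2 => by
    have h1 := U₂_sub X₂ Z₁ Z₂ Y₁ Y₂ (n + 1)
    have h0 := U₂_sub X₂ Z₁ Z₂ Y₁ Y₂ n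
    rw [U₂, U₂, U₁₂, U₂₂]
    linear_combination Y₁ * h1 - X₂ * h0 + U₁_mul Z₁ Y₁ Z₂ n + U₂_mul Y₁ Z₂ Y₂ n

/-- The quotient of `U₁ + x₁ U₂ - powDiff n y₁ x₂` by `x₁ - y₂`, where `U₁` and `U₂` are taken at
the elementary symmetric polynomials of `{x₁, y₁}` and `{x₂, y₂}`. -/
def twist : ℕ → R → R → R → R → R
  | 0, _, _, _, _ => 0
  | 1, _, _, _, _ => 0
  | n + 2, x₁, y₁, y₂, x₂ =>
    (x₂ + y₂) * twist (n + 1) x₁ y₁ y₂ x₂ - x₁ * y₁ * twist n x₁ y₁ y₂ x₂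
      + x₁ * powDiff n x₁ y₂ - powDiff (n + 1) y₁ x₂

theorem twist_mul (x₁ y₁ y₂ x₂ : R) : ∀ n, twist n x₁ y₁ y₂ x₂ * (x₁ - y₂) =
    U₁ n (x₁ + y₁) (x₂ + y₂) (x₁ * y₁) + x₁ * U₂ n (x₂ + y₂) (x₁ * y₁) (x₂ * y₂)
      - powDiff n y₁ x₂
  | 0 => by simp [twist, U₁, U₂, powDiff]
  | 1 => by simp [twist, U₁, U₂, powDiff]
  | n + 2 => by
    have h1 := twist_mul x₁ y₁ y₂ x₂ (n + 1)
    have h0 := twist_mul x₁ y₁ y₂ x₂ n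
    rw [twist, U₁, U₂, psum2_eq, psum2_eq, powDiff_succ (n + 1), powDiff_succ n]
    rw [powDiff_succ n] at h1
    linear_combination (x₂ + y₂) * h1 - x₁ * y₁ * h0 + x₁ * powDiff_mul n x₁ y₂
      + x₁ * powDiff_mul n y₁ x₂

theorem twist_mul' (x₁ y₁ y₂ x₂ : R) : ∀ n, twist n x₁ y₁ y₂ x₂ * (y₁ - x₂) =
    powDiff n x₁ y₂ - U₁ n (x₁ + y₁) (x₂ + y₂) (x₁ * y₁)
      - x₂ * U₂ n (x₂ + y₂) (x₁ * y₁) (x₂ * y₂)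
  | 0 => by simp [twist, U₁, U₂, powDiff]
  | 1 => by simp [twist, U₁, U₂, powDiff]
  | n + 2 => by
    have h1 := twist_mul' x₁ y₁ y₂ x₂ (n + 1)
    have h0 := twist_mul' x₁ y₁ y₂ x₂ n
    rw [twist, U₁, U₂, psum2_eq, psum2_eq, powDiff_succ (n + 1) x₁ y₂,
      powDiff_succ n x₁ y₂, powDiff_succ n y₁ x₂]
    rw [powDiff_succ n] at h1
    linear_combination (x₂ + y₂) * h1 - x₁ * y₁ * h0 - x₂ * powDiff_mul n y₁ x₂
      - x₂ * powDiff_mul n x₁ y₂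

theorem map_psum2 {A : Type} [CommRing A] (f : R →+* A) (u v : R) :
    ∀ n, f (psum2 n u v) = psum2 n (f u) (f v)
  | 0 => by simp [psum2, map_ofNat]
  | 1 => by simp [psum2]
  | n + 2 => by simp [psum2, map_psum2 f u v (n + 1), map_psum2 f u v n]

theorem map_U₁ {A : Type} [CommRing A] (f : R →+* A) (X₁ Y₁ X₂ : R) :
    ∀ n, f (U₁ n X₁ Y₁ X₂) = U₁ n (f X₁) (f Y₁) (f X₂)
  | 0 => by simp [U₁]
  | 1 => by simp [U₁]
  | n + 2 => by simp [U₁, map_U₁ f X₁ Y₁ X₂ (n + 1), map_U₁ f X₁ Y₁ X₂ n, map_psum2]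

theorem map_U₂ {A : Type} [CommRing A] (f : R →+* A) (Y₁ X₂ Y₂ : R) :
    ∀ n, f (U₂ n Y₁ X₂ Y₂) = U₂ n (f Y₁) (f X₂) (f Y₂)
  | 0 => by simp [U₂]
  | 1 => by simp [U₂]
  | n + 2 => by simp [U₂, map_U₂ f Y₁ X₂ Y₂ (n + 1), map_U₂ f Y₁ X₂ Y₂ n, map_psum2]

end Polynomials

/-! ### Matrix factorizations of arcs and crossing resolutions -/

section Pieces

variable {R : Type} [CommRing R]

/-- The matrix factorization `(a U, x₁ - x₂)` of `a (x₁ ^ (N + 1) - x₂ ^ (N + 1))` of an arc of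
color `1` from a point marked `x₂` to a point marked `x₁`.  Here `g` is the bigrading of `R`. -/
def arcMF (N : ℕ) (g : ℤ → ℤ → AddSubgroup R) (a x₁ x₂ : R) : MF R :=
  (MF.base g).row N (a * powDiff (N + 1) x₁ x₂) (x₁ - x₂) 2 (2 * N)

/-- The matrix factorization of the resolution `Γ₀`: two parallel arcs, from `x₂` to `y₁` and from
`y₂` to `x₁`. -/
def parallelMF (N : ℕ) (g : ℤ → ℤ → AddSubgroup R) (a x₁ y₁ y₂ x₂ : R) : MF R :=
  (arcMF N g a y₁ x₂).row N (a * powDiff (N + 1) x₁ y₂) (x₁ - y₂) 2 (2 * N)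

/-- The Koszul matrix factorization of the resolution `Γ₁` over a ring containing the elementary
symmetric polynomials `Z₁`, `Z₂` of the alphabet marking the edge of color `2`; `X₁`, `X₂` and
`Y₁`, `Y₂` are the elementary symmetric polynomials of the alphabets of the two outgoing and of
the two incoming edges of color `1`. The first two rows belong to the vertex where the edge of
color `2` splits, the last two to the vertex where it is formed. -/
def wideMFAux (N : ℕ) (g : ℤ → ℤ → AddSubgroup R) (a X₁ X₂ Y₁ Y₂ Z₁ Z₂ : R) : MF R :=
  (((((MF.base g).row N (a * U₁ (N + 1) X₁ Z₁ X₂) (X₁ - Z₁) 2 (2 * N)).row N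
    (a * U₂ (N + 1) Z₁ X₂ Z₂) (X₂ - Z₂) 2 (2 * N - 2)).row N
    (a * U₁ (N + 1) Z₁ Y₁ Z₂) (Z₁ - Y₁) 2 (2 * N)).row N
    (a * U₂ (N + 1) Y₁ Z₂ Y₂) (Z₂ - Y₂) 2 (2 * N - 2)).shift 0 (-1)

/-- The bigrading of `R[Z₁, Z₂]`, where `Z₁` and `Z₂` have degrees `(0, 2)` and `(0, 4)`. -/
def extendGrading (g : ℤ → ℤ → AddSubgroup R) (j k : ℤ) :
    AddSubgroup (MvPolynomial (Fin 2) R) where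
  carrier := {p | ∀ m, p.coeff m ∈ g j (k - (2 * m 0 + 4 * m 1))}
  zero_mem' := by simp [zero_mem]
  add_mem' hp hq m := by
    rw [MvPolynomial.coeff_add]
    exact add_mem (hp m) (hq m)
  neg_mem' hp m := by
    rw [MvPolynomial.coeff_neg]
    exact neg_mem (hp m)

/-- The matrix factorization of the resolution `Γ₁`: the edges marked `y₂`, `x₂` merge into an
edge of color `2`, which splits into the edges marked `x₁`, `y₁`.  It is defined over
`R[Z₁, Z₂]` and regarded as a matrix factorization over `R`. -/
def wideMF (N : ℕ) (g : ℤ → ℤ → AddSubgroup R) (a x₁ y₁ y₂ x₂ : R) : MF R :=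
  (wideMFAux N (extendGrading g) (MvPolynomial.C a) (MvPolynomial.C (x₁ + y₁))
    (MvPolynomial.C (x₁ * y₁)) (MvPolynomial.C (x₂ + y₂)) (MvPolynomial.C (x₂ * y₂))
    (MvPolynomial.X 0) (MvPolynomial.X 1)).restrict
    (a * (x₁ ^ (N + 1) + y₁ ^ (N + 1) - (x₂ ^ (N + 1) + y₂ ^ (N + 1)))) (by
      rw [← psum2_eq, ← psum2_eq]
      simp only [wideMFAux, MF.shift, MF.row, MF.base, mul_assoc, U₁_mul, U₂_mul]
      rw [MvPolynomial.algebraMap_eq, map_mul, map_sub, map_psum2, map_psum2]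
      ring)

theorem wideMF_w (N : ℕ) (g : ℤ → ℤ → AddSubgroup R) (a x₁ y₁ y₂ x₂ : R) :
    (wideMF N g a x₁ y₁ y₂ x₂).w = (parallelMF N g a x₁ y₁ y₂ x₂).w := by
  simp only [wideMF, MF.restrict, parallelMF, arcMF, MF.row, MF.base, mul_assoc, powDiff_mul]
  ring

/-- The two-row Koszul matrix factorization over `R` obtained from `Γ₁` by contracting the edge of
color `2`. -/
def contractedMF (N : ℕ) (g : ℤ → ℤ → AddSubgroup R) (a x₁ y₁ y₂ x₂ : R) : MF R :=
  (((MF.base g).row N (a * U₁ (N + 1) (x₁ + y₁) (x₂ + y₂) (x₁ * y₁)) (x₁ + y₁ - (x₂ + y₂))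
    2 (2 * N)).row N (a * U₂ (N + 1) (x₂ + y₂) (x₁ * y₁) (x₂ * y₂)) (x₁ * y₁ - x₂ * y₂)
    2 (2 * N - 2)).shift 0 (-1)

/-! An element of a two-row Koszul matrix factorization is `((u, u₁), (u₂, u₁₂))`, where `u`, `u₁`,
`u₂`, `u₁₂` are the coefficients of `1`, `e₁`, `e₂`, `e₁ e₂`, and `eᵢ` is the generator of the
`i`-th row.  An element of `Γ₁` is `((v, v₁), (v₂, v₁₂))`, where `v`, `v₁`, `v₂`, `v₁₂` belong to
the first two rows and are the coefficients of `1`, `f₁`, `f₂`, `f₁ f₂`. -/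

section Maps

variable {A : Type} [CommRing A]

/-- The differential of the Koszul matrix factorization with rows `(α₁, β₁)`, `(α₂, β₂)`. -/
def kosD (α₁ β₁ α₂ β₂ : R) : (R × R) × (R × R) →ₗ[R] (R × R) × (R × R) :=
  rowD (rowD 0 LinearMap.id α₁ β₁) (rowS LinearMap.id) α₂ β₂

theorem kosD_apply (α₁ β₁ α₂ β₂ u u₁ u₂ u₁₂ : R) :
    kosD α₁ β₁ α₂ β₂ ((u, u₁), (u₂, u₁₂)) =
      ((β₁ * u₁ + β₂ * u₂, α₁ * u - β₂ * u₁₂), (β₁ * u₁₂ + α₂ * u, α₁ * u₂ - α₂ * u₁)) := by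
  simp [kosD, sub_eq_add_neg]

/-- The differential of the Koszul matrix factorization with four rows, the last two being
`(α₃, β₃)`, `(α₄, β₄)`. -/
def kosD₄ (α₁ β₁ α₂ β₂ α₃ β₃ α₄ β₄ : R) :=
  rowD (rowD (kosD α₁ β₁ α₂ β₂) (rowS (rowS LinearMap.id)) α₃ β₃)
    (rowS (rowS (rowS LinearMap.id))) α₄ β₄

/-- Apply `ev` to the part of an element without `f₁`, `f₂`, and forget the rest. -/
def contractFun (ev : A → R)
    (v : (((A × A) × (A × A)) × ((A × A) × (A × A))) ×
      (((A × A) × (A × A)) × ((A × A) × (A × A)))) : (R × R) × (R × R) :=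
  ((ev v.1.1.1.1, ev v.1.1.1.2), (ev v.1.1.2.1, ev v.1.1.2.2))

theorem contractFun_d (ev : A →+* R) (α₁ β₁ α₂ β₂ α₃ β₃ α₄ β₄ : A) (a₁ b₁ a₂ b₂ : R)
    (hα₁ : ev α₁ = a₁) (hβ₁ : ev β₁ = b₁) (hα₂ : ev α₂ = a₂) (hβ₂ : ev β₂ = b₂)
    (h₃ : ev β₃ = 0) (h₄ : ev β₄ = 0) (v) :
    contractFun ev (kosD₄ α₁ β₁ α₂ β₂ α₃ β₃ α₄ β₄ v) = kosD a₁ b₁ a₂ b₂ (contractFun ev v) := by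
  subst hα₁ hβ₁ hα₂ hβ₂
  obtain ⟨⟨⟨⟨v1, v2⟩, ⟨v3, v4⟩⟩, ⟨⟨u1, u2⟩, ⟨u3, u4⟩⟩⟩, ⟨⟨⟨w1, w2⟩, ⟨w3, w4⟩⟩, v''⟩⟩ := v
  simp [kosD₄, contractFun, kosD_apply, h₃, h₄]

/-- The algebra map `eᵢ ↦ eᵢ + fᵢ`, followed by the product with the exponential of
`p e₁ f₁ + q e₂ f₂ + r e₂ f₁`. -/
def expandFun (c : R → A) (p q r : A) (u : (R × R) × (R × R)) :
    (((A × A) × (A × A)) × ((A × A) × (A × A))) ×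
      (((A × A) × (A × A)) × ((A × A) × (A × A))) :=
  ((((c u.1.1, c u.1.2), (c u.2.1, c u.2.2)),
      ((c u.1.2, p * c u.1.1), (r * c u.1.1 - c u.2.2, r * c u.1.2 - p * c u.2.1))),
    (((c u.2.1, c u.2.2), (q * c u.1.1, q * c u.1.2)),
      ((c u.2.2, p * c u.2.1), (r * c u.2.1 - q * c u.1.2, r * c u.2.2 - p * q * c u.1.1))))

theorem expandFun_d (c : R →+* A) (α₁ β₁ α₂ β₂ : R) (a₁ b₁ a₂ b₂ a₃ b₃ a₄ b₄ p q r : A)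
    (hβ₁ : c β₁ = b₁ + b₃) (hβ₂ : c β₂ = b₂ + b₄)
    (h₁ : p * b₃ = a₁ - c α₁) (h₂ : r * b₃ + q * b₄ = a₂ - c α₂)
    (h₃ : p * b₁ + r * b₂ = c α₁ - a₃) (h₄ : q * b₂ = c α₂ - a₄) (u) :
    expandFun c p q r (kosD α₁ β₁ α₂ β₂ u) =
      kosD₄ a₁ b₁ a₂ b₂ a₃ b₃ a₄ b₄ (expandFun c p q r u) := by
  obtain ⟨⟨u1, u2⟩, ⟨u3, u4⟩⟩ := u
  have e₁ : c α₁ = a₁ - p * b₃ := by rw [h₁]; ring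
  have e₂ : c α₂ = a₂ - (r * b₃ + q * b₄) := by rw [h₂]; ring
  have e₃ : a₃ = a₁ - p * b₃ - (p * b₁ + r * b₂) := by rw [h₃, e₁]; ring
  have e₄ : a₄ = a₂ - (r * b₃ + q * b₄) - q * b₂ := by rw [h₄, e₂]; ring
  refine Prod.ext (Prod.ext (Prod.ext (Prod.ext ?_ ?_) (Prod.ext ?_ ?_))
      (Prod.ext (Prod.ext ?_ ?_) (Prod.ext ?_ ?_)))
    (Prod.ext (Prod.ext (Prod.ext ?_ ?_) (Prod.ext ?_ ?_))
      (Prod.ext (Prod.ext ?_ ?_) (Prod.ext ?_ ?_))) <;>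
  simp only [kosD₄, expandFun, kosD_apply, rowD_apply, rowS_apply, map_add, map_sub, map_mul, hβ₁,
    hβ₂, e₁, e₂, e₃, e₄, LinearMap.id_apply, smul_eq_mul, Prod.fst_add, Prod.snd_add, Prod.smul_fst,
    Prod.smul_snd, Prod.fst_neg, Prod.snd_neg]
  all_goals ring

theorem contractFun_add (ev : A →+* R) (v v') :
    contractFun ev (v + v') = contractFun ev v + contractFun ev v' := by
  simp [contractFun]

theorem contractFun_smul (ev : A →+* R) (b : A) (v) :
    contractFun ev (b • v) = ev b • contractFun ev v := by
  simp [contractFun]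

theorem contractFun_s (ev : A →+* R) (v) :
    contractFun ev (rowS (rowS (rowS (rowS (LinearMap.id : A →ₗ[A] A)))) v) =
      rowS (rowS (LinearMap.id : R →ₗ[R] R)) (contractFun ev v) := by
  obtain ⟨⟨⟨⟨v1, v2⟩, ⟨v3, v4⟩⟩, v'⟩, v''⟩ := v
  simp [contractFun]

theorem expandFun_add (c : R →+* A) (p q r : A) (u u') :
    expandFun c p q r (u + u') = expandFun c p q r u + expandFun c p q r u' := by
  refine Prod.ext (Prod.ext (Prod.ext (Prod.ext ?_ ?_) (Prod.ext ?_ ?_))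
      (Prod.ext (Prod.ext ?_ ?_) (Prod.ext ?_ ?_)))
    (Prod.ext (Prod.ext (Prod.ext ?_ ?_) (Prod.ext ?_ ?_))
      (Prod.ext (Prod.ext ?_ ?_) (Prod.ext ?_ ?_))) <;>
  simp only [expandFun, Prod.fst_add, Prod.snd_add, map_add] <;> ring

theorem expandFun_smul (c : R →+* A) (p q r : A) (b : R) (u) :
    expandFun c p q r (b • u) = c b • expandFun c p q r u := by
  refine Prod.ext (Prod.ext (Prod.ext (Prod.ext ?_ ?_) (Prod.ext ?_ ?_))
      (Prod.ext (Prod.ext ?_ ?_) (Prod.ext ?_ ?_)))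
    (Prod.ext (Prod.ext (Prod.ext ?_ ?_) (Prod.ext ?_ ?_))
      (Prod.ext (Prod.ext ?_ ?_) (Prod.ext ?_ ?_))) <;>
  simp only [expandFun, Prod.smul_fst, Prod.smul_snd, map_mul, smul_eq_mul] <;> ring

theorem expandFun_s (c : R →+* A) (p q r : A) (u) :
    expandFun c p q r (rowS (rowS (LinearMap.id : R →ₗ[R] R)) u) =
      rowS (rowS (rowS (rowS (LinearMap.id : A →ₗ[A] A)))) (expandFun c p q r u) := by
  obtain ⟨⟨u1, u2⟩, ⟨u3, u4⟩⟩ := u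
  refine Prod.ext (Prod.ext (Prod.ext (Prod.ext ?_ ?_) (Prod.ext ?_ ?_))
      (Prod.ext (Prod.ext ?_ ?_) (Prod.ext ?_ ?_)))
    (Prod.ext (Prod.ext (Prod.ext ?_ ?_) (Prod.ext ?_ ?_))
      (Prod.ext (Prod.ext ?_ ?_) (Prod.ext ?_ ?_))) <;>
  simp [expandFun] <;> ring

/-- The composition of the change of basis turning the rows of `Γ₀` into `(r, t₁)`, `(s l, t₂)`,
where `s = x₂ - x₁`, of the map `e₂ ↦ e₂`, `1 ↦ s` to the factorization with rows `(r, t₁)`,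
`(l, s t₂)`, and of the change of basis to the contraction of `Γ₁`; here `k` is `a` times
`twist`. -/
def jump₀ (k x₁ x₂ : R) : (R × R) × (R × R) →ₗ[R] (R × R) × (R × R) where
  toFun u := (((x₂ - x₁) * u.1.1, x₂ * u.1.2 - x₁ * u.2.1), (u.2.1 - u.1.2, u.2.2 + k * u.1.1))
  map_add' u v := by
    refine Prod.ext (Prod.ext ?_ ?_) (Prod.ext ?_ ?_) <;>
    simp only [Prod.fst_add, Prod.snd_add] <;> ring
  map_smul' b u := by
    refine Prod.ext (Prod.ext ?_ ?_) (Prod.ext ?_ ?_) <;>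
    simp only [Prod.smul_fst, Prod.smul_snd, smul_eq_mul, RingHom.id_apply] <;> ring

/-- The composition in the opposite direction, with the map `1 ↦ 1`, `e₂ ↦ s e₂` in the middle. -/
def jump₁ (k x₁ x₂ : R) : (R × R) × (R × R) →ₗ[R] (R × R) × (R × R) where
  toFun u := ((u.1.1, u.1.2 + x₁ * u.2.1),
    (u.1.2 + x₂ * u.2.1, (x₂ - x₁) * u.2.2 - k * u.1.1))
  map_add' u v := by
    refine Prod.ext (Prod.ext ?_ ?_) (Prod.ext ?_ ?_) <;>
    simp only [Prod.fst_add, Prod.snd_add] <;> ring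
  map_smul' b u := by
    refine Prod.ext (Prod.ext ?_ ?_) (Prod.ext ?_ ?_) <;>
    simp only [Prod.smul_fst, Prod.smul_snd, smul_eq_mul, RingHom.id_apply] <;> ring

theorem jump₁_jump₀ (k x₁ x₂ : R) (u) : jump₁ k x₁ x₂ (jump₀ k x₁ x₂ u) = (x₂ - x₁) • u := by
  refine Prod.ext (Prod.ext ?_ ?_) (Prod.ext ?_ ?_) <;>
  simp only [jump₀, jump₁, LinearMap.coe_mk, AddHom.coe_mk, Prod.smul_fst, Prod.smul_snd,
    smul_eq_mul] <;> ring

theorem jump₀_jump₁ (k x₁ x₂ : R) (u) : jump₀ k x₁ x₂ (jump₁ k x₁ x₂ u) = (x₂ - x₁) • u := by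
  refine Prod.ext (Prod.ext ?_ ?_) (Prod.ext ?_ ?_) <;>
  simp only [jump₀, jump₁, LinearMap.coe_mk, AddHom.coe_mk, Prod.smul_fst, Prod.smul_snd,
    smul_eq_mul] <;> ring

variable {x₁ y₁ y₂ x₂ k α₁ α₂ η₁ η₂ : R}

theorem jump₀_d (h₁ : k * (x₁ - y₂) = α₁ + x₁ * α₂ - η₁)
    (h₂ : k * (y₁ - x₂) = η₂ - α₁ - x₂ * α₂) (u) :
    jump₀ k x₁ x₂ (kosD η₁ (y₁ - x₂) η₂ (x₁ - y₂) u) =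
      kosD α₁ (x₁ + y₁ - (x₂ + y₂)) α₂ (x₁ * y₁ - x₂ * y₂) (jump₀ k x₁ x₂ u) := by
  obtain ⟨⟨u1, u2⟩, ⟨u3, u4⟩⟩ := u
  have e₁ : η₁ = α₁ + x₁ * α₂ - k * (x₁ - y₂) := by rw [h₁]; ring
  have e₂ : η₂ = α₁ + x₂ * α₂ + k * (y₁ - x₂) := by rw [h₂]; ring
  refine Prod.ext (Prod.ext ?_ ?_) (Prod.ext ?_ ?_) <;>
  simp only [jump₀, LinearMap.coe_mk, AddHom.coe_mk, kosD_apply, e₁, e₂] <;> ring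

theorem jump₁_d (h₁ : k * (x₁ - y₂) = α₁ + x₁ * α₂ - η₁)
    (h₂ : k * (y₁ - x₂) = η₂ - α₁ - x₂ * α₂) (u) :
    jump₁ k x₁ x₂ (kosD α₁ (x₁ + y₁ - (x₂ + y₂)) α₂ (x₁ * y₁ - x₂ * y₂) u) =
      kosD η₁ (y₁ - x₂) η₂ (x₁ - y₂) (jump₁ k x₁ x₂ u) := by
  obtain ⟨⟨u1, u2⟩, ⟨u3, u4⟩⟩ := u
  have e₁ : η₁ = α₁ + x₁ * α₂ - k * (x₁ - y₂) := by rw [h₁]; ring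
  have e₂ : η₂ = α₁ + x₂ * α₂ + k * (y₁ - x₂) := by rw [h₂]; ring
  refine Prod.ext (Prod.ext ?_ ?_) (Prod.ext ?_ ?_) <;>
  simp only [jump₁, LinearMap.coe_mk, AddHom.coe_mk, kosD_apply, e₁, e₂] <;> ring

theorem jump₀_s (u) : jump₀ k x₁ x₂ (rowS (rowS (LinearMap.id : R →ₗ[R] R)) u) =
    rowS (rowS (LinearMap.id : R →ₗ[R] R)) (jump₀ k x₁ x₂ u) := by
  obtain ⟨⟨u1, u2⟩, ⟨u3, u4⟩⟩ := u
  refine Prod.ext (Prod.ext ?_ ?_) (Prod.ext ?_ ?_) <;> simp [jump₀] <;> ring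

theorem jump₁_s (u) : jump₁ k x₁ x₂ (rowS (rowS (LinearMap.id : R →ₗ[R] R)) u) =
    rowS (rowS (LinearMap.id : R →ₗ[R] R)) (jump₁ k x₁ x₂ u) := by
  obtain ⟨⟨u1, u2⟩, ⟨u3, u4⟩⟩ := u
  refine Prod.ext (Prod.ext ?_ ?_) (Prod.ext ?_ ?_) <;> simp [jump₁] <;> ring

end Maps

variable (N : ℕ) (g : ℤ → ℤ → AddSubgroup R) (a x₁ y₁ y₂ x₂ : R)

/-- The homotopy equivalence from `Γ₁` to its contraction: set `Z₁ = x₂ + y₂` and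
`Z₂ = x₂ y₂`, and send the multiples of `f₁` and `f₂` to `0`. -/
def contract : MF.Hom (wideMF N g a x₁ y₁ y₂ x₂) (contractedMF N g a x₁ y₁ y₂ x₂) :=
  let c : R →+* MvPolynomial (Fin 2) R := MvPolynomial.C
  let ev : MvPolynomial (Fin 2) R →+* R := MvPolynomial.eval ![x₂ + y₂, x₂ * y₂]
  have hc : ∀ b, ev (c b) = b := fun b => MvPolynomial.eval_C b
  have h0 : ev (MvPolynomial.X 0) = x₂ + y₂ := by simp [ev]
  have h1 : ev (MvPolynomial.X 1) = x₂ * y₂ := by simp [ev]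
  { f :=
      { toFun := contractFun (A := MvPolynomial (Fin 2) R) (R := R) ev
        map_add' := contractFun_add (A := MvPolynomial (Fin 2) R) (R := R) ev
        map_smul' := fun b v => by
          have h := contractFun_smul (A := MvPolynomial (Fin 2) R) (R := R) ev (MvPolynomial.C b) v
          rw [show ev (MvPolynomial.C b) = b from MvPolynomial.eval_C b] at h
          exact h }
    f_d := contractFun_d (A := MvPolynomial (Fin 2) R) (R := R) ev
      (c a * U₁ (N + 1) (c (x₁ + y₁)) (MvPolynomial.X 0) (c (x₁ * y₁)))
      (c (x₁ + y₁) - MvPolynomial.X 0)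
      (c a * U₂ (N + 1) (MvPolynomial.X 0) (c (x₁ * y₁)) (MvPolynomial.X 1))
      (c (x₁ * y₁) - MvPolynomial.X 1)
      (c a * U₁ (N + 1) (MvPolynomial.X 0) (c (x₂ + y₂)) (MvPolynomial.X 1))
      (MvPolynomial.X 0 - c (x₂ + y₂))
      (c a * U₂ (N + 1) (c (x₂ + y₂)) (MvPolynomial.X 1) (c (x₂ * y₂)))
      (MvPolynomial.X 1 - c (x₂ * y₂))
      (a * U₁ (N + 1) (x₁ + y₁) (x₂ + y₂) (x₁ * y₁)) (x₁ + y₁ - (x₂ + y₂))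
      (a * U₂ (N + 1) (x₂ + y₂) (x₁ * y₁) (x₂ * y₂)) (x₁ * y₁ - x₂ * y₂)
      (by rw [map_mul ev, map_U₁, hc, hc, hc, h0]) (by rw [map_sub ev, hc, h0])
      (by rw [map_mul ev, map_U₂, hc, hc, h0, h1]) (by rw [map_sub ev, hc, h1])
      (by rw [map_sub ev, hc, h0, sub_self]) (by rw [map_sub ev, hc, h1, sub_self])
    f_s := contractFun_s (A := MvPolynomial (Fin 2) R) ev }

/-- The inverse homotopy equivalence: the algebra map `eᵢ ↦ eᵢ + fᵢ`, followed by the product with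
the exponential of `a (U₁₁ e₁ f₁ + U₂₂ e₂ f₂ + U₁₂ e₂ f₁)`. -/
def expand : MF.Hom (contractedMF N g a x₁ y₁ y₂ x₂) (wideMF N g a x₁ y₁ y₂ x₂) :=
  let c : R →+* MvPolynomial (Fin 2) R := MvPolynomial.C
  let p := c a * U₁₁ (N + 1) (c (x₁ + y₁)) (MvPolynomial.X 0) (c (x₂ + y₂)) (c (x₁ * y₁))
  let q := c a * U₂₂ (N + 1) (c (x₂ + y₂)) (c (x₁ * y₁)) (MvPolynomial.X 1) (c (x₂ * y₂))
  let r := c a * U₁₂ (N + 1) (MvPolynomial.X 0) (c (x₂ + y₂)) (c (x₁ * y₁)) (MvPolynomial.X 1)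
  { f :=
      { toFun := expandFun (A := MvPolynomial (Fin 2) R) (R := R) c p q r
        map_add' := expandFun_add (A := MvPolynomial (Fin 2) R) (R := R) c p q r
        map_smul' := expandFun_smul (A := MvPolynomial (Fin 2) R) (R := R) c p q r }
    f_d := expandFun_d (A := MvPolynomial (Fin 2) R) (R := R) c (a * U₁ (N + 1) (x₁ + y₁) (x₂ + y₂) (x₁ * y₁)) (x₁ + y₁ - (x₂ + y₂))
      (a * U₂ (N + 1) (x₂ + y₂) (x₁ * y₁) (x₂ * y₂)) (x₁ * y₁ - x₂ * y₂)
      (c a * U₁ (N + 1) (c (x₁ + y₁)) (MvPolynomial.X 0) (c (x₁ * y₁)))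
      (c (x₁ + y₁) - MvPolynomial.X 0)
      (c a * U₂ (N + 1) (MvPolynomial.X 0) (c (x₁ * y₁)) (MvPolynomial.X 1))
      (c (x₁ * y₁) - MvPolynomial.X 1)
      (c a * U₁ (N + 1) (MvPolynomial.X 0) (c (x₂ + y₂)) (MvPolynomial.X 1))
      (MvPolynomial.X 0 - c (x₂ + y₂))
      (c a * U₂ (N + 1) (c (x₂ + y₂)) (MvPolynomial.X 1) (c (x₂ * y₂)))
      (MvPolynomial.X 1 - c (x₂ * y₂)) p q r (by rw [map_sub]; ring) (by rw [map_sub]; ring)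
      (by rw [map_mul c a, map_U₁, mul_assoc, U₁₁_mul]; ring)
      (by rw [map_mul c a, map_U₂]; linear_combination (-c a) * U₂_sub (c (x₁ * y₁))
            (MvPolynomial.X 0) (MvPolynomial.X 1) (c (x₂ + y₂)) (c (x₂ * y₂)) (N + 1))
      (by rw [map_mul c a, map_U₁, mul_assoc, mul_assoc, U₁₁_mul', U₁₂_mul]; ring)
      (by rw [map_mul c a, map_U₂, mul_assoc, U₂₂_mul]; ring)
    f_s := expandFun_s (A := MvPolynomial (Fin 2) R) (R := R) c p q r }

/-- The morphism `χ⁰ : Γ₀ → Γ₁`. -/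
def χ₀ : MF.Hom (parallelMF N g a x₁ y₁ y₂ x₂) (wideMF N g a x₁ y₁ y₂ x₂) :=
  (expand N g a x₁ y₁ y₂ x₂).comp
    { f := (jump₀ (a * twist (N + 1) x₁ y₁ y₂ x₂) x₁ x₂ :
        (R × R) × (R × R) →ₗ[R] (R × R) × (R × R))
      f_d := jump₀_d (R := R) (by linear_combination a * twist_mul x₁ y₁ y₂ x₂ (N + 1))
        (by linear_combination a * twist_mul' x₁ y₁ y₂ x₂ (N + 1))
      f_s := jump₀_s (R := R) }

/-- The morphism `χ¹ : Γ₁ → Γ₀`. -/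
def χ₁ : MF.Hom (wideMF N g a x₁ y₁ y₂ x₂) (parallelMF N g a x₁ y₁ y₂ x₂) :=
  MF.Hom.comp
    { f := (jump₁ (a * twist (N + 1) x₁ y₁ y₂ x₂) x₁ x₂ :
        (R × R) × (R × R) →ₗ[R] (R × R) × (R × R))
      f_d := jump₁_d (R := R) (by linear_combination a * twist_mul x₁ y₁ y₂ x₂ (N + 1))
        (by linear_combination a * twist_mul' x₁ y₁ y₂ x₂ (N + 1))
      f_s := jump₁_s (R := R) }
    (contract N g a x₁ y₁ y₂ x₂)


/-! In the following complexes the potential is `a (x₁ ^ (N + 1) + y₁ ^ (N + 1) - x₂ ^ (N + 1) -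
y₂ ^ (N + 1))`, and the morphisms preserve all gradings after the shifts. -/

/-- The complex `0 → Γ₁⟨1⟩{1, N} → Γ₀⟨1⟩{1, N - 1} → 0` of a positive crossing, with `Γ₀` in
homological degree `0`. -/
def positiveCx : Cx R :=
  Cx.twoTerm (-1) ((wideMF N g a x₁ y₁ y₂ x₂).susp.shift 1 N)
    ((parallelMF N g a x₁ y₁ y₂ x₂).susp.shift 1 (N - 1))
    (((χ₁ N g a x₁ y₁ y₂ x₂).susp).shift 1 N 1 (N - 1)) (wideMF_w N g a x₁ y₁ y₂ x₂).symm

/-- The complex `0 → Γ₀⟨1⟩{-1, 1 - N} → Γ₁⟨1⟩{-1, -N} → 0` of a negative crossing, with `Γ₀` in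
homological degree `0`. -/
def negativeCx : Cx R :=
  Cx.twoTerm 0 ((parallelMF N g a x₁ y₁ y₂ x₂).susp.shift (-1) (1 - N))
    ((wideMF N g a x₁ y₁ y₂ x₂).susp.shift (-1) (-N))
    (((χ₀ N g a x₁ y₁ y₂ x₂).susp).shift (-1) (1 - N) (-1) (-N)) (wideMF_w N g a x₁ y₁ y₂ x₂)

end Pieces

/-! ### Closed braids -/

/-- The pieces of a diagram whose edges are cut at the marked points `P`: an arc from `x₂` to `x₁`,
or a crossing (positive if `pos = true`) whose incoming edges start at `y₂` (on the left) and `x₂`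
(on the right) and whose outgoing edges end at `x₁` (on the left) and `y₁` (on the right). -/
inductive Piece (P : Type) : Type
  | arc (x₁ x₂ : P)
  | crossing (pos : Bool) (x₁ y₁ y₂ x₂ : P)

/-- Rename the marked points. -/
def Piece.map {P Q : Type} (f : P → Q) : Piece P → Piece Q
  | .arc x₁ x₂ => .arc (f x₁) (f x₂)
  | .crossing pos x₁ y₁ y₂ x₂ => .crossing pos (f x₁) (f y₁) (f y₂) (f x₂)

/-- The ring `ℚ[a][P]` with one variable for each marked point. -/
abbrev PointRing (P : Type) : Type := MvPolynomial P ℚ[X]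

/-- The variable `a`. -/
def aVar (P : Type) : PointRing P := MvPolynomial.C Polynomial.X

/-- The bigrading of `ℚ[a][P]`: `a` has degree `(2, 0)` and the points have degree `(0, 2)`. -/
def pointGrading (P : Type) (j k : ℤ) : AddSubgroup (PointRing P) where
  carrier := {p | ∀ m n, (p.coeff m).coeff n ≠ 0 → 2 * (n : ℤ) = j ∧ 2 * (m.degree : ℤ) = k}
  zero_mem' := by simp
  add_mem' := by
    intro p q hp hq m n h
    rw [MvPolynomial.coeff_add, Polynomial.coeff_add] at h
    by_cases h0 : (p.coeff m).coeff n = 0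
    · exact hq m n (by simpa [h0] using h)
    · exact hp m n h0
  neg_mem' := by
    intro p hp m n h
    rw [MvPolynomial.coeff_neg, Polynomial.coeff_neg] at h
    exact hp m n (neg_ne_zero.mp h)

/-- The complex of matrix factorizations of a piece. -/
def Piece.cx (N : ℕ) {P : Type} : Piece P → Cx (PointRing P)
  | .arc x₁ x₂ =>
    Cx.single (arcMF N (pointGrading P) (aVar P) (MvPolynomial.X x₁) (MvPolynomial.X x₂))
  | .crossing true x₁ y₁ y₂ x₂ =>
    positiveCx N (pointGrading P) (aVar P) (MvPolynomial.X x₁) (MvPolynomial.X y₁)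
      (MvPolynomial.X y₂) (MvPolynomial.X x₂)
  | .crossing false x₁ y₁ y₂ x₂ =>
    negativeCx N (pointGrading P) (aVar P) (MvPolynomial.X x₁) (MvPolynomial.X y₁)
      (MvPolynomial.X y₂) (MvPolynomial.X x₂)

/-- The complex of a diagram: the tensor product of the complexes of its pieces, over the
polynomial ring in all marked points. -/
def diagramCx (N : ℕ) {P : Type} (pieces : List (Piece P)) : Cx (PointRing P) :=
  (pieces.map (Piece.cx N)).foldr Cx.tens (Cx.single (MF.base (pointGrading P)))

/-- A braid diagram on `m + 1` strands, running upwards: the marked points, the points at the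
bottom and at the top of the strands (numbered from right to left), and the pieces. -/
structure OpenBraid (m : ℕ) where
  Pt : Type
  bot : Fin (m + 1) → Pt
  top : Fin (m + 1) → Pt
  pieces : List (Piece Pt)

namespace OpenBraid

/-- The trivial braid: one marked point on each strand. -/
def trivial (m : ℕ) : OpenBraid m where
  Pt := Fin (m + 1)
  bot := id
  top := id
  pieces := []

/-- Add on the top of `B` a crossing of the strands at the positions `i` and `i + 1`, with two new
marked points at its upper left end (`Sum.inr true`) and its upper right end (`Sum.inr false`). -/
def cross {m : ℕ} (B : OpenBraid m) (i : Fin m) (pos : Bool) : OpenBraid m where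
  Pt := B.Pt ⊕ Bool
  bot j := Sum.inl (B.bot j)
  top j := if j = i.succ then Sum.inr true else if j = i.castSucc then Sum.inr false
    else Sum.inl (B.top j)
  pieces := B.pieces.map (Piece.map Sum.inl) ++ [Piece.crossing pos (Sum.inr true) (Sum.inr false)
    (Sum.inl (B.top i.succ)) (Sum.inl (B.top i.castSucc))]

/-- The pieces of the closure: the pieces of the braid, and for every position an arc from the top
to the bottom. -/
def closure {m : ℕ} (B : OpenBraid m) : List (Piece B.Pt) :=
  B.pieces ++ List.ofFn fun j : Fin (m + 1) => Piece.arc (B.bot j.rev) (B.top j.rev)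

end OpenBraid

/-- Braid words on `m + 1` strands: the letter `(i, true)` is the generator `σᵢ` crossing the
strands at the positions `i` and `i + 1` positively, and `(i, false)` is its inverse. -/
abbrev BraidWord (m : ℕ) : Type := List (Fin m × Bool)

namespace BraidWord

/-- The diagram of a braid word. -/
def diagram {m : ℕ} (w : BraidWord m) : OpenBraid m :=
  w.foldl (fun B l => B.cross l.1 l.2) (OpenBraid.trivial m)

/-- The complex `C_N(L)` of the closed braid `L` given by a braid word. -/
def complex (N : ℕ) {m : ℕ} (w : BraidWord m) : Cx (PointRing w.diagram.Pt) :=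
  diagramCx N w.diagram.closure

/-- Negative stabilization: add a strand and multiply by the inverse of the last generator. -/
def negStab {m : ℕ} (w : BraidWord m) : BraidWord (m + 1) :=
  w.map (fun l => (l.1.castSucc, l.2)) ++ [(Fin.last m, false)]

/-- The complex `(H(C_N(L), d_mf), d_χ)`. -/
def homologyCx (N : ℕ) {m : ℕ} (w : BraidWord m) : GrCx := (w.complex N).H

/-- The complex `(H(C_N(L) / a C_N(L), d_mf), d_χ)`. -/
def reducedHomologyCx (N : ℕ) {m : ℕ} (w : BraidWord m) : GrCx :=
  ((w.complex N).quot (aVar _)).H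

/-- The chain map `π₀` induced by the quotient map `C_N(L) → C_N(L) / a C_N(L)`, with all `a`- and
`x`-gradings shifted by `{-2, 0}`. -/
def π₀ (N : ℕ) {m : ℕ} (w : BraidWord m) :
    GrCx.Hom ((w.homologyCx N).shift (-2) 0) ((w.reducedHomologyCx N).shift (-2) 0) :=
  ((w.complex N).toQuot (aVar _)).H.shift (-2) 0

end BraidWord

end

end TransverseKR

namespace TransverseKR

noncomputable section

open scoped Polynomial TensorProduct

namespace Cx

section Iso

variable {R R' R'' : Type} [CommRing R] [CommRing R'] [CommRing R'']

/-- Semilinear isomorphisms of complexes of graded matrix factorizations. -/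
structure Iso (φ : R →+* R') (C : Cx R) (D : Cx R') where
  e : C.carrier ≃+ D.carrier
  smul : ∀ r x, e (r • x) = φ r • e x
  dmf : ∀ x, e (C.dmf x) = D.dmf (e x)
  dχ : ∀ x, e (C.dχ x) = D.dχ (e x)
  s : ∀ x, e (C.s x) = D.s (e x)
  t : ∀ x, e (C.t x) = D.t (e x)
  gr : ∀ {ε i j k x}, x ∈ C.gr ε i j k → e x ∈ D.gr ε i j k
  gr_symm : ∀ {ε i j k y}, y ∈ D.gr ε i j k → e.symm y ∈ C.gr ε i j k

namespace Iso

/-- The identity. -/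
def refl (C : Cx R) : Iso (RingHom.id R) C C where
  e := AddEquiv.refl _
  smul _ _ := rfl
  dmf _ := rfl
  dχ _ := rfl
  s _ := rfl
  t _ := rfl
  gr h := h
  gr_symm h := h

/-- The inverse of a linear isomorphism. -/
def symm {C D : Cx R} (f : Iso (RingHom.id R) C D) : Iso (RingHom.id R) D C where
  e := f.e.symm
  smul r x := by rw [AddEquiv.symm_apply_eq, f.smul]; simp
  dmf x := by rw [AddEquiv.symm_apply_eq, f.dmf]; simp
  dχ x := by rw [AddEquiv.symm_apply_eq, f.dχ]; simp
  s x := by rw [AddEquiv.symm_apply_eq, f.s]; simp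
  t x := by rw [AddEquiv.symm_apply_eq, f.t]; simp
  gr h := f.gr_symm h
  gr_symm h := f.gr h

/-- Composition. -/
def trans {φ : R →+* R'} {ψ : R' →+* R''} {χ : R →+* R''} {C : Cx R} {D : Cx R'} {E : Cx R''}
    (f : Iso φ C D) (g : Iso ψ D E) (h : ∀ r, ψ (φ r) = χ r) : Iso χ C E where
  e := f.e.trans g.e
  smul r x := by simp [f.smul, g.smul, h]
  dmf x := by simp [f.dmf, g.dmf]
  dχ x := by simp [f.dχ, g.dχ]
  s x := by simp [f.s, g.s]
  t x := by simp [f.t, g.t]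
  gr h := g.gr (f.gr h)
  gr_symm h := f.gr_symm (g.gr_symm h)

/-- A semilinear isomorphism over the identity as a linear equivalence. -/
def toLinearEquiv {C D : Cx R} (f : Iso (RingHom.id R) C D) : C.carrier ≃ₗ[R] D.carrier :=
  { f.e with map_smul' := f.smul }

end Iso

end Iso

section Tensor

variable {R : Type} [CommRing R]

theorem tmul_mem_tens_gr {C D : Cx R} {ε₁ i₁ j₁ k₁ ε₂ i₂ j₂ k₂ ε i j k} {x : C.carrier}
    {y : D.carrier} (hx : x ∈ C.gr ε₁ i₁ j₁ k₁) (hy : y ∈ D.gr ε₂ i₂ j₂ k₂) (hε : ε₁ + ε₂ = ε)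
    (hi : i₁ + i₂ = i) (hj : j₁ + j₂ = j) (hk : k₁ + k₂ = k) :
    (x ⊗ₜ[R] y : C.carrier ⊗[R] D.carrier) ∈ (C.tens D).gr ε i j k :=
  AddSubgroup.subset_closure ⟨ε₁, i₁, j₁, k₁, ε₂, i₂, j₂, k₂, hε, hi, hj, hk, x, hx, y, hy, rfl⟩

theorem map_mem_of_mem_tens_gr {C D : Cx R} {G : Type} [AddCommGroup G]
    (f : (C.carrier ⊗[R] D.carrier) →+ G) (S : AddSubgroup G) {ε i j k}
    (h : ∀ {ε₁ i₁ j₁ k₁ ε₂ i₂ j₂ k₂}, ε₁ + ε₂ = ε → i₁ + i₂ = i → j₁ + j₂ = j → k₁ + k₂ = k →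
      ∀ {x y}, x ∈ C.gr ε₁ i₁ j₁ k₁ → y ∈ D.gr ε₂ i₂ j₂ k₂ → f (x ⊗ₜ[R] y) ∈ S)
    {z : C.carrier ⊗[R] D.carrier} (hz : z ∈ (C.tens D).gr ε i j k) : f z ∈ S := by
  suffices H : (C.tens D).gr ε i j k ≤ S.comap f from H hz
  refine (AddSubgroup.closure_le _).2 ?_
  rintro _ ⟨ε₁, i₁, j₁, k₁, ε₂, i₂, j₂, k₂, hε, hi, hj, hk, x, hx, y, hy, rfl⟩
  exact h hε hi hj hk hx hy

/-- Additive maps on a tensor product agree if they agree on pure tensors. -/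
theorem tens_addHom_ext {M N G : Type} [AddCommGroup M] [Module R M] [AddCommGroup N] [Module R N]
    [AddCommGroup G] (f g : M ⊗[R] N →+ G) (h : ∀ x y, f (x ⊗ₜ y) = g (x ⊗ₜ y)) (z) :
    f z = g z := by
  induction z using TensorProduct.induction_on with
  | zero => simp only [map_zero]
  | add x y hx hy => simp only [map_add, hx, hy]
  | tmul x y => exact h x y

/-- The action of a differential on a tensor product. -/
abbrev leibniz {M N : Type} [AddCommGroup M] [Module R M] [AddCommGroup N] [Module R N]
    (c s : M →ₗ[R] M) (d : N →ₗ[R] N) : M ⊗[R] N →ₗ[R] M ⊗[R] N :=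
  TensorProduct.map c LinearMap.id + TensorProduct.map s d

/-- An isomorphism out of a tensor product is determined by its values on pure tensors. -/
def isoOfTens {R' : Type} [CommRing R'] {φ : R →+* R'} {C D : Cx R} {E : Cx R'}
    (e : (C.carrier ⊗[R] D.carrier) ≃+ E.carrier)
    (smul : ∀ (r : R) (x : C.carrier ⊗[R] D.carrier), e (r • x) = φ r • e x)
    (dmf : ∀ x y, e (C.dmf x ⊗ₜ y) + e (C.s x ⊗ₜ D.dmf y) = E.dmf (e (x ⊗ₜ y)))
    (dχ : ∀ x y, e (C.dχ x ⊗ₜ y) + e (C.t x ⊗ₜ D.dχ y) = E.dχ (e (x ⊗ₜ y)))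
    (s : ∀ x y, e (C.s x ⊗ₜ D.s y) = E.s (e (x ⊗ₜ y)))
    (t : ∀ x y, e (C.t x ⊗ₜ D.t y) = E.t (e (x ⊗ₜ y)))
    (gr : ∀ {ε₁ i₁ j₁ k₁ ε₂ i₂ j₂ k₂ x y}, x ∈ C.gr ε₁ i₁ j₁ k₁ → y ∈ D.gr ε₂ i₂ j₂ k₂ →
      e (x ⊗ₜ[R] y) ∈ E.gr (ε₁ + ε₂) (i₁ + i₂) (j₁ + j₂) (k₁ + k₂))
    (gr_symm : ∀ {ε i j k y}, y ∈ E.gr ε i j k → e.symm y ∈ (C.tens D).gr ε i j k) :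
    Iso φ (C.tens D) E where
  e := e
  smul := smul
  dmf := tens_addHom_ext (e.toAddMonoidHom.comp (leibniz C.dmf C.s D.dmf).toAddMonoidHom)
    (E.dmf.toAddMonoidHom.comp e.toAddMonoidHom) fun x y => (e.map_add _ _).trans (dmf x y)
  dχ := tens_addHom_ext (e.toAddMonoidHom.comp (leibniz C.dχ C.t D.dχ).toAddMonoidHom)
    (E.dχ.toAddMonoidHom.comp e.toAddMonoidHom) fun x y => (e.map_add _ _).trans (dχ x y)
  s := tens_addHom_ext (e.toAddMonoidHom.comp (TensorProduct.map C.s D.s).toAddMonoidHom)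
    (E.s.toAddMonoidHom.comp e.toAddMonoidHom) s
  t := tens_addHom_ext (e.toAddMonoidHom.comp (TensorProduct.map C.t D.t).toAddMonoidHom)
    (E.t.toAddMonoidHom.comp e.toAddMonoidHom) t
  gr hz := map_mem_of_mem_tens_gr e.toAddMonoidHom _ (by
    rintro _ _ _ _ _ _ _ _ rfl rfl rfl rfl x y hx hy
    exact gr hx hy) hz
  gr_symm := gr_symm

/-- Tensor products of isomorphisms. -/
def Iso.tens {C C' D D' : Cx R} (f : Iso (RingHom.id R) C C') (g : Iso (RingHom.id R) D D') :
    Iso (RingHom.id R) (C.tens D) (C'.tens D') :=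
  isoOfTens (E := C'.tens D')
    (TensorProduct.congr f.toLinearEquiv g.toLinearEquiv).toAddEquiv
    (fun r x => map_smul (TensorProduct.congr f.toLinearEquiv g.toLinearEquiv) r x)
    (fun x y => by
      change f.e (C.dmf x) ⊗ₜ[R] g.e y + f.e (C.s x) ⊗ₜ[R] g.e (D.dmf y) =
        C'.dmf (f.e x) ⊗ₜ[R] g.e y + C'.s (f.e x) ⊗ₜ[R] D'.dmf (g.e y)
      rw [f.dmf, f.s, g.dmf])
    (fun x y => by
      change f.e (C.dχ x) ⊗ₜ[R] g.e y + f.e (C.t x) ⊗ₜ[R] g.e (D.dχ y) =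
        C'.dχ (f.e x) ⊗ₜ[R] g.e y + C'.t (f.e x) ⊗ₜ[R] D'.dχ (g.e y)
      rw [f.dχ, f.t, g.dχ])
    (fun x y => congrArg₂ (TensorProduct.tmul R) (f.s x) (g.s y))
    (fun x y => congrArg₂ (TensorProduct.tmul R) (f.t x) (g.t y))
    (fun hx hy => tmul_mem_tens_gr (f.gr hx) (g.gr hy) rfl rfl rfl rfl)
    (fun {ε i j k y} hz => map_mem_of_mem_tens_gr
      (TensorProduct.congr f.toLinearEquiv g.toLinearEquiv).symm.toLinearMap.toAddMonoidHom
      ((C.tens D).gr ε i j k)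
      (fun hε hi hj hk _ _ hx hy =>
        tmul_mem_tens_gr (f.gr_symm hx) (g.gr_symm hy) hε hi hj hk) hz)

theorem leibniz_assoc {M N P : Type} [AddCommGroup M] [Module R M] [AddCommGroup N] [Module R N]
    [AddCommGroup P] [Module R P] (d s : M →ₗ[R] M) (d' s' : N →ₗ[R] N) (d'' : P →ₗ[R] P) (z) :
    TensorProduct.assoc R M N P (leibniz (leibniz d s d') (TensorProduct.map s s') d'' z) =
      leibniz d s (leibniz d' s' d'') (TensorProduct.assoc R M N P z) := by
  suffices H : (TensorProduct.assoc R M N P).toLinearMap ∘ₗ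
      leibniz (leibniz d s d') (TensorProduct.map s s') d'' =
      leibniz d s (leibniz d' s' d'') ∘ₗ (TensorProduct.assoc R M N P).toLinearMap from
    LinearMap.congr_fun H z
  refine TensorProduct.ext_threefold fun x y w => ?_
  simp [TensorProduct.add_tmul, TensorProduct.tmul_add, add_assoc]

theorem map_assoc {M N P : Type} [AddCommGroup M] [Module R M] [AddCommGroup N] [Module R N]
    [AddCommGroup P] [Module R P] (s : M →ₗ[R] M) (s' : N →ₗ[R] N) (s'' : P →ₗ[R] P) (z) :
    TensorProduct.assoc R M N P (TensorProduct.map (TensorProduct.map s s') s'' z) =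
      TensorProduct.map s (TensorProduct.map s' s'') (TensorProduct.assoc R M N P z) := by
  suffices H : (TensorProduct.assoc R M N P).toLinearMap ∘ₗ
      TensorProduct.map (TensorProduct.map s s') s'' =
      TensorProduct.map s (TensorProduct.map s' s'') ∘ₗ
        (TensorProduct.assoc R M N P).toLinearMap from LinearMap.congr_fun H z
  exact TensorProduct.ext_threefold fun x y w => rfl

/-- Associativity of the tensor product. -/
def assoc (C D E : Cx R) : Iso (RingHom.id R) ((C.tens D).tens E) (C.tens (D.tens E)) :=
  let α := TensorProduct.assoc R C.carrier D.carrier E.carrier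
  { e := α.toAddEquiv
    smul := fun r x => map_smul α r x
    dmf := leibniz_assoc C.dmf C.s D.dmf D.s E.dmf
    dχ := leibniz_assoc C.dχ C.t D.dχ D.t E.dχ
    s := map_assoc C.s D.s E.s
    t := map_assoc C.t D.t E.t
    gr := fun {ε i j k z} hz => map_mem_of_mem_tens_gr (C := C.tens D)
      α.toLinearMap.toAddMonoidHom ((C.tens (D.tens E)).gr ε i j k)
      (fun {ε₁ i₁ j₁ k₁ ε₂ i₂ j₂ k₂} hε hi hj hk x y hx hy => map_mem_of_mem_tens_gr
        ((α.toLinearMap ∘ₗ (TensorProduct.mk R (C.carrier ⊗[R] D.carrier) E.carrier).flip y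
          ).toAddMonoidHom)
        ((C.tens (D.tens E)).gr ε i j k)
        (fun hε' hi' hj' hk' _ _ hx' hy' =>
          tmul_mem_tens_gr hx' (tmul_mem_tens_gr hy' hy rfl rfl rfl rfl)
          (by rw [← hε, ← hε', add_assoc]) (by rw [← hi, ← hi', add_assoc])
          (by rw [← hj, ← hj', add_assoc]) (by rw [← hk, ← hk', add_assoc])) hx) hz
    gr_symm := fun {ε i j k z} hz => map_mem_of_mem_tens_gr (D := D.tens E)
      α.symm.toLinearMap.toAddMonoidHom (((C.tens D).tens E).gr ε i j k)
      (fun {ε₁ i₁ j₁ k₁ ε₂ i₂ j₂ k₂} hε hi hj hk x y hx hy => map_mem_of_mem_tens_gr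
        ((α.symm.toLinearMap ∘ₗ TensorProduct.mk R C.carrier (D.carrier ⊗[R] E.carrier) x
          ).toAddMonoidHom)
        (((C.tens D).tens E).gr ε i j k)
        (fun hε' hi' hj' hk' _ _ hx' hy' =>
          tmul_mem_tens_gr (tmul_mem_tens_gr hx hx' rfl rfl rfl rfl)
          hy' (by rw [← hε, ← hε', add_assoc]) (by rw [← hi, ← hi', add_assoc])
          (by rw [← hj, ← hj', add_assoc]) (by rw [← hk, ← hk', add_assoc])) hy) hz }

end Tensor

end Cx

namespace Cx

variable {R : Type} [CommRing R]

/-- Linear maps commuting with both differentials and both involutions. -/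
structure SHom (C D : Cx R) extends Hom C D where
  f_s : ∀ x, f (C.s x) = D.s (f x)
  f_t : ∀ x, f (C.t x) = D.t (f x)

/-- The differentials and the involutions are homogeneous. -/
structure IsHomogeneous (N : ℕ) (C : Cx R) : Prop where
  dmf : ∀ {ε i j k x}, x ∈ C.gr ε i j k → C.dmf x ∈ C.gr (ε + 1) i (j + 1) (k + (N + 1))
  dχ : ∀ {ε i j k x}, x ∈ C.gr ε i j k → C.dχ x ∈ C.gr ε (i + 1) j k
  s : ∀ {ε i j k x}, x ∈ C.gr ε i j k → C.s x ∈ C.gr ε i j k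
  t : ∀ {ε i j k x}, x ∈ C.gr ε i j k → C.t x ∈ C.gr ε i j k

/-- The total complex of `0 → C → D → 0`, with `C` in position `0`. -/
def cone {C D : Cx R} (F : SHom C D) (hw : D.w = C.w) : Cx R where
  carrier := C.carrier × D.carrier
  w := C.w
  dmf := C.dmf.prodMap D.dmf
  dχ := LinearMap.prod (C.dχ ∘ₗ LinearMap.fst _ _ _)
    (F.f ∘ₗ LinearMap.fst _ _ _ - D.dχ ∘ₗ LinearMap.snd _ _ _)
  s := C.s.prodMap D.s
  t := C.t.prodMap (-D.t)
  gr ε i j k := (C.gr ε i j k).prod (D.gr ε (i - 1) j k)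
  dmf_dmf := by rintro ⟨x, y⟩; simp [C.dmf_dmf, D.dmf_dmf, hw]
  dχ_dχ := by rintro ⟨x, y⟩; simp [C.dχ_dχ, D.dχ_dχ, F.f_dχ]
  dmf_dχ := by rintro ⟨x, y⟩; simp [C.dmf_dχ, D.dmf_dχ, F.f_dmf]
  s_s := by rintro ⟨x, y⟩; simp [C.s_s, D.s_s]
  t_t := by rintro ⟨x, y⟩; simp [C.t_t, D.t_t]
  s_t := by rintro ⟨x, y⟩; simp [C.s_t, D.s_t]
  s_dmf := by rintro ⟨x, y⟩; simp [C.s_dmf, D.s_dmf]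
  s_dχ := by rintro ⟨x, y⟩; simp [C.s_dχ, D.s_dχ, F.f_s]
  t_dmf := by rintro ⟨x, y⟩; simp [C.t_dmf, D.t_dmf]
  t_dχ := by rintro ⟨x, y⟩; simp [C.t_dχ, D.t_dχ, F.f_t]

/-- The product of `C` with the two-term factorization `(0, b)`, the second generator of which
has degree `(p, q)`. -/
def row (C : Cx R) (b : R) (p q : ℤ) : Cx R where
  carrier := C.carrier × C.carrier
  w := C.w
  dmf := rowD C.dmf C.s 0 b
  dχ := C.dχ.prodMap C.dχ
  s := rowS C.s
  t := C.t.prodMap C.t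
  gr ε i j k := (C.gr ε i j k).prod (C.gr (ε + 1) i (j - p) (k - q))
  dmf_dmf := by rintro ⟨x, y⟩; simp [C.dmf_dmf, C.s_dmf]
  dχ_dχ := by rintro ⟨x, y⟩; simp [C.dχ_dχ]
  dmf_dχ := by rintro ⟨x, y⟩; simp [C.dmf_dχ, C.s_dχ]
  s_s := by rintro ⟨x, y⟩; simp [C.s_s]
  t_t := by rintro ⟨x, y⟩; simp [C.t_t]
  s_t := by rintro ⟨x, y⟩; simp [C.s_t]
  s_dmf := by rintro ⟨x, y⟩; simp [C.s_dmf, C.s_s, add_comm]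
  s_dχ := by rintro ⟨x, y⟩; simp [C.s_dχ]
  t_dmf := by rintro ⟨x, y⟩; simp [C.t_dmf, C.s_t]
  t_dχ := by rintro ⟨x, y⟩; simp [C.t_dχ]

/-- The inclusion of `C` into the product with `(0, b)`. -/
def toRow (C : Cx R) (b : R) (p q : ℤ) : SHom C (C.row b p q) where
  f := LinearMap.inl R _ _
  f_dmf x := Prod.ext (by change C.dmf x = C.dmf x + b • C.s 0; rw [map_zero, smul_zero, add_zero])
    (by change 0 = C.dmf 0 + (0 : R) • C.s x; rw [map_zero, zero_smul, add_zero])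
  f_dχ x := Prod.ext rfl (map_zero C.dχ).symm
  f_s x := Prod.ext rfl (by change 0 = -C.s 0; rw [map_zero, neg_zero])
  f_t x := Prod.ext rfl (map_zero C.t).symm

/-- The shift of the `a`- and `x`-gradings. -/
def shift (C : Cx R) (p q : ℤ) : Cx R :=
  { C with gr := fun ε i j k => C.gr ε i (j - p) (k - q) }

/-- A morphism, regarded as a morphism of the shifts. -/
def SHom.shift {C D : Cx R} (F : SHom C D) (p q : ℤ) : SHom (C.shift p q) (D.shift p q) where
  f := F.f
  f_dmf := F.f_dmf
  f_dχ := F.f_dχ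
  f_s := F.f_s
  f_t := F.f_t

/-- The tensor product of a morphism with an identity on the left. -/
def SHom.tensL (P : Cx R) {C D : Cx R} (F : SHom C D) : SHom (P.tens C) (P.tens D) where
  f := TensorProduct.map LinearMap.id F.f
  f_dmf := tens_addHom_ext
    ((TensorProduct.map LinearMap.id F.f).toAddMonoidHom.comp
      (leibniz P.dmf P.s C.dmf).toAddMonoidHom)
    ((leibniz P.dmf P.s D.dmf).toAddMonoidHom.comp
      (TensorProduct.map LinearMap.id F.f).toAddMonoidHom) (by simp [F.f_dmf])
  f_dχ := tens_addHom_ext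
    ((TensorProduct.map LinearMap.id F.f).toAddMonoidHom.comp
      (leibniz P.dχ P.t C.dχ).toAddMonoidHom)
    ((leibniz P.dχ P.t D.dχ).toAddMonoidHom.comp
      (TensorProduct.map LinearMap.id F.f).toAddMonoidHom) (by simp [F.f_dχ])
  f_s := tens_addHom_ext
    ((TensorProduct.map LinearMap.id F.f).toAddMonoidHom.comp
      (TensorProduct.map P.s C.s).toAddMonoidHom)
    ((TensorProduct.map P.s D.s).toAddMonoidHom.comp
      (TensorProduct.map LinearMap.id F.f).toAddMonoidHom) (by simp [F.f_s])
  f_t := tens_addHom_ext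
    ((TensorProduct.map LinearMap.id F.f).toAddMonoidHom.comp
      (TensorProduct.map P.t C.t).toAddMonoidHom)
    ((TensorProduct.map P.t D.t).toAddMonoidHom.comp
      (TensorProduct.map LinearMap.id F.f).toAddMonoidHom) (by simp [F.f_t])

/-- The tensor product of a morphism with an identity on the right. -/
def SHom.tensR {C D : Cx R} (F : SHom C D) (P : Cx R) : SHom (C.tens P) (D.tens P) where
  f := TensorProduct.map F.f LinearMap.id
  f_dmf := tens_addHom_ext
    ((TensorProduct.map F.f LinearMap.id).toAddMonoidHom.comp
      (leibniz C.dmf C.s P.dmf).toAddMonoidHom)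
    ((leibniz D.dmf D.s P.dmf).toAddMonoidHom.comp
      (TensorProduct.map F.f LinearMap.id).toAddMonoidHom) (by simp [F.f_dmf, F.f_s])
  f_dχ := tens_addHom_ext
    ((TensorProduct.map F.f LinearMap.id).toAddMonoidHom.comp
      (leibniz C.dχ C.t P.dχ).toAddMonoidHom)
    ((leibniz D.dχ D.t P.dχ).toAddMonoidHom.comp
      (TensorProduct.map F.f LinearMap.id).toAddMonoidHom) (by simp [F.f_dχ, F.f_t])
  f_s := tens_addHom_ext
    ((TensorProduct.map F.f LinearMap.id).toAddMonoidHom.comp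
      (TensorProduct.map C.s P.s).toAddMonoidHom)
    ((TensorProduct.map D.s P.s).toAddMonoidHom.comp
      (TensorProduct.map F.f LinearMap.id).toAddMonoidHom) (by simp [F.f_s])
  f_t := tens_addHom_ext
    ((TensorProduct.map F.f LinearMap.id).toAddMonoidHom.comp
      (TensorProduct.map C.t P.t).toAddMonoidHom)
    ((TensorProduct.map D.t P.t).toAddMonoidHom.comp
      (TensorProduct.map F.f LinearMap.id).toAddMonoidHom) (by simp [F.f_t])

theorem shift_tens_gr (C D : Cx R) (p q : ℤ) (ε i j k) :
    ((C.shift p q).tens D).gr ε i j k = ((C.tens D).shift p q).gr ε i j k := by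
  refine congrArg AddSubgroup.closure (Set.ext fun z => ⟨?_, ?_⟩)
  · rintro ⟨ε₁, i₁, j₁, k₁, ε₂, i₂, j₂, k₂, hε, hi, hj, hk, x, hx, y, hy, rfl⟩
    exact ⟨ε₁, i₁, j₁ - p, k₁ - q, ε₂, i₂, j₂, k₂, hε, hi, by omega, by omega, x, hx, y, hy, rfl⟩
  · rintro ⟨ε₁, i₁, j₁, k₁, ε₂, i₂, j₂, k₂, hε, hi, hj, hk, x, hx, y, hy, rfl⟩
    refine ⟨ε₁, i₁, j₁ + p, k₁ + q, ε₂, i₂, j₂, k₂, hε, hi, by omega, by omega, x, ?_, y, hy, rfl⟩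
    change x ∈ C.gr ε₁ i₁ (j₁ + p - p) (k₁ + q - q)
    rwa [add_sub_cancel_right, add_sub_cancel_right]

theorem tens_shift_gr (C D : Cx R) (p q : ℤ) (ε i j k) :
    (C.tens (D.shift p q)).gr ε i j k = ((C.tens D).shift p q).gr ε i j k := by
  refine congrArg AddSubgroup.closure (Set.ext fun z => ⟨?_, ?_⟩)
  · rintro ⟨ε₁, i₁, j₁, k₁, ε₂, i₂, j₂, k₂, hε, hi, hj, hk, x, hx, y, hy, rfl⟩
    exact ⟨ε₁, i₁, j₁, k₁, ε₂, i₂, j₂ - p, k₂ - q, hε, hi, by omega, by omega, x, hx, y, hy, rfl⟩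
  · rintro ⟨ε₁, i₁, j₁, k₁, ε₂, i₂, j₂, k₂, hε, hi, hj, hk, x, hx, y, hy, rfl⟩
    refine ⟨ε₁, i₁, j₁, k₁, ε₂, i₂, j₂ + p, k₂ + q, hε, hi, by omega, by omega, x, hx, y, ?_, rfl⟩
    change y ∈ D.gr ε₂ i₂ (j₂ + p - p) (k₂ + q - q)
    rwa [add_sub_cancel_right, add_sub_cancel_right]

/-- A shift of the left factor of a tensor product. -/
def shiftTens (C D : Cx R) (p q : ℤ) :
    Iso (RingHom.id R) ((C.shift p q).tens D) ((C.tens D).shift p q) where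
  e := AddEquiv.refl (C.carrier ⊗[R] D.carrier)
  smul _ _ := rfl
  dmf _ := rfl
  dχ _ := rfl
  s _ := rfl
  t _ := rfl
  gr h := (shift_tens_gr C D p q _ _ _ _).le h
  gr_symm h := (shift_tens_gr C D p q _ _ _ _).ge h

/-- A shift of the right factor of a tensor product. -/
def tensShift (C D : Cx R) (p q : ℤ) :
    Iso (RingHom.id R) (C.tens (D.shift p q)) ((C.tens D).shift p q) where
  e := AddEquiv.refl (C.carrier ⊗[R] D.carrier)
  smul _ _ := rfl
  dmf _ := rfl
  dχ _ := rfl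
  s _ := rfl
  t _ := rfl
  gr h := (tens_shift_gr C D p q _ _ _ _).le h
  gr_symm h := (tens_shift_gr C D p q _ _ _ _).ge h

section Twist

variable {M N P : Type} [AddCommGroup M] [Module R M] [AddCommGroup N] [Module R N]
  [AddCommGroup P] [Module R P]

/-- An involution as an equivalence. -/
def equivOfInvolution (s : M →ₗ[R] M) (h : ∀ x, s (s x) = x) : M ≃ₗ[R] M :=
  LinearEquiv.ofInvolutive s h

/-- Distribution of a tensor product over a product on the right, twisted on the second
summand. -/
def distribRight (t : M →ₗ[R] M) (h : ∀ x, t (t x) = x) :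
    M ⊗[R] (N × P) ≃ₗ[R] (M ⊗[R] N) × (M ⊗[R] P) :=
  TensorProduct.prodRight R R M N P ≪≫ₗ
    (LinearEquiv.refl R _).prodCongr
      (TensorProduct.congr (equivOfInvolution t h) (LinearEquiv.refl R P))

@[simp] theorem distribRight_tmul (t : M →ₗ[R] M) (h) (x : M) (y : N × P) :
    distribRight t h (x ⊗ₜ y) = (x ⊗ₜ y.1, t x ⊗ₜ y.2) := rfl

theorem distribRight_symm_inl (t : M →ₗ[R] M) (h) (x : M) (y : N) :
    (distribRight (P := P) t h).symm (x ⊗ₜ y, 0) = x ⊗ₜ (y, 0) := by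
  rw [LinearEquiv.symm_apply_eq]; simp

theorem distribRight_symm_inr (t : M →ₗ[R] M) (h) (x : M) (y : P) :
    (distribRight (N := N) t h).symm (0, x ⊗ₜ y) = t x ⊗ₜ (0, y) := by
  rw [LinearEquiv.symm_apply_eq]; simp [h]

/-- Distribution of a tensor product over a product on the left, twisted on the second
summand. -/
def distribLeft (t : P →ₗ[R] P) (h : ∀ x, t (t x) = x) :
    (M × N) ⊗[R] P ≃ₗ[R] (M ⊗[R] P) × (N ⊗[R] P) :=
  TensorProduct.prodLeft R R M N P ≪≫ₗ
    (LinearEquiv.refl R _).prodCongr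
      (TensorProduct.congr (LinearEquiv.refl R N) (equivOfInvolution t h))

@[simp] theorem distribLeft_tmul (t : P →ₗ[R] P) (h) (x : M × N) (y : P) :
    distribLeft t h (x ⊗ₜ y) = (x.1 ⊗ₜ y, x.2 ⊗ₜ t y) := rfl

theorem distribLeft_symm_inl (t : P →ₗ[R] P) (h) (x : M) (y : P) :
    (distribLeft (N := N) t h).symm (x ⊗ₜ y, 0) = (x, 0) ⊗ₜ y := by
  rw [LinearEquiv.symm_apply_eq]; simp

theorem distribLeft_symm_inr (t : P →ₗ[R] P) (h) (x : N) (y : P) :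
    (distribLeft (M := M) t h).symm (0, x ⊗ₜ y) = (0, x) ⊗ₜ t y := by
  rw [LinearEquiv.symm_apply_eq]; simp [h]

end Twist

theorem neg_add_sub_eq {M : Type} [AddCommGroup M] (x y z : M) : -x + (y - z) = y - (x + z) := by
  abel

theorem sub_add_neg_eq {M : Type} [AddCommGroup M] (x y z : M) : x - y + -z = x - (y + z) := by
  abel

theorem symm_mem_of_prod {M A B : Type} [AddCommGroup M] [AddCommGroup A] [AddCommGroup B]
    (e : M ≃+ A × B) (S : AddSubgroup M) (S₁ : AddSubgroup A) (S₂ : AddSubgroup B)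
    (h₁ : ∀ x ∈ S₁, e.symm (x, 0) ∈ S) (h₂ : ∀ y ∈ S₂, e.symm (0, y) ∈ S) {z : A × B}
    (hz : z ∈ S₁.prod S₂) : e.symm z ∈ S := by
  obtain ⟨x, y⟩ := z
  have : ((x, y) : A × B) = (x, 0) + (0, y) := by simp
  rw [this, map_add]
  exact add_mem (h₁ x hz.1) (h₂ y hz.2)

/-- The tensor product with a cone on the right. -/
def tensCone (P : Cx R) {C D : Cx R} (F : SHom C D) (hw : D.w = C.w) {N : ℕ}
    (hP : P.IsHomogeneous N) (hw' : (P.tens D).w = (P.tens C).w) :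
    Iso (RingHom.id R) (P.tens (cone F hw)) (cone (F.tensL P) hw') :=
  isoOfTens (D := cone F hw) (E := cone (F.tensL P) hw')
    (distribRight P.t P.t_t).toAddEquiv
    (fun r x => map_smul (distribRight P.t P.t_t) r x)
    (by
      rintro x ⟨y, z⟩
      change (P.dmf x ⊗ₜ[R] y, P.t (P.dmf x) ⊗ₜ[R] z) +
        (P.s x ⊗ₜ[R] C.dmf y, P.t (P.s x) ⊗ₜ[R] D.dmf z) =
        (P.dmf x ⊗ₜ[R] y + P.s x ⊗ₜ[R] C.dmf y,
          P.dmf (P.t x) ⊗ₜ[R] z + P.s (P.t x) ⊗ₜ[R] D.dmf z)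
      rw [P.t_dmf, P.s_t]; rfl)
    (by
      rintro x ⟨y, z⟩
      change (P.dχ x ⊗ₜ[R] y, P.t (P.dχ x) ⊗ₜ[R] z) +
        (P.t x ⊗ₜ[R] C.dχ y, P.t (P.t x) ⊗ₜ[R] (F.f y - D.dχ z)) =
        (P.dχ x ⊗ₜ[R] y + P.t x ⊗ₜ[R] C.dχ y,
          x ⊗ₜ[R] F.f y - (P.dχ (P.t x) ⊗ₜ[R] z + P.t (P.t x) ⊗ₜ[R] D.dχ z))
      rw [P.t_dχ, P.t_t, TensorProduct.neg_tmul, TensorProduct.tmul_sub]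
      exact Prod.ext rfl (neg_add_sub_eq _ _ _))
    (by
      rintro x ⟨y, z⟩
      change (P.s x ⊗ₜ[R] C.s y, P.t (P.s x) ⊗ₜ[R] D.s z) =
        (P.s x ⊗ₜ[R] C.s y, P.s (P.t x) ⊗ₜ[R] D.s z)
      rw [P.s_t])
    (by
      rintro x ⟨y, z⟩
      change (P.t x ⊗ₜ[R] C.t y, P.t (P.t x) ⊗ₜ[R] (-D.t z)) =
        (P.t x ⊗ₜ[R] C.t y, -(P.t (P.t x) ⊗ₜ[R] D.t z))
      rw [TensorProduct.tmul_neg])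
    (by
      rintro ε₁ i₁ j₁ k₁ ε₂ i₂ j₂ k₂ x ⟨y, z⟩ hx ⟨hy, hz⟩
      exact ⟨tmul_mem_tens_gr hx hy rfl rfl rfl rfl,
        tmul_mem_tens_gr (hP.t hx) hz rfl (by omega) rfl rfl⟩)
    (fun {ε i j k z} hz => symm_mem_of_prod (distribRight P.t P.t_t).toAddEquiv _ _ _
      (fun x hx => map_mem_of_mem_tens_gr
        ((distribRight P.t P.t_t).symm.toLinearMap ∘ₗ LinearMap.inl R _ _).toAddMonoidHom _
        (fun hε hi hj hk x y hx hy => by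
          change (distribRight P.t P.t_t).symm (x ⊗ₜ[R] y, 0) ∈ _
          rw [distribRight_symm_inl]
          exact tmul_mem_tens_gr (D := cone F hw) hx ⟨hy, zero_mem _⟩ hε hi hj hk) hx)
      (fun x hx => map_mem_of_mem_tens_gr
        ((distribRight P.t P.t_t).symm.toLinearMap ∘ₗ LinearMap.inr R _ _).toAddMonoidHom _
        (fun {ε₁ i₁ j₁ k₁ ε₂ i₂ j₂ k₂} hε hi hj hk x y hx hy => by
          change (distribRight P.t P.t_t).symm (0, x ⊗ₜ[R] y) ∈ _
          rw [distribRight_symm_inr]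
          refine tmul_mem_tens_gr (D := cone F hw) (i₂ := i₂ + 1) (hP.t hx) ⟨zero_mem _, ?_⟩ hε
            (by omega) hj hk
          simpa using hy) hx) hz)

/-- The tensor product with a cone on the left. -/
def coneTens {C D : Cx R} (F : SHom C D) (hw : D.w = C.w) (P : Cx R)
    (hw' : (D.tens P).w = (C.tens P).w) :
    Iso (RingHom.id R) ((cone F hw).tens P) (cone (F.tensR P) hw') :=
  let e : (C.carrier × D.carrier) ⊗[R] P.carrier ≃ₗ[R]
      (C.carrier ⊗[R] P.carrier) × (D.carrier ⊗[R] P.carrier) :=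
    distribLeft LinearMap.id (fun _ => rfl)
  isoOfTens (C := cone F hw) (E := cone (F.tensR P) hw') e.toAddEquiv (fun r x => map_smul e r x)
    (by
      rintro ⟨y, z⟩ x
      rfl)
    (by
      rintro ⟨y, z⟩ x
      change (C.dχ y ⊗ₜ[R] x, (F.f y - D.dχ z) ⊗ₜ[R] x) +
        (C.t y ⊗ₜ[R] P.dχ x, (-D.t z) ⊗ₜ[R] P.dχ x) =
        (C.dχ y ⊗ₜ[R] x + C.t y ⊗ₜ[R] P.dχ x,
          F.f y ⊗ₜ[R] x - (D.dχ z ⊗ₜ[R] x + D.t z ⊗ₜ[R] P.dχ x))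
      rw [TensorProduct.neg_tmul, TensorProduct.sub_tmul]
      exact Prod.ext rfl (sub_add_neg_eq _ _ _))
    (by
      rintro ⟨y, z⟩ x
      rfl)
    (by
      rintro ⟨y, z⟩ x
      change (C.t y ⊗ₜ[R] P.t x, (-D.t z) ⊗ₜ[R] P.t x) =
        (C.t y ⊗ₜ[R] P.t x, -(D.t z ⊗ₜ[R] P.t x))
      rw [TensorProduct.neg_tmul])
    (by
      rintro ε₁ i₁ j₁ k₁ ε₂ i₂ j₂ k₂ ⟨y, z⟩ x ⟨hy, hz⟩ hx
      exact ⟨tmul_mem_tens_gr hy hx rfl rfl rfl rfl,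
        tmul_mem_tens_gr hz hx rfl (by omega) rfl rfl⟩)
    (fun {ε i j k z} hz => symm_mem_of_prod e.toAddEquiv _ _ _
      (fun x hx => map_mem_of_mem_tens_gr
        (e.symm.toLinearMap ∘ₗ LinearMap.inl R _ _).toAddMonoidHom _
        (fun hε hi hj hk x y hx hy => by
          change e.symm (x ⊗ₜ[R] y, 0) ∈ _
          rw [distribLeft_symm_inl]
          exact tmul_mem_tens_gr (C := cone F hw) ⟨hx, zero_mem _⟩ hy hε hi hj hk) hx)
      (fun x hx => map_mem_of_mem_tens_gr
        (e.symm.toLinearMap ∘ₗ LinearMap.inr R _ _).toAddMonoidHom _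
        (fun {ε₁ i₁ j₁ k₁ ε₂ i₂ j₂ k₂} hε hi hj hk x y hx hy => by
          change e.symm (0, x ⊗ₜ[R] y) ∈ _
          rw [distribLeft_symm_inr]
          refine tmul_mem_tens_gr (C := cone F hw) (i₁ := i₁ + 1) ⟨zero_mem _, ?_⟩ hy hε
            (by omega) hj hk
          simpa using hx) hx) hz)

/-- The tensor product with a row on the right. -/
def tensRow (P C : Cx R) (b : R) (p q : ℤ) :
    Iso (RingHom.id R) (P.tens (C.row b p q)) ((P.tens C).row b p q) :=
  let e : P.carrier ⊗[R] (C.carrier × C.carrier) ≃ₗ[R]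
      (P.carrier ⊗[R] C.carrier) × (P.carrier ⊗[R] C.carrier) :=
    distribRight LinearMap.id (fun _ => rfl)
  isoOfTens (D := C.row b p q) (E := (P.tens C).row b p q) e.toAddEquiv
    (fun r x => map_smul e r x)
    (by
      rintro x ⟨y, z⟩
      change (P.dmf x ⊗ₜ[R] y, P.dmf x ⊗ₜ[R] z) +
        (P.s x ⊗ₜ[R] (C.dmf y + b • C.s z), P.s x ⊗ₜ[R] (C.dmf z + (0 : R) • C.s y)) =
        ((P.dmf x ⊗ₜ[R] y + P.s x ⊗ₜ[R] C.dmf y) + b • (P.s x ⊗ₜ[R] C.s z),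
          (P.dmf x ⊗ₜ[R] z + P.s x ⊗ₜ[R] C.dmf z) + (0 : R) • (P.s x ⊗ₜ[R] C.s y))
      rw [TensorProduct.tmul_add, TensorProduct.tmul_smul, zero_smul, zero_smul, add_zero,
        add_zero]
      exact Prod.ext (add_assoc _ _ _).symm rfl)
    (by rintro x ⟨y, z⟩; rfl)
    (by
      rintro x ⟨y, z⟩
      change (P.s x ⊗ₜ[R] C.s y, P.s x ⊗ₜ[R] (-C.s z)) =
        (P.s x ⊗ₜ[R] C.s y, -(P.s x ⊗ₜ[R] C.s z))
      rw [TensorProduct.tmul_neg])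
    (by rintro x ⟨y, z⟩; rfl)
    (by
      rintro ε₁ i₁ j₁ k₁ ε₂ i₂ j₂ k₂ x ⟨y, z⟩ hx ⟨hy, hz⟩
      exact ⟨tmul_mem_tens_gr hx hy rfl rfl rfl rfl,
        tmul_mem_tens_gr hx hz (by ring) rfl (by omega) (by omega)⟩)
    (fun {ε i j k z} hz => symm_mem_of_prod e.toAddEquiv _ _ _
      (fun x hx => map_mem_of_mem_tens_gr
        (e.symm.toLinearMap ∘ₗ LinearMap.inl R _ _).toAddMonoidHom _
        (fun hε hi hj hk x y hx hy => by
          change e.symm (x ⊗ₜ[R] y, 0) ∈ _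
          rw [distribRight_symm_inl]
          exact tmul_mem_tens_gr (D := C.row b p q) hx ⟨hy, zero_mem _⟩ hε hi hj hk) hx)
      (fun x hx => map_mem_of_mem_tens_gr
        (e.symm.toLinearMap ∘ₗ LinearMap.inr R _ _).toAddMonoidHom _
        (fun {ε₁ i₁ j₁ k₁ ε₂ i₂ j₂ k₂} hε hi hj hk x y hx hy => by
          change e.symm (0, x ⊗ₜ[R] y) ∈ _
          rw [distribRight_symm_inr]
          refine tmul_mem_tens_gr (D := C.row b p q) (ε₂ := ε₂ + 1) (j₂ := j₂ + p) (k₂ := k₂ + q)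
            hx ⟨zero_mem _, ?_⟩
            (by rw [← add_assoc, hε, add_assoc, CharTwo.add_self_eq_zero, add_zero])
            hi (by omega) (by omega)
          simpa [add_assoc, CharTwo.add_self_eq_zero] using hy) hx) hz)

/-- The tensor product with a row on the left. -/
def rowTens (C : Cx R) (b : R) (p q : ℤ) (P : Cx R) {N : ℕ} (hP : P.IsHomogeneous N) :
    Iso (RingHom.id R) ((C.row b p q).tens P) ((C.tens P).row b p q) :=
  let e : (C.carrier × C.carrier) ⊗[R] P.carrier ≃ₗ[R]
      (C.carrier ⊗[R] P.carrier) × (C.carrier ⊗[R] P.carrier) :=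
    distribLeft P.s P.s_s
  isoOfTens (C := C.row b p q) (E := (C.tens P).row b p q) e.toAddEquiv
    (fun r x => map_smul e r x)
    (by
      rintro ⟨y, z⟩ x
      change ((C.dmf y + b • C.s z) ⊗ₜ[R] x, (C.dmf z + (0 : R) • C.s y) ⊗ₜ[R] P.s x) +
        (C.s y ⊗ₜ[R] P.dmf x, (-C.s z) ⊗ₜ[R] P.s (P.dmf x)) =
        ((C.dmf y ⊗ₜ[R] x + C.s y ⊗ₜ[R] P.dmf x) + b • (C.s z ⊗ₜ[R] P.s (P.s x)),
          (C.dmf z ⊗ₜ[R] P.s x + C.s z ⊗ₜ[R] P.dmf (P.s x)) + (0 : R) • (C.s y ⊗ₜ[R] P.s x))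
      rw [TensorProduct.add_tmul, zero_smul, zero_smul, add_zero, add_zero, P.s_s, P.s_dmf,
        TensorProduct.neg_tmul, TensorProduct.tmul_neg, neg_neg, TensorProduct.smul_tmul']
      exact Prod.ext (add_right_comm _ _ _) rfl)
    (by
      rintro ⟨y, z⟩ x
      change (C.dχ y ⊗ₜ[R] x, C.dχ z ⊗ₜ[R] P.s x) +
        (C.t y ⊗ₜ[R] P.dχ x, C.t z ⊗ₜ[R] P.s (P.dχ x)) =
        (C.dχ y ⊗ₜ[R] x + C.t y ⊗ₜ[R] P.dχ x,
          C.dχ z ⊗ₜ[R] P.s x + C.t z ⊗ₜ[R] P.dχ (P.s x))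
      rw [P.s_dχ]; rfl)
    (by
      rintro ⟨y, z⟩ x
      change (C.s y ⊗ₜ[R] P.s x, (-C.s z) ⊗ₜ[R] P.s (P.s x)) =
        (C.s y ⊗ₜ[R] P.s x, -(C.s z ⊗ₜ[R] P.s (P.s x)))
      rw [TensorProduct.neg_tmul])
    (by
      rintro ⟨y, z⟩ x
      change (C.t y ⊗ₜ[R] P.t x, C.t z ⊗ₜ[R] P.s (P.t x)) =
        (C.t y ⊗ₜ[R] P.t x, C.t z ⊗ₜ[R] P.t (P.s x))
      rw [P.s_t])
    (by
      rintro ε₁ i₁ j₁ k₁ ε₂ i₂ j₂ k₂ ⟨y, z⟩ x ⟨hy, hz⟩ hx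
      exact ⟨tmul_mem_tens_gr hy hx rfl rfl rfl rfl,
        tmul_mem_tens_gr hz (hP.s hx) (by ring) rfl (by omega) (by omega)⟩)
    (fun {ε i j k z} hz => symm_mem_of_prod e.toAddEquiv _ _ _
      (fun x hx => map_mem_of_mem_tens_gr
        (e.symm.toLinearMap ∘ₗ LinearMap.inl R _ _).toAddMonoidHom _
        (fun hε hi hj hk x y hx hy => by
          change e.symm (x ⊗ₜ[R] y, 0) ∈ _
          rw [distribLeft_symm_inl]
          exact tmul_mem_tens_gr (C := C.row b p q) ⟨hx, zero_mem _⟩ hy hε hi hj hk) hx)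
      (fun x hx => map_mem_of_mem_tens_gr
        (e.symm.toLinearMap ∘ₗ LinearMap.inr R _ _).toAddMonoidHom _
        (fun {ε₁ i₁ j₁ k₁ ε₂ i₂ j₂ k₂} hε hi hj hk x y hx hy => by
          change e.symm (0, x ⊗ₜ[R] y) ∈ _
          rw [distribLeft_symm_inr]
          refine tmul_mem_tens_gr (C := C.row b p q) (ε₁ := ε₁ + 1) (j₁ := j₁ + p) (k₁ := k₁ + q)
            ⟨zero_mem _, ?_⟩ (hP.s hy)
            (by rw [add_right_comm, hε, add_assoc, CharTwo.add_self_eq_zero, add_zero])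
            hi (by omega) (by omega)
          simpa [add_assoc, CharTwo.add_self_eq_zero] using hx) hx) hz)

end Cx

namespace Cx

variable {R : Type} [CommRing R]

/-- Linear maps that are homotopic with respect to `dmf`. -/
def Homotopic {C D : Cx R} (f g : C.carrier →ₗ[R] D.carrier) : Prop :=
  ∃ η : C.carrier →ₗ[R] D.carrier, (∀ x, η (C.s x) = -D.s (η x)) ∧
    ∀ x, f x = g x + (D.dmf (η x) + η (C.dmf x))

theorem Homotopic.of_eq {C D : Cx R} {f g : C.carrier →ₗ[R] D.carrier} (h : ∀ x, f x = g x) :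
    Homotopic f g :=
  ⟨0, by simp, by simp [h]⟩

theorem Homotopic.tensL (P : Cx R) {C D : Cx R} {f g : C.carrier →ₗ[R] D.carrier}
    (h : Homotopic f g) :
    Homotopic (C := P.tens C) (D := P.tens D) (TensorProduct.map LinearMap.id f)
      (TensorProduct.map LinearMap.id g) := by
  obtain ⟨η, hs, hη⟩ := h
  refine ⟨TensorProduct.map P.s η, ?_, ?_⟩
  · exact tens_addHom_ext
      ((TensorProduct.map P.s η).toAddMonoidHom.comp (TensorProduct.map P.s C.s).toAddMonoidHom)
      (-((TensorProduct.map P.s D.s).toAddMonoidHom.comp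
        (TensorProduct.map P.s η).toAddMonoidHom)) (by simp [hs, TensorProduct.tmul_neg])
  · refine tens_addHom_ext (TensorProduct.map LinearMap.id f).toAddMonoidHom
      ((TensorProduct.map LinearMap.id g).toAddMonoidHom +
        ((leibniz P.dmf P.s D.dmf).toAddMonoidHom.comp (TensorProduct.map P.s η).toAddMonoidHom +
        (TensorProduct.map P.s η).toAddMonoidHom.comp
          (leibniz P.dmf P.s C.dmf).toAddMonoidHom)) ?_
    intro x y
    simp [hη, P.s_s, P.s_dmf, TensorProduct.tmul_add, TensorProduct.neg_tmul]
    abel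

theorem Homotopic.tensR {C D : Cx R} {f g : C.carrier →ₗ[R] D.carrier}
    (h : Homotopic f g) (P : Cx R) :
    Homotopic (C := C.tens P) (D := D.tens P) (TensorProduct.map f LinearMap.id)
      (TensorProduct.map g LinearMap.id) := by
  obtain ⟨η, hs, hη⟩ := h
  refine ⟨TensorProduct.map η LinearMap.id, ?_, ?_⟩
  · exact tens_addHom_ext
      ((TensorProduct.map η LinearMap.id).toAddMonoidHom.comp
        (TensorProduct.map C.s P.s).toAddMonoidHom)
      (-((TensorProduct.map D.s P.s).toAddMonoidHom.comp
        (TensorProduct.map η LinearMap.id).toAddMonoidHom)) (by simp [hs, TensorProduct.neg_tmul])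
  · refine tens_addHom_ext (TensorProduct.map f LinearMap.id).toAddMonoidHom
      ((TensorProduct.map g LinearMap.id).toAddMonoidHom +
        ((leibniz D.dmf D.s P.dmf).toAddMonoidHom.comp
          (TensorProduct.map η LinearMap.id).toAddMonoidHom +
        (TensorProduct.map η LinearMap.id).toAddMonoidHom.comp
          (leibniz C.dmf C.s P.dmf).toAddMonoidHom)) ?_
    intro x y
    simp [hη, hs, TensorProduct.add_tmul, TensorProduct.neg_tmul]
    abel

/-! ### Contexts -/

/-- The tensor product of the complexes in a list, of `C` and of `Y`. -/
def ctx (Y : Cx R) : List (Cx R) → Cx R → Cx R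
  | [], C => C.tens Y
  | P :: L, C => P.tens (ctx Y L C)

theorem ctx_w (Y : Cx R) {C D : Cx R} (h : D.w = C.w) : ∀ L, (ctx Y L D).w = (ctx Y L C).w
  | [] => congrArg (· + Y.w) h
  | P :: L => congrArg (P.w + ·) (ctx_w Y h L)

/-- The map of tensor products induced by a map of the factor `C`. -/
def ctxMap (Y : Cx R) {C D : Cx R} (f : C.carrier →ₗ[R] D.carrier) :
    ∀ L, (ctx Y L C).carrier →ₗ[R] (ctx Y L D).carrier
  | [] => TensorProduct.map f (LinearMap.id : Y.carrier →ₗ[R] Y.carrier)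
  | P :: L => TensorProduct.map (LinearMap.id : P.carrier →ₗ[R] P.carrier) (ctxMap Y f L)

theorem ctxMap_comp (Y : Cx R) {C D E : Cx R} (g : D.carrier →ₗ[R] E.carrier)
    (f : C.carrier →ₗ[R] D.carrier) : ∀ L, ctxMap Y (g ∘ₗ f) L = ctxMap Y g L ∘ₗ ctxMap Y f L
  | [] => TensorProduct.ext' fun _ _ => rfl
  | _ :: L => (congrArg (TensorProduct.map LinearMap.id) (ctxMap_comp Y g f L)).trans
      (TensorProduct.ext' fun _ _ => rfl)

theorem ctxMap_id (Y C : Cx R) : ∀ L, ctxMap Y (LinearMap.id : C.carrier →ₗ[R] C.carrier) L =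
    LinearMap.id
  | [] => TensorProduct.map_id
  | _ :: L => (congrArg (TensorProduct.map LinearMap.id) (ctxMap_id Y C L)).trans
      TensorProduct.map_id

theorem ctxMap_add (Y : Cx R) {C D : Cx R} (f g : C.carrier →ₗ[R] D.carrier) :
    ∀ L, ctxMap Y (f + g) L = ctxMap Y f L + ctxMap Y g L
  | [] => TensorProduct.map_add_left _ _ _
  | _ :: L => (congrArg (TensorProduct.map LinearMap.id) (ctxMap_add Y f g L)).trans
      (TensorProduct.map_add_right _ _ _)

theorem Homotopic.ctx (Y : Cx R) {C D : Cx R} {f g : C.carrier →ₗ[R] D.carrier}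
    (h : Homotopic f g) : ∀ L, Homotopic (ctxMap Y f L) (ctxMap Y g L)
  | [] => h.tensR Y
  | P :: L => (Homotopic.ctx Y h L).tensL P

theorem ctxMap_mem_gr (Y : Cx R) {C D : Cx R} {f : C.carrier →ₗ[R] D.carrier}
    (h : ∀ {ε i j k x}, x ∈ C.gr ε i j k → f x ∈ D.gr ε i j k) :
    ∀ L {ε i j k x}, x ∈ (ctx Y L C).gr ε i j k → ctxMap Y f L x ∈ (ctx Y L D).gr ε i j k
  | [], ε, i, j, k, x, hx => map_mem_of_mem_tens_gr
      (TensorProduct.map f (LinearMap.id : Y.carrier →ₗ[R] Y.carrier)).toAddMonoidHom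
      ((D.tens Y).gr ε i j k)
      (fun hε hi hj hk _ _ hx hy => tmul_mem_tens_gr (h hx) hy hε hi hj hk) hx
  | P :: L, ε, i, j, k, x, hx => map_mem_of_mem_tens_gr
      (TensorProduct.map (LinearMap.id : P.carrier →ₗ[R] P.carrier) (ctxMap Y f L)).toAddMonoidHom
      ((P.tens (Cx.ctx Y L D)).gr ε i j k)
      (fun hε hi hj hk _ _ hx hy => tmul_mem_tens_gr hx (ctxMap_mem_gr Y h L hy) hε hi hj hk) hx

/-- The morphism of tensor products induced by a morphism of the factor `C`. -/
def SHom.ctx (Y : Cx R) {C D : Cx R} (F : SHom C D) : ∀ L, SHom (Cx.ctx Y L C) (Cx.ctx Y L D)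
  | [] => F.tensR Y
  | P :: L => (SHom.ctx Y F L).tensL P

theorem SHom.ctx_f (Y : Cx R) {C D : Cx R} (F : SHom C D) : ∀ L, (F.ctx Y L).f = ctxMap Y F.f L
  | [] => rfl
  | _ :: L => congrArg (TensorProduct.map LinearMap.id) (SHom.ctx_f Y F L)

/-- The isomorphism of tensor products induced by an isomorphism of the factor `C`. -/
def Iso.ctx (Y : Cx R) {C D : Cx R} (f : Iso (RingHom.id R) C D) :
    ∀ L, Iso (RingHom.id R) (Cx.ctx Y L C) (Cx.ctx Y L D)
  | [] => f.tens (Iso.refl Y)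
  | P :: L => (Iso.refl P).tens (Iso.ctx Y f L)

/-- A tensor product with a cone as a cone. -/
def ctxCone (Y : Cx R) {N : ℕ} {C D : Cx R} (F : SHom C D) (hw : D.w = C.w) :
    ∀ L : List (Cx R), (∀ P ∈ L, P.IsHomogeneous N) →
      Iso (RingHom.id R) (ctx Y L (cone F hw)) (cone (F.ctx Y L) (ctx_w Y hw L))
  | [], _ => coneTens F hw Y _
  | P :: L, h =>
    ((Iso.refl P).tens (ctxCone Y F hw L fun Q hQ => h Q (List.mem_cons_of_mem _ hQ))).trans
      (tensCone P (F.ctx Y L) (ctx_w Y hw L) (h P List.mem_cons_self) _) fun _ => rfl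

/-- A tensor product with a row as a row. -/
def ctxRow (Y : Cx R) {N : ℕ} (hY : Y.IsHomogeneous N) (C : Cx R) (b : R) (p q : ℤ) :
    ∀ L : List (Cx R), Iso (RingHom.id R) (ctx Y L (C.row b p q)) ((ctx Y L C).row b p q)
  | [] => rowTens C b p q Y hY
  | P :: L => ((Iso.refl P).tens (ctxRow Y hY C b p q L)).trans
      (tensRow P (ctx Y L C) b p q) fun _ => rfl

theorem ctxRow_toRow (Y : Cx R) {N : ℕ} (hY : Y.IsHomogeneous N) (C : Cx R) (b : R) (p q : ℤ) :
    ∀ (L : List (Cx R)) (x : (ctx Y L C).carrier),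
      (ctxRow Y hY C b p q L).e (ctxMap Y (C.toRow b p q).f L x) =
        ((ctx Y L C).toRow b p q).f x
  | [] => tens_addHom_ext ((rowTens C b p q Y hY).e.toAddMonoidHom.comp
        (ctxMap Y (C.toRow b p q).f []).toAddMonoidHom)
      (LinearMap.inl R (C.carrier ⊗[R] Y.carrier) (C.carrier ⊗[R] Y.carrier)).toAddMonoidHom
      fun x y => Prod.ext rfl (TensorProduct.zero_tmul _ _)
  | P :: L => tens_addHom_ext ((ctxRow Y hY C b p q (P :: L)).e.toAddMonoidHom.comp
        (ctxMap Y (C.toRow b p q).f (P :: L)).toAddMonoidHom)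
      (LinearMap.inl R (P.carrier ⊗[R] (ctx Y L C).carrier)
        (P.carrier ⊗[R] (ctx Y L C).carrier)).toAddMonoidHom
      fun x y => by
        change (tensRow P (ctx Y L C) b p q).e
          (x ⊗ₜ[R] (ctxRow Y hY C b p q L).e (ctxMap Y (C.toRow b p q).f L y)) = _
        rw [ctxRow_toRow Y hY C b p q L y]
        exact Prod.ext rfl (TensorProduct.tmul_zero _ _)

/-- Isomorphic complexes have isomorphic shifts. -/
def shiftCongr {C D : Cx R} (p q : ℤ) (f : Iso (RingHom.id R) C D) :
    Iso (RingHom.id R) (C.shift p q) (D.shift p q) where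
  e := f.e
  smul := f.smul
  dmf := f.dmf
  dχ := f.dχ
  s := f.s
  t := f.t
  gr h := f.gr h
  gr_symm h := f.gr_symm h

/-- A tensor product with a shifted factor as a shift. -/
def ctxShift (Y C : Cx R) (p q : ℤ) :
    ∀ L : List (Cx R), Iso (RingHom.id R) (ctx Y L (C.shift p q)) ((ctx Y L C).shift p q)
  | [] => shiftTens C Y p q
  | P :: L => ((Iso.refl P).tens (ctxShift Y C p q L)).trans
      (tensShift P (ctx Y L C) p q) fun _ => rfl

theorem ctxShift_ctxMap (Y : Cx R) {C D : Cx R} (p q : ℤ) (f : C.carrier →ₗ[R] D.carrier) :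
    ∀ (L : List (Cx R)) (x : (ctx Y L (C.shift p q)).carrier),
      (ctxShift Y D p q L).e (ctxMap Y (C := C.shift p q) (D := D.shift p q) f L x) =
        ctxMap Y f L ((ctxShift Y C p q L).e x)
  | [] => fun _ => rfl
  | P :: L => tens_addHom_ext ((ctxShift Y D p q (P :: L)).e.toAddMonoidHom.comp
        (ctxMap Y (C := C.shift p q) (D := D.shift p q) f (P :: L)).toAddMonoidHom)
      ((ctxMap Y f (P :: L)).toAddMonoidHom.comp (ctxShift Y C p q (P :: L)).e.toAddMonoidHom)
      fun x y => congrArg (TensorProduct.tmul R x) (ctxShift_ctxMap Y p q f L y)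

end Cx

namespace GrCx

/-- Isomorphisms of graded complexes. -/
structure Iso (X Y : GrCx) where
  e : X.carrier ≃ₗ[ℚ[X]] Y.carrier
  d : ∀ x, e (X.d x) = Y.d (e x)
  gr : ∀ {ε i j k x}, x ∈ X.gr ε i j k → e x ∈ Y.gr ε i j k
  gr_symm : ∀ {ε i j k y}, y ∈ Y.gr ε i j k → e.symm y ∈ X.gr ε i j k

theorem Iso.d_symm {X Y : GrCx} (f : Iso X Y) (y) : f.e.symm (Y.d y) = X.d (f.e.symm y) := by
  rw [LinearEquiv.symm_apply_eq, f.d, LinearEquiv.apply_symm_apply]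

/-- An isomorphism as a homotopy equivalence. -/
def Iso.homotopyEquiv {X Y : GrCx} (f : Iso X Y) : HomotopyEquiv X Y where
  hom := ⟨f.e, f.d⟩
  inv := ⟨f.e.symm, f.d_symm⟩
  hom_gr _ _ _ _ _ h := f.gr h
  inv_gr _ _ _ _ _ h := f.gr_symm h
  homotopyX := 0
  homotopyY := 0
  homotopyX_gr _ _ _ _ _ _ := zero_mem _
  homotopyY_gr _ _ _ _ _ _ := zero_mem _
  inv_hom x := by simp
  hom_inv x := by simp

/-- Composition of homotopy equivalences. -/
def HomotopyEquiv.trans {X Y Z : GrCx} (f : HomotopyEquiv X Y) (g : HomotopyEquiv Y Z) :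
    HomotopyEquiv X Z where
  hom := ⟨g.hom.f ∘ₗ f.hom.f, fun x => by simp [f.hom.f_d, g.hom.f_d]⟩
  inv := ⟨f.inv.f ∘ₗ g.inv.f, fun x => by simp [f.inv.f_d, g.inv.f_d]⟩
  hom_gr _ _ _ _ _ h := g.hom_gr _ _ _ _ _ (f.hom_gr _ _ _ _ _ h)
  inv_gr _ _ _ _ _ h := f.inv_gr _ _ _ _ _ (g.inv_gr _ _ _ _ _ h)
  homotopyX := f.homotopyX + f.inv.f ∘ₗ g.homotopyX ∘ₗ f.hom.f
  homotopyY := g.homotopyY + g.hom.f ∘ₗ f.homotopyY ∘ₗ g.inv.f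
  homotopyX_gr _ _ _ _ _ h := add_mem (f.homotopyX_gr _ _ _ _ _ h)
    (f.inv_gr _ _ _ _ _ (g.homotopyX_gr _ _ _ _ _ (f.hom_gr _ _ _ _ _ h)))
  homotopyY_gr _ _ _ _ _ h := add_mem (g.homotopyY_gr _ _ _ _ _ h)
    (g.hom_gr _ _ _ _ _ (f.homotopyY_gr _ _ _ _ _ (g.inv_gr _ _ _ _ _ h)))
  inv_hom x := by
    have h₁ := f.inv_hom x
    have h₂ := congrArg f.inv.f (g.inv_hom (f.hom.f x))
    simp only [map_sub, map_add, f.inv.f_d] at h₂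
    simp only [LinearMap.comp_apply, LinearMap.add_apply, map_add, f.hom.f_d]
    rw [← sub_add_sub_cancel, h₁, h₂]
    abel
  hom_inv y := by
    have h₁ := g.hom_inv y
    have h₂ := congrArg g.hom.f (f.hom_inv (g.inv.f y))
    simp only [map_sub, map_add, g.hom.f_d] at h₂
    simp only [LinearMap.comp_apply, LinearMap.add_apply, map_add, g.inv.f_d]
    rw [← sub_add_sub_cancel, h₁, h₂]
    abel

/-- Isomorphic squares have isomorphic cones. -/
def coneCongr {X Y X' Y' : GrCx} (F : Hom X Y) (F' : Hom X' Y') (f : Iso X X') (g : Iso Y Y')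
    (h : ∀ x, g.e (F.f x) = F'.f (f.e x)) : Iso (cone F) (cone F') where
  e := f.e.prodCongr g.e
  d x := Prod.ext (f.d x.1) (by
    change g.e (F.f x.1 - Y.d x.2) = F'.f (f.e x.1) - Y'.d (g.e x.2)
    rw [map_sub, h, g.d])
  gr h := ⟨f.gr h.1, g.gr h.2⟩
  gr_symm h := ⟨f.gr_symm h.1, g.gr_symm h.2⟩

/-- Maps between two arrows that are inverse to each other up to maps from the target to the source
induce a homotopy equivalence of cones. -/
def coneEquiv {X₀ X₁ Y₀ Y₁ : GrCx} (F : Hom X₀ X₁) (G : Hom Y₀ Y₁) (q₀ : Hom X₀ Y₀)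
    (q₁ : Hom X₁ Y₁) (i₀ : Hom Y₀ X₀) (i₁ : Hom Y₁ X₁) (θ : Hom X₁ X₀) (θ' : Hom Y₁ Y₀)
    (q₀_gr : ∀ ε i j k, ∀ x ∈ X₀.gr ε i j k, q₀.f x ∈ Y₀.gr ε i j k)
    (q₁_gr : ∀ ε i j k, ∀ x ∈ X₁.gr ε i j k, q₁.f x ∈ Y₁.gr ε i j k)
    (i₀_gr : ∀ ε i j k, ∀ x ∈ Y₀.gr ε i j k, i₀.f x ∈ X₀.gr ε i j k)
    (i₁_gr : ∀ ε i j k, ∀ x ∈ Y₁.gr ε i j k, i₁.f x ∈ X₁.gr ε i j k)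
    (θ_gr : ∀ ε i j k, ∀ x ∈ X₁.gr ε i j k, θ.f x ∈ X₀.gr ε i j k)
    (θ'_gr : ∀ ε i j k, ∀ x ∈ Y₁.gr ε i j k, θ'.f x ∈ Y₀.gr ε i j k)
    (hq : ∀ x, q₁.f (F.f x) = G.f (q₀.f x)) (hi : ∀ y, F.f (i₀.f y) = i₁.f (G.f y))
    (h₀ : ∀ x, i₀.f (q₀.f x) = x + θ.f (F.f x)) (h₁ : ∀ x, i₁.f (q₁.f x) = x + F.f (θ.f x))
    (h₀' : ∀ x, q₀.f (i₀.f x) = x + θ'.f (G.f x))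
    (h₁' : ∀ x, q₁.f (i₁.f x) = x + G.f (θ'.f x)) : HomotopyEquiv (cone F) (cone G) where
  hom := ⟨q₀.f.prodMap q₁.f, fun x => Prod.ext (q₀.f_d x.1) (by
    change q₁.f (F.f x.1 - X₁.d x.2) = G.f (q₀.f x.1) - Y₁.d (q₁.f x.2)
    rw [map_sub, hq, q₁.f_d])⟩
  inv := ⟨i₀.f.prodMap i₁.f, fun x => Prod.ext (i₀.f_d x.1) (by
    change i₁.f (G.f x.1 - Y₁.d x.2) = F.f (i₀.f x.1) - X₁.d (i₁.f x.2)
    rw [map_sub, hi, i₁.f_d])⟩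
  hom_gr _ _ _ _ _ h := ⟨q₀_gr _ _ _ _ _ h.1, q₁_gr _ _ _ _ _ h.2⟩
  inv_gr _ _ _ _ _ h := ⟨i₀_gr _ _ _ _ _ h.1, i₁_gr _ _ _ _ _ h.2⟩
  homotopyX := LinearMap.inl _ _ _ ∘ₗ θ.f ∘ₗ LinearMap.snd _ _ _
  homotopyY := LinearMap.inl _ _ _ ∘ₗ θ'.f ∘ₗ LinearMap.snd _ _ _
  homotopyX_gr _ _ _ _ _ h := ⟨θ_gr _ _ _ _ _ h.2, zero_mem _⟩
  homotopyY_gr _ _ _ _ _ h := ⟨θ'_gr _ _ _ _ _ h.2, zero_mem _⟩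
  inv_hom x := Prod.ext (by
      change i₀.f (q₀.f x.1) - x.1 = X₀.d (θ.f x.2) + θ.f (F.f x.1 - X₁.d x.2)
      rw [h₀, map_sub, θ.f_d]; abel)
    (by
      change i₁.f (q₁.f x.2) - x.2 = F.f (θ.f x.2) - X₁.d 0 + 0
      rw [h₁, map_zero]; abel)
  hom_inv x := Prod.ext (by
      change q₀.f (i₀.f x.1) - x.1 = Y₀.d (θ'.f x.2) + θ'.f (G.f x.1 - Y₁.d x.2)
      rw [h₀', map_sub, θ'.f_d]; abel)
    (by
      change q₁.f (i₁.f x.2) - x.2 = G.f (θ'.f x.2) - Y₁.d 0 + 0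
      rw [h₁', map_zero]; abel)

/-! ### The long exact sequence of a cone -/

/-- The class of a cycle. -/
def cls (X : GrCx) (x : X.carrier) (hx : X.d x = 0) : X.Homology :=
  X.boundaries.mkQ ⟨x, hx⟩

theorem exists_cls {X : GrCx} (c : X.Homology) : ∃ x hx, X.cls x hx = c := by
  obtain ⟨⟨x, hx⟩, rfl⟩ := Submodule.mkQ_surjective _ c
  exact ⟨x, hx, rfl⟩

theorem cls_eq_iff {X : GrCx} {x y : X.carrier} {hx hy} :
    X.cls x hx = X.cls y hy ↔ ∃ z, X.d z = x - y := by
  rw [cls, cls, Submodule.mkQ_apply, Submodule.mkQ_apply, Submodule.Quotient.eq]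
  rfl

theorem cls_eq_zero_iff {X : GrCx} {x : X.carrier} {hx} :
    X.cls x hx = 0 ↔ ∃ z, X.d z = x := by
  rw [cls, Submodule.mkQ_apply, Submodule.Quotient.mk_eq_zero]
  rfl

theorem mem_hgr_iff {X : GrCx} {ε i j k} {c : X.Homology} :
    c ∈ X.hgr ε i j k ↔ ∃ x hx, x ∈ X.gr ε i j k ∧ X.cls x hx = c := by
  constructor
  · rintro ⟨⟨x, hx⟩, h, rfl⟩
    exact ⟨x, hx, h, rfl⟩
  · rintro ⟨x, hx, h, rfl⟩
    exact ⟨⟨x, hx⟩, h, rfl⟩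

/-- The map on homology induced by a linear map preserving cycles and boundaries. -/
def mapHomology {X Y : GrCx} (f : X.carrier →ₗ[ℚ[X]] Y.carrier)
    (hd : ∀ x, X.d x = 0 → Y.d (f x) = 0) (hb : ∀ x, ∃ y, Y.d y = f (X.d x)) :
    X.Homology →ₗ[ℚ[X]] Y.Homology :=
  Submodule.mapQ _ _ (f.restrict (p := X.cycles) (q := Y.cycles) hd) (by
    rintro ⟨x, hx⟩ ⟨y, hy⟩
    obtain ⟨z, hz⟩ := hb y
    exact ⟨z, by rw [hz, hy]; rfl⟩)

/-- Projections to the homogeneous parts that are compatible with the differential. -/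
structure Projections (X : GrCx) where
  pr : ZMod 2 → ℤ → ℤ → ℤ → X.carrier →+ X.carrier
  mem : ∀ ε i j k x, pr ε i j k x ∈ X.gr ε i j k
  eq : ∀ {ε i j k x}, x ∈ X.gr ε i j k → pr ε i j k x = x
  d : ∀ ε i j k x, pr ε i j k (X.d x) = X.d (pr ε (i - 1) j k x)

section ConeElements

variable {X Y : GrCx} (π : Hom X Y)

/-- Elements of a cone. -/
def conePair (x : X.carrier) (y : Y.carrier) : (cone π).carrier := (x, y)

/-- The first component. -/
def coneFst : (cone π).carrier →ₗ[ℚ[X]] X.carrier := LinearMap.fst _ _ _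

/-- The second component. -/
def coneSnd : (cone π).carrier →ₗ[ℚ[X]] Y.carrier := LinearMap.snd _ _ _

/-- The inclusion of the second component. -/
def coneInr : Y.carrier →ₗ[ℚ[X]] (cone π).carrier := LinearMap.inr _ _ _

theorem coneFst_pair (x : X.carrier) (y : Y.carrier) : coneFst π (conePair π x y) = x := rfl

theorem coneSnd_pair (x : X.carrier) (y : Y.carrier) : coneSnd π (conePair π x y) = y := rfl

theorem cone_ext {c c' : (cone π).carrier} (h₁ : coneFst π c = coneFst π c')
    (h₂ : coneSnd π c = coneSnd π c') : c = c' := Prod.ext h₁ h₂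

theorem coneFst_d (c) : coneFst π ((cone π).d c) = X.d (coneFst π c) := rfl

theorem coneSnd_d (c) : coneSnd π ((cone π).d c) = π.f (coneFst π c) - Y.d (coneSnd π c) := rfl

theorem mem_cone_gr_iff {ε i j k} {c : (cone π).carrier} :
    c ∈ (cone π).gr ε i j k ↔ coneFst π c ∈ X.gr ε i j k ∧ coneSnd π c ∈ Y.gr ε (i - 1) j k :=
  Iff.rfl

end ConeElements

theorem isLongExact_of_homotopyEquiv {X Y W : GrCx} (π : Hom X Y)
    (π_gr : ∀ ε i j k, ∀ x ∈ X.gr ε i j k, π.f x ∈ Y.gr ε i j k) (pX : Projections X)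
    (pY : Projections Y) (hπ : ∀ ε i j k x, pY.pr ε i j k (π.f x) = π.f (pX.pr ε i j k x))
    (E : HomotopyEquiv W (cone π)) :
    ∃ (δ : Y.Homology →ₗ[ℚ[X]] W.Homology) (β : W.Homology →ₗ[ℚ[X]] X.Homology),
      IsLongExact π δ β := by
  have hd : ∀ x y, (cone π).d (conePair π x y) = conePair π (X.d x) (π.f x - Y.d y) :=
    fun _ _ => rfl
  have h0 : conePair π 0 0 = 0 := rfl
  have hinv : ∀ c, (cone π).d c = 0 → E.hom.f (E.inv.f c) = c + (cone π).d (E.homotopyY c) := by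
    intro c hc
    have := E.hom_inv c
    rw [hc, map_zero, add_zero] at this
    rw [← this]; abel
  have hhom : ∀ c, W.d c = 0 → E.inv.f (E.hom.f c) = c + W.d (E.homotopyX c) := by
    intro c hc
    have := E.inv_hom c
    rw [hc, map_zero, add_zero] at this
    rw [← this]; abel
  have hdy : ∀ y, Y.d y = 0 → (cone π).d (conePair π 0 y) = 0 := by
    intro y hy
    rw [hd, hy, map_zero, map_zero, sub_zero, h0]
  have hdinv : ∀ c, (cone π).d c = 0 → W.d (E.inv.f c) = 0 := by
    intro c hc
    rw [← E.inv.f_d, hc, map_zero]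
  have hdhom : ∀ c, W.d c = 0 → (cone π).d (E.hom.f c) = 0 := by
    intro c hc
    rw [← E.hom.f_d, hc, map_zero]
  have hfst : ∀ c, W.d c = 0 → X.d (coneFst π (E.hom.f c)) = 0 := by
    intro c hc
    rw [← coneFst_d, hdhom c hc, map_zero]
  have hsnd : ∀ c, W.d c = 0 → Y.d (coneSnd π (E.hom.f c)) = π.f (coneFst π (E.hom.f c)) := by
    intro c hc
    have := coneSnd_d π (E.hom.f c)
    rw [hdhom c hc, map_zero] at this
    exact (sub_eq_zero.1 this.symm).symm
  let δ : Y.Homology →ₗ[ℚ[X]] W.Homology := mapHomology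
    (E.inv.f ∘ₗ coneInr π) (fun y hy => hdinv _ (hdy y hy))
    (fun y => ⟨E.inv.f (conePair π 0 (-y)), by
      rw [← E.inv.f_d, hd, map_zero, map_zero, map_neg, sub_neg_eq_add, zero_add]; rfl⟩)
  let β : W.Homology →ₗ[ℚ[X]] X.Homology := mapHomology (coneFst π ∘ₗ E.hom.f) hfst
    (fun y => ⟨coneFst π (E.hom.f y), by
      rw [LinearMap.comp_apply, E.hom.f_d, coneFst_d]⟩)
  have hδ : ∀ y hy, δ (Y.cls y hy) = W.cls (E.inv.f (conePair π 0 y)) (hdinv _ (hdy y hy)) :=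
    fun _ _ => rfl
  have hβ : ∀ y hy, β (W.cls y hy) = X.cls (coneFst π (E.hom.f y)) (hfst y hy) :=
    fun _ _ => rfl
  have hπh : ∀ x hx, π.homology (X.cls x hx) = Y.cls (π.f x) (by rw [← π.f_d, hx, map_zero]) :=
    fun _ _ => rfl
  refine ⟨δ, β, ?_, ?_, ?_, ?_, ?_, ?_⟩
  · intro ε i j k c hc
    obtain ⟨x, hx, hxg, rfl⟩ := mem_hgr_iff.1 hc
    exact mem_hgr_iff.2 ⟨_, _, π_gr _ _ _ _ _ hxg, rfl⟩
  · intro ε i j k c hc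
    obtain ⟨y, hy, hyg, rfl⟩ := mem_hgr_iff.1 hc
    exact mem_hgr_iff.2 ⟨_, hdinv _ (hdy y hy),
      E.inv_gr _ _ _ _ (conePair π 0 y) ⟨zero_mem _, hyg⟩, rfl⟩
  · intro ε i j k c hc
    obtain ⟨y, hy, hyg, rfl⟩ := mem_hgr_iff.1 hc
    exact mem_hgr_iff.2 ⟨_, hfst y hy, (E.hom_gr _ _ _ _ _ hyg).1, rfl⟩
  · intro ε i j k c hc
    obtain ⟨y, hy, hyg, rfl⟩ := mem_hgr_iff.1 hc
    rw [hδ, cls_eq_zero_iff]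
    constructor
    · rintro ⟨z, hz⟩
      have h := hinv _ (hdy y hy)
      rw [← hz, E.hom.f_d] at h
      obtain ⟨c, hxy⟩ : ∃ c, (cone π).d c = conePair π 0 y :=
        ⟨E.hom.f z - E.homotopyY (conePair π 0 y), by rw [map_sub, h]; abel⟩
      have hx : X.d (coneFst π c) = 0 := by rw [← coneFst_d, hxy, coneFst_pair]
      have hy' : π.f (coneFst π c) - Y.d (coneSnd π c) = y := by
        rw [← coneSnd_d, hxy, coneSnd_pair]
      have hx' : X.d (pX.pr ε (i - 1) j k (coneFst π c)) = 0 := by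
        rw [← pX.d ε i j k, hx, map_zero]
      refine ⟨X.cls _ hx', mem_hgr_iff.2 ⟨_, hx', pX.mem _ _ _ _ _, rfl⟩, ?_⟩
      rw [hπh, cls_eq_iff]
      refine ⟨pY.pr ε (i - 1 - 1) j k (coneSnd π c), ?_⟩
      rw [← pY.d, ← hπ]
      conv_rhs => rw [← pY.eq hyg]
      rw [← map_sub, ← hy', sub_sub_cancel]
    · rintro ⟨c, -, hc⟩
      obtain ⟨x, hx, rfl⟩ := exists_cls c
      rw [hπh, cls_eq_iff] at hc
      obtain ⟨z, hz⟩ := hc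
      refine ⟨E.inv.f (conePair π x z), ?_⟩
      rw [← E.inv.f_d, hd, hx, hz, sub_sub_cancel]
  · intro ε i j k c hc
    obtain ⟨y, hy, hyg, rfl⟩ := mem_hgr_iff.1 hc
    rw [hβ, cls_eq_zero_iff]
    constructor
    · rintro ⟨z, hz⟩
      obtain ⟨hg₁, hg₂⟩ := (mem_cone_gr_iff π).1 (E.hom_gr _ _ _ _ _ hyg)
      have hz' : X.d (pX.pr ε (i - 1) j k z) = coneFst π (E.hom.f y) := by
        rw [← pX.d, hz, pX.eq hg₁]
      have hc : Y.d (coneSnd π (E.hom.f y) - π.f (pX.pr ε (i - 1) j k z)) = 0 := by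
        rw [map_sub, ← π.f_d, hz', hsnd y hy, sub_self]
      refine ⟨Y.cls _ hc, mem_hgr_iff.2 ⟨_, hc,
        sub_mem hg₂ (π_gr _ _ _ _ _ (pX.mem _ _ _ _ _)), rfl⟩, ?_⟩
      rw [hδ, cls_eq_iff]
      refine ⟨E.homotopyX y - E.inv.f (conePair π (pX.pr ε (i - 1) j k z) 0), ?_⟩
      rw [map_sub, ← E.inv.f_d, hd, hz', map_zero, sub_zero]
      have h₁ : conePair π 0 (coneSnd π (E.hom.f y) - π.f (pX.pr ε (i - 1) j k z)) =
          E.hom.f y - conePair π (coneFst π (E.hom.f y)) (π.f (pX.pr ε (i - 1) j k z)) := by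
        refine cone_ext π ?_ ?_
        · rw [map_sub, coneFst_pair, coneFst_pair, sub_self]
        · rw [map_sub, coneSnd_pair, coneSnd_pair]
      rw [h₁, map_sub, hhom y hy]
      abel
    · rintro ⟨c, -, hc⟩
      obtain ⟨x, hx, rfl⟩ := exists_cls c
      rw [hδ, cls_eq_iff] at hc
      obtain ⟨z, hz⟩ := hc
      have h := congrArg (fun w => coneFst π (E.hom.f w)) hz
      simp only [map_sub, hinv _ (hdy x hx), E.hom.f_d, coneFst_d, map_add, coneFst_pair] at h
      refine ⟨coneFst π (E.homotopyY (conePair π 0 x)) - coneFst π (E.hom.f z), ?_⟩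
      rw [map_sub, h]; abel
  · intro ε i j k c hc
    obtain ⟨x, hx, hxg, rfl⟩ := mem_hgr_iff.1 hc
    rw [hπh, cls_eq_zero_iff]
    constructor
    · rintro ⟨z, hz⟩
      have hz' : Y.d (pY.pr ε (i - 1) j k z) = π.f x := by
        rw [← pY.d, hz, pY.eq (π_gr _ _ _ _ _ hxg)]
      have hcyc : (cone π).d (conePair π x (pY.pr ε (i - 1) j k z)) = 0 := by
        rw [hd, hx, hz', sub_self, h0]
      refine ⟨W.cls _ (hdinv _ hcyc), mem_hgr_iff.2 ⟨_, hdinv _ hcyc,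
        E.inv_gr _ _ _ _ _ ((mem_cone_gr_iff π).2 ⟨hxg, pY.mem _ _ _ _ _⟩), rfl⟩, ?_⟩
      rw [hβ, cls_eq_iff]
      refine ⟨coneFst π (E.homotopyY (conePair π x (pY.pr ε (i - 1) j k z))), ?_⟩
      rw [hinv _ hcyc, map_add, coneFst_pair, coneFst_d, add_sub_cancel_left]
    · rintro ⟨c, -, hc⟩
      obtain ⟨y, hy, rfl⟩ := exists_cls c
      rw [hβ, cls_eq_iff] at hc
      obtain ⟨z, hz⟩ := hc
      refine ⟨coneSnd π (E.hom.f y) - π.f z, ?_⟩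
      rw [map_sub, ← π.f_d, hz, map_sub, hsnd y hy]
      abel

end GrCx

namespace Cx

section Homology

variable {R R' : Type} [CommRing R] [CommRing R'] [Algebra ℚ[X] R] [Algebra ℚ[X] R']

/-- The class of a cycle of `dmf`. -/
def hcls (C : Cx R) (x : C.carrier) (hx : C.dmf x = 0) : C.H.carrier := C.boundaries.mkQ ⟨x, hx⟩

theorem exists_hcls {C : Cx R} (c : C.H.carrier) : ∃ x hx, c = C.hcls x hx := by
  obtain ⟨⟨x, hx⟩, rfl⟩ := Submodule.mkQ_surjective _ c
  exact ⟨x, hx, rfl⟩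

theorem hcls_eq_iff {C : Cx R} {x y : C.carrier} {hx hy} :
    C.hcls x hx = C.hcls y hy ↔ ∃ z, C.dmf z = x - y :=
  (Submodule.Quotient.eq C.boundaries (x := ⟨x, hx⟩) (y := ⟨y, hy⟩)).trans Iff.rfl

theorem hcls_eq_zero_iff {C : Cx R} {x : C.carrier} {hx} :
    C.hcls x hx = 0 ↔ ∃ z, C.dmf z = x :=
  (Submodule.Quotient.mk_eq_zero C.boundaries (x := (⟨x, hx⟩ : C.cycles))).trans Iff.rfl

theorem hcls_congr {C : Cx R} {x y : C.carrier} {hx hy} (h : x = y) :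
    C.hcls x hx = C.hcls y hy := by
  subst h; rfl

theorem mem_H_gr_iff {C : Cx R} {ε i j k} {c : C.H.carrier} :
    c ∈ C.H.gr ε i j k ↔ ∃ x hx, x ∈ C.gr ε i j k ∧ C.hcls x hx = c := by
  constructor
  · rintro ⟨⟨x, hx⟩, h, rfl⟩
    exact ⟨x, hx, h, rfl⟩
  · rintro ⟨x, hx, h, rfl⟩
    exact ⟨⟨x, hx⟩, h, rfl⟩

theorem Hom.H_hcls {C D : Cx R} (F : Hom C D) {x : C.carrier} (hx) :
    F.H.f (C.hcls x hx) = D.hcls (F.f x) (by rw [← F.f_dmf, hx, map_zero]) := rfl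

/-- The additive map on homology induced by an additive map commuting with `dmf`. -/
def mapHAdd {C : Cx R} {D : Cx R'} (f : C.carrier →+ D.carrier)
    (hf : ∀ x, f (C.dmf x) = D.dmf (f x)) : C.H.carrier →+ D.H.carrier :=
  QuotientAddGroup.map C.boundaries.toAddSubgroup D.boundaries.toAddSubgroup
    ((f.comp C.cycles.subtype.toAddMonoidHom).codRestrict D.cycles.toAddSubgroup fun x => by
      change D.dmf (f x) = 0
      rw [← hf, x.2, map_zero])
    (by
      rintro ⟨x, hx⟩ ⟨y, hy⟩
      exact ⟨f y, by rw [← hf, hy]; rfl⟩)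

/-- The isomorphism on homology induced by an isomorphism. -/
def Iso.H {φ : R →+* R'} {C : Cx R} {D : Cx R'} (f : Iso φ C D)
    (hφ : ∀ c, φ (algebraMap ℚ[X] R c) = algebraMap ℚ[X] R' c) : GrCx.Iso C.H D.H where
  e :=
    { mapHAdd f.e.toAddMonoidHom f.dmf with
      invFun := mapHAdd f.e.symm.toAddMonoidHom fun x => by
        change f.e.symm (D.dmf x) = C.dmf (f.e.symm x)
        rw [AddEquiv.symm_apply_eq, f.dmf, AddEquiv.apply_symm_apply]
      left_inv := fun c => by
        obtain ⟨x, hx, rfl⟩ := exists_hcls c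
        exact hcls_congr (f.e.symm_apply_apply x)
      right_inv := fun c => by
        obtain ⟨x, hx, rfl⟩ := exists_hcls c
        exact hcls_congr (f.e.apply_symm_apply x)
      map_smul' := fun r c => by
        obtain ⟨x, hx, rfl⟩ := exists_hcls c
        refine hcls_congr (C := D) (x := f.e (algebraMap ℚ[X] R r • x))
          (y := algebraMap ℚ[X] R' r • f.e x) ?_
        rw [f.smul, hφ] }
  d c := by
    obtain ⟨x, hx, rfl⟩ := exists_hcls c
    exact hcls_congr (f.dχ x)
  gr h := by
    obtain ⟨x, hx, hg, rfl⟩ := mem_H_gr_iff.1 h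
    exact mem_H_gr_iff.2 ⟨_, _, f.gr hg, rfl⟩
  gr_symm h := by
    obtain ⟨x, hx, hg, rfl⟩ := mem_H_gr_iff.1 h
    refine mem_H_gr_iff.2 ⟨_, ?_, f.gr_symm hg, rfl⟩
    apply f.e.injective
    rw [f.dmf, AddEquiv.apply_symm_apply, hx, map_zero]

/-- The homology of a cone as a cone. -/
def coneH {C D : Cx R} (F : SHom C D) (hw : D.w = C.w) :
    GrCx.Iso (cone F hw).H (GrCx.cone F.toHom.H) where
  e :=
    { (mapHAdd (C := cone F hw) (D := C) (AddMonoidHom.fst C.carrier D.carrier)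
        (fun _ => rfl)).prod (mapHAdd (C := cone F hw) (D := D)
        (AddMonoidHom.snd C.carrier D.carrier) (fun _ => rfl)) with
      invFun := fun c =>
        mapHAdd (C := C) (D := cone F hw) (AddMonoidHom.inl C.carrier D.carrier)
          (fun x => Prod.ext rfl (map_zero D.dmf).symm) c.1 +
        mapHAdd (C := D) (D := cone F hw) (AddMonoidHom.inr C.carrier D.carrier)
          (fun x => Prod.ext (map_zero C.dmf).symm rfl) c.2
      left_inv := fun c => by
        obtain ⟨x, hx, rfl⟩ := exists_hcls c
        exact hcls_congr (C := cone F hw) (Prod.ext (add_zero x.1) (zero_add x.2))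
      right_inv := fun c => by
        obtain ⟨c, c'⟩ := c
        obtain ⟨x, hx, rfl⟩ := exists_hcls c
        obtain ⟨y, hy, rfl⟩ := exists_hcls c'
        exact Prod.ext (hcls_congr (add_zero x)) (hcls_congr (zero_add y))
      map_smul' := fun r c => by
        obtain ⟨x, hx, rfl⟩ := exists_hcls c
        rfl }
  d c := by
    obtain ⟨x, hx, rfl⟩ := exists_hcls c
    rfl
  gr h := by
    obtain ⟨x, hx, hg, rfl⟩ := mem_H_gr_iff.1 h
    exact ⟨mem_H_gr_iff.2 ⟨_, _, hg.1, rfl⟩, mem_H_gr_iff.2 ⟨_, _, hg.2, rfl⟩⟩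
  gr_symm {ε i j k c} h := by
    obtain ⟨c, c'⟩ := c
    obtain ⟨x, hx, hg, rfl⟩ := mem_H_gr_iff.1 h.1
    obtain ⟨y, hy, hg', rfl⟩ := mem_H_gr_iff.1 h.2
    exact mem_H_gr_iff.2 ⟨(x, y), Prod.ext hx hy, ⟨hg, hg'⟩,
      hcls_congr (C := cone F hw) (Prod.ext (add_zero x).symm (zero_add y).symm)⟩

/-- The homology of a shift. -/
def shiftH (C : Cx R) (p q : ℤ) : GrCx.Iso (C.shift p q).H (C.H.shift p q) where
  e := LinearEquiv.refl ℚ[X] C.H.carrier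
  d _ := rfl
  gr h := h
  gr_symm h := h

/-- The homogeneous elements of `C` have no torsion with respect to `b`, where `b` has degree
`(p, 0)`. -/
structure IsRegular (C : Cx R) (b : R) (p : ℤ) : Prop where
  eq_zero : ∀ {x : C.carrier}, b • x = 0 → x = 0
  gr : ∀ {ε i j k} {x : C.carrier}, b • x ∈ C.gr ε i j k → x ∈ C.gr ε i (j - p) k

/-- The projection from `C` times `(0, b)` to `C / b C`. -/
def rowToQuot (C : Cx R) (b : R) (p q : ℤ) :
    (C.row b p q).carrier →ₗ[R] (C.quot b).carrier :=
  (C.multiples b).mkQ ∘ₗ LinearMap.fst R C.carrier C.carrier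

theorem rowToQuot_dmf (C : Cx R) (b : R) (p q : ℤ) (x : (C.row b p q).carrier) :
    rowToQuot C b p q ((C.row b p q).dmf x) = (C.quot b).dmf (rowToQuot C b p q x) := by
  change (C.multiples b).mkQ (C.dmf x.1 + b • C.s x.2) = (C.multiples b).mkQ (C.dmf x.1)
  rw [← sub_eq_zero, ← map_sub, add_sub_cancel_left, Submodule.mkQ_apply,
    Submodule.Quotient.mk_eq_zero]
  exact ⟨C.s x.2, rfl⟩

theorem quot_mk_eq_zero_iff (C : Cx R) (b : R) (x : C.carrier) :
    (C.multiples b).mkQ x = 0 ↔ ∃ y, b • y = x := by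
  rw [Submodule.mkQ_apply, Submodule.Quotient.mk_eq_zero]
  rfl

theorem rowToQuot_bijective {C : Cx R} {b : R} (p q : ℤ) {r : ℤ} (hC : C.IsRegular b r)
    (hw : C.w = 0) : Function.Bijective (mapHAdd (rowToQuot C b p q).toAddMonoidHom
      (rowToQuot_dmf C b p q)) := by
  constructor
  · rw [injective_iff_map_eq_zero]
    intro c hc
    obtain ⟨⟨x, y⟩, hx, rfl⟩ := exists_hcls c
    obtain ⟨z, hz⟩ := hcls_eq_zero_iff.1 (show (C.quot b).hcls _ _ = 0 from hc)
    obtain ⟨z, rfl⟩ := Submodule.mkQ_surjective _ z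
    have hz0 : (C.multiples b).mkQ (C.dmf z - x) = 0 := by
      rw [map_sub]; exact sub_eq_zero.2 hz
    rw [quot_mk_eq_zero_iff] at hz0
    obtain ⟨v, hv⟩ := hz0
    have hx1 : C.dmf x + b • C.s y = 0 := congrArg Prod.fst hx
    refine hcls_eq_zero_iff.2 ⟨((z, -C.s v) : C.carrier × C.carrier), Prod.ext ?_ ?_⟩
    · change C.dmf z + b • C.s (-C.s v) = x
      rw [map_neg, C.s_s, smul_neg, hv]; abel
    · change C.dmf (-C.s v) + (0 : R) • C.s z = y
      rw [zero_smul, add_zero, map_neg, ← C.s_dmf]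
      have h1 : C.dmf v = C.s y := by
        apply sub_eq_zero.1 (hC.eq_zero _)
        have h2 := congrArg C.dmf hv
        rw [map_smul, map_sub, C.dmf_dmf, hw, zero_smul, zero_sub] at h2
        rw [smul_sub, h2, ← neg_add', hx1, neg_zero]
      rw [h1, C.s_s]
  · intro c
    obtain ⟨x, hx, rfl⟩ := exists_hcls c
    obtain ⟨x, rfl⟩ := Submodule.mkQ_surjective _ x
    obtain ⟨y, hy⟩ := (quot_mk_eq_zero_iff C b (C.dmf x)).1 hx
    have hdy : C.dmf y = 0 := by
      apply hC.eq_zero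
      rw [← map_smul, hy, C.dmf_dmf, hw, zero_smul]
    refine ⟨hcls (C.row b p q) ((x, -C.s y) : C.carrier × C.carrier) (Prod.ext ?_ ?_), rfl⟩
    · change C.dmf x + b • C.s (-C.s y) = 0
      rw [map_neg, C.s_s, smul_neg, hy, add_neg_cancel]
    · change C.dmf (-C.s y) + (0 : R) • C.s x = 0
      rw [zero_smul, add_zero, map_neg, ← C.s_dmf, hdy, map_zero]

/-- The homology of `C` times `(0, b)` is the homology of `C / b C`. -/
def rowH {C : Cx R} {b : R} {p : ℤ} {N : ℕ} (hC : C.IsRegular b p) (hN : C.IsHomogeneous N)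
    (hw : C.w = 0) : GrCx.Iso (C.row b (p - 1) (-(N + 1))).H (C.quot b).H where
  e := LinearEquiv.ofBijective
    { mapHAdd (rowToQuot C b (p - 1) (-(N + 1))).toAddMonoidHom (rowToQuot_dmf C b _ _) with
      map_smul' := fun r c => by
        obtain ⟨x, hx, rfl⟩ := exists_hcls c
        rfl } (rowToQuot_bijective (p - 1) (-(N + 1)) hC hw)
  d c := by
    obtain ⟨x, hx, rfl⟩ := exists_hcls c
    rfl
  gr h := by
    obtain ⟨x, hx, hg, rfl⟩ := mem_H_gr_iff.1 h
    exact mem_H_gr_iff.2 ⟨_, _, ⟨x.1, hg.1, rfl⟩, rfl⟩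
  gr_symm {ε i j k c} h := by
    obtain ⟨x, hx, ⟨x, hg, rfl⟩, rfl⟩ := mem_H_gr_iff.1 h
    obtain ⟨y, hy⟩ := (quot_mk_eq_zero_iff C b (C.dmf x)).1 hx
    have hdy : C.dmf y = 0 := by
      apply hC.eq_zero
      rw [← map_smul, hy, C.dmf_dmf, hw, zero_smul]
    have hyg : y ∈ C.gr (ε + 1) i (j + 1 - p) (k + (N + 1)) := hC.gr (hy ▸ hN.dmf hg)
    refine mem_H_gr_iff.2 ⟨((x, -C.s y) : C.carrier × C.carrier), Prod.ext ?_ ?_,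
      ⟨hg, (C.gr _ _ _ _).neg_mem (hN.s ?_)⟩, (LinearEquiv.eq_symm_apply _).2 rfl⟩
    · change C.dmf x + b • C.s (-C.s y) = 0
      rw [map_neg, C.s_s, smul_neg, hy, add_neg_cancel]
    · change C.dmf (-C.s y) + (0 : R) • C.s x = 0
      rw [zero_smul, add_zero, map_neg, ← C.s_dmf, hdy, map_zero]
    · rwa [show j - (p - 1) = j + 1 - p by ring, sub_neg_eq_add]

theorem rowH_toRow {C : Cx R} {b : R} {p : ℤ} {N : ℕ} (hC : C.IsRegular b p)
    (hN : C.IsHomogeneous N) (hw : C.w = 0) (c : C.H.carrier) :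
    (rowH hC hN hw).e ((C.toRow b (p - 1) (-(N + 1))).toHom.H.f c) = (C.toQuot b).H.f c := by
  obtain ⟨x, hx, rfl⟩ := exists_hcls c
  rfl

/-! ### Projections -/

/-- Projections to the homogeneous parts that are compatible with `b` of degree `(p, 0)` and with
the differentials. -/
structure Projections (N : ℕ) (C : Cx R) (b : R) (p : ℤ) where
  pr : ZMod 2 → ℤ → ℤ → ℤ → C.carrier →+ C.carrier
  mem : ∀ ε i j k x, pr ε i j k x ∈ C.gr ε i j k
  eq : ∀ {ε i j k x}, x ∈ C.gr ε i j k → pr ε i j k x = x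
  smul : ∀ ε i j k x, pr ε i j k (b • x) = b • pr ε i (j - p) k x
  dmf : ∀ ε i j k x, pr ε i j k (C.dmf x) = C.dmf (pr (ε + 1) i (j - 1) (k - (N + 1)) x)
  dχ : ∀ ε i j k x, pr ε i j k (C.dχ x) = C.dχ (pr ε (i - 1) j k x)

theorem Projections.dmf' {N : ℕ} {C : Cx R} {b : R} {p : ℤ} (P : Projections N C b p) (ε i j k x) :
    C.dmf (P.pr ε i j k x) = P.pr (ε + 1) i (j + 1) (k + (N + 1)) (C.dmf x) := by
  rw [P.dmf, add_assoc, CharTwo.add_self_eq_zero, add_zero, add_sub_cancel_right,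
    add_sub_cancel_right]

/-- The projections of the homology. -/
def Projections.H {N : ℕ} {C : Cx R} {b : R} {p : ℤ} (P : Projections N C b p) :
    GrCx.Projections C.H where
  pr ε i j k := QuotientAddGroup.map C.boundaries.toAddSubgroup C.boundaries.toAddSubgroup
    (((P.pr ε i j k).comp C.cycles.subtype.toAddMonoidHom).codRestrict C.cycles.toAddSubgroup
      fun x => by
        change C.dmf (P.pr ε i j k x) = 0
        rw [P.dmf', x.2, map_zero])
    (by
      rintro ⟨x, hx⟩ ⟨y, hy⟩
      refine ⟨P.pr (ε + 1) i (j - 1) (k - (N + 1)) y, ?_⟩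
      rw [← P.dmf, hy]; rfl)
  mem ε i j k c := by
    obtain ⟨x, hx, rfl⟩ := exists_hcls c
    exact mem_H_gr_iff.2 ⟨_, _, P.mem ε i j k x, rfl⟩
  eq h := by
    obtain ⟨x, hx, hg, rfl⟩ := mem_H_gr_iff.1 h
    exact hcls_congr (P.eq hg)
  d ε i j k c := by
    obtain ⟨x, hx, rfl⟩ := exists_hcls c
    exact hcls_congr (P.dχ ε i j k x)

/-- The projections of `C / b C`. -/
def Projections.quot {N : ℕ} {C : Cx R} {b : R} {p : ℤ} (P : Projections N C b p) :
    Projections N (C.quot b) b p where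
  pr ε i j k := QuotientAddGroup.map (C.multiples b).toAddSubgroup (C.multiples b).toAddSubgroup
    (P.pr ε i j k) (by
      rintro x ⟨y, rfl⟩
      exact ⟨P.pr ε i (j - p) k y, (P.smul ε i j k y).symm⟩)
  mem ε i j k c := by
    obtain ⟨x, rfl⟩ := Submodule.mkQ_surjective _ c
    exact ⟨_, P.mem ε i j k x, rfl⟩
  eq h := by
    obtain ⟨x, hg, rfl⟩ := h
    exact congrArg (C.multiples b).mkQ (P.eq hg)
  smul ε i j k c := by
    obtain ⟨x, rfl⟩ := Submodule.mkQ_surjective _ c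
    exact congrArg (C.multiples b).mkQ (P.smul ε i j k x)
  dmf ε i j k c := by
    obtain ⟨x, rfl⟩ := Submodule.mkQ_surjective _ c
    exact congrArg (C.multiples b).mkQ (P.dmf ε i j k x)
  dχ ε i j k c := by
    obtain ⟨x, rfl⟩ := Submodule.mkQ_surjective _ c
    exact congrArg (C.multiples b).mkQ (P.dχ ε i j k x)

/-- The projections of a shift. -/
def _root_.TransverseKR.GrCx.Projections.shift {X : GrCx} (P : X.Projections) (p q : ℤ) :
    (X.shift p q).Projections where
  pr ε i j k := P.pr ε i (j - p) (k - q)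
  mem ε i j k := P.mem ε i (j - p) (k - q)
  eq h := P.eq h
  d ε i j k := P.d ε i (j - p) (k - q)

end Homology

/-! ### Equivalences of arrows -/

section ArrowEquiv

variable {R : Type} [CommRing R]

/-- Degree-preserving maps between two arrows that are inverse to each other up to homotopy and up
to maps from the target to the source. -/
structure ArrowEquiv {M₀ M₁ N₀ N₁ : Cx R} (f : SHom M₀ M₁) (g : SHom N₀ N₁) where
  q₀ : SHom M₀ N₀
  q₁ : SHom M₁ N₁
  i₀ : SHom N₀ M₀
  i₁ : SHom N₁ M₁
  θ : SHom M₁ M₀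
  θ' : SHom N₁ N₀
  q₀_gr : ∀ {ε i j k x}, x ∈ M₀.gr ε i j k → q₀.f x ∈ N₀.gr ε i j k
  q₁_gr : ∀ {ε i j k x}, x ∈ M₁.gr ε i j k → q₁.f x ∈ N₁.gr ε i j k
  i₀_gr : ∀ {ε i j k x}, x ∈ N₀.gr ε i j k → i₀.f x ∈ M₀.gr ε i j k
  i₁_gr : ∀ {ε i j k x}, x ∈ N₁.gr ε i j k → i₁.f x ∈ M₁.gr ε i j k
  θ_gr : ∀ {ε i j k x}, x ∈ M₁.gr ε i j k → θ.f x ∈ M₀.gr ε i j k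
  θ'_gr : ∀ {ε i j k x}, x ∈ N₁.gr ε i j k → θ'.f x ∈ N₀.gr ε i j k
  q_f : Homotopic (q₁.f ∘ₗ f.f) (g.f ∘ₗ q₀.f)
  f_i : Homotopic (f.f ∘ₗ i₀.f) (i₁.f ∘ₗ g.f)
  i_q₀ : Homotopic (i₀.f ∘ₗ q₀.f) (LinearMap.id + θ.f ∘ₗ f.f)
  i_q₁ : Homotopic (i₁.f ∘ₗ q₁.f) (LinearMap.id + f.f ∘ₗ θ.f)
  q_i₀ : Homotopic (q₀.f ∘ₗ i₀.f) (LinearMap.id + θ'.f ∘ₗ g.f)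
  q_i₁ : Homotopic (q₁.f ∘ₗ i₁.f) (LinearMap.id + g.f ∘ₗ θ'.f)

theorem Homotopic.eq_hcls [Algebra ℚ[X] R] {C D : Cx R} {f g : C.carrier →ₗ[R] D.carrier}
    (h : Homotopic f g) {x} (hx : C.dmf x = 0) (h₁ : D.dmf (f x) = 0) (h₂ : D.dmf (g x) = 0) :
    D.hcls (f x) h₁ = D.hcls (g x) h₂ := by
  obtain ⟨η, -, hη⟩ := h
  refine hcls_eq_iff.2 ⟨η x, ?_⟩
  rw [hη, hx, map_zero]; abel

theorem ctx_f_gr [Algebra ℚ[X] R] (Y : Cx R) (L : List (Cx R)) {C D : Cx R} (F : SHom C D)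
    (h : ∀ {ε i j k x}, x ∈ C.gr ε i j k → F.f x ∈ D.gr ε i j k) (ε i j k) :
    ∀ c ∈ (Cx.ctx Y L C).H.gr ε i j k, (F.ctx Y L).toHom.H.f c ∈ (Cx.ctx Y L D).H.gr ε i j k := by
  intro c hc
  obtain ⟨x, hx, hg, rfl⟩ := mem_H_gr_iff.1 hc
  refine mem_H_gr_iff.2 ⟨_, _, ?_, rfl⟩
  rw [SHom.ctx_f]
  exact ctxMap_mem_gr Y h L hg

/-- Equivalent arrows induce homotopy equivalent cones in every context. -/
def ArrowEquiv.homotopyEquiv [Algebra ℚ[X] R] {M₀ M₁ N₀ N₁ : Cx R} {f : SHom M₀ M₁}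
    {g : SHom N₀ N₁} (E : ArrowEquiv f g) (Y : Cx R) (L : List (Cx R)) :
    GrCx.HomotopyEquiv (GrCx.cone (f.ctx Y L).toHom.H) (GrCx.cone (g.ctx Y L).toHom.H) :=
  have comp₂ : ∀ {A B C D : Cx R} (u : SHom B C) (v : SHom A B) (u' : SHom D C) (v' : SHom A D),
      Homotopic (u.f ∘ₗ v.f) (u'.f ∘ₗ v'.f) → ∀ c, (u.ctx Y L).toHom.H.f ((v.ctx Y L).toHom.H.f c) =
        (u'.ctx Y L).toHom.H.f ((v'.ctx Y L).toHom.H.f c) := by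
    intro A B C D u v u' v' h c
    obtain ⟨x, hx, rfl⟩ := exists_hcls c
    have h' := h.ctx Y L
    rw [ctxMap_comp, ctxMap_comp, ← SHom.ctx_f, ← SHom.ctx_f, ← SHom.ctx_f, ← SHom.ctx_f] at h'
    exact h'.eq_hcls hx _ _
  have comp₁ : ∀ {A B D : Cx R} (u : SHom B A) (v : SHom A B) (u' : SHom D A) (v' : SHom A D),
      Homotopic (u.f ∘ₗ v.f) (LinearMap.id + u'.f ∘ₗ v'.f) →
      ∀ c, (u.ctx Y L).toHom.H.f ((v.ctx Y L).toHom.H.f c) =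
        c + (u'.ctx Y L).toHom.H.f ((v'.ctx Y L).toHom.H.f c) := by
    intro A B D u v u' v' h c
    obtain ⟨x, hx, rfl⟩ := exists_hcls c
    have h' := h.ctx Y L
    rw [ctxMap_comp, ctxMap_add, ctxMap_id, ctxMap_comp, ← SHom.ctx_f, ← SHom.ctx_f,
      ← SHom.ctx_f, ← SHom.ctx_f] at h'
    exact h'.eq_hcls hx _ _
  GrCx.coneEquiv _ _ (E.q₀.ctx Y L).toHom.H (E.q₁.ctx Y L).toHom.H (E.i₀.ctx Y L).toHom.H
    (E.i₁.ctx Y L).toHom.H (E.θ.ctx Y L).toHom.H (E.θ'.ctx Y L).toHom.H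
    (ctx_f_gr Y L E.q₀ E.q₀_gr) (ctx_f_gr Y L E.q₁ E.q₁_gr) (ctx_f_gr Y L E.i₀ E.i₀_gr)
    (ctx_f_gr Y L E.i₁ E.i₁_gr) (ctx_f_gr Y L E.θ E.θ_gr) (ctx_f_gr Y L E.θ' E.θ'_gr)
    (comp₂ _ _ _ _ E.q_f) (comp₂ _ _ _ _ E.f_i) (comp₁ _ _ _ _ E.i_q₀) (comp₁ _ _ _ _ E.i_q₁)
    (comp₁ _ _ _ _ E.q_i₀) (comp₁ _ _ _ _ E.q_i₁)

end ArrowEquiv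

end Cx

/-! ### Homogeneous bases -/

/-- The bigrading of a ring is multiplicative. -/
structure IsGradedRing {R : Type} [CommRing R] (g : ℤ → ℤ → AddSubgroup R) : Prop where
  one_mem : (1 : R) ∈ g 0 0
  mul_mem : ∀ {j k j' k' x y}, x ∈ g j k → y ∈ g j' k' → x * y ∈ g (j + j') (k + k')

theorem IsGradedRing.mul_mem' {R : Type} [CommRing R] {g : ℤ → ℤ → AddSubgroup R}
    (hg : IsGradedRing g) {j k j' k' l m x y} (hx : x ∈ g j k) (hy : y ∈ g j' k') (hl : j + j' = l)
    (hm : k + k' = m) : x * y ∈ g l m :=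
  hl ▸ hm ▸ hg.mul_mem hx hy

namespace MF

variable {R R' : Type} [CommRing R] [CommRing R']

/-- A basis such that the elements of a given degree are those with coordinates of given
degrees. -/
structure GrBasis (g : ℤ → ℤ → AddSubgroup R) (M : MF R) (ι : Type) where
  b : Module.Basis ι R M.carrier
  ε : ι → ZMod 2
  j : ι → ℤ
  k : ι → ℤ
  mem_gr : ∀ {ε' j' k' x}, x ∈ M.gr ε' j' k' ↔
    ∀ n, b.repr x n = 0 ∨ ε n = ε' ∧ b.repr x n ∈ g (j' - j n) (k' - k n)

namespace GrBasis

variable {g : ℤ → ℤ → AddSubgroup R}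

/-- The basis `1` of `R`. -/
def base (g : ℤ → ℤ → AddSubgroup R) : GrBasis g (MF.base g) Unit where
  b := Module.Basis.singleton Unit R
  ε _ := 0
  j _ := 0
  k _ := 0
  mem_gr {ε j k x} := by
    suffices H : ∀ x : R, x ∈ (if ε = 0 then g j k else ⊥) ↔ ∀ n : Unit,
        (Module.Basis.singleton Unit R).repr x n = 0 ∨ (0 : ZMod 2) = ε ∧
          (Module.Basis.singleton Unit R).repr x n ∈ g (j - 0) (k - 0) from H x
    intro x
    simp only [Module.Basis.singleton_repr, sub_zero, forall_const]
    split_ifs with h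
    · subst h
      simp only [true_and]
      exact ⟨Or.inr, fun h => h.elim (fun h => h ▸ zero_mem _) id⟩
    · simp [Ne.symm h]

/-- The basis of `M` times a row. -/
def row {M : MF R} {ι : Type} (B : GrBasis g M ι) (n : ℕ) (a₀ a₁ : R) (p q : ℤ) :
    GrBasis g (M.row n a₀ a₁ p q) (ι ⊕ ι) where
  b := B.b.prod B.b
  ε := Sum.elim B.ε fun m => B.ε m + 1
  j := Sum.elim B.j fun m => B.j m + (1 - p)
  k := Sum.elim B.k fun m => B.k m + (n + 1 - q)
  mem_gr {ε j k x} := by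
    have h2 : ∀ m, B.ε m + 1 = ε ↔ B.ε m = ε + 1 := fun m =>
      ⟨fun h => by rw [← h, add_assoc, CharTwo.add_self_eq_zero, add_zero],
        fun h => by rw [h, add_assoc, CharTwo.add_self_eq_zero, add_zero]⟩
    change x.1 ∈ M.gr ε j k ∧ x.2 ∈ M.gr (ε + 1) (j - (1 - p)) (k - (n + 1 - q)) ↔ _
    rw [B.mem_gr, B.mem_gr, Sum.forall]
    refine and_congr Iff.rfl (forall_congr' fun m => ?_)
    change _ ↔ B.b.repr x.2 m = 0 ∨ B.ε m + 1 = ε ∧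
      B.b.repr x.2 m ∈ g (j - (B.j m + (1 - p))) (k - (B.k m + (n + 1 - q)))
    rw [h2, show j - (1 - p) - B.j m = j - (B.j m + (1 - p)) by ring,
      show k - (n + 1 - q) - B.k m = k - (B.k m + (n + 1 - q)) by ring]

/-- The basis of `M⟨1⟩`. -/
def susp {M : MF R} {ι : Type} (B : GrBasis g M ι) : GrBasis g M.susp ι where
  b := B.b
  ε m := B.ε m + 1
  j := B.j
  k := B.k
  mem_gr {ε j k x} := by
    have h2 : ∀ m, B.ε m + 1 = ε ↔ B.ε m = ε + 1 := fun m =>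
      ⟨fun h => by rw [← h, add_assoc, CharTwo.add_self_eq_zero, add_zero],
        fun h => by rw [h, add_assoc, CharTwo.add_self_eq_zero, add_zero]⟩
    refine (B.mem_gr (ε' := ε + 1) (j' := j) (k' := k) (x := x)).trans (forall_congr' fun m => ?_)
    rw [← h2]; rfl

/-- The basis of `M{p, q}`. -/
def shift {M : MF R} {ι : Type} (B : GrBasis g M ι) (p q : ℤ) : GrBasis g (M.shift p q) ι where
  b := B.b
  ε := B.ε
  j m := B.j m + p
  k m := B.k m + q
  mem_gr {ε j k x} := by
    refine (B.mem_gr (ε' := ε) (j' := j - p) (k' := k - q) (x := x)).trans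
      (forall_congr' fun m => ?_)
    rw [show j - p - B.j m = j - (B.j m + p) by ring, show k - q - B.k m = k - (B.k m + q) by ring]
    rfl

/-- The basis over `R` of a matrix factorization over `R[Z₁, Z₂]`. -/
def restrict {M : MF (MvPolynomial (Fin 2) R)} {ι : Type} (B : GrBasis (extendGrading g) M ι)
    (w : R) (h : algebraMap R (MvPolynomial (Fin 2) R) w = M.w) :
    GrBasis g (M.restrict w h) ((Fin 2 →₀ ℕ) × ι) :=
  letI : Module R M.carrier := Module.compHom M.carrier (algebraMap R (MvPolynomial (Fin 2) R))
  haveI : IsScalarTower R (MvPolynomial (Fin 2) R) M.carrier := IsScalarTower.of_compHom R _ _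
  let b : Module.Basis ((Fin 2 →₀ ℕ) × ι) R M.carrier :=
    (MvPolynomial.basisMonomials (Fin 2) R).smulTower B.b
  { b := b
    ε := fun m => B.ε m.2
    j := fun m => B.j m.2
    k := fun m => B.k m.2 + (2 * m.1 0 + 4 * m.1 1)
    mem_gr := fun {ε j k x} => by
      refine (B.mem_gr (ε' := ε) (j' := j) (k' := k) (x := x)).trans ?_
      suffices H : ∀ x : M.carrier, (∀ n, B.b.repr x n = 0 ∨ B.ε n = ε ∧
          B.b.repr x n ∈ extendGrading g (j - B.j n) (k - B.k n)) ↔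
          ∀ m, b.repr x m = 0 ∨ B.ε m.2 = ε ∧
            b.repr x m ∈ g (j - B.j m.2) (k - (B.k m.2 + (2 * m.1 0 + 4 * m.1 1))) from H x
      intro x
      constructor
      · rintro H ⟨m, n⟩
        rw [show b.repr x (m, n) = (B.b.repr x n).coeff m from Module.Basis.smulTower_repr _ _ _ _]
        rcases H n with H | ⟨H₁, H₂⟩
        · left; rw [H, MvPolynomial.coeff_zero]
        · refine Or.inr ⟨H₁, ?_⟩
          have := H₂ m
          rwa [sub_sub] at this
      · intro H n
        replace H : ∀ m : (Fin 2 →₀ ℕ) × ι, (B.b.repr x m.2).coeff m.1 = 0 ∨ B.ε m.2 = ε ∧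
            (B.b.repr x m.2).coeff m.1 ∈ g (j - B.j m.2)
              (k - (B.k m.2 + (2 * m.1 0 + 4 * m.1 1))) := fun m => by
          rw [← show b.repr x m = (B.b.repr x m.2).coeff m.1 from Module.Basis.smulTower_repr _ _ _ _]
          exact H m
        by_cases hn : B.ε n = ε
        · refine Or.inr ⟨hn, fun m => ?_⟩
          rcases H (m, n) with H | ⟨-, H⟩
          · rw [H]; exact zero_mem _
          · rwa [sub_sub]
        · left
          ext m
          rcases H (m, n) with H | ⟨H, -⟩
          · rw [H, MvPolynomial.coeff_zero]
          · exact absurd H hn }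

end GrBasis

/-- `M'` is obtained from `M` by extension of scalars along `φ`. -/
structure BaseChange (φ : R →+* R') (g : ℤ → ℤ → AddSubgroup R) (g' : ℤ → ℤ → AddSubgroup R')
    (M : MF R) (M' : MF R') where
  ι : Type
  B : GrBasis g M ι
  B' : GrBasis g' M' ι
  ε_eq : B'.ε = B.ε
  j_eq : B'.j = B.j
  k_eq : B'.k = B.k
  β : M.carrier →+ M'.carrier
  smul : ∀ r x, β (r • x) = φ r • β x
  basis : ∀ n, β (B.b n) = B'.b n
  d : ∀ x, β (M.d x) = M'.d (β x)
  s : ∀ x, β (M.s x) = M'.s (β x)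

namespace BaseChange

variable {φ : R →+* R'} {g : ℤ → ℤ → AddSubgroup R} {g' : ℤ → ℤ → AddSubgroup R'}

/-- Extension of scalars of the ring itself. -/
def base (φ : R →+* R') (g : ℤ → ℤ → AddSubgroup R) (g' : ℤ → ℤ → AddSubgroup R') :
    BaseChange φ g g' (MF.base g) (MF.base g') where
  ι := Unit
  B := GrBasis.base g
  B' := GrBasis.base g'
  ε_eq := rfl
  j_eq := rfl
  k_eq := rfl
  β := φ.toAddMonoidHom
  smul := map_mul φ
  basis _ := by
    change φ (Module.Basis.singleton Unit R _) = Module.Basis.singleton Unit R' _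
    rw [Module.Basis.singleton_apply, Module.Basis.singleton_apply, map_one]
  d _ := map_zero φ
  s _ := rfl

/-- Extension of scalars of a row. -/
def row {M : MF R} {M' : MF R'} (F : BaseChange φ g g' M M') (n : ℕ) {a₀ a₁ : R} {b₀ b₁ : R'}
    (p q : ℤ) (h₀ : φ a₀ = b₀) (h₁ : φ a₁ = b₁) :
    BaseChange φ g g' (M.row n a₀ a₁ p q) (M'.row n b₀ b₁ p q) where
  ι := F.ι ⊕ F.ι
  B := F.B.row n a₀ a₁ p q
  B' := F.B'.row n b₀ b₁ p q
  ε_eq := by simp only [GrBasis.row, F.ε_eq]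
  j_eq := by simp only [GrBasis.row, F.j_eq]
  k_eq := by simp only [GrBasis.row, F.k_eq]
  β := F.β.prodMap F.β
  smul r x := Prod.ext (F.smul r x.1) (F.smul r x.2)
  basis := by
    rintro (m | m)
    · change (F.β.prodMap F.β) (F.B.b.prod F.B.b (Sum.inl m)) = F.B'.b.prod F.B'.b (Sum.inl m)
      simp [Module.Basis.prod_apply, F.basis]
    · change (F.β.prodMap F.β) (F.B.b.prod F.B.b (Sum.inr m)) = F.B'.b.prod F.B'.b (Sum.inr m)
      simp [Module.Basis.prod_apply, F.basis]
  d x := by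
    subst h₀ h₁
    refine Prod.ext ?_ ?_
    · change F.β (M.d x.1 + a₁ • M.s x.2) = M'.d (F.β x.1) + φ a₁ • M'.s (F.β x.2)
      rw [map_add, F.smul, F.d, F.s]
    · change F.β (M.d x.2 + a₀ • M.s x.1) = M'.d (F.β x.2) + φ a₀ • M'.s (F.β x.1)
      rw [map_add, F.smul, F.d, F.s]
  s x := Prod.ext (F.s x.1) ((map_neg F.β _).trans (congrArg Neg.neg (F.s x.2)))

/-- Extension of scalars of `M⟨1⟩`. -/
def susp {M : MF R} {M' : MF R'} (F : BaseChange φ g g' M M') :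
    BaseChange φ g g' M.susp M'.susp where
  ι := F.ι
  B := F.B.susp
  B' := F.B'.susp
  ε_eq := by simp only [GrBasis.susp, F.ε_eq]
  j_eq := F.j_eq
  k_eq := F.k_eq
  β := F.β
  smul := F.smul
  basis := F.basis
  d := F.d
  s x := (map_neg F.β _).trans (congrArg Neg.neg (F.s x))

/-- Extension of scalars of `M{p, q}`. -/
def shift {M : MF R} {M' : MF R'} (F : BaseChange φ g g' M M') (p q : ℤ) :
    BaseChange φ g g' (M.shift p q) (M'.shift p q) where
  ι := F.ι
  B := F.B.shift p q
  B' := F.B'.shift p q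
  ε_eq := F.ε_eq
  j_eq := by simp only [GrBasis.shift, F.j_eq]
  k_eq := by simp only [GrBasis.shift, F.k_eq]
  β := F.β
  smul := F.smul
  basis := F.basis
  d := F.d
  s := F.s

/-- Extension of scalars of a matrix factorization over `R[Z₁, Z₂]` regarded over `R`. -/
def restrict {M : MF (MvPolynomial (Fin 2) R)} {M' : MF (MvPolynomial (Fin 2) R')}
    (F : BaseChange (MvPolynomial.map φ) (extendGrading g) (extendGrading g') M M')
    (w : R) (h : algebraMap R (MvPolynomial (Fin 2) R) w = M.w)
    (w' : R') (h' : algebraMap R' (MvPolynomial (Fin 2) R') w' = M'.w) :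
    BaseChange φ g g' (M.restrict w h) (M'.restrict w' h') where
  ι := (Fin 2 →₀ ℕ) × F.ι
  B := F.B.restrict w h
  B' := F.B'.restrict w' h'
  ε_eq := by simp only [GrBasis.restrict, F.ε_eq]
  j_eq := by simp only [GrBasis.restrict, F.j_eq]
  k_eq := by simp only [GrBasis.restrict, F.k_eq]
  β := F.β
  smul r x := by
    refine (F.smul (MvPolynomial.C r) x).trans ?_
    rw [MvPolynomial.map_C]
    rfl
  basis m := by
    let _ : Module R M.carrier := Module.compHom M.carrier (algebraMap R (MvPolynomial (Fin 2) R))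
    have : IsScalarTower R (MvPolynomial (Fin 2) R) M.carrier := IsScalarTower.of_compHom R _ _
    let _ : Module R' M'.carrier :=
      Module.compHom M'.carrier (algebraMap R' (MvPolynomial (Fin 2) R'))
    have : IsScalarTower R' (MvPolynomial (Fin 2) R') M'.carrier :=
      IsScalarTower.of_compHom R' _ _
    change F.β ((MvPolynomial.basisMonomials (Fin 2) R).smulTower F.B.b m) =
      (MvPolynomial.basisMonomials (Fin 2) R').smulTower F.B'.b m
    rw [Module.Basis.smulTower_apply, Module.Basis.smulTower_apply, F.smul, F.basis,
      MvPolynomial.coe_basisMonomials, MvPolynomial.coe_basisMonomials, MvPolynomial.map_monomial,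
      map_one]
  d := F.d
  s := F.s

end BaseChange

end MF

namespace Cx

variable {R R' : Type} [CommRing R] [CommRing R']

/-- A basis such that the elements of a given degree are those with coordinates of given
degrees. -/
structure GrBasis (g : ℤ → ℤ → AddSubgroup R) (C : Cx R) (ι : Type) where
  b : Module.Basis ι R C.carrier
  ε : ι → ZMod 2
  i : ι → ℤ
  j : ι → ℤ
  k : ι → ℤ
  mem_gr : ∀ {ε' i' j' k' x}, x ∈ C.gr ε' i' j' k' ↔
    ∀ n, b.repr x n = 0 ∨ (ε n = ε' ∧ i n = i') ∧ b.repr x n ∈ g (j' - j n) (k' - k n)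

namespace GrBasis

variable {g : ℤ → ℤ → AddSubgroup R}

theorem mem_ite_gr {M : MF R} {ι : Type} (B : MF.GrBasis g M ι) (l : ℤ) (x : M.carrier) {ε i j k} :
    x ∈ (if i = l then M.gr ε j k else ⊥) ↔
      ∀ n, B.b.repr x n = 0 ∨ (B.ε n = ε ∧ l = i) ∧ B.b.repr x n ∈ g (j - B.j n) (k - B.k n) := by
  split_ifs with h
  · simp only [h, and_true]
    exact B.mem_gr
  · simp only [Ne.symm h, and_false, false_and, or_false]
    rw [AddSubgroup.mem_bot]
    exact ⟨fun h n => by rw [h, map_zero]; rfl, fun h => B.b.ext_elem fun n => by simp [h]⟩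

/-- The basis of a complex concentrated in degree `0`. -/
def single {M : MF R} {ι : Type} (B : MF.GrBasis g M ι) : GrBasis g (Cx.single M) ι where
  b := B.b
  ε := B.ε
  i _ := 0
  j := B.j
  k := B.k
  mem_gr {ε i j k x} := by
    exact mem_ite_gr B 0 x

/-- The basis of a two-term complex. -/
def twoTerm (i₀ : ℤ) {M₀ M₁ : MF R} (f : MF.Hom M₀ M₁) (hw : M₁.w = M₀.w) {ι κ : Type}
    (B₀ : MF.GrBasis g M₀ ι) (B₁ : MF.GrBasis g M₁ κ) :
    GrBasis g (Cx.twoTerm i₀ M₀ M₁ f hw) (ι ⊕ κ) where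
  b := B₀.b.prod B₁.b
  ε := Sum.elim B₀.ε B₁.ε
  i := Sum.elim (fun _ => i₀) fun _ => i₀ + 1
  j := Sum.elim B₀.j B₁.j
  k := Sum.elim B₀.k B₁.k
  mem_gr {ε i j k x} := by
    rw [Sum.forall]
    exact and_congr (mem_ite_gr B₀ i₀ x.1) (mem_ite_gr B₁ (i₀ + 1) x.2)

variable {C D : Cx R} {ι κ : Type}

theorem coord_mem {B : GrBasis g C ι} {ε i j k x} (hx : x ∈ C.gr ε i j k) {n}
    (h : B.b.repr x n ≠ 0) :
    B.ε n = ε ∧ B.i n = i ∧ B.b.repr x n ∈ g (j - B.j n) (k - B.k n) :=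
  and_assoc.1 ((B.mem_gr.1 hx n).resolve_left h)

theorem smul_basis_mem (B : GrBasis g C ι) {n r j k} (hr : r ∈ g j k) :
    r • B.b n ∈ C.gr (B.ε n) (B.i n) (j + B.j n) (k + B.k n) := by
  rw [B.mem_gr]
  intro m
  rcases eq_or_ne n m with rfl | h
  · refine Or.inr ⟨⟨rfl, rfl⟩, ?_⟩
    rw [map_smul]
    simpa using hr
  · left
    rw [map_smul]
    simp [Finsupp.single_eq_of_ne' h]

theorem basis_mem (B : GrBasis g C ι) (hg : IsGradedRing g) (n) :
    B.b n ∈ C.gr (B.ε n) (B.i n) (B.j n) (B.k n) := by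
  have := B.smul_basis_mem (n := n) hg.one_mem
  rwa [one_smul, zero_add, zero_add] at this

theorem smul_mem (B : GrBasis g C ι) (hg : IsGradedRing g) {r j k x ε i j' k'} (hr : r ∈ g j k)
    (hx : x ∈ C.gr ε i j' k') : r • x ∈ C.gr ε i (j + j') (k + k') := by
  rw [B.mem_gr] at hx ⊢
  intro n
  rw [map_smul, Finsupp.smul_apply, smul_eq_mul]
  rcases hx n with h | ⟨h, h'⟩
  · left; rw [h, mul_zero]
  · exact Or.inr ⟨h, hg.mul_mem' hr h' (by ring) (by ring)⟩

/-- The basis of a tensor product. -/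
def tens (hg : IsGradedRing g) (B : GrBasis g C ι) (B' : GrBasis g D κ) :
    GrBasis g (C.tens D) (ι × κ) :=
  let b : Module.Basis (ι × κ) R (C.carrier ⊗[R] D.carrier) := B.b.tensorProduct B'.b
  { b := b
    ε := fun n => B.ε n.1 + B'.ε n.2
    i := fun n => B.i n.1 + B'.i n.2
    j := fun n => B.j n.1 + B'.j n.2
    k := fun n => B.k n.1 + B'.k n.2
    mem_gr := fun {ε i j k z} => by
      change z ∈ (C.tens D).gr ε i j k ↔ ∀ n, b.repr z n = 0 ∨
        (B.ε n.1 + B'.ε n.2 = ε ∧ B.i n.1 + B'.i n.2 = i) ∧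
          b.repr z n ∈ g (j - (B.j n.1 + B'.j n.2)) (k - (B.k n.1 + B'.k n.2))
      constructor
      · intro hz n
        let S : AddSubgroup R :=
          if B.ε n.1 + B'.ε n.2 = ε ∧ B.i n.1 + B'.i n.2 = i then
            g (j - (B.j n.1 + B'.j n.2)) (k - (B.k n.1 + B'.k n.2)) else ⊥
        have h : b.coord n z ∈ S := by
          refine map_mem_of_mem_tens_gr (b.coord n).toAddMonoidHom S ?_ hz
          rintro ε₁ i₁ j₁ k₁ ε₂ i₂ j₂ k₂ rfl rfl rfl rfl x y hx hy
          change b.repr (x ⊗ₜ[R] y) n ∈ S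
          rw [show n = (n.1, n.2) from rfl, Module.Basis.tensorProduct_repr_tmul_apply, smul_eq_mul]
          by_cases h₁ : B.b.repr x n.1 = 0
          · rw [h₁, mul_zero]; exact zero_mem _
          by_cases h₂ : B'.b.repr y n.2 = 0
          · rw [h₂, zero_mul]; exact zero_mem _
          obtain ⟨e₁, e₂, e₃⟩ := coord_mem hx h₁
          obtain ⟨e₁', e₂', e₃'⟩ := coord_mem hy h₂
          simp only [S, e₁, e₂, e₁', e₂', and_self, if_true]
          exact hg.mul_mem' e₃' e₃ (by ring) (by ring)
        change b.repr z n ∈ S at h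
        by_cases hc : B.ε n.1 + B'.ε n.2 = ε ∧ B.i n.1 + B'.i n.2 = i
        · right
          simp only [S, if_pos hc] at h
          exact ⟨hc, h⟩
        · left
          simp only [S, if_neg hc] at h
          exact h
      · intro H
        rw [← b.linearCombination_repr z, Finsupp.linearCombination_apply]
        refine AddSubgroup.sum_mem _ fun n hn => ?_
        obtain ⟨⟨h₁, h₂⟩, h₃⟩ := (H n).resolve_left (Finsupp.mem_support_iff.1 hn)
        change b.repr z n • b n ∈ _
        rw [show b n = B.b n.1 ⊗ₜ B'.b n.2 from Module.Basis.tensorProduct_apply' _ _ _,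
          TensorProduct.smul_tmul']
        exact tmul_mem_tens_gr (B.smul_basis_mem h₃) (B'.basis_mem hg n.2) h₁ h₂ (by ring)
          (by ring) }

end GrBasis

end Cx

namespace Cx

variable {R R' : Type} [CommRing R] [CommRing R']

/-- `C'` is obtained from `C` by extension of scalars along `φ`. -/
structure BaseChange (φ : R →+* R') (g : ℤ → ℤ → AddSubgroup R) (g' : ℤ → ℤ → AddSubgroup R')
    (C : Cx R) (C' : Cx R') where
  ι : Type
  B : GrBasis g C ι
  B' : GrBasis g' C' ι
  ε_eq : B'.ε = B.ε
  i_eq : B'.i = B.i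
  j_eq : B'.j = B.j
  k_eq : B'.k = B.k
  β : C.carrier →+ C'.carrier
  smul : ∀ r x, β (r • x) = φ r • β x
  basis : ∀ n, β (B.b n) = B'.b n
  dmf : ∀ x, β (C.dmf x) = C'.dmf (β x)
  dχ : ∀ x, β (C.dχ x) = C'.dχ (β x)
  s : ∀ x, β (C.s x) = C'.s (β x)
  t : ∀ x, β (C.t x) = C'.t (β x)

namespace BaseChange

variable {φ : R →+* R'} {g : ℤ → ℤ → AddSubgroup R} {g' : ℤ → ℤ → AddSubgroup R'}

/-- Extension of scalars of a complex concentrated in degree `0`. -/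
def single {M : MF R} {M' : MF R'} (F : MF.BaseChange φ g g' M M') :
    BaseChange φ g g' (Cx.single M) (Cx.single M') where
  ι := F.ι
  B := GrBasis.single F.B
  B' := GrBasis.single F.B'
  ε_eq := F.ε_eq
  i_eq := rfl
  j_eq := F.j_eq
  k_eq := F.k_eq
  β := F.β
  smul := F.smul
  basis := F.basis
  dmf := F.d
  dχ _ := map_zero F.β
  s := F.s
  t _ := rfl

/-- Extension of scalars of a two-term complex. -/
def twoTerm (i₀ : ℤ) {M₀ M₁ : MF R} {M₀' M₁' : MF R'} (f : MF.Hom M₀ M₁) (hw : M₁.w = M₀.w)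
    (f' : MF.Hom M₀' M₁') (hw' : M₁'.w = M₀'.w) (F₀ : MF.BaseChange φ g g' M₀ M₀')
    (F₁ : MF.BaseChange φ g g' M₁ M₁') (h : ∀ x, F₁.β (f.f x) = f'.f (F₀.β x)) :
    BaseChange φ g g' (Cx.twoTerm i₀ M₀ M₁ f hw) (Cx.twoTerm i₀ M₀' M₁' f' hw') where
  ι := F₀.ι ⊕ F₁.ι
  B := GrBasis.twoTerm i₀ f hw F₀.B F₁.B
  B' := GrBasis.twoTerm i₀ f' hw' F₀.B' F₁.B'
  ε_eq := by simp only [GrBasis.twoTerm, F₀.ε_eq, F₁.ε_eq]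
  i_eq := rfl
  j_eq := by simp only [GrBasis.twoTerm, F₀.j_eq, F₁.j_eq]
  k_eq := by simp only [GrBasis.twoTerm, F₀.k_eq, F₁.k_eq]
  β := F₀.β.prodMap F₁.β
  smul r x := Prod.ext (F₀.smul r x.1) (F₁.smul r x.2)
  basis := by
    rintro (m | m)
    · change (F₀.β.prodMap F₁.β) (F₀.B.b.prod F₁.B.b (Sum.inl m)) =
        F₀.B'.b.prod F₁.B'.b (Sum.inl m)
      simp [Module.Basis.prod_apply, F₀.basis]
    · change (F₀.β.prodMap F₁.β) (F₀.B.b.prod F₁.B.b (Sum.inr m)) =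
        F₀.B'.b.prod F₁.B'.b (Sum.inr m)
      simp [Module.Basis.prod_apply, F₁.basis]
  dmf x := Prod.ext (F₀.d x.1) (F₁.d x.2)
  dχ x := Prod.ext (map_zero F₀.β) (h x.1)
  s x := Prod.ext (F₀.s x.1) (F₁.s x.2)
  t x := by
    refine Prod.ext ?_ ?_
    · exact map_zsmul F₀.β (i₀.negOnePow : ℤ) x.1
    · exact (map_zsmul F₁.β (i₀.negOnePow : ℤ) (-x.2)).trans
        (congrArg ((i₀.negOnePow : ℤ) • ·) (map_neg F₁.β x.2))

variable {C D : Cx R} {C' D' : Cx R'}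

theorem repr_β (F : BaseChange φ g g' C C') (x) (n) :
    F.B'.b.repr (F.β x) n = φ (F.B.b.repr x n) := by
  conv_lhs => rw [← F.B.b.linearCombination_repr x, Finsupp.linearCombination_apply, Finsupp.sum,
    map_sum, map_sum, Finsupp.finsetSum_apply]
  simp only [F.smul, F.basis, map_smul, Finsupp.smul_apply, Module.Basis.repr_self, smul_eq_mul]
  rw [Finset.sum_eq_single n]
  · simp
  · intro m _ hm; simp [Finsupp.single_eq_of_ne' hm]
  · intro h; simp [Finsupp.notMem_support_iff.1 h]

theorem β_mem (F : BaseChange φ g g' C C') (hφ : ∀ {j k x}, x ∈ g j k → φ x ∈ g' j k) {ε i j k x}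
    (hx : x ∈ C.gr ε i j k) : F.β x ∈ C'.gr ε i j k := by
  rw [F.B'.mem_gr]
  intro n
  rw [F.repr_β, F.ε_eq, F.i_eq, F.j_eq, F.k_eq]
  rcases F.B.mem_gr.1 hx n with h | ⟨h, h'⟩
  · left; rw [h, map_zero]
  · exact Or.inr ⟨h, hφ h'⟩

/-- The semilinear map of tensor products given by semilinear maps of the factors. -/
def mapTens {M N : Type} {M' N' : Type} [AddCommGroup M] [Module R M] [AddCommGroup N]
    [Module R N] [AddCommGroup M'] [Module R' M'] [AddCommGroup N'] [Module R' N'] (f : M →+ M')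
    (f' : N →+ N') (hf : ∀ r x, f (r • x) = φ r • f x) (hf' : ∀ r x, f' (r • x) = φ r • f' x) :
    M ⊗[R] N →+ M' ⊗[R'] N' :=
  TensorProduct.liftAddHom
    { toFun := fun x => (TensorProduct.mk R' M' N' (f x)).toAddMonoidHom.comp f'
      map_zero' := by ext; simp
      map_add' := fun x y => by ext; simp }
    (fun r x y => by simp [hf, hf'])

@[simp] theorem mapTens_tmul {M N : Type} {M' N' : Type} [AddCommGroup M] [Module R M]
    [AddCommGroup N] [Module R N] [AddCommGroup M'] [Module R' M'] [AddCommGroup N']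
    [Module R' N'] (f : M →+ M') (f' : N →+ N') (hf : ∀ r x, f (r • x) = φ r • f x)
    (hf' : ∀ r x, f' (r • x) = φ r • f' x) (x : M) (y : N) :
    mapTens f f' hf hf' (x ⊗ₜ[R] y) = f x ⊗ₜ[R'] f' y := rfl

theorem mapTens_smul {M N : Type} {M' N' : Type} [AddCommGroup M] [Module R M]
    [AddCommGroup N] [Module R N] [AddCommGroup M'] [Module R' M'] [AddCommGroup N']
    [Module R' N'] (f : M →+ M') (f' : N →+ N') (hf : ∀ r x, f (r • x) = φ r • f x)
    (hf' : ∀ r x, f' (r • x) = φ r • f' x) (r : R) (z : M ⊗[R] N) :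
    mapTens f f' hf hf' (r • z) = φ r • mapTens f f' hf hf' z := by
  induction z using TensorProduct.induction_on with
  | zero => simp
  | add x y hx hy => simp only [smul_add, map_add, hx, hy]
  | tmul x y => rw [TensorProduct.smul_tmul', mapTens_tmul, hf, mapTens_tmul,
      TensorProduct.smul_tmul']

/-- Extension of scalars of a tensor product. -/
def tens (hg : IsGradedRing g) (hg' : IsGradedRing g') (F : BaseChange φ g g' C C')
    (F' : BaseChange φ g g' D D') : BaseChange φ g g' (C.tens D) (C'.tens D') :=
  let β := mapTens F.β F'.β F.smul F'.smul
  { ι := F.ι × F'.ι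
    B := F.B.tens hg F'.B
    B' := F.B'.tens hg' F'.B'
    ε_eq := by simp only [GrBasis.tens, F.ε_eq, F'.ε_eq]
    i_eq := by simp only [GrBasis.tens, F.i_eq, F'.i_eq]
    j_eq := by simp only [GrBasis.tens, F.j_eq, F'.j_eq]
    k_eq := by simp only [GrBasis.tens, F.k_eq, F'.k_eq]
    β := β
    smul := mapTens_smul F.β F'.β F.smul F'.smul
    basis := fun n => by
      change β (F.B.b.tensorProduct F'.B.b n) = F.B'.b.tensorProduct F'.B'.b n
      rw [Module.Basis.tensorProduct_apply', Module.Basis.tensorProduct_apply', mapTens_tmul,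
        F.basis, F'.basis]
    dmf := tens_addHom_ext (β.comp (leibniz C.dmf C.s D.dmf).toAddMonoidHom)
      ((leibniz C'.dmf C'.s D'.dmf).toAddMonoidHom.comp β) fun x y => by
        simp [β, F.dmf, F.s, F'.dmf]
    dχ := tens_addHom_ext (β.comp (leibniz C.dχ C.t D.dχ).toAddMonoidHom)
      ((leibniz C'.dχ C'.t D'.dχ).toAddMonoidHom.comp β) fun x y => by
        simp [β, F.dχ, F.t, F'.dχ]
    s := tens_addHom_ext (β.comp (TensorProduct.map C.s D.s).toAddMonoidHom)
      ((TensorProduct.map C'.s D'.s).toAddMonoidHom.comp β) fun x y => by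
        simp [β, F.s, F'.s]
    t := tens_addHom_ext (β.comp (TensorProduct.map C.t D.t).toAddMonoidHom)
      ((TensorProduct.map C'.t D'.t).toAddMonoidHom.comp β) fun x y => by
        simp [β, F.t, F'.t] }

/-- The elements of `R'` act on the homogeneous elements with the expected degrees. -/
def _root_.TransverseKR.Cx.IsGradedModule (g : ℤ → ℤ → AddSubgroup R) (C : Cx R) : Prop :=
  ∀ {r j k ε i j' k' x}, r ∈ g j k → x ∈ C.gr ε i j' k' → r • x ∈ C.gr ε i (j + j') (k + k')

theorem _root_.TransverseKR.Cx.IsGradedModule.tens (P : Cx R) (h : C.IsGradedModule g) :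
    (P.tens C).IsGradedModule g := by
  intro r j k ε i j' k' x hr hx
  refine map_mem_of_mem_tens_gr (LinearMap.lsmul R (P.carrier ⊗[R] C.carrier) r).toAddMonoidHom
    ((P.tens C).gr ε i (j + j') (k + k')) ?_ hx
  intro ε₁ i₁ j₁ k₁ ε₂ i₂ j₂ k₂ hε hi hj hk x y hx hy
  change r • (x ⊗ₜ[R] y) ∈ _
  rw [← TensorProduct.tmul_smul]
  exact tmul_mem_tens_gr hx (h hr hy) hε hi (by omega) (by omega)

/-- The inverse of the isomorphism `P ⊗ Z ≃ P' ⊗ Z'`, where `P'` is obtained from `P` by extension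
of scalars. -/
def lSymm (F : BaseChange φ g g' C C') (e : Iso φ D D') :
    C'.carrier ⊗[R'] D'.carrier →+ C.carrier ⊗[R] D.carrier :=
  let f : D'.carrier →+ F.ι → (R' →+ C.carrier ⊗[R] D.carrier) :=
    { toFun := fun z n =>
        ((TensorProduct.mk R C.carrier D.carrier (F.B.b n)).toAddMonoidHom.comp
          e.e.symm.toAddMonoidHom).comp ((smulAddHom R' D'.carrier).flip z)
      map_zero' := by ext; simp
      map_add' := fun x y => by ext; simp [TensorProduct.tmul_add] }
  TensorProduct.liftAddHom
    { toFun := fun x =>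
        { toFun := fun z => Finsupp.liftAddHom (f z) (F.B'.b.repr x)
          map_zero' := by simp [map_zero f]
          map_add' := fun z z' => by
            rw [map_add f]
            simp }
      map_zero' := by ext; simp
      map_add' := fun x y => by ext; simp [Finsupp.sum_add_index'] }
    (fun r x z => by
      simp only [AddMonoidHom.coe_mk, ZeroHom.coe_mk, map_smul, Finsupp.liftAddHom_apply]
      rw [Finsupp.sum_smul_index']
      · refine Finset.sum_congr rfl fun n _ => ?_
        change F.B.b n ⊗ₜ[R] e.e.symm ((r • F.B'.b.repr x n) • z) =
          F.B.b n ⊗ₜ[R] e.e.symm (F.B'.b.repr x n • r • z)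
        rw [smul_smul, smul_eq_mul, mul_comm]
      · simp)

theorem lSymm_tmul (F : BaseChange φ g g' C C') (e : Iso φ D D') (x : C'.carrier)
    (z : D'.carrier) : lSymm F e (x ⊗ₜ z) =
      (F.B'.b.repr x).sum fun n r => F.B.b n ⊗ₜ e.e.symm (r • z) := rfl

theorem symm_smul (e : Iso φ D D') (r x) : e.e.symm (φ r • e.e x) = r • x := by
  rw [AddEquiv.symm_apply_eq, e.smul]

/-- The isomorphism `P ⊗ Z ≃ P' ⊗ Z'`, where `P'` is obtained from `P` by extension of
scalars. -/
def isoL (hφ : ∀ {j k x}, x ∈ g j k → φ x ∈ g' j k)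
    (F : BaseChange φ g g' C C') (e : Iso φ D D') (hD : D'.IsGradedModule g') (hg : IsGradedRing g) :
    Iso φ (C.tens D) (C'.tens D') :=
  let β := mapTens F.β e.e.toAddMonoidHom F.smul e.smul
  isoOfTens (E := C'.tens D')
    { β with
      invFun := lSymm F e
      left_inv := tens_addHom_ext ((lSymm F e).comp β) (AddMonoidHom.id _) fun x z => by
        change lSymm F e (F.β x ⊗ₜ e.e z) = x ⊗ₜ z
        rw [lSymm_tmul]
        rw [show F.B'.b.repr (F.β x) = (F.B.b.repr x).mapRange φ (map_zero φ) from
          Finsupp.ext fun n => F.repr_β x n, Finsupp.sum_mapRange_index (by simp)]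
        conv_rhs => rw [← F.B.b.linearCombination_repr x, Finsupp.linearCombination_apply,
          Finsupp.sum, TensorProduct.sum_tmul]
        refine Finset.sum_congr rfl fun n _ => ?_
        refine (congrArg (F.B.b n ⊗ₜ[R] ·) (symm_smul e _ z)).trans ?_
        rw [TensorProduct.smul_tmul]
      right_inv := tens_addHom_ext (β.comp (lSymm F e)) (AddMonoidHom.id _) fun x z => by
        change β (lSymm F e (x ⊗ₜ z)) = x ⊗ₜ z
        rw [lSymm_tmul, Finsupp.sum, map_sum]
        conv_rhs => rw [← F.B'.b.linearCombination_repr x, Finsupp.linearCombination_apply,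
          Finsupp.sum, TensorProduct.sum_tmul]
        refine Finset.sum_congr rfl fun n _ => ?_
        change F.β (F.B.b n) ⊗ₜ[R'] e.e (e.e.symm (F.B'.b.repr x n • z)) = _
        rw [F.basis, AddEquiv.apply_symm_apply, TensorProduct.smul_tmul] }
    (mapTens_smul F.β e.e.toAddMonoidHom F.smul e.smul)
    (fun x z => by
      change F.β (C.dmf x) ⊗ₜ[R'] e.e z + F.β (C.s x) ⊗ₜ[R'] e.e (D.dmf z) =
        C'.dmf (F.β x) ⊗ₜ[R'] e.e z + C'.s (F.β x) ⊗ₜ[R'] D'.dmf (e.e z)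
      rw [F.dmf, F.s, e.dmf])
    (fun x z => by
      change F.β (C.dχ x) ⊗ₜ[R'] e.e z + F.β (C.t x) ⊗ₜ[R'] e.e (D.dχ z) =
        C'.dχ (F.β x) ⊗ₜ[R'] e.e z + C'.t (F.β x) ⊗ₜ[R'] D'.dχ (e.e z)
      rw [F.dχ, F.t, e.dχ])
    (fun x z => congrArg₂ (TensorProduct.tmul R') (F.s x) (e.s z))
    (fun x z => congrArg₂ (TensorProduct.tmul R') (F.t x) (e.t z))
    (fun hx hz => tmul_mem_tens_gr (F.β_mem hφ hx) (e.gr hz) rfl rfl rfl rfl)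
    (fun {ε i j k z} hz => map_mem_of_mem_tens_gr (lSymm F e) ((C.tens D).gr ε i j k)
      (fun {ε₁ i₁ j₁ k₁ ε₂ i₂ j₂ k₂} hε hi hj hk x z hx hz => by
        rw [lSymm_tmul]
        refine AddSubgroup.sum_mem _ fun n hn => ?_
        obtain ⟨h₁, h₂, h₃⟩ := GrBasis.coord_mem hx (Finsupp.mem_support_iff.1 hn)
        exact tmul_mem_tens_gr (F.B.basis_mem hg n) (e.gr_symm (hD h₃ hz))
          (by rw [← F.ε_eq, h₁, hε]) (by rw [← F.i_eq, h₂, hi]) (by rw [← F.j_eq, ← hj]; ring)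
          (by rw [← F.k_eq, ← hk]; ring)) hz)

/-- The inverse of the isomorphism `Z ⊗ P ≃ Z' ⊗ P'`, where `P'` is obtained from `P` by extension
of scalars. -/
def rSymm (F : BaseChange φ g g' C C') (e : Iso φ D D') :
    D'.carrier ⊗[R'] C'.carrier →+ D.carrier ⊗[R] C.carrier :=
  let f : D'.carrier →+ F.ι → (R' →+ D.carrier ⊗[R] C.carrier) :=
    { toFun := fun z n =>
        (((TensorProduct.mk R D.carrier C.carrier).flip (F.B.b n)).toAddMonoidHom.comp
          e.e.symm.toAddMonoidHom).comp ((smulAddHom R' D'.carrier).flip z)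
      map_zero' := by ext; simp
      map_add' := fun x y => by ext; simp }
  TensorProduct.liftAddHom
    { toFun := fun z =>
        { toFun := fun x => Finsupp.liftAddHom (f z) (F.B'.b.repr x)
          map_zero' := by simp
          map_add' := fun x y => by simp [Finsupp.sum_add_index'] }
      map_zero' := by ext; simp [map_zero f]
      map_add' := fun z z' => by
        ext
        simp only [AddMonoidHom.add_apply]
        rw [map_add f]
        simp }
    (fun r z x => by
      simp only [AddMonoidHom.coe_mk, ZeroHom.coe_mk, map_smul, Finsupp.liftAddHom_apply]
      rw [Finsupp.sum_smul_index']
      · refine Finset.sum_congr rfl fun n _ => ?_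
        change e.e.symm (F.B'.b.repr x n • r • z) ⊗ₜ[R] F.B.b n =
          e.e.symm ((r • F.B'.b.repr x n) • z) ⊗ₜ[R] F.B.b n
        rw [smul_smul, smul_eq_mul, mul_comm]
      · simp)

theorem rSymm_tmul (F : BaseChange φ g g' C C') (e : Iso φ D D') (x : C'.carrier)
    (z : D'.carrier) : rSymm F e (z ⊗ₜ x) =
      (F.B'.b.repr x).sum fun n r => e.e.symm (r • z) ⊗ₜ F.B.b n := rfl

/-- The isomorphism `Z ⊗ P ≃ Z' ⊗ P'`, where `P'` is obtained from `P` by extension of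
scalars. -/
def isoR (hφ : ∀ {j k x}, x ∈ g j k → φ x ∈ g' j k)
    (F : BaseChange φ g g' C C') (e : Iso φ D D') (hD : D'.IsGradedModule g') (hg : IsGradedRing g) :
    Iso φ (D.tens C) (D'.tens C') :=
  let β := mapTens e.e.toAddMonoidHom F.β e.smul F.smul
  isoOfTens (E := D'.tens C')
    { β with
      invFun := rSymm F e
      left_inv := tens_addHom_ext ((rSymm F e).comp β) (AddMonoidHom.id _) fun z x => by
        change rSymm F e (e.e z ⊗ₜ F.β x) = z ⊗ₜ x
        rw [rSymm_tmul]
        rw [show F.B'.b.repr (F.β x) = (F.B.b.repr x).mapRange φ (map_zero φ) from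
          Finsupp.ext fun n => F.repr_β x n, Finsupp.sum_mapRange_index (by simp)]
        conv_rhs => rw [← F.B.b.linearCombination_repr x, Finsupp.linearCombination_apply,
          Finsupp.sum, TensorProduct.tmul_sum]
        refine Finset.sum_congr rfl fun n _ => ?_
        refine (congrArg (· ⊗ₜ[R] F.B.b n) (symm_smul e _ z)).trans ?_
        rw [TensorProduct.smul_tmul]
      right_inv := tens_addHom_ext (β.comp (rSymm F e)) (AddMonoidHom.id _) fun z x => by
        change β (rSymm F e (z ⊗ₜ x)) = z ⊗ₜ x
        rw [rSymm_tmul, Finsupp.sum, map_sum]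
        conv_rhs => rw [← F.B'.b.linearCombination_repr x, Finsupp.linearCombination_apply,
          Finsupp.sum, TensorProduct.tmul_sum]
        refine Finset.sum_congr rfl fun n _ => ?_
        change e.e (e.e.symm (F.B'.b.repr x n • z)) ⊗ₜ[R'] F.β (F.B.b n) = _
        rw [F.basis, AddEquiv.apply_symm_apply, TensorProduct.smul_tmul] }
    (mapTens_smul e.e.toAddMonoidHom F.β e.smul F.smul)
    (fun z x => by
      change e.e (D.dmf z) ⊗ₜ[R'] F.β x + e.e (D.s z) ⊗ₜ[R'] F.β (C.dmf x) =
        D'.dmf (e.e z) ⊗ₜ[R'] F.β x + D'.s (e.e z) ⊗ₜ[R'] C'.dmf (F.β x)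
      rw [F.dmf, e.s, e.dmf])
    (fun z x => by
      change e.e (D.dχ z) ⊗ₜ[R'] F.β x + e.e (D.t z) ⊗ₜ[R'] F.β (C.dχ x) =
        D'.dχ (e.e z) ⊗ₜ[R'] F.β x + D'.t (e.e z) ⊗ₜ[R'] C'.dχ (F.β x)
      rw [F.dχ, e.t, e.dχ])
    (fun z x => congrArg₂ (TensorProduct.tmul R') (e.s z) (F.s x))
    (fun z x => congrArg₂ (TensorProduct.tmul R') (e.t z) (F.t x))
    (fun hz hx => tmul_mem_tens_gr (e.gr hz) (F.β_mem hφ hx) rfl rfl rfl rfl)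
    (fun {ε i j k z} hz => map_mem_of_mem_tens_gr (rSymm F e) ((D.tens C).gr ε i j k)
      (fun {ε₁ i₁ j₁ k₁ ε₂ i₂ j₂ k₂} hε hi hj hk z x hz hx => by
        rw [rSymm_tmul]
        refine AddSubgroup.sum_mem _ fun n hn => ?_
        obtain ⟨h₁, h₂, h₃⟩ := GrBasis.coord_mem hx (Finsupp.mem_support_iff.1 hn)
        exact tmul_mem_tens_gr (e.gr_symm (hD h₃ hz)) (F.B.basis_mem hg n)
          (by rw [← F.ε_eq, h₁, hε]) (by rw [← F.i_eq, h₂, hi]) (by rw [← F.j_eq, ← hj]; ring)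
          (by rw [← F.k_eq, ← hk]; ring)) hz)

end BaseChange

end Cx

/-! ### Homogeneity of the polynomials -/

section Degrees

variable {R : Type} [CommRing R] {g : ℤ → ℤ → AddSubgroup R}

theorem mem_of_mem {j k l m x} (hx : x ∈ g j k) (hj : j = l) (hk : k = m) : x ∈ g l m :=
  hj ▸ hk ▸ hx

namespace IsGradedRing

variable (hg : IsGradedRing g)

include hg

theorem pow_mem {x : R} {j k : ℤ} (hx : x ∈ g j k) : ∀ n : ℕ, x ^ n ∈ g (n * j) (n * k)
  | 0 => by simpa using hg.one_mem
  | n + 1 => by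
    rw [pow_succ]
    exact hg.mul_mem' (pow_mem hx n) hx (by push_cast; ring) (by push_cast; ring)

theorem prod_mem {ι : Type} (f : ι → R) (d : ι → ℕ) {k : ℤ} (hf : ∀ i, f i ∈ g 0 k)
    (s : Finset ι) : ∏ i ∈ s, f i ^ d i ∈ g 0 (k * ∑ i ∈ s, d i) := by
  classical
  induction s using Finset.induction_on with
  | empty => simpa using hg.one_mem
  | insert i s hi ih =>
    rw [Finset.prod_insert hi, Finset.sum_insert hi]
    exact hg.mul_mem' (hg.pow_mem (hf i) _) ih (by ring) (by push_cast; ring)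

theorem powDiff_mem {x y : R} (hx : x ∈ g 0 2) (hy : y ∈ g 0 2) (n : ℕ) :
    powDiff n x y ∈ g 0 (2 * n - 2) := by
  refine AddSubgroup.sum_mem _ fun i hi => ?_
  have := Finset.mem_range.1 hi
  exact hg.mul_mem' (hg.pow_mem hx i) (hg.pow_mem hy _) (by ring) (by omega)

theorem psum2_mem {e₁ e₂ : R} (h₁ : e₁ ∈ g 0 2) (h₂ : e₂ ∈ g 0 4) :
    ∀ n : ℕ, psum2 n e₁ e₂ ∈ g 0 (2 * n)
  | 0 => by
    have h := add_mem hg.one_mem hg.one_mem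
    rw [one_add_one_eq_two] at h
    simpa [psum2] using h
  | 1 => by simpa [psum2] using h₁
  | n + 2 => sub_mem
      (hg.mul_mem' h₁ (psum2_mem h₁ h₂ (n + 1)) (by ring) (by push_cast; ring))
      (hg.mul_mem' h₂ (psum2_mem h₁ h₂ n) (by ring) (by push_cast; ring))

theorem U₁_mem {X₁ Y₁ X₂ : R} (h₁ : X₁ ∈ g 0 2) (h₂ : Y₁ ∈ g 0 2) (h₃ : X₂ ∈ g 0 4) :
    ∀ n : ℕ, U₁ n X₁ Y₁ X₂ ∈ g 0 (2 * n - 2)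
  | 0 => zero_mem _
  | 1 => by simpa [U₁] using hg.one_mem
  | n + 2 => sub_mem (add_mem
      (mem_of_mem (hg.psum2_mem h₁ h₃ (n + 1)) (by ring) (by push_cast; ring))
      (hg.mul_mem' h₂ (U₁_mem h₁ h₂ h₃ (n + 1)) (by ring) (by push_cast; ring)))
      (hg.mul_mem' h₃ (U₁_mem h₁ h₂ h₃ n) (by ring) (by push_cast; ring))

theorem U₂_mem {Y₁ X₂ Y₂ : R} (h₁ : Y₁ ∈ g 0 2) (h₂ : X₂ ∈ g 0 4) (h₃ : Y₂ ∈ g 0 4) :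
    ∀ n : ℕ, U₂ n Y₁ X₂ Y₂ ∈ g 0 (2 * n - 4)
  | 0 => zero_mem _
  | 1 => zero_mem _
  | n + 2 => sub_mem (sub_mem
      (hg.mul_mem' h₁ (U₂_mem h₁ h₂ h₃ (n + 1)) (by ring) (by push_cast; ring))
      (hg.mul_mem' h₂ (U₂_mem h₁ h₂ h₃ n) (by ring) (by push_cast; ring)))
      (mem_of_mem (hg.psum2_mem h₁ h₃ n) (by ring) (by push_cast; ring))

theorem U₁₁_mem {X₁ Z₁ Y₁ X₂ : R} (h₁ : X₁ ∈ g 0 2) (h₂ : Z₁ ∈ g 0 2) (h₃ : Y₁ ∈ g 0 2)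
    (h₄ : X₂ ∈ g 0 4) : ∀ n : ℕ, U₁₁ n X₁ Z₁ Y₁ X₂ ∈ g 0 (2 * n - 4)
  | 0 => zero_mem _
  | 1 => zero_mem _
  | n + 2 => sub_mem (add_mem
      (mem_of_mem (hg.U₁_mem h₁ h₂ h₄ (n + 1)) (by ring) (by push_cast; ring))
      (hg.mul_mem' h₃ (U₁₁_mem h₁ h₂ h₃ h₄ (n + 1)) (by ring) (by push_cast; ring)))
      (hg.mul_mem' h₄ (U₁₁_mem h₁ h₂ h₃ h₄ n) (by ring) (by push_cast; ring))

theorem U₂₂_mem {Y₁ X₂ Z₂ Y₂ : R} (h₁ : Y₁ ∈ g 0 2) (h₂ : X₂ ∈ g 0 4) (h₃ : Z₂ ∈ g 0 4)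
    (h₄ : Y₂ ∈ g 0 4) : ∀ n : ℕ, U₂₂ n Y₁ X₂ Z₂ Y₂ ∈ g 0 (2 * n - 8)
  | 0 => zero_mem _
  | 1 => zero_mem _
  | n + 2 => sub_mem (sub_mem
      (hg.mul_mem' h₁ (U₂₂_mem h₁ h₂ h₃ h₄ (n + 1)) (by ring) (by push_cast; ring))
      (hg.mul_mem' h₂ (U₂₂_mem h₁ h₂ h₃ h₄ n) (by ring) (by push_cast; ring)))
      (mem_of_mem (hg.U₂_mem h₁ h₃ h₄ n) (by ring) (by push_cast; ring))

theorem U₁₂_mem {Z₁ Y₁ X₂ Z₂ : R} (h₁ : Z₁ ∈ g 0 2) (h₂ : Y₁ ∈ g 0 2) (h₃ : X₂ ∈ g 0 4)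
    (h₄ : Z₂ ∈ g 0 4) : ∀ n : ℕ, U₁₂ n Z₁ Y₁ X₂ Z₂ ∈ g 0 (2 * n - 6)
  | 0 => zero_mem _
  | 1 => zero_mem _
  | n + 2 => sub_mem (sub_mem (add_mem
      (mem_of_mem (hg.U₂_mem h₁ h₃ h₄ (n + 1)) (by ring) (by push_cast; ring))
      (hg.mul_mem' h₂ (U₁₂_mem h₁ h₂ h₃ h₄ (n + 1)) (by ring) (by push_cast; ring)))
      (hg.mul_mem' h₃ (U₁₂_mem h₁ h₂ h₃ h₄ n) (by ring) (by push_cast; ring)))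
      (mem_of_mem (hg.U₁_mem h₁ h₂ h₄ n) (by ring) (by push_cast; ring))

theorem twist_mem {x₁ y₁ y₂ x₂ : R} (h₁ : x₁ ∈ g 0 2) (h₂ : y₁ ∈ g 0 2) (h₃ : y₂ ∈ g 0 2)
    (h₄ : x₂ ∈ g 0 2) : ∀ n : ℕ, twist n x₁ y₁ y₂ x₂ ∈ g 0 (2 * n - 4)
  | 0 => zero_mem _
  | 1 => zero_mem _
  | n + 2 => sub_mem (add_mem (sub_mem
      (hg.mul_mem' (add_mem h₄ h₃) (twist_mem h₁ h₂ h₃ h₄ (n + 1)) (by ring) (by push_cast; ring))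
      (hg.mul_mem' (hg.mul_mem h₁ h₂) (twist_mem h₁ h₂ h₃ h₄ n) (by ring) (by push_cast; ring)))
      (hg.mul_mem' h₁ (hg.powDiff_mem h₁ h₃ n) (by ring) (by push_cast; ring)))
      (mem_of_mem (hg.powDiff_mem h₂ h₄ (n + 1)) (by ring) (by push_cast; ring))

theorem extend : IsGradedRing (extendGrading g) where
  one_mem m := by
    rw [MvPolynomial.coeff_one]
    split_ifs with h
    · subst h; simpa using hg.one_mem
    · exact zero_mem _
  mul_mem hx hy m := by
    rw [MvPolynomial.coeff_mul]
    refine AddSubgroup.sum_mem _ fun n hn => ?_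
    have h := Finset.HasAntidiagonal.mem_antidiagonal.1 hn
    refine hg.mul_mem' (hx n.1) (hy n.2) rfl ?_
    rw [← h, Finsupp.add_apply, Finsupp.add_apply]
    push_cast
    ring

end IsGradedRing

theorem C_mem_extendGrading {x : R} {j k} (hx : x ∈ g j k) :
    MvPolynomial.C x ∈ extendGrading g j k := by
  intro m
  rw [MvPolynomial.coeff_C]
  split_ifs with h
  · subst h; simpa using hx
  · exact zero_mem _

theorem X_zero_mem_extendGrading (hg : IsGradedRing g) :
    MvPolynomial.X 0 ∈ extendGrading g 0 2 := by
  intro m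
  rw [MvPolynomial.coeff_X]
  split_ifs with h
  · subst h; simpa using hg.one_mem
  · exact zero_mem _

theorem X_one_mem_extendGrading (hg : IsGradedRing g) :
    MvPolynomial.X 1 ∈ extendGrading g 0 4 := by
  intro m
  rw [MvPolynomial.coeff_X]
  split_ifs with h
  · subst h; simpa using hg.one_mem
  · exact zero_mem _

end Degrees

section PointRing

variable {P : Type}

theorem isGradedRing_pointGrading (P : Type) : IsGradedRing (pointGrading P) where
  one_mem := by
    classical
    intro m n h
    rw [MvPolynomial.coeff_one] at h
    split_ifs at h with hm
    · subst hm
      rw [Polynomial.coeff_one] at h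
      split_ifs at h with hn
      · subst hn; simp
      · exact absurd rfl h
    · simp at h
  mul_mem {j k j' k' x y} hx hy := by
    classical
    intro m n h
    rw [MvPolynomial.coeff_mul, Polynomial.finsetSum_coeff] at h
    obtain ⟨⟨m₁, m₂⟩, hm, h⟩ := Finset.exists_ne_zero_of_sum_ne_zero h
    rw [Polynomial.coeff_mul] at h
    obtain ⟨⟨n₁, n₂⟩, hn, h⟩ := Finset.exists_ne_zero_of_sum_ne_zero h
    rw [Finset.HasAntidiagonal.mem_antidiagonal] at hm hn
    obtain ⟨h₁, h₂⟩ := hx m₁ n₁ (left_ne_zero_of_mul h)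
    obtain ⟨h₃, h₄⟩ := hy m₂ n₂ (right_ne_zero_of_mul h)
    simp only at hm hn
    subst hm hn
    rw [map_add]
    push_cast
    constructor <;> linarith

theorem aVar_mem : aVar P ∈ pointGrading P 2 0 := by
  classical
  intro m n h
  rw [aVar, MvPolynomial.coeff_C] at h
  split_ifs at h with hm
  · subst hm
    rw [Polynomial.coeff_X] at h
    split_ifs at h with hn
    · subst hn; simp
    · exact absurd rfl h
  · simp at h

theorem C_C_mem (q : ℚ) :
    (MvPolynomial.C (Polynomial.C q) : PointRing P) ∈ pointGrading P 0 0 := by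
  classical
  intro m n h
  rw [MvPolynomial.coeff_C] at h
  split_ifs at h with hm
  · subst hm
    rw [Polynomial.coeff_C] at h
    split_ifs at h with hn
    · subst hn; simp
    · exact absurd rfl h
  · simp at h

theorem X_mem (p : P) : (MvPolynomial.X p : PointRing P) ∈ pointGrading P 0 2 := by
  classical
  intro m n h
  rw [MvPolynomial.coeff_X] at h
  split_ifs at h with hm
  · subst hm
    rw [Polynomial.coeff_one] at h
    split_ifs at h with hn
    · subst hn; simp
    · exact absurd rfl h
  · simp at h

/-- The `ℚ[a]`-algebra homomorphisms sending the points to elements of degree `(0, 2)` are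
homogeneous. -/
theorem aeval_mem {Q : Type} (f : P → PointRing Q) (hf : ∀ p, f p ∈ pointGrading Q 0 2) {j k : ℤ}
    {x : PointRing P} (hx : x ∈ pointGrading P j k) :
    MvPolynomial.aeval (R := ℚ[X]) f x ∈ pointGrading Q j k := by
  have hQ := isGradedRing_pointGrading Q
  rw [MvPolynomial.aeval_def, MvPolynomial.eval₂_eq]
  refine AddSubgroup.sum_mem _ fun m _ => ?_
  rw [(x.coeff m).as_sum_support_C_mul_X_pow, map_sum, Finset.sum_mul]
  refine AddSubgroup.sum_mem _ fun n hn => ?_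
  obtain ⟨h₁, h₂⟩ := hx m n (Polynomial.mem_support_iff.1 hn)
  rw [map_mul, map_pow]
  refine hQ.mul_mem' (j := 2 * n) (k := 0) (hQ.mul_mem' (j := 0) (k := 0) ?_
    (hQ.pow_mem aVar_mem n) (by ring) (by ring)) (hQ.prod_mem f m hf m.support) (by omega) ?_
  · exact C_C_mem _
  · rw [← h₂, Finsupp.degree_apply]; push_cast; ring

end PointRing

namespace MF

variable {R : Type} [CommRing R] {g : ℤ → ℤ → AddSubgroup R}

theorem base_mem {g : ℤ → ℤ → AddSubgroup R} {ε ε' j j' k k'} {x : R}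
    (hx : x ∈ (base g).gr ε j k) (hε : ε = ε') (hj : j = j') (hk : k = k') :
    x ∈ (base g).gr ε' j' k' := hε ▸ hj ▸ hk ▸ hx

theorem add_base_mem {ε j k} {x y : R} (hx : x ∈ (base g).gr ε j k) (hy : y ∈ (base g).gr ε j k) :
    x + y ∈ (base g).gr ε j k := AddSubgroup.add_mem _ hx hy

theorem sub_base_mem {ε j k} {x y : R} (hx : x ∈ (base g).gr ε j k) (hy : y ∈ (base g).gr ε j k) :
    x - y ∈ (base g).gr ε j k := AddSubgroup.sub_mem _ hx hy

theorem mul_base_mem (hg : IsGradedRing g) {ε ε' j k j' k' l m} {r x : R} (hr : r ∈ g j k)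
    (hx : x ∈ (base g).gr ε j' k') (hε : ε = ε') (hj : j + j' = l) (hk : k + k' = m) :
    r * x ∈ (base g).gr ε' l m := by
  subst hε hj hk
  change x ∈ (if ε = 0 then g j' k' else ⊥) at hx
  change r * x ∈ (if ε = 0 then g (j + j') (k + k') else ⊥)
  split_ifs at hx ⊢
  · exact hg.mul_mem hr hx
  · rw [(AddSubgroup.mem_bot).1 hx, mul_zero]
    exact zero_mem _

theorem map_base_mem {A : Type} [CommRing A] {g' : ℤ → ℤ → AddSubgroup A} {f : R →+* A}
    (hf : ∀ {j k x}, x ∈ g j k → f x ∈ g' j k) {ε j k} {x : R} (hx : x ∈ (base g).gr ε j k) :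
    f x ∈ (base g').gr ε j k := by
  change x ∈ (if ε = 0 then g j k else ⊥) at hx
  change f x ∈ (if ε = 0 then g' j k else ⊥)
  split_ifs at hx ⊢
  · exact hf hx
  · rw [(AddSubgroup.mem_bot).1 hx, map_zero]
    exact zero_mem _

/-- The action of `R`, the differential and the involution are homogeneous. -/
structure IsHomogeneous (g : ℤ → ℤ → AddSubgroup R) (N : ℕ) (M : MF R) : Prop where
  smul : ∀ {r j k ε j' k' x}, r ∈ g j k → x ∈ M.gr ε j' k' → r • x ∈ M.gr ε (j + j') (k + k')
  d : ∀ {ε j k x}, x ∈ M.gr ε j k → M.d x ∈ M.gr (ε + 1) (j + 1) (k + (N + 1))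
  s : ∀ {ε j k x}, x ∈ M.gr ε j k → M.s x ∈ M.gr ε j k

namespace IsHomogeneous

theorem gr_congr {M : MF R} {ε ε' j j' k k'} {x : M.carrier} (hx : x ∈ M.gr ε j k) (hε : ε = ε')
    (hj : j = j') (hk : k = k') : x ∈ M.gr ε' j' k' := hε ▸ hj ▸ hk ▸ hx

theorem base (hg : IsGradedRing g) (N : ℕ) : IsHomogeneous g N (MF.base g) where
  smul hr hx := mul_base_mem hg hr hx rfl rfl rfl
  d _ := zero_mem _
  s hx := hx

theorem row {N : ℕ} {M : MF R} (hM : IsHomogeneous g N M) {a₀ a₁ : R} {p q : ℤ} (h₀ : a₀ ∈ g p q)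
    (h₁ : a₁ ∈ g (2 - p) (2 * N + 2 - q)) : IsHomogeneous g N (M.row N a₀ a₁ p q) where
  smul hr hx := ⟨hM.smul hr hx.1, gr_congr (hM.smul hr hx.2) rfl (by ring) (by ring)⟩
  d {ε j k x} hx := by
    constructor
    · change M.d x.1 + a₁ • M.s x.2 ∈ _
      exact add_mem (hM.d hx.1) (gr_congr (hM.smul h₁ (hM.s hx.2)) rfl (by ring) (by ring))
    · change M.d x.2 + a₀ • M.s x.1 ∈ _
      refine add_mem (gr_congr (hM.d hx.2) rfl (by ring) (by ring))
        (gr_congr (hM.smul h₀ (hM.s hx.1)) ?_ (by ring) (by ring))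
      rw [add_assoc, CharTwo.add_self_eq_zero, add_zero]
  s hx := ⟨hM.s hx.1, (M.gr _ _ _).neg_mem (hM.s hx.2)⟩

theorem susp {N : ℕ} {M : MF R} (hM : IsHomogeneous g N M) : IsHomogeneous g N M.susp where
  smul hr hx := hM.smul hr hx
  d hx := hM.d hx
  s hx := (M.gr _ _ _).neg_mem (hM.s hx)

theorem shift {N : ℕ} {M : MF R} (hM : IsHomogeneous g N M) (p q : ℤ) :
    IsHomogeneous g N (M.shift p q) where
  smul hr hx := gr_congr (M := M) (hM.smul hr hx) rfl (by ring) (by ring)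
  d hx := gr_congr (M := M) (hM.d hx) rfl (by ring) (by ring)
  s hx := hM.s hx

theorem restrict {N : ℕ} {A : Type} [CommRing A] [Algebra R A] {g' : ℤ → ℤ → AddSubgroup A}
    {M : MF A} (hM : IsHomogeneous g' N M) (w : R) (h : algebraMap R A w = M.w)
    (hA : ∀ {j k x}, x ∈ g j k → algebraMap R A x ∈ g' j k) :
    IsHomogeneous g N (M.restrict w h) where
  smul hr hx := hM.smul (hA hr) hx
  d hx := hM.d hx
  s hx := hM.s hx

end IsHomogeneous

end MF

namespace Cx.IsHomogeneous

variable {R : Type} [CommRing R] {g : ℤ → ℤ → AddSubgroup R}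

theorem ite_bot_mem {M M' : Type} [AddCommGroup M] [AddCommGroup M'] {p p' : Prop} [Decidable p]
    [Decidable p'] {S : AddSubgroup M} {S' : AddSubgroup M'} (f : M →+ M') (hp : p → p')
    (h : ∀ x ∈ S, f x ∈ S') {x : M} (hx : x ∈ (if p then S else ⊥)) :
    f x ∈ (if p' then S' else ⊥) := by
  split_ifs at hx with hp₁
  · rw [if_pos (hp hp₁)]; exact h x hx
  · rw [(AddSubgroup.mem_bot).1 hx, map_zero]; exact zero_mem _

theorem single {N : ℕ} {M : MF R} (hM : MF.IsHomogeneous g N M) :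
    Cx.IsHomogeneous N (Cx.single M) where
  dmf hx := ite_bot_mem M.d.toAddMonoidHom id (fun _ => hM.d) hx
  dχ _ := zero_mem _
  s hx := ite_bot_mem M.s.toAddMonoidHom id (fun _ => hM.s) hx
  t hx := hx

theorem twoTerm {N : ℕ} (i₀ : ℤ) {M₀ M₁ : MF R} (f : MF.Hom M₀ M₁) (hw : M₁.w = M₀.w)
    (h₀ : MF.IsHomogeneous g N M₀) (h₁ : MF.IsHomogeneous g N M₁)
    (hf : ∀ {ε j k x}, x ∈ M₀.gr ε j k → f.f x ∈ M₁.gr ε j k) :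
    Cx.IsHomogeneous N (Cx.twoTerm i₀ M₀ M₁ f hw) where
  dmf hx := ⟨ite_bot_mem M₀.d.toAddMonoidHom id (fun _ => h₀.d) hx.1,
    ite_bot_mem M₁.d.toAddMonoidHom id (fun _ => h₁.d) hx.2⟩
  dχ hx := ⟨zero_mem _, ite_bot_mem f.f.toAddMonoidHom (fun h => by rw [h]) (fun _ => hf) hx.1⟩
  s hx := ⟨ite_bot_mem M₀.s.toAddMonoidHom id (fun _ => h₀.s) hx.1,
    ite_bot_mem M₁.s.toAddMonoidHom id (fun _ => h₁.s) hx.2⟩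
  t hx := ⟨AddSubgroup.zsmul_mem _ hx.1 _, AddSubgroup.zsmul_mem _ (neg_mem hx.2) _⟩

theorem tens {N : ℕ} {C D : Cx R} (hC : C.IsHomogeneous N) (hD : D.IsHomogeneous N) :
    (C.tens D).IsHomogeneous N where
  dmf {ε i j k x} hx := map_mem_of_mem_tens_gr (leibniz C.dmf C.s D.dmf).toAddMonoidHom
    ((C.tens D).gr (ε + 1) i (j + 1) (k + (N + 1)))
    (fun hε hi hj hk x y hx hy => add_mem
      (tmul_mem_tens_gr (hC.dmf hx) hy (by rw [← hε]; ring) hi (by omega) (by omega))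
      (tmul_mem_tens_gr (hC.s hx) (hD.dmf hy) (by rw [← hε]; ring) hi (by omega) (by omega))) hx
  dχ {ε i j k x} hx := map_mem_of_mem_tens_gr (leibniz C.dχ C.t D.dχ).toAddMonoidHom
    ((C.tens D).gr ε (i + 1) j k)
    (fun hε hi hj hk x y hx hy => add_mem
      (tmul_mem_tens_gr (hC.dχ hx) hy hε (by omega) hj hk)
      (tmul_mem_tens_gr (hC.t hx) (hD.dχ hy) hε (by omega) hj hk)) hx
  s {ε i j k x} hx := map_mem_of_mem_tens_gr (TensorProduct.map C.s D.s).toAddMonoidHom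
    ((C.tens D).gr ε i j k)
    (fun hε hi hj hk x y hx hy => tmul_mem_tens_gr (hC.s hx) (hD.s hy) hε hi hj hk) hx
  t {ε i j k x} hx := map_mem_of_mem_tens_gr (TensorProduct.map C.t D.t).toAddMonoidHom
    ((C.tens D).gr ε i j k)
    (fun hε hi hj hk x y hx hy => tmul_mem_tens_gr (hC.t hx) (hD.t hy) hε hi hj hk) hx

end Cx.IsHomogeneous

/-! ### Homogeneity of the pieces -/

theorem zmod_two_add_one_add_one (ε : ZMod 2) : ε + 1 + 1 = ε := by
  rw [add_assoc, CharTwo.add_self_eq_zero, add_zero]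

section Pieces

variable {R : Type} [CommRing R] {g : ℤ → ℤ → AddSubgroup R} (hg : IsGradedRing g) (N : ℕ)
  {a x₁ y₁ y₂ x₂ : R}

include hg

theorem mul_powDiff_mem (ha : a ∈ g 2 0) (h₁ : x₁ ∈ g 0 2) (h₂ : x₂ ∈ g 0 2) :
    a * powDiff (N + 1) x₁ x₂ ∈ g 2 (2 * N) :=
  hg.mul_mem' ha (hg.powDiff_mem h₁ h₂ (N + 1)) (by ring) (by push_cast; ring)

theorem mul_U₁_mem {X₁ Y₁ X₂ : R} (ha : a ∈ g 2 0) (h₁ : X₁ ∈ g 0 2) (h₂ : Y₁ ∈ g 0 2)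
    (h₃ : X₂ ∈ g 0 4) : a * U₁ (N + 1) X₁ Y₁ X₂ ∈ g 2 (2 * N) :=
  hg.mul_mem' ha (hg.U₁_mem h₁ h₂ h₃ (N + 1)) (by ring) (by push_cast; ring)

theorem mul_U₂_mem {Y₁ X₂ Y₂ : R} (ha : a ∈ g 2 0) (h₁ : Y₁ ∈ g 0 2) (h₂ : X₂ ∈ g 0 4)
    (h₃ : Y₂ ∈ g 0 4) : a * U₂ (N + 1) Y₁ X₂ Y₂ ∈ g 2 (2 * N - 2) :=
  hg.mul_mem' ha (hg.U₂_mem h₁ h₂ h₃ (N + 1)) (by ring) (by push_cast; ring)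

theorem arcMF_isHomogeneous (ha : a ∈ g 2 0) (h₁ : x₁ ∈ g 0 2) (h₂ : x₂ ∈ g 0 2) :
    (arcMF N g a x₁ x₂).IsHomogeneous g N :=
  (MF.IsHomogeneous.base hg N).row (mul_powDiff_mem hg N ha h₁ h₂)
    (mem_of_mem (sub_mem h₁ h₂) (by ring) (by ring))

theorem parallelMF_isHomogeneous (ha : a ∈ g 2 0) (h₁ : x₁ ∈ g 0 2) (h₁' : y₁ ∈ g 0 2)
    (h₂' : y₂ ∈ g 0 2) (h₂ : x₂ ∈ g 0 2) : (parallelMF N g a x₁ y₁ y₂ x₂).IsHomogeneous g N :=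
  (arcMF_isHomogeneous hg N ha h₁' h₂).row (mul_powDiff_mem hg N ha h₁ h₂')
    (mem_of_mem (sub_mem h₁ h₂') (by ring) (by ring))

theorem contractedMF_isHomogeneous (ha : a ∈ g 2 0) (h₁ : x₁ ∈ g 0 2) (h₁' : y₁ ∈ g 0 2)
    (h₂' : y₂ ∈ g 0 2) (h₂ : x₂ ∈ g 0 2) : (contractedMF N g a x₁ y₁ y₂ x₂).IsHomogeneous g N :=
  (((MF.IsHomogeneous.base hg N).row
    (mul_U₁_mem hg N ha (add_mem h₁ h₁') (add_mem h₂ h₂') (hg.mul_mem h₁ h₁'))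
    (mem_of_mem (sub_mem (add_mem h₁ h₁') (add_mem h₂ h₂')) (by ring) (by ring))).row
    (mul_U₂_mem hg N ha (add_mem h₂ h₂') (hg.mul_mem h₁ h₁') (hg.mul_mem h₂ h₂'))
    (mem_of_mem (sub_mem (hg.mul_mem h₁ h₁') (hg.mul_mem h₂ h₂')) (by ring) (by ring))).shift _ _

theorem wideMFAux_isHomogeneous {X₁ X₂ Y₁ Y₂ Z₁ Z₂ : R} (ha : a ∈ g 2 0) (h₁ : X₁ ∈ g 0 2)
    (h₂ : X₂ ∈ g 0 4) (h₃ : Y₁ ∈ g 0 2) (h₄ : Y₂ ∈ g 0 4) (h₅ : Z₁ ∈ g 0 2) (h₆ : Z₂ ∈ g 0 4) :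
    (wideMFAux N g a X₁ X₂ Y₁ Y₂ Z₁ Z₂).IsHomogeneous g N :=
  (((((MF.IsHomogeneous.base hg N).row (mul_U₁_mem hg N ha h₁ h₅ h₂)
    (mem_of_mem (sub_mem h₁ h₅) (by ring) (by ring))).row (mul_U₂_mem hg N ha h₅ h₂ h₆)
    (mem_of_mem (sub_mem h₂ h₆) (by ring) (by ring))).row (mul_U₁_mem hg N ha h₅ h₃ h₆)
    (mem_of_mem (sub_mem h₅ h₃) (by ring) (by ring))).row (mul_U₂_mem hg N ha h₃ h₆ h₄)
    (mem_of_mem (sub_mem h₆ h₄) (by ring) (by ring))).shift _ _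

theorem wideMF_isHomogeneous (ha : a ∈ g 2 0) (h₁ : x₁ ∈ g 0 2) (h₁' : y₁ ∈ g 0 2)
    (h₂' : y₂ ∈ g 0 2) (h₂ : x₂ ∈ g 0 2) : (wideMF N g a x₁ y₁ y₂ x₂).IsHomogeneous g N :=
  (wideMFAux_isHomogeneous hg.extend N (C_mem_extendGrading ha)
    (C_mem_extendGrading (add_mem h₁ h₁')) (C_mem_extendGrading (hg.mul_mem h₁ h₁'))
    (C_mem_extendGrading (add_mem h₂ h₂')) (C_mem_extendGrading (hg.mul_mem h₂ h₂'))
    (X_zero_mem_extendGrading hg) (X_one_mem_extendGrading hg)).restrict _ _ C_mem_extendGrading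

theorem jump₀_mem (ha : a ∈ g 2 0) (h₁ : x₁ ∈ g 0 2) (h₁' : y₁ ∈ g 0 2)
    (h₂' : y₂ ∈ g 0 2) (h₂ : x₂ ∈ g 0 2) {ε j k u}
    (hu : u ∈ (parallelMF N g a x₁ y₁ y₂ x₂).gr ε j k) :
    jump₀ (a * twist (N + 1) x₁ y₁ y₂ x₂) x₁ x₂ u ∈
      (contractedMF N g a x₁ y₁ y₂ x₂).gr ε j (k + 1) := by
  obtain ⟨⟨hu, hu₁⟩, ⟨hu₂, hu₁₂⟩⟩ := hu
  have hk : a * twist (N + 1) x₁ y₁ y₂ x₂ ∈ g 2 (2 * N - 2) :=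
    hg.mul_mem' ha (hg.twist_mem h₁ h₁' h₂' h₂ (N + 1)) (by ring) (by push_cast; ring)
  refine ⟨⟨?_, ?_⟩, ⟨?_, ?_⟩⟩
  · exact MF.mul_base_mem hg (sub_mem h₂ h₁) hu rfl (by ring) (by ring)
  · exact MF.sub_base_mem (MF.mul_base_mem hg h₂ hu₁ rfl (by ring) (by ring))
      (MF.mul_base_mem hg h₁ hu₂ rfl (by ring) (by ring))
  · exact MF.sub_base_mem (MF.base_mem hu₂ rfl (by ring) (by ring))
      (MF.base_mem hu₁ rfl (by ring) (by ring))
  · exact MF.add_base_mem (MF.base_mem hu₁₂ rfl (by ring) (by ring))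
      (MF.mul_base_mem hg hk hu (zmod_two_add_one_add_one ε).symm (by ring) (by ring))

theorem jump₁_mem (ha : a ∈ g 2 0) (h₁ : x₁ ∈ g 0 2) (h₁' : y₁ ∈ g 0 2)
    (h₂' : y₂ ∈ g 0 2) (h₂ : x₂ ∈ g 0 2) {ε j k u}
    (hu : u ∈ (contractedMF N g a x₁ y₁ y₂ x₂).gr ε j k) :
    jump₁ (a * twist (N + 1) x₁ y₁ y₂ x₂) x₁ x₂ u ∈
      (parallelMF N g a x₁ y₁ y₂ x₂).gr ε j (k + 1) := by
  obtain ⟨⟨hu, hu₁⟩, ⟨hu₂, hu₁₂⟩⟩ := hu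
  have hk : a * twist (N + 1) x₁ y₁ y₂ x₂ ∈ g 2 (2 * N - 2) :=
    hg.mul_mem' ha (hg.twist_mem h₁ h₁' h₂' h₂ (N + 1)) (by ring) (by push_cast; ring)
  refine ⟨⟨?_, ?_⟩, ⟨?_, ?_⟩⟩
  · exact MF.base_mem hu rfl (by ring) (by ring)
  · exact MF.add_base_mem (MF.base_mem hu₁ rfl (by ring) (by ring))
      (MF.mul_base_mem hg h₁ hu₂ rfl (by ring) (by ring))
  · exact MF.add_base_mem (MF.base_mem hu₁ rfl (by ring) (by ring))
      (MF.mul_base_mem hg h₂ hu₂ rfl (by ring) (by ring))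
  · exact MF.sub_base_mem
      (MF.mul_base_mem hg (sub_mem h₂ h₁) hu₁₂ rfl (by ring) (by ring))
      (MF.mul_base_mem hg hk hu (zmod_two_add_one_add_one ε).symm (by ring) (by ring))

theorem eval_mem_of_mem_extendGrading {s p : R} (hs : s ∈ g 0 2) (hp : p ∈ g 0 4) {j k}
    {x : MvPolynomial (Fin 2) R} (hx : x ∈ extendGrading g j k) :
    MvPolynomial.eval ![s, p] x ∈ g j k := by
  rw [MvPolynomial.eval_eq']
  refine AddSubgroup.sum_mem _ fun m _ => ?_
  rw [Fin.prod_univ_two]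
  exact hg.mul_mem' (hx m) (hg.mul_mem (hg.pow_mem hs (m 0)) (hg.pow_mem hp (m 1))) (by ring)
    (by ring)

theorem contract_mem (h₂' : y₂ ∈ g 0 2) (h₂ : x₂ ∈ g 0 2) {ε j k v}
    (hv : v ∈ (wideMF N g a x₁ y₁ y₂ x₂).gr ε j k) :
    (contract N g a x₁ y₁ y₂ x₂).f v ∈ (contractedMF N g a x₁ y₁ y₂ x₂).gr ε j k := by
  obtain ⟨⟨⟨⟨hv, hv₁⟩, ⟨hv₂, hv₁₂⟩⟩, -⟩, -⟩ := hv
  have hev : ∀ {j k x}, x ∈ extendGrading g j k →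
      MvPolynomial.eval ![x₂ + y₂, x₂ * y₂] x ∈ g j k :=
    eval_mem_of_mem_extendGrading hg (add_mem h₂ h₂') (hg.mul_mem h₂ h₂')
  exact ⟨⟨MF.map_base_mem hev hv, MF.map_base_mem hev hv₁⟩,
    ⟨MF.map_base_mem hev hv₂, MF.map_base_mem hev hv₁₂⟩⟩

theorem expand_mem (ha : a ∈ g 2 0) (h₁ : x₁ ∈ g 0 2) (h₁' : y₁ ∈ g 0 2)
    (h₂' : y₂ ∈ g 0 2) (h₂ : x₂ ∈ g 0 2) {ε j k u}
    (hu : u ∈ (contractedMF N g a x₁ y₁ y₂ x₂).gr ε j k) :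
    (expand N g a x₁ y₁ y₂ x₂).f u ∈ (wideMF N g a x₁ y₁ y₂ x₂).gr ε j k := by
  obtain ⟨⟨hu, hu₁⟩, ⟨hu₂, hu₁₂⟩⟩ := hu
  have hg' := hg.extend
  have hX := C_mem_extendGrading (add_mem h₁ h₁')
  have hX₂ := C_mem_extendGrading (hg.mul_mem h₁ h₁')
  have hY := C_mem_extendGrading (add_mem h₂ h₂')
  have hY₂ := C_mem_extendGrading (hg.mul_mem h₂ h₂')
  have hZ := X_zero_mem_extendGrading hg
  have hZ₂ := X_one_mem_extendGrading hg
  have hp := hg'.mul_mem (C_mem_extendGrading ha) (hg'.U₁₁_mem hX hZ hY hX₂ (N + 1))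
  have hq := hg'.mul_mem (C_mem_extendGrading ha) (hg'.U₂₂_mem hY hX₂ hZ₂ hY₂ (N + 1))
  have hr := hg'.mul_mem (C_mem_extendGrading ha) (hg'.U₁₂_mem hZ hY hX₂ hZ₂ (N + 1))
  have hc : ∀ {j k x}, x ∈ g j k → MvPolynomial.C x ∈ extendGrading g j k := C_mem_extendGrading
  replace hu := MF.map_base_mem hc hu
  replace hu₁ := MF.map_base_mem hc hu₁
  replace hu₂ := MF.map_base_mem hc hu₂
  replace hu₁₂ := MF.map_base_mem hc hu₁₂
  have e := zmod_two_add_one_add_one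
  refine ⟨⟨⟨⟨?_, ?_⟩, ⟨?_, ?_⟩⟩, ⟨⟨?_, ?_⟩, ⟨?_, ?_⟩⟩⟩, ⟨⟨⟨?_, ?_⟩, ⟨?_, ?_⟩⟩, ⟨⟨?_, ?_⟩, ⟨?_, ?_⟩⟩⟩⟩
  · exact hu
  · exact hu₁
  · exact hu₂
  · exact hu₁₂
  · exact hu₁
  · exact MF.mul_base_mem hg' hp hu (e _).symm (by ring) (by push_cast; ring)
  · exact MF.sub_base_mem
      (MF.mul_base_mem hg' hr hu (e _).symm (by ring) (by push_cast; ring))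
      (MF.base_mem hu₁₂ rfl (by ring) (by ring))
  · exact MF.sub_base_mem
      (MF.mul_base_mem hg' hr hu₁ (e _).symm (by ring) (by push_cast; ring))
      (MF.mul_base_mem hg' hp hu₂ (e _).symm (by ring) (by push_cast; ring))
  · exact hu₂
  · exact MF.base_mem hu₁₂ rfl (by ring) (by ring)
  · exact MF.mul_base_mem hg' hq hu (e _).symm (by ring) (by push_cast; ring)
  · exact MF.mul_base_mem hg' hq hu₁ (e _).symm (by ring) (by push_cast; ring)
  · exact MF.base_mem hu₁₂ rfl (by ring) (by ring)
  · exact MF.mul_base_mem hg' hp hu₂ (e _).symm (by ring) (by push_cast; ring)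
  · exact MF.sub_base_mem
      (MF.mul_base_mem hg' hr hu₂ (e _).symm (by ring) (by push_cast; ring))
      (MF.mul_base_mem hg' hq hu₁ (e _).symm (by ring) (by push_cast; ring))
  · exact MF.sub_base_mem
      (MF.mul_base_mem hg' hr hu₁₂ (e _).symm (by ring) (by push_cast; ring))
      (MF.mul_base_mem hg' (hg'.mul_mem hp hq) hu (by rw [e, e]) (by ring) (by push_cast; ring))

theorem χ₀_mem (ha : a ∈ g 2 0) (h₁ : x₁ ∈ g 0 2) (h₁' : y₁ ∈ g 0 2)
    (h₂' : y₂ ∈ g 0 2) (h₂ : x₂ ∈ g 0 2) {ε j k u}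
    (hu : u ∈ (parallelMF N g a x₁ y₁ y₂ x₂).gr ε j k) :
    (χ₀ N g a x₁ y₁ y₂ x₂).f u ∈ (wideMF N g a x₁ y₁ y₂ x₂).gr ε j (k + 1) :=
  expand_mem hg N ha h₁ h₁' h₂' h₂ (jump₀_mem hg N ha h₁ h₁' h₂' h₂ hu)

theorem χ₁_mem (ha : a ∈ g 2 0) (h₁ : x₁ ∈ g 0 2) (h₁' : y₁ ∈ g 0 2)
    (h₂' : y₂ ∈ g 0 2) (h₂ : x₂ ∈ g 0 2) {ε j k u}
    (hu : u ∈ (wideMF N g a x₁ y₁ y₂ x₂).gr ε j k) :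
    (χ₁ N g a x₁ y₁ y₂ x₂).f u ∈ (parallelMF N g a x₁ y₁ y₂ x₂).gr ε j (k + 1) :=
  jump₁_mem hg N ha h₁ h₁' h₂' h₂ (contract_mem hg N h₂' h₂ hu)

theorem positiveCx_isHomogeneous (ha : a ∈ g 2 0) (h₁ : x₁ ∈ g 0 2) (h₁' : y₁ ∈ g 0 2)
    (h₂' : y₂ ∈ g 0 2) (h₂ : x₂ ∈ g 0 2) : (positiveCx N g a x₁ y₁ y₂ x₂).IsHomogeneous N :=
  Cx.IsHomogeneous.twoTerm _ _ _ ((wideMF_isHomogeneous hg N ha h₁ h₁' h₂' h₂).susp.shift _ _)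
    ((parallelMF_isHomogeneous hg N ha h₁ h₁' h₂' h₂).susp.shift _ _) fun hu =>
    MF.IsHomogeneous.gr_congr (M := parallelMF N g a x₁ y₁ y₂ x₂)
      (χ₁_mem hg N ha h₁ h₁' h₂' h₂ hu) rfl rfl (by ring)

theorem negativeCx_isHomogeneous (ha : a ∈ g 2 0) (h₁ : x₁ ∈ g 0 2) (h₁' : y₁ ∈ g 0 2)
    (h₂' : y₂ ∈ g 0 2) (h₂ : x₂ ∈ g 0 2) : (negativeCx N g a x₁ y₁ y₂ x₂).IsHomogeneous N :=
  Cx.IsHomogeneous.twoTerm _ _ _ ((parallelMF_isHomogeneous hg N ha h₁ h₁' h₂' h₂).susp.shift _ _)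
    ((wideMF_isHomogeneous hg N ha h₁ h₁' h₂' h₂).susp.shift _ _) fun hu =>
    MF.IsHomogeneous.gr_congr (M := wideMF N g a x₁ y₁ y₂ x₂)
      (χ₀_mem hg N ha h₁ h₁' h₂' h₂ hu) rfl rfl (by ring)

end Pieces

theorem Piece.isHomogeneous (N : ℕ) {P : Type} : ∀ p : Piece P, (p.cx N).IsHomogeneous N
  | .arc _ _ => .single (arcMF_isHomogeneous (isGradedRing_pointGrading P) N aVar_mem (X_mem _)
      (X_mem _))
  | .crossing true _ _ _ _ => positiveCx_isHomogeneous (isGradedRing_pointGrading P) N aVar_mem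
      (X_mem _) (X_mem _) (X_mem _) (X_mem _)
  | .crossing false _ _ _ _ => negativeCx_isHomogeneous (isGradedRing_pointGrading P) N aVar_mem
      (X_mem _) (X_mem _) (X_mem _) (X_mem _)

section Maps

variable {R A : Type} [CommRing R] [CommRing A] (f : R →+* A)

theorem map_powDiff (n : ℕ) (x y : R) : f (powDiff n x y) = powDiff n (f x) (f y) := by
  simp [powDiff]

theorem map_U₁₁ (X₁ Z₁ Y₁ X₂ : R) :
    ∀ n, f (U₁₁ n X₁ Z₁ Y₁ X₂) = U₁₁ n (f X₁) (f Z₁) (f Y₁) (f X₂)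
  | 0 => by simp [U₁₁]
  | 1 => by simp [U₁₁]
  | n + 2 => by simp [U₁₁, map_U₁, map_U₁₁ X₁ Z₁ Y₁ X₂ (n + 1), map_U₁₁ X₁ Z₁ Y₁ X₂ n]

theorem map_U₂₂ (Y₁ X₂ Z₂ Y₂ : R) :
    ∀ n, f (U₂₂ n Y₁ X₂ Z₂ Y₂) = U₂₂ n (f Y₁) (f X₂) (f Z₂) (f Y₂)
  | 0 => by simp [U₂₂]
  | 1 => by simp [U₂₂]
  | n + 2 => by simp [U₂₂, map_U₂, map_U₂₂ Y₁ X₂ Z₂ Y₂ (n + 1), map_U₂₂ Y₁ X₂ Z₂ Y₂ n]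

theorem map_U₁₂ (Z₁ Y₁ X₂ Z₂ : R) :
    ∀ n, f (U₁₂ n Z₁ Y₁ X₂ Z₂) = U₁₂ n (f Z₁) (f Y₁) (f X₂) (f Z₂)
  | 0 => by simp [U₁₂]
  | 1 => by simp [U₁₂]
  | n + 2 => by
    simp [U₁₂, map_U₁, map_U₂, map_U₁₂ Z₁ Y₁ X₂ Z₂ (n + 1), map_U₁₂ Z₁ Y₁ X₂ Z₂ n]

theorem map_twist (x₁ y₁ y₂ x₂ : R) :
    ∀ n, f (twist n x₁ y₁ y₂ x₂) = twist n (f x₁) (f y₁) (f y₂) (f x₂)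
  | 0 => by simp [twist]
  | 1 => by simp [twist]
  | n + 2 => by
    simp [twist, map_powDiff, map_twist x₁ y₁ y₂ x₂ (n + 1), map_twist x₁ y₁ y₂ x₂ n]

theorem map_jump₀ (k x₁ x₂ : R) (u : (R × R) × (R × R)) :
    (f.toAddMonoidHom.prodMap f.toAddMonoidHom).prodMap
      (f.toAddMonoidHom.prodMap f.toAddMonoidHom) (jump₀ k x₁ x₂ u) =
      jump₀ (f k) (f x₁) (f x₂) ((f.toAddMonoidHom.prodMap f.toAddMonoidHom).prodMap
        (f.toAddMonoidHom.prodMap f.toAddMonoidHom) u) := by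
  refine Prod.ext (Prod.ext ?_ ?_) (Prod.ext ?_ ?_) <;> simp [jump₀]

theorem map_jump₁ (k x₁ x₂ : R) (u : (R × R) × (R × R)) :
    (f.toAddMonoidHom.prodMap f.toAddMonoidHom).prodMap
      (f.toAddMonoidHom.prodMap f.toAddMonoidHom) (jump₁ k x₁ x₂ u) =
      jump₁ (f k) (f x₁) (f x₂) ((f.toAddMonoidHom.prodMap f.toAddMonoidHom).prodMap
        (f.toAddMonoidHom.prodMap f.toAddMonoidHom) u) := by
  refine Prod.ext (Prod.ext ?_ ?_) (Prod.ext ?_ ?_) <;> simp [jump₁]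

/-- The map induced on the products of four copies. -/
def prodMap₄ : (R × R) × (R × R) →+ (A × A) × (A × A) :=
  (f.toAddMonoidHom.prodMap f.toAddMonoidHom).prodMap (f.toAddMonoidHom.prodMap f.toAddMonoidHom)

/-- The map induced on the products of sixteen copies. -/
def prodMap₁₆ : (((R × R) × (R × R)) × ((R × R) × (R × R))) ×
      (((R × R) × (R × R)) × ((R × R) × (R × R))) →+
      (((A × A) × (A × A)) × ((A × A) × (A × A))) × (((A × A) × (A × A)) × ((A × A) × (A × A))) :=
  ((prodMap₄ f).prodMap (prodMap₄ f)).prodMap ((prodMap₄ f).prodMap (prodMap₄ f))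

variable {S B : Type} [CommRing S] [CommRing B]

theorem map_contractFun (ev : R → S) (ev' : A → B) (h : S →+* B) (hh : ∀ x, ev' (f x) = h (ev x))
    (v) : contractFun ev' (prodMap₁₆ f v) = prodMap₄ h (contractFun ev v) := by
  refine Prod.ext (Prod.ext ?_ ?_) (Prod.ext ?_ ?_) <;>
    simp [contractFun, prodMap₁₆, prodMap₄, hh]

theorem map_expandFun (c : S → R) (c' : B → A) (h : S →+* B) (hh : ∀ x, f (c x) = c' (h x))
    (p q r : R) (u) : prodMap₁₆ f (expandFun c p q r u) =
      expandFun c' (f p) (f q) (f r) (prodMap₄ h u) := by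
  refine Prod.ext (Prod.ext (Prod.ext (Prod.ext ?_ ?_) (Prod.ext ?_ ?_))
      (Prod.ext (Prod.ext ?_ ?_) (Prod.ext ?_ ?_)))
    (Prod.ext (Prod.ext (Prod.ext ?_ ?_) (Prod.ext ?_ ?_))
      (Prod.ext (Prod.ext ?_ ?_) (Prod.ext ?_ ?_))) <;>
  simp [expandFun, prodMap₁₆, prodMap₄, hh]

end Maps

/-! ### Extension of scalars of the pieces -/

section Pieces

variable {R R' : Type} [CommRing R] [CommRing R'] (φ : R →+* R') (N : ℕ)
  (g : ℤ → ℤ → AddSubgroup R) (g' : ℤ → ℤ → AddSubgroup R') {a x₁ y₁ y₂ x₂ : R}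
  {a' x₁' y₁' y₂' x₂' : R'}

/-- Extension of scalars of an arc. -/
def arcBaseChange (ha : φ a = a') (h₁ : φ x₁ = x₁') (h₂ : φ x₂ = x₂') :
    MF.BaseChange φ g g' (arcMF N g a x₁ x₂) (arcMF N g' a' x₁' x₂') :=
  (MF.BaseChange.base φ g g').row N 2 (2 * N) (by rw [map_mul, map_powDiff, ha, h₁, h₂])
    (by rw [map_sub, h₁, h₂])

/-- Extension of scalars of `Γ₀`. -/
def parallelBaseChange (ha : φ a = a') (h₁ : φ x₁ = x₁') (h₁' : φ y₁ = y₁') (h₂' : φ y₂ = y₂')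
    (h₂ : φ x₂ = x₂') : MF.BaseChange φ g g' (parallelMF N g a x₁ y₁ y₂ x₂)
      (parallelMF N g' a' x₁' y₁' y₂' x₂') :=
  (arcBaseChange φ N g g' ha h₁' h₂).row N 2 (2 * N) (by rw [map_mul, map_powDiff, ha, h₁, h₂'])
    (by rw [map_sub, h₁, h₂'])

/-- Extension of scalars of `Γ₁` over the ring with the additional variables. -/
def wideAuxBaseChange {X₁ X₂ Y₁ Y₂ Z₁ Z₂ : R} {X₁' X₂' Y₁' Y₂' Z₁' Z₂' : R'} (ha : φ a = a')
    (h₁ : φ X₁ = X₁') (h₂ : φ X₂ = X₂') (h₃ : φ Y₁ = Y₁') (h₄ : φ Y₂ = Y₂') (h₅ : φ Z₁ = Z₁')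
    (h₆ : φ Z₂ = Z₂') : MF.BaseChange φ g g' (wideMFAux N g a X₁ X₂ Y₁ Y₂ Z₁ Z₂)
      (wideMFAux N g' a' X₁' X₂' Y₁' Y₂' Z₁' Z₂') :=
  (((((MF.BaseChange.base φ g g').row N 2 (2 * N) (by rw [map_mul, map_U₁, ha, h₁, h₅, h₂])
    (by rw [map_sub, h₁, h₅])).row N 2 (2 * N - 2) (by rw [map_mul, map_U₂, ha, h₅, h₂, h₆])
    (by rw [map_sub, h₂, h₆])).row N 2 (2 * N) (by rw [map_mul, map_U₁, ha, h₅, h₃, h₆])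
    (by rw [map_sub, h₅, h₃])).row N 2 (2 * N - 2) (by rw [map_mul, map_U₂, ha, h₃, h₆, h₄])
    (by rw [map_sub, h₆, h₄])).shift 0 (-1)

/-- Extension of scalars of `Γ₁`. -/
def wideBaseChange (ha : φ a = a') (h₁ : φ x₁ = x₁') (h₁' : φ y₁ = y₁') (h₂' : φ y₂ = y₂')
    (h₂ : φ x₂ = x₂') : MF.BaseChange φ g g' (wideMF N g a x₁ y₁ y₂ x₂)
      (wideMF N g' a' x₁' y₁' y₂' x₂') :=
  (wideAuxBaseChange (MvPolynomial.map φ) N (extendGrading g) (extendGrading g')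
    (by rw [MvPolynomial.map_C, ha]) (by rw [MvPolynomial.map_C, map_add, h₁, h₁'])
    (by rw [MvPolynomial.map_C, map_mul, h₁, h₁']) (by rw [MvPolynomial.map_C, map_add, h₂, h₂'])
    (by rw [MvPolynomial.map_C, map_mul, h₂, h₂']) (MvPolynomial.map_X _ _)
    (MvPolynomial.map_X _ _)).restrict _ _ _ _

theorem map_contract (ha : φ a = a') (h₁ : φ x₁ = x₁') (h₁' : φ y₁ = y₁') (h₂' : φ y₂ = y₂')
    (h₂ : φ x₂ = x₂') (v : (wideMF N g a x₁ y₁ y₂ x₂).carrier) :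
    (contract N g' a' x₁' y₁' y₂' x₂').f
      ((wideBaseChange φ N g g' ha h₁ h₁' h₂' h₂).β v) =
      prodMap₄ φ ((contract N g a x₁ y₁ y₂ x₂).f v) := by
  subst ha h₁ h₁' h₂' h₂
  refine map_contractFun (MvPolynomial.map φ) _ _ φ (fun x => ?_) v
  rw [MvPolynomial.eval_map, MvPolynomial.eval₂_eq', MvPolynomial.eval_eq', map_sum]
  simp [Fin.prod_univ_two]

theorem map_expand (ha : φ a = a') (h₁ : φ x₁ = x₁') (h₁' : φ y₁ = y₁') (h₂' : φ y₂ = y₂')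
    (h₂ : φ x₂ = x₂') (u : (R × R) × (R × R)) :
    (wideBaseChange φ N g g' ha h₁ h₁' h₂' h₂).β ((expand N g a x₁ y₁ y₂ x₂).f u) =
      (expand N g' a' x₁' y₁' y₂' x₂').f (prodMap₄ φ u) := by
  subst ha h₁ h₁' h₂' h₂
  refine (map_expandFun (MvPolynomial.map φ) MvPolynomial.C MvPolynomial.C φ
    (MvPolynomial.map_C φ) _ _ _ u).trans
    (congrFun (congr (congr (congrArg (expandFun MvPolynomial.C) ?_) ?_) ?_) _) <;>
  simp only [map_U₁₁, map_U₂₂, map_U₁₂, MvPolynomial.map_C, MvPolynomial.map_X, map_add, map_mul]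

/-- Extension of scalars of the complex of a positive crossing. -/
def positiveBaseChange (ha : φ a = a') (h₁ : φ x₁ = x₁') (h₁' : φ y₁ = y₁') (h₂' : φ y₂ = y₂')
    (h₂ : φ x₂ = x₂') : Cx.BaseChange φ g g' (positiveCx N g a x₁ y₁ y₂ x₂)
      (positiveCx N g' a' x₁' y₁' y₂' x₂') :=
  Cx.BaseChange.twoTerm _ _ _ _ _ ((wideBaseChange φ N g g' ha h₁ h₁' h₂' h₂).susp.shift _ _)
    ((parallelBaseChange φ N g g' ha h₁ h₁' h₂' h₂).susp.shift _ _) fun v => by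
    refine ((map_jump₁ φ (a * twist (N + 1) x₁ y₁ y₂ x₂) x₁ x₂ _).trans ?_).trans
      (congrArg (jump₁ (a' * twist (N + 1) x₁' y₁' y₂' x₂') x₁' x₂')
        (map_contract φ N g g' ha h₁ h₁' h₂' h₂ v).symm)
    rw [map_mul, map_twist, ha, h₁, h₁', h₂', h₂]
    rfl

/-- Extension of scalars of the complex of a negative crossing. -/
def negativeBaseChange (ha : φ a = a') (h₁ : φ x₁ = x₁') (h₁' : φ y₁ = y₁') (h₂' : φ y₂ = y₂')
    (h₂ : φ x₂ = x₂') : Cx.BaseChange φ g g' (negativeCx N g a x₁ y₁ y₂ x₂)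
      (negativeCx N g' a' x₁' y₁' y₂' x₂') :=
  Cx.BaseChange.twoTerm _ _ _ _ _ ((parallelBaseChange φ N g g' ha h₁ h₁' h₂' h₂).susp.shift _ _)
    ((wideBaseChange φ N g g' ha h₁ h₁' h₂' h₂).susp.shift _ _) fun u => by
    refine (map_expand φ N g g' ha h₁ h₁' h₂' h₂ _).trans ?_
    refine congrArg (expand N g' a' x₁' y₁' y₂' x₂').f ((map_jump₀ φ _ _ _ u).trans ?_)
    rw [map_mul, map_twist, ha, h₁, h₁', h₂', h₂]
    rfl

end Pieces

/-- The homomorphism of rings given by a map of marked points. -/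
def renameHom {P Q : Type} (f : P → Q) : PointRing P →+* PointRing Q :=
  (MvPolynomial.rename f : PointRing P →ₐ[ℚ[X]] PointRing Q).toRingHom

theorem renameHom_X {P Q : Type} (f : P → Q) (p : P) :
    renameHom f (MvPolynomial.X p) = MvPolynomial.X (f p) := MvPolynomial.rename_X f p

theorem renameHom_C {P Q : Type} (f : P → Q) (r : ℚ[X]) :
    renameHom f (MvPolynomial.C r) = MvPolynomial.C r := MvPolynomial.rename_C f r

theorem renameHom_mem {P Q : Type} (f : P → Q) {j k : ℤ} {x : PointRing P}
    (hx : x ∈ pointGrading P j k) : renameHom f x ∈ pointGrading Q j k := by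
  have h := aeval_mem (MvPolynomial.X ∘ f : P → PointRing Q) (fun p => X_mem (f p)) hx
  rwa [← MvPolynomial.aeval_rename, MvPolynomial.aeval_X_left_apply] at h

/-- Extension of scalars of a piece. -/
def Piece.baseChange (N : ℕ) {P Q : Type} (f : P → Q) : ∀ p : Piece P,
    Cx.BaseChange (renameHom f) (pointGrading P) (pointGrading Q) (p.cx N) ((p.map f).cx N)
  | .arc _ _ => .single (arcBaseChange _ N _ _ (renameHom_C f _) (renameHom_X f _)
      (renameHom_X f _))
  | .crossing true _ _ _ _ => positiveBaseChange _ N _ _ (renameHom_C f _) (renameHom_X f _)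
      (renameHom_X f _) (renameHom_X f _) (renameHom_X f _)
  | .crossing false _ _ _ _ => negativeBaseChange _ N _ _ (renameHom_C f _) (renameHom_X f _)
      (renameHom_X f _) (renameHom_X f _) (renameHom_X f _)

/-- Extension of scalars of a diagram. -/
def diagramBaseChange (N : ℕ) {P Q : Type} (f : P → Q) : ∀ L : List (Piece P),
    Cx.BaseChange (renameHom f) (pointGrading P) (pointGrading Q) (diagramCx N L)
      (diagramCx N (L.map (Piece.map f)))
  | [] => .single (.base _ _ _)
  | p :: L => .tens (isGradedRing_pointGrading P) (isGradedRing_pointGrading Q)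
      (p.baseChange N f) (diagramBaseChange N f L)

theorem diagramCx_isHomogeneous (N : ℕ) {P : Type} : ∀ L : List (Piece P),
    (diagramCx N L).IsHomogeneous N
  | [] => .single (.base (isGradedRing_pointGrading P) N)
  | p :: L => (p.isHomogeneous N).tens (diagramCx_isHomogeneous N L)

/-! ### Projections to the homogeneous parts -/

section Coordinates

variable {R M ι : Type} [CommRing R] [AddCommGroup M] [Module R M]

/-- Apply additive maps to the coordinates. -/
def coordMap (b : Module.Basis ι R M) (f : ι → R →+ R) : M →+ M :=
  (b.repr.symm.toLinearMap.toAddMonoidHom.comp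
    (Finsupp.liftAddHom fun n => (Finsupp.singleAddHom n).comp (f n))).comp
      b.repr.toLinearMap.toAddMonoidHom

theorem repr_coordMap (b : Module.Basis ι R M) (f : ι → R →+ R) (x : M) (n : ι) :
    b.repr (coordMap b f x) n = f n (b.repr x n) := by
  classical
  change b.repr (b.repr.symm (Finsupp.liftAddHom _ (b.repr x))) n = _
  rw [LinearEquiv.apply_symm_apply, Finsupp.liftAddHom_apply, Finsupp.sum, Finsupp.finsetSum_apply]
  simp only [AddMonoidHom.comp_apply, Finsupp.singleAddHom_apply, Finsupp.single_apply]
  rw [Finset.sum_ite_eq']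
  split_ifs with h
  · rfl
  · rw [Finsupp.notMem_support_iff.1 h, map_zero]

end Coordinates

/-- Projections of a ring to the homogeneous parts. -/
structure RingProjections {R : Type} [CommRing R] (g : ℤ → ℤ → AddSubgroup R) where
  pr : ℤ → ℤ → R →+ R
  mem : ∀ j k x, pr j k x ∈ g j k
  eq : ∀ {j k x}, x ∈ g j k → pr j k x = x
  eq_zero : ∀ {j k j' k' x}, x ∈ g j k → ¬(j = j' ∧ k = k') → pr j' k' x = 0
  span : ∀ x, x ∈ AddSubgroup.closure {y | ∃ j k, y ∈ g j k}

theorem RingProjections.pr_mul {R : Type} [CommRing R] {g : ℤ → ℤ → AddSubgroup R}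
    (π : RingProjections g) (hg : IsGradedRing g) {b : R} {p q : ℤ} (hb : b ∈ g p q) (j k : ℤ)
    (x : R) : π.pr j k (b * x) = b * π.pr (j - p) (k - q) x := by
  induction π.span x using AddSubgroup.closure_induction with
  | zero => simp
  | add x y _ _ hx hy => rw [mul_add, map_add, hx, hy, map_add, mul_add]
  | neg x _ hx => rw [mul_neg, map_neg, hx, map_neg, mul_neg]
  | mem x hx =>
    obtain ⟨j', k', hx⟩ := hx
    by_cases h : p + j' = j ∧ q + k' = k
    · obtain ⟨rfl, rfl⟩ := h
      rw [π.eq (hg.mul_mem hb hx), add_sub_cancel_left, add_sub_cancel_left, π.eq hx]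
    · rw [π.eq_zero (hg.mul_mem hb hx) h, π.eq_zero hx (by omega), mul_zero]

theorem RingProjections.mem_of_mul_mem {R : Type} [CommRing R] {g : ℤ → ℤ → AddSubgroup R}
    (π : RingProjections g) (hg : IsGradedRing g) {b : R} {p q : ℤ} (hb : b ∈ g p q)
    (hb' : ∀ x, b * x = 0 → x = 0) {j k : ℤ} {x : R} (hx : b * x ∈ g j k) :
    x ∈ g (j - p) (k - q) := by
  have h := π.pr_mul hg hb j k x
  rw [π.eq hx, ← sub_eq_zero, ← mul_sub] at h
  rw [sub_eq_zero.1 (hb' _ h)]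
  exact π.mem _ _ _

/-- The projections of `ℚ[a][P]`. -/
def pointProjections (P : Type) : RingProjections (pointGrading P) :=
  let c (j : ℤ) : ℚ[X] →+ ℚ[X] := coordMap (Polynomial.basisMonomials ℚ) fun n =>
    if 2 * (n : ℤ) = j then AddMonoidHom.id ℚ else 0
  let pr (j k : ℤ) : PointRing P →+ PointRing P :=
    coordMap (MvPolynomial.basisMonomials P ℚ[X]) fun m =>
      if 2 * (m.degree : ℤ) = k then c j else 0
  have hpr : ∀ j k x m n, ((pr j k x).coeff m).coeff n =
      if 2 * (n : ℤ) = j ∧ 2 * (m.degree : ℤ) = k then (x.coeff m).coeff n else 0 := by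
    intro j k x m n
    rw [show (pr j k x).coeff m = _ from repr_coordMap (MvPolynomial.basisMonomials P ℚ[X]) _ x m]
    change ((if 2 * (m.degree : ℤ) = k then c j else 0) (x.coeff m)).coeff n = _
    split_ifs with h₁ h₂ h₂
    · rw [show (c j (x.coeff m)).coeff n = _ from repr_coordMap (Polynomial.basisMonomials ℚ) _ (x.coeff m) n, if_pos h₂.1]
      rfl
    · rw [show (c j (x.coeff m)).coeff n = _ from repr_coordMap (Polynomial.basisMonomials ℚ) _ (x.coeff m) n,
        if_neg fun h => h₂ ⟨h, h₁⟩]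
      rfl
    · exact absurd h₂.2 h₁
    · simp
  { pr := pr
    mem := fun j k x m n h => by
      rw [hpr] at h
      exact (ite_ne_right_iff.1 h).1
    eq := fun {j k x} hx => by
      ext m n
      rw [hpr]
      split_ifs with h
      · rfl
      · by_contra h'
        exact h (hx m n (Ne.symm h'))
    eq_zero := fun {j k j' k' x} hx h => by
      ext m n
      rw [hpr]
      split_ifs with h₁
      · by_contra h'
        obtain ⟨h₂, h₃⟩ := hx m n h'
        exact h ⟨h₂ ▸ h₁.1, h₃ ▸ h₁.2⟩
      · simp
    span := fun x => by
      rw [← x.support_sum_monomial_coeff]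
      refine AddSubgroup.sum_mem _ fun m _ => ?_
      rw [(x.coeff m).as_sum_support, map_sum]
      refine AddSubgroup.sum_mem _ fun n _ => AddSubgroup.subset_closure ⟨2 * n, 2 * m.degree, ?_⟩
      classical
      intro m' n' h
      rw [MvPolynomial.coeff_monomial] at h
      split_ifs at h with hm
      · subst hm
        rw [Polynomial.coeff_monomial] at h
        split_ifs at h with hn
        · subst hn; exact ⟨rfl, rfl⟩
        · exact absurd rfl h
      · simp at h }

namespace Cx

variable {R : Type} [CommRing R] {g : ℤ → ℤ → AddSubgroup R} {C : Cx R} {ι : Type}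

/-- The projections of a complex with a homogeneous basis. -/
def GrBasis.pr (B : GrBasis g C ι) (π : RingProjections g) (ε : ZMod 2) (i j k : ℤ) :
    C.carrier →+ C.carrier :=
  coordMap B.b fun n => if B.ε n = ε ∧ B.i n = i then π.pr (j - B.j n) (k - B.k n) else 0

theorem GrBasis.pr_mem (B : GrBasis g C ι) (π : RingProjections g) (ε : ZMod 2) (i j k : ℤ) (x) :
    B.pr π ε i j k x ∈ C.gr ε i j k := by
  rw [B.mem_gr]
  intro n
  rw [GrBasis.pr, repr_coordMap]
  split_ifs with h
  · exact Or.inr ⟨h, π.mem _ _ _⟩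
  · exact Or.inl rfl

theorem GrBasis.pr_eq (B : GrBasis g C ι) (π : RingProjections g) {ε : ZMod 2} {i j k : ℤ} {x}
    (hx : x ∈ C.gr ε i j k) : B.pr π ε i j k x = x := by
  refine B.b.ext_elem fun n => ?_
  rw [GrBasis.pr, repr_coordMap]
  rcases B.mem_gr.1 hx n with h | ⟨h, h'⟩
  · rw [h, map_zero]
  · rw [if_pos h, π.eq h']

theorem GrBasis.pr_eq_zero (B : GrBasis g C ι) (π : RingProjections g) {ε ε' : ZMod 2}
    {i j k i' j' k' : ℤ} {x} (hx : x ∈ C.gr ε i j k)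
    (h : ¬(ε = ε' ∧ i = i' ∧ j = j' ∧ k = k')) : B.pr π ε' i' j' k' x = 0 := by
  refine B.b.ext_elem fun n => ?_
  rw [GrBasis.pr, repr_coordMap, map_zero, Finsupp.zero_apply]
  rcases B.mem_gr.1 hx n with h₁ | ⟨⟨rfl, rfl⟩, h₂⟩
  · rw [h₁, map_zero]
  · split_ifs with h₃
    · exact π.eq_zero h₂ fun h₄ => h ⟨h₃.1, h₃.2, by omega, by omega⟩
    · rfl

theorem GrBasis.span (B : GrBasis g C ι) (π : RingProjections g) (x : C.carrier) :
    x ∈ AddSubgroup.closure {y | ∃ ε i j k, y ∈ C.gr ε i j k} := by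
  rw [← B.b.linearCombination_repr x, Finsupp.linearCombination_apply]
  refine AddSubgroup.sum_mem _ fun n _ => ?_
  suffices H : AddSubgroup.closure {y | ∃ j k, y ∈ g j k} ≤
      (AddSubgroup.closure {y | ∃ ε i j k, y ∈ C.gr ε i j k}).comap
        (LinearMap.toSpanSingleton R C.carrier (B.b n)).toAddMonoidHom from H (π.span _)
  rw [AddSubgroup.closure_le]
  rintro r ⟨j, k, hr⟩
  exact AddSubgroup.subset_closure ⟨_, _, _, _, B.smul_basis_mem hr⟩

/-- A homogeneous map commutes with the projections. -/
theorem GrBasis.pr_comm (B : GrBasis g C ι) (π : RingProjections g) (f : C.carrier →+ C.carrier)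
    (ε₀ : ZMod 2) (i₀ j₀ k₀ : ℤ)
    (hf : ∀ {ε i j k x}, x ∈ C.gr ε i j k → f x ∈ C.gr (ε + ε₀) (i + i₀) (j + j₀) (k + k₀))
    (ε : ZMod 2) (i j k : ℤ) (x) :
    B.pr π ε i j k (f x) = f (B.pr π (ε - ε₀) (i - i₀) (j - j₀) (k - k₀) x) := by
  induction B.span π x using AddSubgroup.closure_induction with
  | zero => simp
  | add x y _ _ hx hy => simp only [map_add, hx, hy]
  | neg x _ hx => simp only [map_neg, hx]
  | mem x hx =>
    obtain ⟨ε', i', j', k', hx⟩ := hx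
    by_cases h : ε' + ε₀ = ε ∧ i' + i₀ = i ∧ j' + j₀ = j ∧ k' + k₀ = k
    · obtain ⟨rfl, rfl, rfl, rfl⟩ := h
      rw [B.pr_eq π (hf hx)]
      simp only [add_sub_cancel_right]
      rw [B.pr_eq π hx]
    · rw [B.pr_eq_zero π (hf hx) h, B.pr_eq_zero π hx, map_zero]
      rintro ⟨h₁, h₂, h₃, h₄⟩
      exact h ⟨by rw [h₁, sub_add_cancel], by omega, by omega, by omega⟩

/-- The projections of a homogeneous complex with a homogeneous basis. -/
def GrBasis.projections (B : GrBasis g C ι) (π : RingProjections g) (hg : IsGradedRing g) {N : ℕ}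
    (hC : C.IsHomogeneous N) {b : R} {p : ℤ} (hb : b ∈ g p 0) : Projections N C b p where
  pr := B.pr π
  mem := B.pr_mem π
  eq := B.pr_eq π
  smul ε i j k x := by
    have h := B.pr_comm π (LinearMap.lsmul R C.carrier b).toAddMonoidHom 0 0 p 0
      (fun {ε i j k x} hx => by
        have := B.smul_mem hg hb hx
        rwa [add_comm p, add_comm 0 k, ← add_zero ε, ← add_zero i] at this) ε i j k x
    rwa [sub_zero, sub_zero, sub_zero] at h
  dmf ε i j k x := by
    have h := B.pr_comm π C.dmf.toAddMonoidHom 1 0 1 (N + 1)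
      (fun {ε i j k x} hx => by
        have := hC.dmf hx
        rwa [← add_zero i] at this) ε i j k x
    rwa [sub_zero, CharTwo.sub_eq_add] at h
  dχ ε i j k x := by
    have h := B.pr_comm π C.dχ.toAddMonoidHom 0 1 0 0
      (fun {ε i j k x} hx => by
        have := hC.dχ hx
        rwa [← add_zero ε, ← add_zero j, ← add_zero k] at this) ε i j k x
    rwa [sub_zero, sub_zero, sub_zero] at h

theorem GrBasis.isRegular (B : GrBasis g C ι) (π : RingProjections g) (hg : IsGradedRing g) {b : R}
    {p : ℤ} (hb : b ∈ g p 0) (hb' : ∀ x, b * x = 0 → x = 0) : C.IsRegular b p where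
  eq_zero {x} hx := by
    refine B.b.ext_elem fun n => ?_
    have h : B.b.repr (b • x) n = 0 := by rw [hx, map_zero]; rfl
    rw [map_smul, Finsupp.smul_apply, smul_eq_mul] at h
    rw [hb' _ h, map_zero]
    rfl
  gr {ε i j k x} hx := by
    rw [B.mem_gr] at hx ⊢
    intro n
    have := hx n
    rw [map_smul, Finsupp.smul_apply, smul_eq_mul] at this
    rcases this with h | ⟨h, h'⟩
    · exact Or.inl (hb' _ h)
    · refine Or.inr ⟨h, ?_⟩
      have := π.mem_of_mul_mem hg hb hb' h'
      rwa [sub_zero, sub_right_comm] at this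

end Cx

theorem aVar_mul_eq_zero {P : Type} (x : PointRing P) (h : aVar P * x = 0) : x = 0 := by
  refine (mul_eq_zero.1 h).resolve_left fun h => Polynomial.X_ne_zero (R := ℚ) ?_
  exact MvPolynomial.C_injective P ℚ[X] (h.trans (map_zero _).symm)

namespace MF

/-! ### Homotopy equivalences of matrix factorizations -/

variable {R A A' A'' : Type} [CommRing R] [CommRing A] [CommRing A'] [CommRing A'']

/-- Homotopy equivalences, linear over `R`, of matrix factorizations over two `R`-algebras. -/
structure HEquiv (φ : R →+* A) (φ' : R →+* A') (M : MF A) (M' : MF A') where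
  c : M.carrier →+ M'.carrier
  e : M'.carrier →+ M.carrier
  c_smul : ∀ r x, c (φ r • x) = φ' r • c x
  e_smul : ∀ r x, e (φ' r • x) = φ r • e x
  c_d : ∀ x, c (M.d x) = M'.d (c x)
  e_d : ∀ x, e (M'.d x) = M.d (e x)
  c_s : ∀ x, c (M.s x) = M'.s (c x)
  e_s : ∀ x, e (M'.s x) = M.s (e x)
  c_gr : ∀ {ε j k x}, x ∈ M.gr ε j k → c x ∈ M'.gr ε j k
  e_gr : ∀ {ε j k x}, x ∈ M'.gr ε j k → e x ∈ M.gr ε j k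
  η : M.carrier →+ M.carrier
  η' : M'.carrier →+ M'.carrier
  η_smul : ∀ r x, η (φ r • x) = φ r • η x
  η'_smul : ∀ r x, η' (φ' r • x) = φ' r • η' x
  η_s : ∀ x, η (M.s x) = -M.s (η x)
  η'_s : ∀ x, η' (M'.s x) = -M'.s (η' x)
  e_c : ∀ x, e (c x) = x + (M.d (η x) + η (M.d x))
  c_e : ∀ x, c (e x) = x + (M'.d (η' x) + η' (M'.d x))

namespace HEquiv

variable {φ : R →+* A} {φ' : R →+* A'} {φ'' : R →+* A''} {M : MF A} {M' : MF A'} {M'' : MF A''}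

/-- Composition. -/
def trans (E : HEquiv φ φ' M M') (F : HEquiv φ' φ'' M' M'') : HEquiv φ φ'' M M'' where
  c := F.c.comp E.c
  e := E.e.comp F.e
  c_smul r x := (congrArg F.c (E.c_smul r x)).trans (F.c_smul _ _)
  e_smul r x := (congrArg E.e (F.e_smul r x)).trans (E.e_smul _ _)
  c_d x := (congrArg F.c (E.c_d x)).trans (F.c_d _)
  e_d x := (congrArg E.e (F.e_d x)).trans (E.e_d _)
  c_s x := (congrArg F.c (E.c_s x)).trans (F.c_s _)
  e_s x := (congrArg E.e (F.e_s x)).trans (E.e_s _)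
  c_gr h := F.c_gr (E.c_gr h)
  e_gr h := E.e_gr (F.e_gr h)
  η := E.η + (E.e.comp F.η).comp E.c
  η' := F.η' + (F.c.comp E.η').comp F.e
  η_smul r x := by simp [E.η_smul, E.c_smul, F.η_smul, E.e_smul]
  η'_smul r x := by simp [F.η'_smul, F.e_smul, E.η'_smul, F.c_smul]
  η_s x := by simp [E.η_s, E.c_s, F.η_s, E.e_s]; abel
  η'_s x := by simp [F.η'_s, F.e_s, E.η'_s, F.c_s]; abel
  e_c x := by
    simp only [AddMonoidHom.comp_apply, AddMonoidHom.add_apply, F.e_c, map_add, E.e_c, E.e_d, E.c_d]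
    abel
  c_e x := by
    simp only [AddMonoidHom.comp_apply, AddMonoidHom.add_apply, E.c_e, map_add, F.c_e, F.c_d, F.e_d]
    abel

/-- Restriction of scalars. -/
def restrict {B : Type} [CommRing B] (E : HEquiv φ φ' M M') (ψ : B →+* R) {χ : B →+* A}
    {χ' : B →+* A'} (h : ∀ b, φ (ψ b) = χ b) (h' : ∀ b, φ' (ψ b) = χ' b) : HEquiv χ χ' M M' :=
  { E with
    c_smul := fun b x => by rw [← h, ← h', E.c_smul]
    e_smul := fun b x => by rw [← h, ← h', E.e_smul]
    η_smul := fun b x => by rw [← h, E.η_smul]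
    η'_smul := fun b x => by rw [← h', E.η'_smul] }

/-- The homotopy equivalence of the shifts `M⟨1⟩`. -/
def susp (E : HEquiv φ φ' M M') : HEquiv φ φ' M.susp M'.susp where
  c := E.c
  e := E.e
  c_smul := E.c_smul
  e_smul := E.e_smul
  c_d := E.c_d
  e_d := E.e_d
  c_s x := (map_neg E.c _).trans (congrArg Neg.neg (E.c_s x))
  e_s x := (map_neg E.e _).trans (congrArg Neg.neg (E.e_s x))
  c_gr h := E.c_gr h
  e_gr h := E.e_gr h
  η := E.η
  η' := E.η'
  η_smul := E.η_smul
  η'_smul := E.η'_smul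
  η_s x := (map_neg E.η _).trans (congrArg Neg.neg (E.η_s x))
  η'_s x := (map_neg E.η' _).trans (congrArg Neg.neg (E.η'_s x))
  e_c := E.e_c
  c_e := E.c_e

/-- The homotopy equivalence of the shifts `M{p, q}`. -/
def shift (E : HEquiv φ φ' M M') (p q : ℤ) : HEquiv φ φ' (M.shift p q) (M'.shift p q) :=
  { E with
    c_gr := fun h => E.c_gr h
    e_gr := fun h => E.e_gr h }

theorem row_homotopy_aux {R M : Type} [CommRing R] [AddCommGroup M] [Module R M] (d s : M →ₗ[R] M)
    (η : M →+ M) (hs : ∀ x, η (s x) = -s (η x)) (b : R) (hb : ∀ x, η (b • x) = b • η x) (x y : M) :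
    d (η x) + b • s (η y) + η (d x + b • s y) = d (η x) + η (d x) := by
  rw [map_add, hb, hs, smul_neg]; abel

/-- The homotopy equivalence of the tensor products with a row. -/
def row (E : HEquiv φ φ' M M') (n : ℕ) (r₀ r₁ : R) (p q : ℤ) {a₀ a₁ : A} {a₀' a₁' : A'}
    (h₀ : φ r₀ = a₀) (h₁ : φ r₁ = a₁) (h₀' : φ' r₀ = a₀') (h₁' : φ' r₁ = a₁') :
    HEquiv φ φ' (M.row n a₀ a₁ p q) (M'.row n a₀' a₁' p q) where
  c := E.c.prodMap E.c
  e := E.e.prodMap E.e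
  c_smul r x := Prod.ext (E.c_smul r x.1) (E.c_smul r x.2)
  e_smul r x := Prod.ext (E.e_smul r x.1) (E.e_smul r x.2)
  c_d x := by
    subst h₀ h₁ h₀' h₁'
    refine Prod.ext ?_ ?_
    · change E.c (M.d x.1 + φ r₁ • M.s x.2) = M'.d (E.c x.1) + φ' r₁ • M'.s (E.c x.2)
      rw [map_add, E.c_d, E.c_smul, E.c_s]
    · change E.c (M.d x.2 + φ r₀ • M.s x.1) = M'.d (E.c x.2) + φ' r₀ • M'.s (E.c x.1)
      rw [map_add, E.c_d, E.c_smul, E.c_s]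
  e_d x := by
    subst h₀ h₁ h₀' h₁'
    refine Prod.ext ?_ ?_
    · change E.e (M'.d x.1 + φ' r₁ • M'.s x.2) = M.d (E.e x.1) + φ r₁ • M.s (E.e x.2)
      rw [map_add, E.e_d, E.e_smul, E.e_s]
    · change E.e (M'.d x.2 + φ' r₀ • M'.s x.1) = M.d (E.e x.2) + φ r₀ • M.s (E.e x.1)
      rw [map_add, E.e_d, E.e_smul, E.e_s]
  c_s x := Prod.ext (E.c_s x.1) ((map_neg E.c _).trans (congrArg Neg.neg (E.c_s x.2)))
  e_s x := Prod.ext (E.e_s x.1) ((map_neg E.e _).trans (congrArg Neg.neg (E.e_s x.2)))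
  c_gr h := ⟨E.c_gr h.1, E.c_gr h.2⟩
  e_gr h := ⟨E.e_gr h.1, E.e_gr h.2⟩
  η := E.η.prodMap E.η
  η' := E.η'.prodMap E.η'
  η_smul r x := Prod.ext (E.η_smul r x.1) (E.η_smul r x.2)
  η'_smul r x := Prod.ext (E.η'_smul r x.1) (E.η'_smul r x.2)
  η_s x := Prod.ext (E.η_s x.1) ((map_neg E.η _).trans (congrArg Neg.neg (E.η_s x.2)))
  η'_s x := Prod.ext (E.η'_s x.1) ((map_neg E.η' _).trans (congrArg Neg.neg (E.η'_s x.2)))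
  e_c x := by
    subst h₀ h₁
    exact Prod.ext ((E.e_c x.1).trans (congrArg (x.1 + ·)
        (row_homotopy_aux M.d M.s E.η E.η_s (φ r₁) (E.η_smul r₁) x.1 x.2).symm))
      ((E.e_c x.2).trans (congrArg (x.2 + ·)
        (row_homotopy_aux M.d M.s E.η E.η_s (φ r₀) (E.η_smul r₀) x.2 x.1).symm))
  c_e x := by
    subst h₀' h₁'
    exact Prod.ext ((E.c_e x.1).trans (congrArg (x.1 + ·)
        (row_homotopy_aux M'.d M'.s E.η' E.η'_s (φ' r₁) (E.η'_smul r₁) x.1 x.2).symm))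
      ((E.c_e x.2).trans (congrArg (x.2 + ·)
        (row_homotopy_aux M'.d M'.s E.η' E.η'_s (φ' r₀) (E.η'_smul r₀) x.2 x.1).symm))

end HEquiv

end MF

/-! ### Exclusion of variables -/

section Elim

variable {A B : Type} [CommRing A] [CommRing B]

/-- A retraction `ev` of a ring extension `c`, the kernel of which is generated by the regular
homogeneous element `δ` of degree `(p, q)`. -/
structure RingElim (c : B →+* A) (ev : A →+* B) (δ : A) (gA : ℤ → ℤ → AddSubgroup A)
    (gB : ℤ → ℤ → AddSubgroup B) (p q : ℤ) : Prop where
  ev_c : ∀ b, ev (c b) = b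
  dvd : ∀ x, ∃ y, x = c (ev x) + δ * y
  ev_δ : ev δ = 0
  regular : ∀ x, δ * x = 0 → x = 0
  c_mem : ∀ {j k x}, x ∈ gB j k → c x ∈ gA j k
  ev_mem : ∀ {j k x}, x ∈ gA j k → ev x ∈ gB j k
  gr_regular : ∀ {j k x}, δ * x ∈ gA j k → x ∈ gA (j - p) (k - q)

/-- A retraction of matrix factorizations over a retraction of rings. -/
structure MF.Elim (c : B →+* A) (v : A →+* B) (δ : A) (p q : ℤ) (M : MF A) (M' : MF B) where
  ev : M.carrier →+ M'.carrier
  σ : M'.carrier →+ M.carrier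
  ev_smul : ∀ a x, ev (a • x) = v a • ev x
  σ_smul : ∀ b x, σ (b • x) = c b • σ x
  ev_σ : ∀ x, ev (σ x) = x
  dvd : ∀ x, ∃ y : M.carrier, x = σ (ev x) + δ • y
  regular : ∀ x : M.carrier, δ • x = 0 → x = 0
  ev_d : ∀ x, ev (M.d x) = M'.d (ev x)
  ev_s : ∀ x, ev (M.s x) = M'.s (ev x)
  σ_s : ∀ x, σ (M'.s x) = M.s (σ x)
  ev_gr : ∀ {ε j k x}, x ∈ M.gr ε j k → ev x ∈ M'.gr ε j k
  σ_gr : ∀ {ε j k x}, x ∈ M'.gr ε j k → σ x ∈ M.gr ε j k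
  gr_regular : ∀ {ε j k} {x : M.carrier}, δ • x ∈ M.gr ε j k → x ∈ M.gr ε (j - p) (k - q)

namespace MF.Elim

variable {c : B →+* A} {v : A →+* B} {δ : A} {gA : ℤ → ℤ → AddSubgroup A}
  {gB : ℤ → ℤ → AddSubgroup B} {p q : ℤ} {M : MF A} {M' : MF B}

/-- The retraction of the ring itself. -/
def base (E : RingElim c v δ gA gB p q) : MF.Elim c v δ p q (MF.base gA) (MF.base gB) where
  ev := v.toAddMonoidHom
  σ := c.toAddMonoidHom
  ev_smul := map_mul v
  σ_smul := map_mul c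
  ev_σ := E.ev_c
  dvd := E.dvd
  regular := E.regular
  ev_d _ := map_zero v
  ev_s _ := rfl
  σ_s _ := rfl
  ev_gr h := MF.map_base_mem E.ev_mem h
  σ_gr h := MF.map_base_mem E.c_mem h
  gr_regular {ε j k x} := by
    suffices H : ∀ x : A, δ * x ∈ (if ε = 0 then gA j k else ⊥) →
        x ∈ (if ε = 0 then gA (j - p) (k - q) else ⊥) from H x
    intro x h
    split_ifs at h ⊢
    · exact E.gr_regular h
    · rw [AddSubgroup.mem_bot] at h ⊢
      exact E.regular x h

/-- The retraction of a tensor product with a row. -/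
def row (E : MF.Elim c v δ p q M M') (n : ℕ) {a₀ a₁ : A} {b₀ b₁ : B} (p' q' : ℤ) (h₀ : v a₀ = b₀)
    (h₁ : v a₁ = b₁) : MF.Elim c v δ p q (M.row n a₀ a₁ p' q') (M'.row n b₀ b₁ p' q') where
  ev := E.ev.prodMap E.ev
  σ := E.σ.prodMap E.σ
  ev_smul a x := Prod.ext (E.ev_smul a x.1) (E.ev_smul a x.2)
  σ_smul a x := Prod.ext (E.σ_smul a x.1) (E.σ_smul a x.2)
  ev_σ x := Prod.ext (E.ev_σ x.1) (E.ev_σ x.2)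
  dvd x := by
    obtain ⟨y, hy⟩ := E.dvd x.1
    obtain ⟨z, hz⟩ := E.dvd x.2
    exact ⟨((y, z) : M.carrier × M.carrier), Prod.ext hy hz⟩
  regular x h := Prod.ext (E.regular x.1 (congrArg Prod.fst h)) (E.regular x.2 (congrArg Prod.snd h))
  ev_d x := by
    subst h₀ h₁
    refine Prod.ext ?_ ?_
    · change E.ev (M.d x.1 + a₁ • M.s x.2) = M'.d (E.ev x.1) + v a₁ • M'.s (E.ev x.2)
      rw [map_add, E.ev_d, E.ev_smul, E.ev_s]
    · change E.ev (M.d x.2 + a₀ • M.s x.1) = M'.d (E.ev x.2) + v a₀ • M'.s (E.ev x.1)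
      rw [map_add, E.ev_d, E.ev_smul, E.ev_s]
  ev_s x := Prod.ext (E.ev_s x.1) ((map_neg E.ev _).trans (congrArg Neg.neg (E.ev_s x.2)))
  σ_s x := Prod.ext (E.σ_s x.1) ((map_neg E.σ _).trans (congrArg Neg.neg (E.σ_s x.2)))
  ev_gr h := ⟨E.ev_gr h.1, E.ev_gr h.2⟩
  σ_gr h := ⟨E.σ_gr h.1, E.σ_gr h.2⟩
  gr_regular h := ⟨E.gr_regular h.1, IsHomogeneous.gr_congr (E.gr_regular h.2) rfl (by ring)
    (by ring)⟩

/-- The retraction of `M⟨1⟩`. -/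
def susp (E : MF.Elim c v δ p q M M') : MF.Elim c v δ p q M.susp M'.susp where
  ev := E.ev
  σ := E.σ
  ev_smul := E.ev_smul
  σ_smul := E.σ_smul
  ev_σ := E.ev_σ
  dvd := E.dvd
  regular := E.regular
  ev_d := E.ev_d
  ev_s x := (map_neg E.ev _).trans (congrArg Neg.neg (E.ev_s x))
  σ_s x := (map_neg E.σ _).trans (congrArg Neg.neg (E.σ_s x))
  ev_gr h := E.ev_gr h
  σ_gr h := E.σ_gr h
  gr_regular h := E.gr_regular h

/-- The retraction of `M{p, q}`. -/
def shift (E : MF.Elim c v δ p q M M') (p' q' : ℤ) :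
    MF.Elim c v δ p q (M.shift p' q') (M'.shift p' q') where
  ev := E.ev
  σ := E.σ
  ev_smul := E.ev_smul
  σ_smul := E.σ_smul
  ev_σ := E.ev_σ
  dvd := E.dvd
  regular := E.regular
  ev_d := E.ev_d
  ev_s := E.ev_s
  σ_s := E.σ_s
  ev_gr h := E.ev_gr h
  σ_gr h := E.σ_gr h
  gr_regular h := IsHomogeneous.gr_congr (M := M) (E.gr_regular h) rfl (by ring) (by ring)

theorem smul_left_cancel (E : MF.Elim c v δ p q M M') {x y : M.carrier} (h : δ • x = δ • y) : x = y := by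
  rw [← sub_eq_zero]
  refine E.regular _ ?_
  rw [smul_sub, h, sub_self]

variable (E : MF.Elim c v δ p q M M')

/-- The quotient of `x - σ (ev x)` by `δ`. -/
def quo : M.carrier →+ M.carrier :=
  have h : ∀ x, δ • (E.dvd x).choose = x - E.σ (E.ev x) := fun x =>
    eq_sub_of_add_eq' (E.dvd x).choose_spec.symm
  AddMonoidHom.mk' (fun x => (E.dvd x).choose) fun x y => E.smul_left_cancel (by
    rw [smul_add, h, h, h, map_add, map_add]
    abel)

theorem eq_add_quo (x : M.carrier) : x = E.σ (E.ev x) + δ • E.quo x := (E.dvd x).choose_spec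

theorem smul_quo (x : M.carrier) : δ • E.quo x = x - E.σ (E.ev x) :=
  eq_sub_of_add_eq' (E.eq_add_quo x).symm

theorem quo_smul (hv : ∀ b, v (c b) = b) (b : B) (x) : E.quo (c b • x) = c b • E.quo x := by
  refine E.smul_left_cancel ?_
  rw [smul_quo, smul_comm, smul_quo, E.ev_smul, hv, E.σ_smul, smul_sub]

theorem quo_s (x) : E.quo (M.s x) = M.s (E.quo x) := by
  refine E.smul_left_cancel ?_
  rw [smul_quo, ← map_smul, smul_quo, E.ev_s, E.σ_s, map_sub]

theorem quo_δ (hv : v δ = 0) (x) : E.quo (δ • x) = x := by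
  refine E.smul_left_cancel ?_
  rw [smul_quo, E.ev_smul, hv, zero_smul, map_zero, sub_zero]

theorem quo_mem {ε j k x} (h : x ∈ M.gr ε j k) : E.quo x ∈ M.gr ε (j - p) (k - q) := by
  refine E.gr_regular ?_
  rw [smul_quo]
  exact sub_mem h (E.σ_gr (E.ev_gr h))

theorem quo_d_σ {α : A} (hw : c M'.w = M.w + α * δ) (x) :
    M.d (E.quo (M.d (E.σ x))) + α • E.σ x = -E.quo (M.d (E.σ (M'.d x))) := by
  refine E.smul_left_cancel ?_
  rw [smul_neg, smul_quo, smul_add, ← map_smul, smul_quo, map_sub, M.d_d, E.ev_d, E.ev_d, E.ev_σ,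
    E.ev_σ, M'.d_d, E.σ_smul, hw, add_smul, smul_smul, mul_comm δ]
  abel

/-- Exclusion of a variable: the last row of the matrix factorization and the variable
eliminated by its second entry are omitted. -/
def exclude {N : ℕ} (hM : M.IsHomogeneous gA N) (hv : ∀ b, v (c b) = b) (hδ : v δ = 0) {α : A}
    (hw : c M'.w = M.w + α * δ) {p' q' : ℤ} (hp : p = 2 - p') (hq : q = 2 * N + 2 - q') :
    HEquiv c (RingHom.id B) (M.row N α δ p' q') M' where
  c := E.ev.comp (AddMonoidHom.fst M.carrier M.carrier)
  e := (E.σ.prod (-(M.s.toAddMonoidHom.comp (E.quo.comp (M.d.toAddMonoidHom.comp E.σ)))))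
  c_smul b x := by
    change E.ev (c b • x.1) = b • E.ev x.1
    rw [E.ev_smul, hv]
  e_smul b x := Prod.ext (E.σ_smul b x) (by
    change -M.s (E.quo (M.d (E.σ (b • x)))) = c b • -M.s (E.quo (M.d (E.σ x)))
    rw [E.σ_smul, map_smul, E.quo_smul hv, map_smul, smul_neg])
  c_d x := by
    change E.ev (M.d x.1 + δ • M.s x.2) = M'.d (E.ev x.1)
    rw [map_add, E.ev_smul, hδ, zero_smul, add_zero, E.ev_d]
  e_d x := by
    refine Prod.ext ?_ ?_
    · change E.σ (M'.d x) = M.d (E.σ x) + δ • M.s (-M.s (E.quo (M.d (E.σ x))))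
      rw [map_neg, M.s_s, smul_neg, smul_quo, E.ev_d, E.ev_σ]
      abel
    · change -M.s (E.quo (M.d (E.σ (M'.d x)))) =
        M.d (-M.s (E.quo (M.d (E.σ x)))) + α • M.s (E.σ x)
      rw [map_neg M.d, ← M.s_d, ← map_smul, ← map_add, E.quo_d_σ hw, map_neg]
  c_s x := E.ev_s x.1
  e_s x := Prod.ext (E.σ_s x) (by
    change -M.s (E.quo (M.d (E.σ (M'.s x)))) = -M.s (-M.s (E.quo (M.d (E.σ x))))
    rw [E.σ_s, ← neg_neg (M.d (M.s _)), ← M.s_d, map_neg E.quo, E.quo_s])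
  c_gr h := E.ev_gr h.1
  e_gr {ε j k x} h := ⟨E.σ_gr h, by
    refine (M.gr _ _ _).neg_mem (hM.s ?_)
    exact IsHomogeneous.gr_congr (E.quo_mem (hM.d (E.σ_gr h))) rfl (by rw [hp]; ring)
      (by rw [hq]; ring)⟩
  η := (0 : M.carrier × M.carrier →+ M.carrier).prod
    (-(M.s.toAddMonoidHom.comp (E.quo.comp (AddMonoidHom.fst M.carrier M.carrier))))
  η' := 0
  η_smul b x := Prod.ext (smul_zero (c b)).symm (by
    change -M.s (E.quo (c b • x.1)) = c b • -M.s (E.quo x.1)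
    rw [E.quo_smul hv, map_smul, smul_neg])
  η'_smul b _ := (smul_zero b).symm
  η_s x := by
    refine Prod.ext ?_ ?_
    · change (0 : M.carrier) = -M.s 0
      rw [map_zero, neg_zero]
    · change -M.s (E.quo (M.s x.1)) = - -M.s (-M.s (E.quo x.1))
      rw [E.quo_s, neg_neg, map_neg]
  η'_s x := by
    change (0 : M'.carrier) = -M'.s 0
    rw [map_zero, neg_zero]
  e_c x := by
    refine Prod.ext ?_ ?_
    · change E.σ (E.ev x.1) = x.1 + ((M.d 0 + δ • M.s (-M.s (E.quo x.1))) + 0)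
      rw [map_zero, map_neg, M.s_s, smul_neg, smul_quo]
      abel
    · change -M.s (E.quo (M.d (E.σ (E.ev x.1)))) =
        x.2 + ((M.d (-M.s (E.quo x.1)) + α • M.s 0) + -M.s (E.quo (M.d x.1 + δ • M.s x.2)))
      have h := congrArg (fun y => M.s (E.quo (M.d y))) (E.eq_add_quo x.1)
      simp only [map_add, map_smul, E.quo_δ hδ] at h
      rw [map_zero, smul_zero, add_zero, map_add E.quo, E.quo_δ hδ, map_add, M.s_s, map_neg M.d,
        ← M.s_d, h]
      abel
  c_e x := by
    change E.ev (E.σ x) = x + (M'.d 0 + 0)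
    rw [E.ev_σ, map_zero, add_zero, add_zero]

end MF.Elim

end Elim

/-! ### Polynomial rings in one variable -/

section PolyGrading

variable {R : Type} [CommRing R] {g : ℤ → ℤ → AddSubgroup R}

/-- The bigrading of `R[x]`, where `x` has degree `(0, 2)`. -/
def polyGrading (g : ℤ → ℤ → AddSubgroup R) (j k : ℤ) : AddSubgroup R[X] where
  carrier := {p | ∀ m : ℕ, p.coeff m ∈ g j (k - 2 * m)}
  zero_mem' := by simp [zero_mem]
  add_mem' hp hq m := by
    rw [Polynomial.coeff_add]
    exact add_mem (hp m) (hq m)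
  neg_mem' hp m := by
    rw [Polynomial.coeff_neg]
    exact neg_mem (hp m)

theorem C_mem_polyGrading {j k : ℤ} {x : R} (hx : x ∈ g j k) :
    Polynomial.C x ∈ polyGrading g j k := by
  intro m
  rw [Polynomial.coeff_C]
  split_ifs with h
  · subst h; simpa using hx
  · exact zero_mem _

theorem X_mem_polyGrading (hg : IsGradedRing g) : (Polynomial.X : R[X]) ∈ polyGrading g 0 2 := by
  intro m
  rw [Polynomial.coeff_X]
  split_ifs with h
  · subst h; simpa using hg.one_mem
  · exact zero_mem _

theorem IsGradedRing.poly (hg : IsGradedRing g) : IsGradedRing (polyGrading g) where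
  one_mem := by
    rw [← Polynomial.C_1]
    exact C_mem_polyGrading hg.one_mem
  mul_mem hx hy m := by
    rw [Polynomial.coeff_mul]
    refine AddSubgroup.sum_mem _ fun n hn => ?_
    rw [Finset.HasAntidiagonal.mem_antidiagonal] at hn
    exact hg.mul_mem' (hx n.1) (hy n.2) rfl (by rw [← hn]; push_cast; ring)

/-- Additive maps that are homogeneous on multiples of the powers of `x` are homogeneous. -/
theorem map_mem_of_mem_polyGrading {M : Type} [AddCommGroup M] (f : R[X] →+ M) (S : AddSubgroup M)
    {j k : ℤ} (hf : ∀ m : ℕ, ∀ r ∈ g j (k - 2 * m), f (Polynomial.C r * Polynomial.X ^ m) ∈ S)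
    {x : R[X]} (hx : x ∈ polyGrading g j k) : f x ∈ S := by
  rw [x.as_sum_support_C_mul_X_pow, map_sum]
  exact AddSubgroup.sum_mem _ fun m _ => hf m _ (hx m)

end PolyGrading

/-- A homomorphism on `ℚ[a][P]` is homogeneous if it is so on the generators. -/
theorem hom_mem {T P : Type} [CommRing T] {h : ℤ → ℤ → AddSubgroup T} (hh : IsGradedRing h)
    (F : PointRing P →+* T) (hC : ∀ q : ℚ, F (MvPolynomial.C (Polynomial.C q)) ∈ h 0 0)
    (ha : F (aVar P) ∈ h 2 0) (hX : ∀ p, F (MvPolynomial.X p) ∈ h 0 2) {j k : ℤ} {x : PointRing P}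
    (hx : x ∈ pointGrading P j k) : F x ∈ h j k := by
  rw [← x.support_sum_monomial_coeff, map_sum]
  refine AddSubgroup.sum_mem _ fun m _ => ?_
  rw [MvPolynomial.monomial_eq, map_mul, Finsupp.prod, map_prod]
  simp only [map_pow]
  rw [(x.coeff m).as_sum_support_C_mul_X_pow, map_sum, map_sum, Finset.sum_mul]
  refine AddSubgroup.sum_mem _ fun n hn => ?_
  obtain ⟨h₁, h₂⟩ := hx m n (Polynomial.mem_support_iff.1 hn)
  rw [map_mul, map_mul, map_pow, map_pow]
  refine hh.mul_mem' (j := 2 * n) (k := 0) (hh.mul_mem' (j := 0) (k := 0) (hC _)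
    (hh.pow_mem ha n) (by ring) (by ring)) (hh.prod_mem _ m hX m.support) (by omega) ?_
  rw [← h₂, Finsupp.degree_apply]; push_cast; ring

/-! ### Elimination of a variable from a polynomial ring -/

theorem exists_eq_add_mul {σ K B : Type} [CommRing K] [CommRing B] (c : B →+* MvPolynomial σ K)
    (v : MvPolynomial σ K →+* B) (δ : MvPolynomial σ K)
    (hC : ∀ r, c (v (MvPolynomial.C r)) = MvPolynomial.C r)
    (hX : ∀ i, δ ∣ MvPolynomial.X i - c (v (MvPolynomial.X i))) (x : MvPolynomial σ K) :
    ∃ y, x = c (v x) + δ * y := by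
  suffices H : δ ∣ x - c (v x) by
    obtain ⟨y, hy⟩ := H
    exact ⟨y, eq_add_of_sub_eq' hy⟩
  rw [← Ideal.mem_span_singleton, ← Ideal.Quotient.eq]
  suffices H : Ideal.Quotient.mk (Ideal.span {δ}) = ((Ideal.Quotient.mk _).comp c).comp v from
    DFunLike.congr_fun H x
  refine MvPolynomial.ringHom_ext (fun r => ?_) fun i => ?_
  · change _ = Ideal.Quotient.mk _ (c (v _))
    rw [hC]
  · change _ = Ideal.Quotient.mk _ (c (v _))
    rw [Ideal.Quotient.eq, Ideal.mem_span_singleton]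
    exact hX i

theorem eq_zero_of_mul_eq_zero {A : Type} [CommRing A] [IsDomain A] {δ : A} (h : δ ≠ 0) (x : A)
    (hx : δ * x = 0) : x = 0 := (mul_eq_zero.1 hx).resolve_left h

theorem X_sub_X_ne_zero {σ K : Type} [CommRing K] [Nontrivial K] {i j : σ} (h : i ≠ j) :
    (MvPolynomial.X i - MvPolynomial.X j : MvPolynomial σ K) ≠ 0 :=
  sub_ne_zero.2 fun h' => h (MvPolynomial.X_injective h')

/-- The evaluation of a marked point at another one. -/
def evalPoint {P Q : Type} (e : Option Q ≃ P) (q : Q) : PointRing P →+* PointRing Q :=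
  renameHom fun p => (e.symm p).getD q

/-- Elimination of a marked point. -/
theorem ringElim_point {P Q : Type} (e : Option Q ≃ P) (q : Q) :
    RingElim (renameHom (e ∘ some)) (evalPoint e q)
      (MvPolynomial.X (e (some q)) - MvPolynomial.X (e none)) (pointGrading P) (pointGrading Q)
      0 2 := by
  have h0 : (MvPolynomial.X (e (some q)) - MvPolynomial.X (e none) : PointRing P) ≠ 0 :=
    X_sub_X_ne_zero (e.injective.ne (by simp))
  refine ⟨fun b => ?_, exists_eq_add_mul _ _ _ (fun r => ?_) fun i => ?_, ?_,
    eq_zero_of_mul_eq_zero h0, renameHom_mem _, renameHom_mem _, fun hx =>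
    (pointProjections P).mem_of_mul_mem (isGradedRing_pointGrading P) (sub_mem (X_mem _) (X_mem _))
      (eq_zero_of_mul_eq_zero h0) hx⟩
  · suffices H : (evalPoint e q).comp (renameHom (e ∘ some)) = RingHom.id _ from
      DFunLike.congr_fun H b
    refine MvPolynomial.ringHom_ext (fun r => ?_) fun i => ?_
    · simp [evalPoint, renameHom_C]
    · simp [evalPoint, renameHom_X]
  · rw [evalPoint, renameHom_C, renameHom_C]
  · rw [evalPoint, renameHom_X, renameHom_X]
    obtain ⟨i, rfl⟩ := e.surjective i
    rw [e.symm_apply_apply]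
    rcases i with _ | i
    · exact ⟨-1, by simp⟩
    · exact ⟨0, by simp⟩
  · rw [map_sub, evalPoint, renameHom_X, renameHom_X]
    simp

/-- The inclusion of `ℚ[a][P][x]`. -/
def polyIncl (P : Type) : (PointRing P)[X] →+* PointRing (Option (Option P)) :=
  Polynomial.eval₂RingHom (renameHom (some ∘ some)) (MvPolynomial.X (some none))

/-- The evaluation of the first and of the second additional point at `x`. -/
def polyEval (P : Type) : PointRing (Option (Option P)) →+* (PointRing P)[X] :=
  MvPolynomial.eval₂Hom (Polynomial.C.comp MvPolynomial.C)
    fun p => p.elim Polynomial.X fun p => p.elim Polynomial.X fun p =>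
      Polynomial.C (MvPolynomial.X p)

theorem polyIncl_C {P : Type} (x : PointRing P) :
    polyIncl P (Polynomial.C x) = renameHom (some ∘ some) x := Polynomial.eval₂_C _ _

theorem polyIncl_X {P : Type} : polyIncl P Polynomial.X = MvPolynomial.X (some none) :=
  Polynomial.eval₂_X _ _

theorem polyEval_C {P : Type} (r : ℚ[X]) :
    polyEval P (MvPolynomial.C r) = Polynomial.C (MvPolynomial.C r) := MvPolynomial.eval₂_C _ _ _

theorem polyEval_X {P : Type} (p : Option (Option P)) : polyEval P (MvPolynomial.X p) =
    p.elim Polynomial.X fun p => p.elim Polynomial.X fun p => Polynomial.C (MvPolynomial.X p) :=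
  MvPolynomial.eval₂_X _ _ _

theorem ringElim_poly (P : Type) : RingElim (polyIncl P) (polyEval P)
    (MvPolynomial.X none - MvPolynomial.X (some none)) (pointGrading (Option (Option P)))
    (polyGrading (pointGrading P)) 0 2 := by
  have h0 : (MvPolynomial.X none - MvPolynomial.X (some none) : PointRing (Option (Option P))) ≠ 0 :=
    X_sub_X_ne_zero (by simp)
  have hP := isGradedRing_pointGrading (Option (Option P))
  have hQ := isGradedRing_pointGrading P
  refine ⟨fun b => ?_, exists_eq_add_mul _ _ _ (fun r => ?_) fun i => ?_, ?_,
    eq_zero_of_mul_eq_zero h0, fun hx => map_mem_of_mem_polyGrading (polyIncl P).toAddMonoidHom _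
      (fun m r hr => ?_) hx, hom_mem hQ.poly _ (fun r => ?_) ?_ fun p => ?_, fun hx =>
    (pointProjections _).mem_of_mul_mem hP (sub_mem (X_mem _) (X_mem _))
      (eq_zero_of_mul_eq_zero h0) hx⟩
  · suffices H : (polyEval P).comp (polyIncl P) = RingHom.id _ from DFunLike.congr_fun H b
    refine Polynomial.ringHom_ext' (MvPolynomial.ringHom_ext (fun r => ?_) fun i => ?_) ?_
    · simp [polyIncl_C, renameHom_C, polyEval_C]
    · simp [polyIncl_C, renameHom_X, polyEval_X]
    · simp [polyIncl_X, polyEval_X]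
  · rw [polyEval_C, polyIncl_C, renameHom_C]
  · rw [polyEval_X]
    rcases i with _ | _ | i
    · exact ⟨1, by simp [polyIncl_X]⟩
    · exact ⟨0, by simp [polyIncl_X]⟩
    · exact ⟨0, by simp [polyIncl_C, renameHom_X]⟩
  · rw [map_sub, polyEval_X, polyEval_X]
    simp
  · change polyIncl P (Polynomial.C r * Polynomial.X ^ m) ∈ _
    rw [map_mul, map_pow, polyIncl_C, polyIncl_X]
    exact hP.mul_mem' (renameHom_mem _ hr) (hP.pow_mem (X_mem _) m) (by ring) (by ring)
  · rw [polyEval_C]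
    exact C_mem_polyGrading (C_C_mem _)
  · rw [aVar, polyEval_C]
    exact C_mem_polyGrading aVar_mem
  · rw [polyEval_X]
    rcases p with _ | _ | p
    · exact X_mem_polyGrading hQ
    · exact X_mem_polyGrading hQ
    · exact C_mem_polyGrading (X_mem _)

/-! ### Contraction of the edge of color `2` -/

section Contraction

variable {R : Type} [CommRing R] [IsDomain R]

/-- The grading in which every element has every degree. -/
abbrev topGrading (A : Type) [CommRing A] (_ _ : ℤ) : AddSubgroup A := ⊤

/-- Elimination of the second variable. -/
theorem ringElim_second (p : R) : RingElim
    (Polynomial.eval₂RingHom MvPolynomial.C (MvPolynomial.X 0) : R[X] →+* MvPolynomial (Fin 2) R)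
    (MvPolynomial.eval₂Hom Polynomial.C ![Polynomial.X, Polynomial.C p])
    (MvPolynomial.X 1 - MvPolynomial.C p) (topGrading _) (topGrading _) 0 4 := by
  have h0 : (MvPolynomial.X 1 - MvPolynomial.C p : MvPolynomial (Fin 2) R) ≠ 0 := by
    intro h
    have := congrArg (MvPolynomial.eval (fun _ => p + 1)) h
    simp at this
  refine ⟨fun b => ?_, exists_eq_add_mul _ _ _ (fun r => by simp) fun i => ?_, by simp,
    eq_zero_of_mul_eq_zero h0, fun _ => trivial, fun _ => trivial, fun _ => trivial⟩
  · suffices H : (MvPolynomial.eval₂Hom Polynomial.C ![Polynomial.X, Polynomial.C p]).comp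
        (Polynomial.eval₂RingHom MvPolynomial.C (MvPolynomial.X 0) :
          R[X] →+* MvPolynomial (Fin 2) R) = RingHom.id _ from DFunLike.congr_fun H b
    exact Polynomial.ringHom_ext (fun r => by simp) (by simp)
  · fin_cases i
    · exact ⟨0, by simp⟩
    · exact ⟨1, by simp⟩

/-- Elimination of the first variable. -/
theorem ringElim_first (s : R) : RingElim (Polynomial.C : R →+* R[X])
    (Polynomial.evalRingHom s) (Polynomial.X - Polynomial.C s) (topGrading _) (topGrading _)
    0 2 := by
  refine ⟨fun b => by simp, fun x => ?_, by simp,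
    eq_zero_of_mul_eq_zero (Polynomial.X_sub_C_ne_zero s), fun _ => trivial, fun _ => trivial,
    fun _ => trivial⟩
  obtain ⟨y, hy⟩ := Polynomial.X_sub_C_dvd_sub_C_eval (a := s) (p := x)
  exact ⟨y, eq_add_of_sub_eq' hy⟩

theorem topGrading_isGradedRing (A : Type) [CommRing A] : IsGradedRing (topGrading A) :=
  ⟨trivial, fun _ _ => trivial⟩

end Contraction

/-- A morphism with a right inverse that is homotopic to an equivalence is an equivalence with
this inverse. -/
def MF.HEquiv.ofLeftInverse {R : Type} [CommRing R] {M M' : MF R} (c : Hom M M') (e : Hom M' M)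
    (c_gr : ∀ {ε j k x}, x ∈ M.gr ε j k → c.f x ∈ M'.gr ε j k)
    (e_gr : ∀ {ε j k x}, x ∈ M'.gr ε j k → e.f x ∈ M.gr ε j k)
    (hce : ∀ u, c.f (e.f u) = u) (e' : M'.carrier →+ M.carrier) (ζ : M.carrier →+ M.carrier)
    (ζ_smul : ∀ (r : R) x, ζ (r • x) = r • ζ x) (ζ_s : ∀ x, ζ (M.s x) = -M.s (ζ x))
    (hζ : ∀ x, e' (c.f x) = x + (M.d (ζ x) + ζ (M.d x))) :
    HEquiv (RingHom.id R) (RingHom.id R) M M' where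
  c := c.f.toAddMonoidHom
  e := e.f.toAddMonoidHom
  c_smul r x := c.f.map_smul r x
  e_smul r x := e.f.map_smul r x
  c_d := c.f_d
  e_d := e.f_d
  c_s := c.f_s
  e_s := e.f_s
  c_gr := c_gr
  e_gr := e_gr
  η := ζ - ζ.comp (e.f.toAddMonoidHom.comp c.f.toAddMonoidHom)
  η' := 0
  η_smul r x := by
    change ζ (r • x) - ζ (e.f (c.f (r • x))) = r • (ζ x - ζ (e.f (c.f x)))
    rw [map_smul c.f, map_smul e.f, ζ_smul, ζ_smul, smul_sub]
  η'_smul r _ := (smul_zero r).symm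
  η_s x := by
    change ζ (M.s x) - ζ (e.f (c.f (M.s x))) = -M.s (ζ x - ζ (e.f (c.f x)))
    rw [c.f_s, e.f_s, ζ_s, ζ_s, map_sub]
    abel
  η'_s x := by simp
  e_c x := by
    change e.f (c.f x) = x + (M.d (ζ x - ζ (e.f (c.f x))) +
      (ζ (M.d x) - ζ (e.f (c.f (M.d x)))))
    have h := (hζ (e.f (c.f x))).symm.trans ((congrArg e' (hce (c.f x))).trans (hζ x))
    rw [c.f_d, e.f_d, map_sub]
    refine (eq_sub_of_add_eq h).trans ?_
    abel
  c_e u := by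
    change c.f (e.f u) = u + (M'.d 0 + 0)
    rw [hce, map_zero, add_zero, add_zero]

section Contraction

variable {R : Type} [CommRing R] (N : ℕ) (g : ℤ → ℤ → AddSubgroup R) (a x₁ y₁ y₂ x₂ : R)

theorem contract_expand (u) :
    (contract N g a x₁ y₁ y₂ x₂).f ((expand N g a x₁ y₁ y₂ x₂).f u) = u := by
  suffices H : ∀ (p q r : MvPolynomial (Fin 2) R) (u : (R × R) × (R × R)),
      contractFun (MvPolynomial.eval ![x₂ + y₂, x₂ * y₂]) (expandFun MvPolynomial.C p q r u) = u
    from H _ _ _ u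
  intro p q r u
  simp [contractFun, expandFun]

/-- The homotopy equivalence from `Γ₁` to its contraction, the homotopy being obtained from any
homotopy equivalence with the same underlying map. -/
def wideHEquivOf {N : ℕ} {g : ℤ → ℤ → AddSubgroup R} (hg : IsGradedRing g) {a x₁ y₁ y₂ x₂ : R}
    (E : MF.HEquiv (MvPolynomial.C : R →+* MvPolynomial (Fin 2) R) (RingHom.id R)
      (wideMFAux N (topGrading _) (MvPolynomial.C a) (MvPolynomial.C (x₁ + y₁))
        (MvPolynomial.C (x₁ * y₁)) (MvPolynomial.C (x₂ + y₂)) (MvPolynomial.C (x₂ * y₂))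
        (MvPolynomial.X 0) (MvPolynomial.X 1))
      (contractedMF N (topGrading R) a x₁ y₁ y₂ x₂))
    (hE : ∀ x : (wideMF N g a x₁ y₁ y₂ x₂).carrier, E.c x = (contract N g a x₁ y₁ y₂ x₂).f x)
    (ha : a ∈ g 2 0) (h₁ : x₁ ∈ g 0 2) (h₁' : y₁ ∈ g 0 2) (h₂' : y₂ ∈ g 0 2) (h₂ : x₂ ∈ g 0 2) :
    MF.HEquiv (RingHom.id R) (RingHom.id R) (wideMF N g a x₁ y₁ y₂ x₂)
      (contractedMF N g a x₁ y₁ y₂ x₂) :=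
  .ofLeftInverse (contract N g a x₁ y₁ y₂ x₂) (expand N g a x₁ y₁ y₂ x₂)
    (contract_mem hg N h₂' h₂) (expand_mem hg N ha h₁ h₁' h₂' h₂)
    (contract_expand N g a x₁ y₁ y₂ x₂) E.e E.η E.η_smul E.η_s fun x =>
      (congrArg E.e (hE x).symm).trans (E.e_c x)

variable [IsDomain R]

/-- The exclusion of both variables from `Γ₁`, with coarse gradings. -/
def excludeBoth : MF.HEquiv (MvPolynomial.C : R →+* MvPolynomial (Fin 2) R) (RingHom.id R)
    (wideMFAux N (topGrading _) (MvPolynomial.C a) (MvPolynomial.C (x₁ + y₁))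
      (MvPolynomial.C (x₁ * y₁)) (MvPolynomial.C (x₂ + y₂)) (MvPolynomial.C (x₂ * y₂))
      (MvPolynomial.X 0) (MvPolynomial.X 1))
    (contractedMF N (topGrading R) a x₁ y₁ y₂ x₂) :=
  let v : MvPolynomial (Fin 2) R →+* R[X] :=
    MvPolynomial.eval₂Hom Polynomial.C ![Polynomial.X, Polynomial.C (x₂ * y₂)]
  let v' : R[X] →+* R := Polynomial.evalRingHom (x₂ + y₂)
  have hC : ∀ r, v (MvPolynomial.C r) = Polynomial.C r := fun r => MvPolynomial.eval₂_C _ _ _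
  have h0 : v (MvPolynomial.X 0) = Polynomial.X := by simp [v]
  have h1 : v (MvPolynomial.X 1) = Polynomial.C (x₂ * y₂) := by simp [v]
  have hC' : ∀ r, v' (Polynomial.C r) = r := fun r => Polynomial.eval_C
  have hX' : v' Polynomial.X = x₂ + y₂ := Polynomial.eval_X
  have E := ringElim_second (x₂ * y₂)
  have E' := ringElim_first (x₂ + y₂)
  let F := (((MF.Elim.base E).row N
    (a₀ := MvPolynomial.C a * U₁ (N + 1) (MvPolynomial.C (x₁ + y₁)) (MvPolynomial.X 0)
      (MvPolynomial.C (x₁ * y₁))) (a₁ := MvPolynomial.C (x₁ + y₁) - MvPolynomial.X 0)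
    (b₀ := Polynomial.C a * U₁ (N + 1) (Polynomial.C (x₁ + y₁)) Polynomial.X
      (Polynomial.C (x₁ * y₁))) (b₁ := Polynomial.C (x₁ + y₁) - Polynomial.X) 2 (2 * N)
    (by rw [map_mul v, map_U₁, hC, hC, hC, h0]) (by rw [map_sub v, hC, h0])).row N
    (a₀ := MvPolynomial.C a * U₂ (N + 1) (MvPolynomial.X 0) (MvPolynomial.C (x₁ * y₁))
      (MvPolynomial.X 1)) (a₁ := MvPolynomial.C (x₁ * y₁) - MvPolynomial.X 1)
    (b₀ := Polynomial.C a * U₂ (N + 1) Polynomial.X (Polynomial.C (x₁ * y₁))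
      (Polynomial.C (x₂ * y₂))) (b₁ := Polynomial.C (x₁ * y₁) - Polynomial.C (x₂ * y₂))
    2 (2 * N - 2)
    (by rw [map_mul v, map_U₂, hC, hC, h0, h1]) (by rw [map_sub v, hC, h1])).row N
    (a₀ := MvPolynomial.C a * U₁ (N + 1) (MvPolynomial.X 0) (MvPolynomial.C (x₂ + y₂))
      (MvPolynomial.X 1)) (a₁ := MvPolynomial.X 0 - MvPolynomial.C (x₂ + y₂))
    (b₀ := Polynomial.C a * U₁ (N + 1) Polynomial.X (Polynomial.C (x₂ + y₂))
      (Polynomial.C (x₂ * y₂))) (b₁ := Polynomial.X - Polynomial.C (x₂ + y₂)) 2 (2 * N)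
    (by rw [map_mul v, map_U₁, hC, hC, h0, h1]) (by rw [map_sub v, hC, h0])
  let F' := ((MF.Elim.base E').row N
    (a₀ := Polynomial.C a * U₁ (N + 1) (Polynomial.C (x₁ + y₁)) Polynomial.X
      (Polynomial.C (x₁ * y₁))) (a₁ := Polynomial.C (x₁ + y₁) - Polynomial.X)
    (b₀ := a * U₁ (N + 1) (x₁ + y₁) (x₂ + y₂) (x₁ * y₁)) (b₁ := x₁ + y₁ - (x₂ + y₂)) 2 (2 * N)
    (by rw [map_mul v', map_U₁, hC', hC', hC', hX']) (by rw [map_sub v', hC', hX'])).row N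
    (a₀ := Polynomial.C a * U₂ (N + 1) Polynomial.X (Polynomial.C (x₁ * y₁))
      (Polynomial.C (x₂ * y₂))) (a₁ := Polynomial.C (x₁ * y₁) - Polynomial.C (x₂ * y₂))
    (b₀ := a * U₂ (N + 1) (x₂ + y₂) (x₁ * y₁) (x₂ * y₂)) (b₁ := x₁ * y₁ - x₂ * y₂)
    2 (2 * N - 2)
    (by rw [map_mul v', map_U₂, hC', hC', hC', hX']) (by rw [map_sub v', hC', hC'])
  have hA := topGrading_isGradedRing (MvPolynomial (Fin 2) R)
  have hB := topGrading_isGradedRing R[X]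
  have hT : ∀ {A : Type} [CommRing A] {x : A} {j k : ℤ}, x ∈ topGrading A j k := trivial
  (((F.exclude ((((MF.IsHomogeneous.base hA N).row hT hT).row hT hT).row hT hT) E.ev_c E.ev_δ
    (N := N) (p' := 2) (q' := 2 * N - 2)
    (α := MvPolynomial.C a * U₂ (N + 1) (MvPolynomial.C (x₂ + y₂)) (MvPolynomial.X 1)
      (MvPolynomial.C (x₂ * y₂)))
    (by
      simp only [MF.row, MF.base, mul_assoc, U₁_mul, U₂_mul]
      simp only [map_add, map_mul, map_sub, map_psum2, map_zero, Polynomial.coe_eval₂RingHom,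
        Polynomial.eval₂_C, Polynomial.eval₂_X]
      ring)
    (by ring) (by ring)).restrict Polynomial.C (fun b => Polynomial.eval₂_C _ _)
      fun _ => rfl).trans
    (F'.exclude (((MF.IsHomogeneous.base hB N).row hT hT).row hT hT) E'.ev_c E'.ev_δ
      (N := N) (p' := 2) (q' := 2 * N)
      (α := Polynomial.C a * U₁ (N + 1) Polynomial.X (Polynomial.C (x₂ + y₂))
        (Polynomial.C (x₂ * y₂)))
      (by
        simp only [MF.row, MF.base, mul_assoc, U₁_mul, U₂_mul]
        simp only [map_add, map_mul, map_sub, map_psum2, map_zero]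
        ring)
      (by ring) (by ring))).shift 0 (-1)

theorem excludeBoth_c (x : (wideMF N g a x₁ y₁ y₂ x₂).carrier) :
    (excludeBoth N a x₁ y₁ y₂ x₂).c x = (contract N g a x₁ y₁ y₂ x₂).f x := by
  let A := MvPolynomial (Fin 2) R
  have h : ∀ p : MvPolynomial (Fin 2) R, Polynomial.evalRingHom (x₂ + y₂)
      (MvPolynomial.eval₂Hom Polynomial.C ![Polynomial.X, Polynomial.C (x₂ * y₂)] p) =
      MvPolynomial.eval ![x₂ + y₂, x₂ * y₂] p := by
    intro p
    suffices H : (Polynomial.evalRingHom (x₂ + y₂)).comp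
        (MvPolynomial.eval₂Hom Polynomial.C ![Polynomial.X, Polynomial.C (x₂ * y₂)]) =
        MvPolynomial.eval ![x₂ + y₂, x₂ * y₂] from DFunLike.congr_fun H p
    refine MvPolynomial.ringHom_ext (fun r => by simp) fun i => ?_
    fin_cases i <;> simp
  suffices H : ∀ x : (((A × A) × (A × A)) × ((A × A) × (A × A))) ×
      (((A × A) × (A × A)) × ((A × A) × (A × A))),
      contractFun (fun p => Polynomial.evalRingHom (x₂ + y₂)
        (MvPolynomial.eval₂Hom Polynomial.C ![Polynomial.X, Polynomial.C (x₂ * y₂)] p)) x =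
      contractFun (MvPolynomial.eval ![x₂ + y₂, x₂ * y₂]) x from H x
  intro x
  exact congrFun (congrArg contractFun (funext h)) x

/-- The homotopy equivalence from `Γ₁` to its contraction. -/
def wideHEquiv {g : ℤ → ℤ → AddSubgroup R} (hg : IsGradedRing g) {a x₁ y₁ y₂ x₂ : R}
    (ha : a ∈ g 2 0) (h₁ : x₁ ∈ g 0 2) (h₁' : y₁ ∈ g 0 2) (h₂' : y₂ ∈ g 0 2) (h₂ : x₂ ∈ g 0 2) :
    MF.HEquiv (RingHom.id R) (RingHom.id R) (wideMF N g a x₁ y₁ y₂ x₂)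
      (contractedMF N g a x₁ y₁ y₂ x₂) :=
  wideHEquivOf hg (excludeBoth N a x₁ y₁ y₂ x₂) (excludeBoth_c N g a x₁ y₁ y₂ x₂) ha h₁ h₁' h₂' h₂

end Contraction

/-! ### Restriction of scalars along a homomorphism -/

namespace MF

variable {R A A' : Type} [CommRing R] [CommRing A] [CommRing A']

/-- A matrix factorization over `A`, regarded as one over `R` by means of `φ : R → A`. -/
def comap (φ : R →+* A) (M : MF A) (w : R) (h : φ w = M.w) : MF R :=
  letI := φ.toAlgebra
  M.restrict w h

/-- A morphism, regarded as one over `R`. -/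
def Hom.comap (φ : R →+* A) {M M' : MF A} (f : Hom M M') (w : R) (h : φ w = M.w)
    (h' : φ w = M'.w) : Hom (M.comap φ w h) (M'.comap φ w h') where
  f := { toFun := f.f, map_add' := f.f.map_add, map_smul' := fun r x => f.f.map_smul (φ r) x }
  f_d := f.f_d
  f_s := f.f_s

/-- The morphism of tensor products with a row. -/
def Hom.row {M M' : MF R} (f : Hom M M') (n : ℕ) (a₀ a₁ : R) (p q : ℤ) :
    Hom (M.row n a₀ a₁ p q) (M'.row n a₀ a₁ p q) where
  f := f.f.prodMap f.f
  f_d x := Prod.ext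
    (by
      change f.f (M.d x.1 + a₁ • M.s x.2) = M'.d (f.f x.1) + a₁ • M'.s (f.f x.2)
      rw [map_add, map_smul, f.f_d, f.f_s])
    (by
      change f.f (M.d x.2 + a₀ • M.s x.1) = M'.d (f.f x.2) + a₀ • M'.s (f.f x.1)
      rw [map_add, map_smul, f.f_d, f.f_s])
  f_s x := Prod.ext (f.f_s x.1) ((map_neg f.f _).trans (congrArg Neg.neg (f.f_s x.2)))

namespace HEquiv

variable {φ : R →+* A} {φ' : R →+* A'} {M : MF A} {M' : MF A'} (E : HEquiv φ φ' M M') (w : R)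
  (h : φ w = M.w) (h' : φ' w = M'.w)

/-- The homotopy equivalence as a morphism over `R`. -/
def cHom : Hom (M.comap φ w h) (M'.comap φ' w h') where
  f := { toFun := E.c, map_add' := E.c.map_add, map_smul' := E.c_smul }
  f_d := E.c_d
  f_s := E.c_s

/-- The inverse homotopy equivalence as a morphism over `R`. -/
def eHom : Hom (M'.comap φ' w h') (M.comap φ w h) where
  f := { toFun := E.e, map_add' := E.e.map_add, map_smul' := E.e_smul }
  f_d := E.e_d
  f_s := E.e_s

/-- The homotopy, over `R`. -/
def ηHom : (M.comap φ w h).carrier →ₗ[R] (M.comap φ w h).carrier where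
  toFun := E.η
  map_add' := E.η.map_add
  map_smul' := E.η_smul

/-- The homotopy for the opposite composition, over `R`. -/
def ηHom' : (M'.comap φ' w h').carrier →ₗ[R] (M'.comap φ' w h').carrier where
  toFun := E.η'
  map_add' := E.η'.map_add
  map_smul' := E.η'_smul

end HEquiv

theorem IsHomogeneous.base_smul_mem {g : ℤ → ℤ → AddSubgroup R} {N : ℕ} {M : MF R}
    (hM : M.IsHomogeneous g N) {ε j k ε' j' k'} {r : R} {x : M.carrier}
    (hr : r ∈ (MF.base g).gr ε j k) (hx : x ∈ M.gr ε' j' k') :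
    r • x ∈ M.gr (ε' + ε) (j' + j) (k' + k) := by
  change r ∈ (if ε = 0 then g j k else ⊥) at hr
  split_ifs at hr with hε
  · exact gr_congr (hM.smul hr hx) (by rw [hε, add_zero]) (add_comm _ _) (add_comm _ _)
  · rw [(AddSubgroup.mem_bot).1 hr, zero_smul]
    exact zero_mem _

end MF

namespace Cx

variable {R A A' : Type} [CommRing R] [CommRing A] [CommRing A']

/-- A morphism of matrix factorizations as a morphism of complexes. -/
def singleHom {M M' : MF R} (f : MF.Hom M M') : SHom (single M) (single M') where
  f := f.f
  f_dmf := f.f_d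
  f_dχ _ := map_zero f.f
  f_s := f.f_s
  f_t _ := rfl

theorem singleHom_mem {M M' : MF R} (f : MF.Hom M M')
    (hf : ∀ {ε j k x}, x ∈ M.gr ε j k → f.f x ∈ M'.gr ε j k) {ε i j k x}
    (hx : x ∈ (single M).gr ε i j k) : (singleHom f).f x ∈ (single M').gr ε i j k :=
  IsHomogeneous.ite_bot_mem f.f.toAddMonoidHom id (fun _ => hf) hx

/-- A two-term complex over `A`, regarded as a complex over `R`, as a cone. -/
def coneTwoTerm (φ : R →+* A) {M₀ M₁ : MF A} (f : MF.Hom M₀ M₁) (hw : M₁.w = M₀.w) (w : R)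
    (h : φ w = M₀.w) (h' : φ w = M₁.w)
    (hw' : (single (M₁.comap φ w h')).w = (single (M₀.comap φ w h)).w) :
    Iso φ (cone (singleHom (f.comap φ w h h')) hw') (twoTerm 0 M₀ M₁ f hw) where
  e := AddEquiv.refl (M₀.carrier × M₁.carrier)
  smul _ _ := rfl
  dmf _ := rfl
  dχ x := Prod.ext rfl (sub_zero (f.f x.1))
  s _ := rfl
  t x := by
    refine Prod.ext ?_ ?_
    · exact (one_zsmul (G := M₀.carrier) x.1).symm
    · exact (one_zsmul (G := M₁.carrier) (-x.2)).symm
  gr {ε i j k x} hx := ⟨hx.1, IsHomogeneous.ite_bot_mem (AddMonoidHom.id M₁.carrier)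
    (fun h : i - 1 = 0 => by omega) (fun _ h => h) hx.2⟩
  gr_symm {ε i j k x} hx := ⟨hx.1, IsHomogeneous.ite_bot_mem (AddMonoidHom.id M₁.carrier)
    (fun h : i = 0 + 1 => by omega) (fun _ h => h) hx.2⟩

section TwoTermTens

/-- The tensor product with `R ⊕ R`. -/
def prodTensEquiv (M₀ M₁ : Type) [AddCommGroup M₀] [Module R M₀] [AddCommGroup M₁] [Module R M₁] :
    (M₀ × M₁) ⊗[R] (R × R) ≃ₗ[R] (M₀ × M₀) × (M₁ × M₁) :=
  TensorProduct.prodRight R R (M₀ × M₁) R R ≪≫ₗ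
    ((TensorProduct.rid R _).prodCongr (TensorProduct.rid R _)) ≪≫ₗ
    LinearEquiv.prodProdProdComm R M₀ M₁ M₀ M₁

theorem prodTensEquiv_tmul (M₀ M₁ : Type) [AddCommGroup M₀] [Module R M₀] [AddCommGroup M₁]
    [Module R M₁] (x : M₀ × M₁) (y : R × R) : prodTensEquiv M₀ M₁ (x ⊗ₜ[R] y) =
      ((y.1 • x.1, y.2 • x.1), (y.1 • x.2, y.2 • x.2)) := by
  simp [prodTensEquiv]

theorem prodTensEquiv_symm (M₀ M₁ : Type) [AddCommGroup M₀] [Module R M₀] [AddCommGroup M₁]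
    [Module R M₁] (x : M₀ × M₀) (y : M₁ × M₁) : (prodTensEquiv M₀ M₁).symm (x, y) =
      ((x.1, 0) ⊗ₜ[R] (1, 0) + (x.2, 0) ⊗ₜ[R] (0, 1)) +
        ((0, y.1) ⊗ₜ[R] (1, 0) + (0, y.2) ⊗ₜ[R] (0, 1)) := by
  rw [LinearEquiv.symm_apply_eq]
  simp [prodTensEquiv_tmul]

/-- The tensor product of a two-term complex with a row. -/
def twoTermTens (i₀ : ℤ) {M₀ M₁ : MF R} (f : MF.Hom M₀ M₁) (hw : M₁.w = M₀.w)
    {g : ℤ → ℤ → AddSubgroup R} (hg : IsGradedRing g) {N : ℕ} (h₀ : M₀.IsHomogeneous g N)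
    (h₁ : M₁.IsHomogeneous g N) (a₀ a₁ : R) (p q : ℤ)
    (hw' : (M₁.row N a₀ a₁ p q).w = (M₀.row N a₀ a₁ p q).w) :
    Iso (RingHom.id R) ((twoTerm i₀ M₀ M₁ f hw).tens (single ((MF.base g).row N a₀ a₁ p q)))
      (twoTerm i₀ (M₀.row N a₀ a₁ p q) (M₁.row N a₀ a₁ p q) (f.row N a₀ a₁ p q) hw') :=
  let e := prodTensEquiv (R := R) M₀.carrier M₁.carrier
  have he : ∀ x y, e (x ⊗ₜ[R] y) = _ := prodTensEquiv_tmul M₀.carrier M₁.carrier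
  have one_mem : (1 : R) ∈ (MF.base g).gr 0 0 0 := hg.one_mem
  have gr_eq : ∀ {i ε j k} {x : M₀.carrier × M₁.carrier} {y : R × R},
      x ∈ (twoTerm i₀ M₀ M₁ f hw).gr ε i j k → ∀ {ε' i' j' k'},
      y ∈ (single ((MF.base g).row N a₀ a₁ p q)).gr ε' i' j' k' →
      e (x ⊗ₜ[R] y) ∈ (twoTerm i₀ (M₀.row N a₀ a₁ p q) (M₁.row N a₀ a₁ p q)
        (f.row N a₀ a₁ p q) hw').gr (ε + ε') (i + i') (j + j') (k + k') := by
    rintro i ε j k ⟨x₀, x₁⟩ ⟨r, s⟩ hx ε' i' j' k' hy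
    suffices H : ∀ (x₀ : M₀.carrier) (x₁ : M₁.carrier) (r s : R),
        x₀ ∈ (if i = i₀ then M₀.gr ε j k else ⊥) → x₁ ∈ (if i = i₀ + 1 then M₁.gr ε j k else ⊥) →
        (r, s) ∈ (if i' = 0 then ((MF.base g).gr ε' j' k').prod
          ((MF.base g).gr (ε' + 1) (j' - (1 - p)) (k' - (N + 1 - q))) else ⊥) →
        e ((x₀, x₁) ⊗ₜ[R] (r, s)) ∈ (twoTerm i₀ (M₀.row N a₀ a₁ p q) (M₁.row N a₀ a₁ p q)
          (f.row N a₀ a₁ p q) hw').gr (ε + ε') (i + i') (j + j') (k + k') from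
      H _ _ _ _ hx.1 hx.2 hy
    clear hx hy x₀ x₁ r s
    intro x₀ x₁ r s hx₀ hx₁ hy
    split_ifs at hy with hi
    · subst hi
      rw [add_zero, he]
      have key : ∀ {P : Prop} [Decidable P] {M : MF R}, M.IsHomogeneous g N → ∀ {x : M.carrier},
          x ∈ (if P then M.gr ε j k else ⊥) → ((r • x, s • x) : M.carrier × M.carrier) ∈
            (if P then (M.row N a₀ a₁ p q).gr (ε + ε') (j + j') (k + k') else ⊥) := by
        intro P _ M hM x hx
        split_ifs at hx ⊢
        · exact ⟨hM.base_smul_mem hy.1 hx, MF.IsHomogeneous.gr_congr (hM.base_smul_mem hy.2 hx) (by ring)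
            (by ring) (by ring)⟩
        · rw [(AddSubgroup.mem_bot).1 hx, smul_zero, smul_zero]
          exact zero_mem _
      exact ⟨key h₀ hx₀, key h₁ hx₁⟩
    · obtain ⟨rfl, rfl⟩ := Prod.mk_eq_zero.1 ((AddSubgroup.mem_bot).1 hy)
      have h0 : e ((x₀, x₁) ⊗ₜ[R] ((0, 0) : R × R)) = 0 :=
        (congrArg e (TensorProduct.tmul_zero (R := R) (R × R) (x₀, x₁))).trans (map_zero e)
      exact h0 ▸ zero_mem _
  isoOfTens (C := twoTerm i₀ M₀ M₁ f hw) (D := single ((MF.base g).row N a₀ a₁ p q))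
    (E := twoTerm i₀ (M₀.row N a₀ a₁ p q) (M₁.row N a₀ a₁ p q) (f.row N a₀ a₁ p q) hw')
    e.toAddEquiv (fun r x => map_smul e r x)
    (by
      rintro ⟨x₀, x₁⟩ ⟨r, s⟩
      suffices H : ∀ (x₀ : M₀.carrier) (x₁ : M₁.carrier) (r s : R), e ((M₀.d x₀, M₁.d x₁) ⊗ₜ[R] (r, s)) + e ((M₀.s x₀, M₁.s x₁) ⊗ₜ[R]
          rowD 0 LinearMap.id a₀ a₁ (r, s)) = ((rowD M₀.d M₀.s a₀ a₁).prodMap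
            (rowD M₁.d M₁.s a₀ a₁)) (e ((x₀, x₁) ⊗ₜ[R] (r, s))) from H _ _ _ _
      intro x₀ x₁ r s
      rw [he, he, he]
      simp [mul_smul])
    (by
      rintro ⟨x₀, x₁⟩ ⟨r, s⟩
      suffices H : ∀ (z : M₀.carrier × M₁.carrier) (x₀ : M₀.carrier) (x₁ : M₁.carrier) (r s : R),
          e ((0, f.f x₀) ⊗ₜ[R] (r, s)) + e (z ⊗ₜ[R] (0 : R × R)) = (0, (f.f.prodMap f.f) (e ((x₀, x₁) ⊗ₜ[R] (r, s))).1) from H _ _ _ _ _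
      intro z x₀ x₁ r s
      rw [TensorProduct.tmul_zero, map_zero, he, he]
      simp)
    (by
      rintro ⟨x₀, x₁⟩ ⟨r, s⟩
      suffices H : ∀ (x₀ : M₀.carrier) (x₁ : M₁.carrier) (r s : R), e ((M₀.s x₀, M₁.s x₁) ⊗ₜ[R] (r, -s)) = ((rowS M₀.s).prodMap
            (rowS M₁.s)) (e ((x₀, x₁) ⊗ₜ[R] (r, s))) from H _ _ _ _
      intro x₀ x₁ r s
      rw [he, he]
      simp)
    (by
      rintro ⟨x₀, x₁⟩ ⟨r, s⟩
      suffices H : ∀ (x₀ : M₀.carrier) (x₁ : M₁.carrier) (r s : R), e ((((i₀.negOnePow : ℤ) • x₀, (i₀.negOnePow : ℤ) • -x₁) :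
          M₀.carrier × M₁.carrier) ⊗ₜ[R] (r, s)) =
          ((i₀.negOnePow : ℤ) • (e ((x₀, x₁) ⊗ₜ[R] (r, s))).1,
            (i₀.negOnePow : ℤ) • -(e ((x₀, x₁) ⊗ₜ[R] (r, s))).2) from H _ _ _ _
      intro x₀ x₁ r s
      rw [he, he]
      refine Prod.ext (Prod.ext ?_ ?_) (Prod.ext ?_ ?_)
      · exact smul_comm r _ x₀
      · exact smul_comm s _ x₀
      · exact (smul_comm r _ _).trans (congrArg _ (smul_neg r x₁))
      · exact (smul_comm s _ _).trans (congrArg _ (smul_neg s x₁)))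
    (fun hx hy => gr_eq hx hy)
    (by
      rintro ε i j k ⟨⟨x₁, x₂⟩, ⟨y₁, y₂⟩⟩ hz
      have e₁ : ((1 : R), (0 : R)) ∈ (single ((MF.base g).row N a₀ a₁ p q)).gr 0 0 0 0 := by
        exact ⟨one_mem, zero_mem _⟩
      have e₂ : ((0 : R), (1 : R)) ∈ (single ((MF.base g).row N a₀ a₁ p q)).gr 1 0 (1 - p)
          (N + 1 - q) := by
        refine ⟨zero_mem _, MF.IsHomogeneous.gr_congr (M := MF.base g) one_mem ?_ ?_ ?_⟩
        · decide
        · ring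
        · ring
      have key : ∀ {P : Prop} [Decidable P] {M : MF R} {x y : M.carrier},
          ((x, y) : M.carrier × M.carrier) ∈
            (if P then (M.row N a₀ a₁ p q).gr ε j k else ⊥) →
          x ∈ (if P then M.gr ε j k else ⊥) ∧
            y ∈ (if P then M.gr (ε + 1) (j - (1 - p)) (k - (N + 1 - q)) else ⊥) := by
        intro P _ M x y h
        split_ifs at h ⊢
        · exact ⟨h.1, h.2⟩
        · have h' := (AddSubgroup.mem_bot).1 h
          exact ⟨congrArg Prod.fst h', congrArg Prod.snd h'⟩
      obtain ⟨hx₁, hx₂⟩ := key hz.1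
      obtain ⟨hy₁, hy₂⟩ := key hz.2
      have h := add_mem
        (add_mem (tmul_mem_tens_gr (C := twoTerm i₀ M₀ M₁ f hw)
            (x := ((x₁, 0) : M₀.carrier × M₁.carrier)) ⟨hx₁, zero_mem _⟩ e₁
            (add_zero ε) (add_zero i) (add_zero j) (add_zero k))
          (tmul_mem_tens_gr (C := twoTerm i₀ M₀ M₁ f hw)
            (x := ((x₂, 0) : M₀.carrier × M₁.carrier)) ⟨hx₂, zero_mem _⟩ e₂
            (zmod_two_add_one_add_one ε) (add_zero i) (sub_add_cancel j _) (sub_add_cancel k _)))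
        (add_mem (tmul_mem_tens_gr (C := twoTerm i₀ M₀ M₁ f hw)
            (x := ((0, y₁) : M₀.carrier × M₁.carrier)) ⟨zero_mem _, hy₁⟩ e₁
            (add_zero ε) (add_zero i) (add_zero j) (add_zero k))
          (tmul_mem_tens_gr (C := twoTerm i₀ M₀ M₁ f hw)
            (x := ((0, y₂) : M₀.carrier × M₁.carrier)) ⟨zero_mem _, hy₂⟩ e₂
            (zmod_two_add_one_add_one ε) (add_zero i) (sub_add_cancel j _) (sub_add_cancel k _)))
      exact (prodTensEquiv_symm (R := R) M₀.carrier M₁.carrier (x₁, x₂) (y₁, y₂)) ▸ h)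

end TwoTermTens

/-- Homotopy equivalences commuting with two morphisms give equivalent arrows. -/
def ArrowEquiv.ofHEquiv {φ : R →+* A} {φ' : R →+* A'} {M₀ M₁ : MF A} {N₀ N₁ : MF A'}
    (E₀ : MF.HEquiv φ φ' M₀ N₀) (E₁ : MF.HEquiv φ φ' M₁ N₁) (f : MF.Hom M₀ M₁) (g : MF.Hom N₀ N₁)
    (comm : ∀ x, E₁.c (f.f x) = g.f (E₀.c x)) (w : R) (h₀ : φ w = M₀.w) (h₁ : φ w = M₁.w)
    (h₀' : φ' w = N₀.w) (h₁' : φ' w = N₁.w) :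
    ArrowEquiv (singleHom (f.comap φ w h₀ h₁)) (singleHom (g.comap φ' w h₀' h₁')) where
  q₀ := singleHom (E₀.cHom w h₀ h₀')
  q₁ := singleHom (E₁.cHom w h₁ h₁')
  i₀ := singleHom (E₀.eHom w h₀ h₀')
  i₁ := singleHom (E₁.eHom w h₁ h₁')
  θ :=
    { f := 0
      f_dmf := fun x => ((single (M₀.comap φ w h₀)).dmf.map_zero).symm
      f_dχ := fun x => ((single (M₀.comap φ w h₀)).dχ.map_zero).symm
      f_s := fun x => ((single (M₀.comap φ w h₀)).s.map_zero).symm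
      f_t := fun x => ((single (M₀.comap φ w h₀)).t.map_zero).symm }
  θ' :=
    { f := 0
      f_dmf := fun x => ((single (N₀.comap φ' w h₀')).dmf.map_zero).symm
      f_dχ := fun x => ((single (N₀.comap φ' w h₀')).dχ.map_zero).symm
      f_s := fun x => ((single (N₀.comap φ' w h₀')).s.map_zero).symm
      f_t := fun x => ((single (N₀.comap φ' w h₀')).t.map_zero).symm }
  q₀_gr := singleHom_mem (E₀.cHom w h₀ h₀') fun h => E₀.c_gr h
  q₁_gr := singleHom_mem (E₁.cHom w h₁ h₁') fun h => E₁.c_gr h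
  i₀_gr := singleHom_mem (E₀.eHom w h₀ h₀') fun h => E₀.e_gr h
  i₁_gr := singleHom_mem (E₁.eHom w h₁ h₁') fun h => E₁.e_gr h
  θ_gr _ := zero_mem _
  θ'_gr _ := zero_mem _
  q_f := Homotopic.of_eq comm
  f_i := ⟨(E₁.eHom w h₁ h₁').f ∘ₗ (g.comap φ' w h₀' h₁').f ∘ₗ E₀.ηHom' w h₀' -
      E₁.ηHom w h₁ ∘ₗ (f.comap φ w h₀ h₁).f ∘ₗ (E₀.eHom w h₀ h₀').f, by
    suffices H : ∀ y : N₀.carrier, E₁.e (g.f (E₀.η' (N₀.s y))) - E₁.η (f.f (E₀.e (N₀.s y))) =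
      -M₁.s (E₁.e (g.f (E₀.η' y)) - E₁.η (f.f (E₀.e y))) from H
    intro y
    rw [E₀.η'_s, map_neg, g.f_s, map_neg, E₁.e_s, E₀.e_s, f.f_s, E₁.η_s, map_sub]
    abel, by
    suffices H : ∀ y : N₀.carrier, f.f (E₀.e y) = E₁.e (g.f y) +
      (M₁.d (E₁.e (g.f (E₀.η' y)) - E₁.η (f.f (E₀.e y))) +
        (E₁.e (g.f (E₀.η' (N₀.d y))) - E₁.η (f.f (E₀.e (N₀.d y))))) from H
    intro y
    have h := E₁.e_c (f.f (E₀.e y))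
    rw [comm, E₀.c_e, map_add, map_add, map_add, map_add, g.f_d, E₁.e_d] at h
    rw [map_sub, E₀.e_d, f.f_d, ← sub_eq_zero, ← sub_eq_zero.2 h.symm]
    abel⟩
  i_q₀ := ⟨E₀.ηHom w h₀, E₀.η_s, fun x => (E₀.e_c x).trans
    (congrArg (· + _) (add_zero x).symm)⟩
  i_q₁ := ⟨E₁.ηHom w h₁, E₁.η_s, fun x => (E₁.e_c x).trans
    (congrArg (· + _) ((congrArg (x + ·) (map_zero f.f)).trans (add_zero x)).symm)⟩
  q_i₀ := ⟨E₀.ηHom' w h₀', E₀.η'_s, fun x => (E₀.c_e x).trans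
    (congrArg (· + _) (add_zero x).symm)⟩
  q_i₁ := ⟨E₁.ηHom' w h₁', E₁.η'_s, fun x => (E₁.c_e x).trans
    (congrArg (· + _) ((congrArg (x + ·) (map_zero g.f)).trans (add_zero x)).symm)⟩

end Cx

/-! ### Division by monic homogeneous polynomials -/

section Division

variable {R : Type} [CommRing R] {g : ℤ → ℤ → AddSubgroup R}

theorem X_pow_succ_divMod [Nontrivial R] {p : R[X]} (hp : p.Monic) {d : ℕ}
    (hd : p.natDegree = d + 1) (m : ℕ) :
    Polynomial.X ^ (m + 1) /ₘ p = Polynomial.X * (Polynomial.X ^ m /ₘ p) +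
        Polynomial.C ((Polynomial.X ^ m %ₘ p).coeff d) ∧
      Polynomial.X ^ (m + 1) %ₘ p = Polynomial.X * (Polynomial.X ^ m %ₘ p) -
        Polynomial.C ((Polynomial.X ^ m %ₘ p).coeff d) * p := by
  refine Polynomial.div_modByMonic_unique _ _ hp ⟨?_, ?_⟩
  · linear_combination Polynomial.X * Polynomial.modByMonic_add_div (Polynomial.X ^ m) p
  · set r := Polynomial.X ^ m %ₘ p with hr
    have hrd : r.degree < (d + 1 : ℕ) := by
      rw [← hd, ← Polynomial.degree_eq_natDegree hp.ne_zero]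
      exact Polynomial.degree_modByMonic_lt _ hp
    rw [Polynomial.degree_eq_natDegree hp.ne_zero, hd, Polynomial.degree_lt_iff_coeff_zero]
    intro n hn
    rw [Polynomial.coeff_sub, Polynomial.coeff_C_mul]
    obtain _ | n := n
    · omega
    rw [Polynomial.coeff_X_mul]
    rcases Nat.eq_or_lt_of_le (Nat.le_of_succ_le_succ hn) with rfl | h
    · rw [← hd, hp.coeff_natDegree, mul_one, sub_self]
    · rw [(Polynomial.degree_lt_iff_coeff_zero _ _).1 hrd n h,
        Polynomial.coeff_eq_zero_of_natDegree_lt (p := p) (by omega), mul_zero, sub_zero]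

theorem X_pow_divMod_mem [Nontrivial R] (hg : IsGradedRing g) {p : R[X]} (hp : p.Monic) {d : ℕ}
    (hd : p.natDegree = d + 1) (hpg : p ∈ polyGrading g 0 (2 * (d + 1 : ℕ))) : ∀ m : ℕ,
    Polynomial.X ^ m /ₘ p ∈ polyGrading g 0 (2 * m - 2 * (d + 1 : ℕ)) ∧
      Polynomial.X ^ m %ₘ p ∈ polyGrading g 0 (2 * m)
  | 0 => by
    have h : (Polynomial.X ^ 0 : R[X]).degree < p.degree := by
      rw [pow_zero, Polynomial.degree_one, Polynomial.degree_eq_natDegree hp.ne_zero, hd]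
      exact_mod_cast Nat.succ_pos d
    rw [(Polynomial.divByMonic_eq_zero_iff hp).2 h, (Polynomial.modByMonic_eq_self_iff hp).2 h,
      pow_zero]
    exact ⟨zero_mem _, hg.poly.one_mem⟩
  | m + 1 => by
    obtain ⟨h₁, h₂⟩ := X_pow_divMod_mem hg hp hd hpg m
    obtain ⟨e₁, e₂⟩ := X_pow_succ_divMod hp hd m
    have h₃ := h₂ d
    rw [e₁, e₂]
    exact ⟨add_mem (hg.poly.mul_mem' (X_mem_polyGrading hg) h₁ (by ring) (by push_cast; ring))
        (mem_of_mem (C_mem_polyGrading h₃) (by ring) (by push_cast; ring)),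
      sub_mem (hg.poly.mul_mem' (X_mem_polyGrading hg) h₂ (by ring) (by push_cast; ring))
        (hg.poly.mul_mem' (C_mem_polyGrading h₃) hpg (by ring) (by push_cast; ring))⟩

/-- Division by a monic polynomial as an additive map. -/
def divByMonicHom [Nontrivial R] {p : R[X]} (hp : p.Monic) : R[X] →+ R[X] :=
  AddMonoidHom.mk' (· /ₘ p) fun x y => (Polynomial.div_modByMonic_unique _ (x %ₘ p + y %ₘ p) hp
    ⟨by linear_combination Polynomial.modByMonic_add_div x p + Polynomial.modByMonic_add_div y p,
      (Polynomial.degree_add_le _ _).trans_lt (max_lt (Polynomial.degree_modByMonic_lt _ hp)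
        (Polynomial.degree_modByMonic_lt _ hp))⟩).1

theorem divByMonicHom_C_mul [Nontrivial R] {p : R[X]} (hp : p.Monic) (r : R) (x : R[X]) :
    divByMonicHom hp (Polynomial.C r * x) = Polynomial.C r * divByMonicHom hp x :=
  (Polynomial.div_modByMonic_unique _ (Polynomial.C r * (x %ₘ p)) hp
    ⟨by
      change _ + p * (Polynomial.C r * (x /ₘ p)) = _
      linear_combination Polynomial.C r * Polynomial.modByMonic_add_div x p, by
      rw [← Polynomial.smul_eq_C_mul]
      exact (Polynomial.degree_smul_le _ _).trans_lt (Polynomial.degree_modByMonic_lt _ hp)⟩).1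

/-- Division by a monic homogeneous polynomial is homogeneous. -/
theorem divByMonic_mem [Nontrivial R] (hg : IsGradedRing g) {p : R[X]} (hp : p.Monic) {d : ℕ}
    (hd : p.natDegree = d) (hpg : p ∈ polyGrading g 0 (2 * d)) {j k : ℤ} {x : R[X]}
    (hx : x ∈ polyGrading g j k) :
    divByMonicHom hp x ∈ polyGrading g j (k - 2 * d) := by
  obtain _ | d := d
  · have h : divByMonicHom hp x = x := by
      change x /ₘ p = x
      rw [hp.natDegree_eq_zero.1 hd, Polynomial.divByMonic_one]
    rw [h]
    simpa using hx
  · refine map_mem_of_mem_polyGrading (divByMonicHom hp) _ (fun m r hr => ?_) hx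
    rw [divByMonicHom_C_mul]
    exact hg.poly.mul_mem' (C_mem_polyGrading hr) (X_pow_divMod_mem hg hp hd hpg m).1 (by ring)
      (by ring)

end Division

section Leading

variable {R : Type} [CommRing R]

/-- The leading coefficient of the polynomial in the second row of the contraction of `Γ₁`, when
two ends of the crossing are joined. -/
theorem U₂_joined (b t : R) : ∀ n : ℕ,
    (U₂ (n + 2) (Polynomial.C t + Polynomial.X) (Polynomial.X * Polynomial.C b)
      (Polynomial.C t * Polynomial.X)).natDegree ≤ n ∧
    (U₂ (n + 2) (Polynomial.C t + Polynomial.X) (Polynomial.X * Polynomial.C b)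
      (Polynomial.C t * Polynomial.X)).coeff n = -(n + 2 : R)
  | 0 => by
    rw [show U₂ 2 (Polynomial.C t + Polynomial.X) (Polynomial.X * Polynomial.C b)
      (Polynomial.C t * Polynomial.X) = Polynomial.C (-2) by
        rw [show (-2 : R) = -(2 : ℕ) by norm_num, map_neg, map_natCast]; simp [U₂, psum2]]
    simp
  | 1 => by
    rw [show U₂ 3 (Polynomial.C t + Polynomial.X) (Polynomial.X * Polynomial.C b)
      (Polynomial.C t * Polynomial.X) = Polynomial.C (-3) * Polynomial.X + Polynomial.C (-3 * t) by
        rw [show (-3 : R) = -(3 : ℕ) by norm_num, map_mul, map_neg, map_natCast]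
        simp [U₂, psum2]; ring]
    refine ⟨Polynomial.natDegree_linear_le, ?_⟩
    simp
    norm_num
  | n + 2 => by
    obtain ⟨h₁, h₁'⟩ := U₂_joined b t (n + 1)
    obtain ⟨h₀, -⟩ := U₂_joined b t n
    set u₁ := U₂ (n + 1 + 2) (Polynomial.C t + Polynomial.X) (Polynomial.X * Polynomial.C b)
      (Polynomial.C t * Polynomial.X) with hu₁
    set u₀ := U₂ (n + 2) (Polynomial.C t + Polynomial.X) (Polynomial.X * Polynomial.C b)
      (Polynomial.C t * Polynomial.X) with hu₀
    have e : U₂ (n + 2 + 2) (Polynomial.C t + Polynomial.X) (Polynomial.X * Polynomial.C b)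
      (Polynomial.C t * Polynomial.X) = Polynomial.C t * u₁ + u₁ * Polynomial.X -
        Polynomial.C b * u₀ * Polynomial.X - Polynomial.X ^ (n + 2) - Polynomial.C (t ^ (n + 2)) := by
      rw [U₂, psum2_eq, hu₁, hu₀, map_pow]
      ring
    rw [e]
    constructor
    · rw [Polynomial.natDegree_le_iff_coeff_eq_zero]
      intro m hm
      obtain ⟨m, rfl⟩ : ∃ k, m = k + 1 := ⟨m - 1, by omega⟩
      simp only [Polynomial.coeff_sub, Polynomial.coeff_add, Polynomial.coeff_C_mul,
        Polynomial.coeff_mul_X, Polynomial.coeff_X_pow, Polynomial.coeff_C_succ]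
      rw [Polynomial.coeff_eq_zero_of_natDegree_lt (p := u₁) (by omega),
        Polynomial.coeff_eq_zero_of_natDegree_lt (p := u₁) (by omega),
        Polynomial.coeff_eq_zero_of_natDegree_lt (p := u₀) (by omega), if_neg (by omega)]
      simp
    · simp only [Polynomial.coeff_sub, Polynomial.coeff_add, Polynomial.coeff_C_mul,
        Polynomial.coeff_mul_X, Polynomial.coeff_X_pow, Polynomial.coeff_C_succ]
      rw [Polynomial.coeff_eq_zero_of_natDegree_lt (p := u₁) (by omega), h₁',
        Polynomial.coeff_eq_zero_of_natDegree_lt (p := u₀) (by omega), if_pos trivial]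
      push_cast
      ring

end Leading

/-! ### Straightening the joined crossing -/

/-- An isomorphism of matrix factorizations as a homotopy equivalence. -/
def MF.HEquiv.ofEquiv {R : Type} [CommRing R] {M M' : MF R} (c : Hom M M')
    (e : M'.carrier → M.carrier) (e_c : ∀ x, e (c.f x) = x) (c_e : ∀ x, c.f (e x) = x)
    (c_gr : ∀ {ε j k x}, x ∈ M.gr ε j k → c.f x ∈ M'.gr ε j k)
    (e_gr : ∀ {ε j k x}, x ∈ M'.gr ε j k → e x ∈ M.gr ε j k) :
    HEquiv (RingHom.id R) (RingHom.id R) M M' :=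
  let E : M.carrier ≃ₗ[R] M'.carrier := { c.f with invFun := e, left_inv := e_c, right_inv := c_e }
  have hE : ∀ y, E.symm y = e y := fun _ => rfl
  { c := c.f.toAddMonoidHom
    e := E.symm.toLinearMap.toAddMonoidHom
    c_smul := fun r x => c.f.map_smul r x
    e_smul := fun r x => E.symm.map_smul r x
    c_d := c.f_d
    e_d := fun x => E.injective ((E.apply_symm_apply _).trans
      ((congrArg M'.d (E.apply_symm_apply x).symm).trans (c.f_d _).symm))
    c_s := c.f_s
    e_s := fun x => E.injective ((E.apply_symm_apply _).trans
      ((congrArg M'.s (E.apply_symm_apply x).symm).trans (c.f_s _).symm))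
    c_gr := c_gr
    e_gr := e_gr
    η := 0
    η' := 0
    η_smul := fun r _ => (smul_zero r).symm
    η'_smul := fun r _ => (smul_zero r).symm
    η_s := fun x => by simp
    η'_s := fun x => by simp
    e_c := fun x => (e_c x).trans (by simp)
    c_e := fun x => (c_e x).trans (by simp) }

section Straighten

variable {R : Type} [CommRing R] (N : ℕ) (g : ℤ → ℤ → AddSubgroup R) (a x b t : R)

/-- The polynomial in the second row of the contraction of `Γ₁`, when the ends `x₁` and `y₂` of the
crossing are joined. -/
def joinedPoly : R := U₂ (N + 1) (t + x) (x * b) (t * x)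

/-- The matrix factorization isomorphic to that of `Γ₀` when `x₁` and `y₂` are joined. -/
def straight₀ : MF R := (arcMF N g a b t).row N (a * ((t - x) * joinedPoly N x b t)) 0 2 (2 * N)

/-- The matrix factorization isomorphic to that of `Γ₁` when `x₁` and `y₂` are joined. -/
def straight₁ : MF R :=
  ((arcMF N g a b t).row N (a * joinedPoly N x b t) 0 2 (2 * N - 2)).shift 0 (-1)

/-- The morphism corresponding to `χ⁰`. -/
def straightHom : MF.Hom (straight₀ N g a x b t) (straight₁ N g a x b t) where
  f := (((t - x) • (LinearMap.id : R × R →ₗ[R] R × R)).prodMap LinearMap.id :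
    (R × R) × (R × R) →ₗ[R] (R × R) × (R × R))
  f_d := by
    suffices H : ∀ α β l u₁ u₂ u₃ u₄ : R, ((t - x) • (LinearMap.id : R × R →ₗ[R] R × R)).prodMap
        LinearMap.id (kosD α β (a * ((t - x) * l)) 0 ((u₁, u₂), (u₃, u₄))) = kosD α β (a * l) 0
          (((t - x) • (LinearMap.id : R × R →ₗ[R] R × R)).prodMap LinearMap.id
            ((u₁, u₂), (u₃, u₄))) from fun u => H _ _ _ u.1.1 u.1.2 u.2.1 u.2.2
    intro α β l u₁ u₂ u₃ u₄
    simp only [kosD_apply, LinearMap.prodMap_apply, LinearMap.smul_apply, LinearMap.id_apply,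
      Prod.smul_mk, smul_eq_mul]
    refine Prod.ext (Prod.ext ?_ ?_) (Prod.ext ?_ ?_) <;> simp only [] <;> ring
  f_s := by
    suffices H : ∀ u₁ u₂ u₃ u₄ : R, ((t - x) • (LinearMap.id : R × R →ₗ[R] R × R)).prodMap
        LinearMap.id (rowS (rowS (LinearMap.id : R →ₗ[R] R)) ((u₁, u₂), (u₃, u₄))) =
        rowS (rowS LinearMap.id)
          (((t - x) • (LinearMap.id : R × R →ₗ[R] R × R)).prodMap LinearMap.id
            ((u₁, u₂), (u₃, u₄))) from fun u => H u.1.1 u.1.2 u.2.1 u.2.2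
    intro u₁ u₂ u₃ u₄
    simp

/-- The isomorphism for `Γ₀`, as a morphism. -/
def parallelStraighten : MF.Hom (parallelMF N g a x b x t) (straight₀ N g a x b t) where
  f := ({ toFun := fun u => (u.1, (u.2.1 - u.1.2, u.2.2 + a * twist (N + 1) x b x t * u.1.1))
          map_add' := fun u v => by
            refine Prod.ext rfl (Prod.ext ?_ ?_) <;> simp only [Prod.fst_add, Prod.snd_add] <;> ring
          map_smul' := fun r u => by
            refine Prod.ext rfl (Prod.ext ?_ ?_) <;>
            simp only [Prod.smul_fst, Prod.smul_snd, smul_eq_mul, RingHom.id_apply] <;> ring } :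
    (R × R) × (R × R) →ₗ[R] (R × R) × (R × R))
  f_d := by
    have h₁ := twist_mul x b x t (N + 1)
    have h₂ := twist_mul' x b x t (N + 1)
    suffices H : ∀ u₁ u₂ u₃ u₄ : R, ∀ F : (R × R) × (R × R) → (R × R) × (R × R),
        (∀ u, F u = (u.1, (u.2.1 - u.1.2, u.2.2 + a * twist (N + 1) x b x t * u.1.1))) →
        F (kosD (a * powDiff (N + 1) b t) (b - t) (a * powDiff (N + 1) x x) (x - x)
          ((u₁, u₂), (u₃, u₄))) =
        kosD (a * powDiff (N + 1) b t) (b - t) (a * ((t - x) * joinedPoly N x b t)) 0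
          (F ((u₁, u₂), (u₃, u₄))) from fun u => H u.1.1 u.1.2 u.2.1 u.2.2 _ fun _ => rfl
    intro u₁ u₂ u₃ u₄ F hF
    rw [hF, hF, kosD_apply, kosD_apply, joinedPoly]
    refine Prod.ext (Prod.ext ?_ ?_) (Prod.ext ?_ ?_) <;> simp only []
    · ring
    · ring
    · linear_combination (-a * u₁) * h₁ - (a * u₁) * h₂
    · linear_combination (a * u₂) * h₁ + (a * u₂) * h₂
  f_s := by
    suffices H : ∀ k u₁ u₂ u₃ u₄ : R, ∀ F : (R × R) × (R × R) → (R × R) × (R × R),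
        (∀ u, F u = (u.1, (u.2.1 - u.1.2, u.2.2 + k * u.1.1))) →
        F (rowS (rowS (LinearMap.id : R →ₗ[R] R)) ((u₁, u₂), (u₃, u₄))) =
          rowS (rowS (LinearMap.id : R →ₗ[R] R)) (F ((u₁, u₂), (u₃, u₄))) from
      fun u => H (a * twist (N + 1) x b x t) u.1.1 u.1.2 u.2.1 u.2.2 _ fun _ => rfl
    intro k u₁ u₂ u₃ u₄ F hF
    rw [hF, hF]
    refine Prod.ext rfl (Prod.ext ?_ ?_) <;> simp <;> ring

/-- The isomorphism for `Γ₁`, as a morphism. -/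
def contractedStraighten : MF.Hom (contractedMF N g a x b x t) (straight₁ N g a x b t) where
  f := ({ toFun := fun u => ((u.1.1, u.1.2 + x * u.2.1), u.2)
          map_add' := fun u v => by
            refine Prod.ext (Prod.ext rfl ?_) rfl; simp only [Prod.fst_add, Prod.snd_add]; ring
          map_smul' := fun r u => by
            refine Prod.ext (Prod.ext rfl ?_) rfl
            simp only [Prod.smul_fst, Prod.smul_snd, smul_eq_mul, RingHom.id_apply]; ring } :
    (R × R) × (R × R) →ₗ[R] (R × R) × (R × R))
  f_d := by
    have h₁ := twist_mul x b x t (N + 1)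
    suffices H : ∀ u₁ u₂ u₃ u₄ : R, ∀ F : (R × R) × (R × R) → (R × R) × (R × R),
        (∀ u, F u = ((u.1.1, u.1.2 + x * u.2.1), u.2)) →
        F (kosD (a * U₁ (N + 1) (x + b) (t + x) (x * b)) (x + b - (t + x))
          (a * U₂ (N + 1) (t + x) (x * b) (t * x)) (x * b - t * x) ((u₁, u₂), (u₃, u₄))) =
        kosD (a * powDiff (N + 1) b t) (b - t) (a * joinedPoly N x b t) 0
          (F ((u₁, u₂), (u₃, u₄))) from fun u => H u.1.1 u.1.2 u.2.1 u.2.2 _ fun _ => rfl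
    intro u₁ u₂ u₃ u₄ F hF
    rw [hF, hF, kosD_apply, kosD_apply, joinedPoly]
    refine Prod.ext (Prod.ext ?_ ?_) (Prod.ext ?_ ?_) <;> simp only []
    · ring
    · linear_combination (-a * u₁) * h₁
    · ring
    · linear_combination (-a * u₃) * h₁
  f_s := by
    suffices H : ∀ u₁ u₂ u₃ u₄ : R, ∀ F : (R × R) × (R × R) → (R × R) × (R × R),
        (∀ u, F u = ((u.1.1, u.1.2 + x * u.2.1), u.2)) →
        F (rowS (rowS (LinearMap.id : R →ₗ[R] R)) ((u₁, u₂), (u₃, u₄))) =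
          rowS (rowS (LinearMap.id : R →ₗ[R] R)) (F ((u₁, u₂), (u₃, u₄))) from
      fun u => H u.1.1 u.1.2 u.2.1 u.2.2 _ fun _ => rfl
    intro u₁ u₂ u₃ u₄ F hF
    rw [hF, hF]
    refine Prod.ext (Prod.ext rfl ?_) rfl
    simp; ring

variable {g a x b t}

theorem twist_mem (hg : IsGradedRing g) (ha : a ∈ g 2 0) (hx : x ∈ g 0 2) (hb : b ∈ g 0 2)
    (ht : t ∈ g 0 2) : a * twist (N + 1) x b x t ∈ g 2 (2 * N - 2) :=
  hg.mul_mem' ha (hg.twist_mem hx hb hx ht (N + 1)) (by ring) (by push_cast; ring)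

/-- The isomorphism for `Γ₀`. -/
def parallelStraightenEquiv (hg : IsGradedRing g) (ha : a ∈ g 2 0) (hx : x ∈ g 0 2)
    (hb : b ∈ g 0 2) (ht : t ∈ g 0 2) : MF.HEquiv (RingHom.id R) (RingHom.id R)
      (parallelMF N g a x b x t) (straight₀ N g a x b t) :=
  have hk := twist_mem N hg ha hx hb ht
  .ofEquiv (parallelStraighten N g a x b t)
    (fun u : (R × R) × (R × R) =>
      (u.1, (u.2.1 + u.1.2, u.2.2 - a * twist (N + 1) x b x t * u.1.1)))
    (fun u => Prod.ext rfl (Prod.ext (sub_add_cancel _ _) (add_sub_cancel_right _ _)))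
    (fun u => Prod.ext rfl (Prod.ext (add_sub_cancel_right _ _) (sub_add_cancel _ _)))
    (fun {ε j k u} hu => ⟨hu.1, MF.sub_base_mem hu.2.1
        (MF.base_mem hu.1.2 rfl (by ring) (by ring)),
      MF.add_base_mem hu.2.2 (MF.mul_base_mem hg hk hu.1.1
        (zmod_two_add_one_add_one ε).symm (by ring) (by ring))⟩)
    (fun {ε j k u} hu => ⟨hu.1, MF.add_base_mem hu.2.1
        (MF.base_mem hu.1.2 rfl (by ring) (by ring)),
      MF.sub_base_mem hu.2.2 (MF.mul_base_mem hg hk hu.1.1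
        (zmod_two_add_one_add_one ε).symm (by ring) (by ring))⟩)

/-- The isomorphism for `Γ₁`. -/
def contractedStraightenEquiv (hg : IsGradedRing g) (hx : x ∈ g 0 2) :
    MF.HEquiv (RingHom.id R) (RingHom.id R)
      (contractedMF N g a x b x t) (straight₁ N g a x b t) :=
  .ofEquiv (contractedStraighten N g a x b t)
    (fun u : (R × R) × (R × R) => ((u.1.1, u.1.2 - x * u.2.1), u.2))
    (fun u => Prod.ext (Prod.ext rfl (add_sub_cancel_right _ _)) rfl)
    (fun u => Prod.ext (Prod.ext rfl (sub_add_cancel _ _)) rfl)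
    (fun {ε j k u} hu => ⟨⟨hu.1.1, MF.add_base_mem hu.1.2 (MF.mul_base_mem hg hx hu.2.1 rfl
        (by ring) (by ring))⟩, hu.2⟩)
    (fun {ε j k u} hu => ⟨⟨hu.1.1, MF.sub_base_mem hu.1.2 (MF.mul_base_mem hg hx hu.2.1 rfl
        (by ring) (by ring))⟩, hu.2⟩)

theorem straighten_jump₀ (hg : IsGradedRing g) (ha : a ∈ g 2 0) (hx : x ∈ g 0 2)
    (hb : b ∈ g 0 2) (ht : t ∈ g 0 2) (u : (R × R) × (R × R)) :
    (contractedStraightenEquiv (a := a) (b := b) (t := t) N hg hx).c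
      (jump₀ (a * twist (N + 1) x b x t) x t u) =
      (straightHom N g a x b t).f ((parallelStraightenEquiv N hg ha hx hb ht).c u) := by
  suffices H : ∀ k : R, (((t - x) * u.1.1, (t * u.1.2 - x * u.2.1) + x * (u.2.1 - u.1.2)),
      (u.2.1 - u.1.2, u.2.2 + k * u.1.1)) = (((t - x) * u.1.1, (t - x) * u.1.2),
      (u.2.1 - u.1.2, u.2.2 + k * u.1.1)) from H _
  intro k
  refine Prod.ext (Prod.ext rfl ?_) rfl
  change (t * u.1.2 - x * u.2.1) + x * (u.2.1 - u.1.2) = (t - x) * u.1.2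
  ring

end Straighten

/-! ### Removing the joined strand -/

section Split

variable {R : Type} [CommRing R]

/-- The data needed to split off the contractible summands of the straightened factorizations. -/
structure ArcSplitting (N : ℕ) (g : ℤ → ℤ → AddSubgroup R) (a b t : R) where
  Λ : R[X] →+ R
  e : R
  c : R
  Λ_C_mul : ∀ r s, Λ (Polynomial.C r * s) = r * Λ s
  Λ_mul : ∀ s, Λ (joinedPoly N Polynomial.X (Polynomial.C b) (Polynomial.C t) * s) =
    e * s.eval t
  joinedPoly_mul_e : joinedPoly N Polynomial.X (Polynomial.C b) (Polynomial.C t) * Polynomial.C e =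
    joinedPoly N Polynomial.X (Polynomial.C b) (Polynomial.C t)
  joinedPoly_mul_c : joinedPoly N Polynomial.X (Polynomial.C b) (Polynomial.C t) *
    Polynomial.C c = 0
  e_add_c : a * e + c * (a * powDiff (N + 1) b t) = a
  Λ_mem : ∀ {j k s}, s ∈ polyGrading g j k → Λ s ∈ g j (k - (2 * N - 2))
  e_mem : e ∈ g 0 0
  c_mem : c ∈ g 0 (-(2 * N))

theorem MF.addHom_base_mem {A : Type} [CommRing A] {g : ℤ → ℤ → AddSubgroup R}
    {g' : ℤ → ℤ → AddSubgroup A} (f : R →+ A) {ε ε' j k j' k'}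
    (hf : ∀ x ∈ g j k, f x ∈ g' j' k') {x : R} (hx : x ∈ (MF.base g).gr ε j k) (hε : ε = ε') :
    f x ∈ (MF.base g').gr ε' j' k' :=
  Cx.IsHomogeneous.ite_bot_mem f (fun h => hε ▸ h) hf hx

theorem ite_pair_mem {X Y Z : Type} [AddCommGroup X] [AddCommGroup Y] [AddCommGroup Z] {p : Prop}
    [Decidable p] {A : AddSubgroup X} {B : AddSubgroup Y} {C : AddSubgroup Z} (f : X → Y → Z)
    (h₀ : f 0 0 = 0) (h : ∀ {x y}, x ∈ A → y ∈ B → f x y ∈ C) {x : X} {y : Y}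
    (hx : x ∈ (if p then A else ⊥)) (hy : y ∈ (if p then B else ⊥)) :
    f x y ∈ (if p then C else ⊥) := by
  split_ifs at hx hy ⊢
  · exact h hx hy
  · rw [(AddSubgroup.mem_bot).1 hx, (AddSubgroup.mem_bot).1 hy, h₀]
    exact zero_mem _

theorem divByMonicHom_X_sub_C [Nontrivial R] (t : R) (s : R[X]) :
    (Polynomial.C t - Polynomial.X) * divByMonicHom (Polynomial.monic_X_sub_C t) s =
      Polynomial.C (s.eval t) - s := by
  have h := Polynomial.modByMonic_add_div s (Polynomial.X - Polynomial.C t)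
  rw [Polynomial.modByMonic_X_sub_C_eq_C_eval] at h
  change (Polynomial.C t - Polynomial.X) * (s /ₘ (Polynomial.X - Polynomial.C t)) = _
  linear_combination -h

theorem divByMonicHom_mul [Nontrivial R] (t : R) (s : R[X]) :
    divByMonicHom (Polynomial.monic_X_sub_C t) ((Polynomial.C t - Polynomial.X) * s) = -s := by
  have h := Polynomial.mul_divByMonic_cancel_left s (Polynomial.monic_X_sub_C t)
  rw [show (Polynomial.C t - Polynomial.X) * s = -((Polynomial.X - Polynomial.C t) * s) by ring,
    map_neg]
  exact congrArg Neg.neg h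

variable {N : ℕ} {g : ℤ → ℤ → AddSubgroup R} {a b t : R} (S : ArcSplitting N g a b t)

namespace ArcSplitting

/-- The polynomial in the second row. -/
abbrev pol (_ : ArcSplitting N g a b t) : R[X] :=
  joinedPoly N Polynomial.X (Polynomial.C b) (Polynomial.C t)

/-- The straightened factorization of `Γ₀`, over `R`. -/
abbrev src₀ (_ : ArcSplitting N g a b t) (w : R) (h₀ : Polynomial.C w =
      (straight₀ N (polyGrading g) (Polynomial.C a) Polynomial.X (Polynomial.C b)
        (Polynomial.C t)).w) : Cx R :=
  Cx.single ((((straight₀ N (polyGrading g) (Polynomial.C a) Polynomial.X (Polynomial.C b)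
    (Polynomial.C t)).susp).shift (-1) (1 - N)).comap Polynomial.C w h₀)

/-- The straightened factorization of `Γ₁`, over `R`. -/
abbrev src₁ (_ : ArcSplitting N g a b t) (w : R) (h₁ : Polynomial.C w =
      (straight₁ N (polyGrading g) (Polynomial.C a) Polynomial.X (Polynomial.C b)
        (Polynomial.C t)).w) : Cx R :=
  Cx.single ((((straight₁ N (polyGrading g) (Polynomial.C a) Polynomial.X (Polynomial.C b)
    (Polynomial.C t)).susp).shift (-1) (-N)).comap Polynomial.C w h₁)

/-- The factorization of the arc. -/
abbrev tgt₀ (_ : ArcSplitting N g a b t) : Cx R :=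
  (Cx.single (arcMF N g a b t)).shift (-2) 0

/-- The product of the factorization of the arc with the row `(0, a)`. -/
abbrev tgt₁ (_ : ArcSplitting N g a b t) : Cx R :=
  ((Cx.single (arcMF N g a b t)).row a 1 (-(N + 1))).shift (-2) 0

variable {w : R} (h₀ : Polynomial.C w = (straight₀ N (polyGrading g) (Polynomial.C a) Polynomial.X
    (Polynomial.C b) (Polynomial.C t)).w)
  (h₁ : Polynomial.C w = (straight₁ N (polyGrading g) (Polynomial.C a) Polynomial.X
    (Polynomial.C b) (Polynomial.C t)).w)

/-- The coefficients of the factorization of the arc. -/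
theorem map_arc_coeff (_ : ArcSplitting N g a b t) :
    Polynomial.C a * powDiff (N + 1) (Polynomial.C b) (Polynomial.C t) =
      Polynomial.C (a * powDiff (N + 1) b t) := by
  rw [map_mul, map_powDiff]

theorem Λ_mul_pol (s : R[X]) : S.Λ (Polynomial.C a * S.pol * s) = a * (S.e * s.eval t) := by
  rw [mul_assoc, S.Λ_C_mul, S.Λ_mul]

theorem Λ_mul_pol' (s : R[X]) :
    S.Λ (Polynomial.C a * ((Polynomial.C t - Polynomial.X) * S.pol) * s) = 0 := by
  rw [show Polynomial.C a * ((Polynomial.C t - Polynomial.X) * S.pol) * s =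
    Polynomial.C a * S.pol * ((Polynomial.C t - Polynomial.X) * s) by ring, S.Λ_mul_pol]
  simp

/-- The differential of the straightened factorization of `Γ₀`. -/
abbrev d₀ : (R[X] × R[X]) × (R[X] × R[X]) →ₗ[R[X]] (R[X] × R[X]) × (R[X] × R[X]) :=
  kosD (Polynomial.C a * powDiff (N + 1) (Polynomial.C b) (Polynomial.C t))
    (Polynomial.C b - Polynomial.C t)
    (Polynomial.C a * ((Polynomial.C t - Polynomial.X) * S.pol)) 0

/-- The differential of the straightened factorization of `Γ₁`. -/
abbrev d₁ : (R[X] × R[X]) × (R[X] × R[X]) →ₗ[R[X]] (R[X] × R[X]) × (R[X] × R[X]) :=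
  kosD (Polynomial.C a * powDiff (N + 1) (Polynomial.C b) (Polynomial.C t))
    (Polynomial.C b - Polynomial.C t) (Polynomial.C a * S.pol) 0

theorem d₀_apply (u₁ u₂ u₃ u₄ : R[X]) : S.d₀ ((u₁, u₂), (u₃, u₄)) =
    ((Polynomial.C (b - t) * u₂, Polynomial.C (a * powDiff (N + 1) b t) * u₁),
      (Polynomial.C (b - t) * u₄ + Polynomial.C a * ((Polynomial.C t - Polynomial.X) * S.pol) * u₁,
        Polynomial.C (a * powDiff (N + 1) b t) * u₃ -
          Polynomial.C a * ((Polynomial.C t - Polynomial.X) * S.pol) * u₂)) := by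
  rw [d₀, kosD_apply, S.map_arc_coeff, ← map_sub, zero_mul, zero_mul, add_zero, sub_zero]

theorem d₁_apply (u₁ u₂ u₃ u₄ : R[X]) : S.d₁ ((u₁, u₂), (u₃, u₄)) =
    ((Polynomial.C (b - t) * u₂, Polynomial.C (a * powDiff (N + 1) b t) * u₁),
      (Polynomial.C (b - t) * u₄ + Polynomial.C a * S.pol * u₁,
        Polynomial.C (a * powDiff (N + 1) b t) * u₃ - Polynomial.C a * S.pol * u₂)) := by
  rw [d₁, kosD_apply, S.map_arc_coeff, ← map_sub, zero_mul, zero_mul, add_zero, sub_zero]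

/-- The involution. -/
abbrev inv (A : Type) [CommRing A] : (A × A) × (A × A) →ₗ[A] (A × A) × (A × A) :=
  -rowS (rowS LinearMap.id)

theorem inv_apply {A : Type} [CommRing A] (u₁ u₂ u₃ u₄ : A) :
    inv A ((u₁, u₂), (u₃, u₄)) = ((-u₁, u₂), (u₃, -u₄)) := by
  simp

/-- The differential of the factorization of the arc. -/
abbrev dT₀ (_ : ArcSplitting N g a b t) : R × R →ₗ[R] R × R :=
  rowD 0 LinearMap.id (a * powDiff (N + 1) b t) (b - t)

theorem dT₀_apply (x₁ x₂ : R) : S.dT₀ (x₁, x₂) =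
    ((b - t) * x₂, a * powDiff (N + 1) b t * x₁) := by
  simp

theorem dT₁_apply (x₁ x₂ y₁ y₂ : R) : rowD S.dT₀ (rowS LinearMap.id) 0 a ((x₁, x₂), (y₁, y₂)) =
    (((b - t) * x₂ + a * y₁, a * powDiff (N + 1) b t * x₁ - a * y₂),
      ((b - t) * y₂, a * powDiff (N + 1) b t * y₁)) := by
  simp [sub_eq_add_neg]

/-- Forget everything but the second summand. -/
def q₀ : Cx.SHom (S.src₀ w h₀) S.tgt₀ where
  f :=
    { toFun := fun u : (R[X] × R[X]) × (R[X] × R[X]) => ((S.Λ u.2.1, S.Λ u.2.2) : R × R)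
      map_add' := fun u v => Prod.ext (map_add S.Λ _ _) (map_add S.Λ _ _)
      map_smul' := fun r u => Prod.ext (S.Λ_C_mul r _) (S.Λ_C_mul r _) }
  f_dmf := by
    suffices H : ∀ (u₁ u₂ u₃ u₄ : R[X]) (F : (R[X] × R[X]) × (R[X] × R[X]) → R × R),
        (∀ u, F u = (S.Λ u.2.1, S.Λ u.2.2)) → F (S.d₀ ((u₁, u₂), (u₃, u₄))) =
        S.dT₀ (F ((u₁, u₂), (u₃, u₄))) from fun u => H u.1.1 u.1.2 u.2.1 u.2.2 _ fun _ => rfl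
    intro u₁ u₂ u₃ u₄ F hF
    rw [hF, hF, S.d₀_apply, S.dT₀_apply]
    simp only [map_add, map_sub S.Λ, S.Λ_C_mul, S.Λ_mul_pol', add_zero, sub_zero]
  f_dχ u := map_zero _
  f_s := by
    suffices H : ∀ (u₁ u₂ u₃ u₄ : R[X]) (F : (R[X] × R[X]) × (R[X] × R[X]) → R × R),
        (∀ u, F u = (S.Λ u.2.1, S.Λ u.2.2)) → F (inv R[X] ((u₁, u₂), (u₃, u₄))) =
        rowS LinearMap.id (F ((u₁, u₂), (u₃, u₄))) from
      fun u => H u.1.1 u.1.2 u.2.1 u.2.2 _ fun _ => rfl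
    intro u₁ u₂ u₃ u₄ F hF
    rw [hF, hF, inv_apply]
    simp
  f_t _ := rfl

/-- The inclusion of the second summand. -/
def i₀ : Cx.SHom S.tgt₀ (S.src₀ w h₀) where
  f :=
    { toFun := fun x : R × R => (((0, 0), (S.pol * Polynomial.C x.1, S.pol * Polynomial.C x.2)) :
        (R[X] × R[X]) × (R[X] × R[X]))
      map_add' := fun x y => Prod.ext (Prod.ext (add_zero 0).symm (add_zero 0).symm)
        (Prod.ext ((congrArg (S.pol * ·) (map_add Polynomial.C _ _)).trans (mul_add _ _ _))
          ((congrArg (S.pol * ·) (map_add Polynomial.C _ _)).trans (mul_add _ _ _)))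
      map_smul' := fun r x => Prod.ext (Prod.ext (mul_zero _).symm (mul_zero _).symm)
        (Prod.ext ((congrArg (S.pol * ·) (map_mul Polynomial.C r _)).trans (mul_left_comm _ _ _))
          ((congrArg (S.pol * ·) (map_mul Polynomial.C r _)).trans (mul_left_comm _ _ _))) }
  f_dmf := by
    suffices H : ∀ (x₁ x₂ : R) (F : R × R → (R[X] × R[X]) × (R[X] × R[X])),
        (∀ x, F x = ((0, 0), (S.pol * Polynomial.C x.1, S.pol * Polynomial.C x.2))) →
        F (S.dT₀ (x₁, x₂)) = S.d₀ (F (x₁, x₂)) from fun x => H x.1 x.2 _ fun _ => rfl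
    intro x₁ x₂ F hF
    rw [hF, hF, S.d₀_apply, S.dT₀_apply]
    refine Prod.ext (Prod.ext ?_ ?_) (Prod.ext ?_ ?_) <;> simp only [map_mul] <;> ring
  f_dχ u := by
    refine Prod.ext (Prod.ext rfl rfl) (Prod.ext ?_ ?_) <;>
    exact (congrArg (S.pol * ·) (map_zero Polynomial.C)).trans (mul_zero _)
  f_s := by
    suffices H : ∀ (x₁ x₂ : R) (F : R × R → (R[X] × R[X]) × (R[X] × R[X])),
        (∀ x, F x = ((0, 0), (S.pol * Polynomial.C x.1, S.pol * Polynomial.C x.2))) →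
        F (rowS LinearMap.id (x₁, x₂)) = inv R[X] (F (x₁, x₂)) from
      fun x => H x.1 x.2 _ fun _ => rfl
    intro x₁ x₂ F hF
    rw [hF, hF, inv_apply]
    simp
  f_t _ := rfl

/-- The projection onto the product with the row `(0, a)`. -/
def q₁ : Cx.SHom (S.src₁ w h₁) S.tgt₁ where
  f :=
    { toFun := fun u : (R[X] × R[X]) × (R[X] × R[X]) =>
        (((S.Λ u.2.1 + S.c * u.1.2.eval t, S.Λ u.2.2), (u.1.1.eval t, u.1.2.eval t)) :
          (R × R) × (R × R))
      map_add' := by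
        suffices H : ∀ u v : (R[X] × R[X]) × (R[X] × R[X]),
          (((S.Λ (u + v).2.1 + S.c * (u + v).1.2.eval t, S.Λ (u + v).2.2),
            ((u + v).1.1.eval t, (u + v).1.2.eval t)) : (R × R) × (R × R)) =
          ((S.Λ u.2.1 + S.c * u.1.2.eval t, S.Λ u.2.2), (u.1.1.eval t, u.1.2.eval t)) +
          ((S.Λ v.2.1 + S.c * v.1.2.eval t, S.Λ v.2.2), (v.1.1.eval t, v.1.2.eval t)) from H
        intro u v
        refine Prod.ext (Prod.ext ?_ ?_) (Prod.ext ?_ ?_) <;> simp <;> ring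
      map_smul' := by
        suffices H : ∀ (r : R) (u : (R[X] × R[X]) × (R[X] × R[X])),
          (((S.Λ (Polynomial.C r * u.2.1) + S.c * (Polynomial.C r * u.1.2).eval t,
              S.Λ (Polynomial.C r * u.2.2)),
            ((Polynomial.C r * u.1.1).eval t, (Polynomial.C r * u.1.2).eval t)) :
              (R × R) × (R × R)) =
          r • ((S.Λ u.2.1 + S.c * u.1.2.eval t, S.Λ u.2.2), (u.1.1.eval t, u.1.2.eval t)) from H
        intro r u
        refine Prod.ext (Prod.ext ?_ ?_) (Prod.ext ?_ ?_) <;> simp [S.Λ_C_mul] <;> ring }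
  f_dmf := by
    suffices H : ∀ (u₁ u₂ u₃ u₄ : R[X]) (F : (R[X] × R[X]) × (R[X] × R[X]) → (R × R) × (R × R)),
        (∀ u, F u = ((S.Λ u.2.1 + S.c * u.1.2.eval t, S.Λ u.2.2),
          (u.1.1.eval t, u.1.2.eval t))) → F (S.d₁ ((u₁, u₂), (u₃, u₄))) =
        rowD S.dT₀ (rowS LinearMap.id) 0 a (F ((u₁, u₂), (u₃, u₄))) from
      fun u => H u.1.1 u.1.2 u.2.1 u.2.2 _ fun _ => rfl
    intro u₁ u₂ u₃ u₄ F hF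
    rw [hF, hF, S.d₁_apply, S.dT₁_apply]
    simp only [map_add, map_sub S.Λ, S.Λ_C_mul, S.Λ_mul_pol, Polynomial.eval_mul,
      Polynomial.eval_C]
    refine Prod.ext (Prod.ext ?_ ?_) (Prod.ext ?_ ?_) <;> simp only []
    · linear_combination u₁.eval t * S.e_add_c
    · linear_combination (-u₂.eval t) * S.e_add_c
  f_dχ u := by
    suffices H : (((S.Λ 0 + S.c * (0 : R[X]).eval t, S.Λ 0),
      ((0 : R[X]).eval t, (0 : R[X]).eval t)) : (R × R) × (R × R)) = ((0, 0), (0, 0)) from H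
    simp
  f_s := by
    suffices H : ∀ (u₁ u₂ u₃ u₄ : R[X]) (F : (R[X] × R[X]) × (R[X] × R[X]) → (R × R) × (R × R)),
        (∀ u, F u = ((S.Λ u.2.1 + S.c * u.1.2.eval t, S.Λ u.2.2),
          (u.1.1.eval t, u.1.2.eval t))) → F (inv R[X] ((u₁, u₂), (u₃, u₄))) =
        rowS (rowS LinearMap.id) (F ((u₁, u₂), (u₃, u₄))) from
      fun u => H u.1.1 u.1.2 u.2.1 u.2.2 _ fun _ => rfl
    intro u₁ u₂ u₃ u₄ F hF
    rw [hF, hF, inv_apply]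
    simp
  f_t _ := rfl

/-- The inclusion of the product with the row `(0, a)`. -/
def i₁ : Cx.SHom S.tgt₁ (S.src₁ w h₁) where
  f :=
    { toFun := fun x : (R × R) × (R × R) => (((Polynomial.C x.2.1, Polynomial.C x.2.2),
        (S.pol * Polynomial.C x.1.1, S.pol * Polynomial.C x.1.2)) :
        (R[X] × R[X]) × (R[X] × R[X]))
      map_add' := fun x y => Prod.ext (Prod.ext (map_add Polynomial.C _ _)
        (map_add Polynomial.C _ _))
        (Prod.ext ((congrArg (S.pol * ·) (map_add Polynomial.C _ _)).trans (mul_add _ _ _))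
          ((congrArg (S.pol * ·) (map_add Polynomial.C _ _)).trans (mul_add _ _ _)))
      map_smul' := fun r x => Prod.ext (Prod.ext (map_mul Polynomial.C r _)
        (map_mul Polynomial.C r _))
        (Prod.ext ((congrArg (S.pol * ·) (map_mul Polynomial.C r _)).trans (mul_left_comm _ _ _))
          ((congrArg (S.pol * ·) (map_mul Polynomial.C r _)).trans (mul_left_comm _ _ _))) }
  f_dmf := by
    suffices H : ∀ (x₁ x₂ y₁ y₂ : R) (F : (R × R) × (R × R) → (R[X] × R[X]) × (R[X] × R[X])),
        (∀ x, F x = ((Polynomial.C x.2.1, Polynomial.C x.2.2),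
          (S.pol * Polynomial.C x.1.1, S.pol * Polynomial.C x.1.2))) →
        F (rowD S.dT₀ (rowS LinearMap.id) 0 a ((x₁, x₂), (y₁, y₂))) =
          S.d₁ (F ((x₁, x₂), (y₁, y₂))) from
      fun x => H x.1.1 x.1.2 x.2.1 x.2.2 _ fun _ => rfl
    intro x₁ x₂ y₁ y₂ F hF
    rw [hF, hF, S.d₁_apply, S.dT₁_apply]
    refine Prod.ext (Prod.ext ?_ ?_) (Prod.ext ?_ ?_) <;>
    simp only [map_mul, map_add, map_sub Polynomial.C] <;> ring
  f_dχ u := by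
    suffices H : (((Polynomial.C 0, Polynomial.C 0), (S.pol * Polynomial.C 0,
      S.pol * Polynomial.C 0)) : (R[X] × R[X]) × (R[X] × R[X])) = ((0, 0), (0, 0)) from H
    simp
  f_s := by
    suffices H : ∀ (x₁ x₂ y₁ y₂ : R) (F : (R × R) × (R × R) → (R[X] × R[X]) × (R[X] × R[X])),
        (∀ x, F x = ((Polynomial.C x.2.1, Polynomial.C x.2.2),
          (S.pol * Polynomial.C x.1.1, S.pol * Polynomial.C x.1.2))) →
        F (rowS (rowS LinearMap.id) ((x₁, x₂), (y₁, y₂))) = inv R[X] (F ((x₁, x₂), (y₁, y₂))) from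
      fun x => H x.1.1 x.1.2 x.2.1 x.2.2 _ fun _ => rfl
    intro x₁ x₂ y₁ y₂ F hF
    rw [hF, hF, inv_apply]
    simp
  f_t _ := rfl

/-- The homotopy on the target. -/
def θ' : Cx.SHom S.tgt₁ S.tgt₀ where
  f :=
    { toFun := fun x : (R × R) × (R × R) =>
        (((S.e - 1) * x.1.1 + S.c * x.2.2, (S.e - 1) * x.1.2) : R × R)
      map_add' := by
        suffices H : ∀ x y : (R × R) × (R × R),
            (((S.e - 1) * (x + y).1.1 + S.c * (x + y).2.2, (S.e - 1) * (x + y).1.2) : R × R) =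
            ((S.e - 1) * x.1.1 + S.c * x.2.2, (S.e - 1) * x.1.2) +
            ((S.e - 1) * y.1.1 + S.c * y.2.2, (S.e - 1) * y.1.2) from H
        intro x y
        refine Prod.ext ?_ ?_ <;> simp <;> ring
      map_smul' := by
        suffices H : ∀ (r : R) (x : (R × R) × (R × R)),
            (((S.e - 1) * (r • x).1.1 + S.c * (r • x).2.2, (S.e - 1) * (r • x).1.2) : R × R) =
            r • ((S.e - 1) * x.1.1 + S.c * x.2.2, (S.e - 1) * x.1.2) from H
        intro r x
        refine Prod.ext ?_ ?_ <;> simp <;> ring }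
  f_dmf := by
    suffices H : ∀ (x₁ x₂ y₁ y₂ : R) (F : (R × R) × (R × R) → R × R),
        (∀ x, F x = ((S.e - 1) * x.1.1 + S.c * x.2.2, (S.e - 1) * x.1.2)) →
        F (rowD S.dT₀ (rowS LinearMap.id) 0 a ((x₁, x₂), (y₁, y₂))) =
          S.dT₀ (F ((x₁, x₂), (y₁, y₂))) from
      fun x => H x.1.1 x.1.2 x.2.1 x.2.2 _ fun _ => rfl
    intro x₁ x₂ y₁ y₂ F hF
    rw [hF, hF, S.dT₀_apply, S.dT₁_apply]
    refine Prod.ext ?_ ?_ <;> simp only []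
    · linear_combination y₁ * S.e_add_c
    · linear_combination (-y₂) * S.e_add_c
  f_dχ u := by
    suffices H : (((S.e - 1) * 0 + S.c * 0, (S.e - 1) * 0) : R × R) = (0, 0) from H
    simp
  f_s := by
    suffices H : ∀ (x₁ x₂ y₁ y₂ : R) (F : (R × R) × (R × R) → R × R),
        (∀ x, F x = ((S.e - 1) * x.1.1 + S.c * x.2.2, (S.e - 1) * x.1.2)) →
        F (rowS (rowS LinearMap.id) ((x₁, x₂), (y₁, y₂))) =
          rowS LinearMap.id (F ((x₁, x₂), (y₁, y₂))) from
      fun x => H x.1.1 x.1.2 x.2.1 x.2.2 _ fun _ => rfl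
    intro x₁ x₂ y₁ y₂ F hF
    rw [hF, hF]
    simp
  f_t _ := rfl

/-- The homotopy on the source. -/
def θ [Nontrivial R] : Cx.SHom (S.src₁ w h₁) (S.src₀ w h₀) where
  f :=
    let Q := divByMonicHom (Polynomial.monic_X_sub_C t)
    { toFun := fun u : (R[X] × R[X]) × (R[X] × R[X]) =>
        (((Q u.1.1, Q u.1.2), (S.pol * Polynomial.C (S.Λ u.2.1) - u.2.1,
          S.pol * Polynomial.C (S.Λ u.2.2) - u.2.2)) : (R[X] × R[X]) × (R[X] × R[X]))
      map_add' := by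
        suffices H : ∀ u v : (R[X] × R[X]) × (R[X] × R[X]),
          (((Q (u + v).1.1, Q (u + v).1.2), (S.pol * Polynomial.C (S.Λ (u + v).2.1) - (u + v).2.1,
            S.pol * Polynomial.C (S.Λ (u + v).2.2) - (u + v).2.2)) :
              (R[X] × R[X]) × (R[X] × R[X])) =
          ((Q u.1.1, Q u.1.2), (S.pol * Polynomial.C (S.Λ u.2.1) - u.2.1,
            S.pol * Polynomial.C (S.Λ u.2.2) - u.2.2)) +
          ((Q v.1.1, Q v.1.2), (S.pol * Polynomial.C (S.Λ v.2.1) - v.2.1,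
            S.pol * Polynomial.C (S.Λ v.2.2) - v.2.2)) from H
        intro u v
        refine Prod.ext (Prod.ext ?_ ?_) (Prod.ext ?_ ?_) <;> simp <;> ring
      map_smul' := by
        suffices H : ∀ (r : R) (u : (R[X] × R[X]) × (R[X] × R[X])),
          (((Q (Polynomial.C r * u.1.1), Q (Polynomial.C r * u.1.2)),
            (S.pol * Polynomial.C (S.Λ (Polynomial.C r * u.2.1)) - Polynomial.C r * u.2.1,
            S.pol * Polynomial.C (S.Λ (Polynomial.C r * u.2.2)) - Polynomial.C r * u.2.2)) :
              (R[X] × R[X]) × (R[X] × R[X])) =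
          Polynomial.C r • ((Q u.1.1, Q u.1.2), (S.pol * Polynomial.C (S.Λ u.2.1) - u.2.1,
            S.pol * Polynomial.C (S.Λ u.2.2) - u.2.2)) from H
        intro r u
        simp only [Q, divByMonicHom_C_mul, S.Λ_C_mul, map_mul]
        refine Prod.ext (Prod.ext rfl rfl) (Prod.ext ?_ ?_) <;>
        simp only [Prod.smul_mk, smul_eq_mul] <;> ring }
  f_dmf := by
    suffices H : ∀ (u₁ u₂ u₃ u₄ : R[X]) (Q : R[X] →+ R[X])
        (F : (R[X] × R[X]) × (R[X] × R[X]) → (R[X] × R[X]) × (R[X] × R[X])),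
        (∀ u, F u = ((Q u.1.1, Q u.1.2), (S.pol * Polynomial.C (S.Λ u.2.1) - u.2.1,
            S.pol * Polynomial.C (S.Λ u.2.2) - u.2.2))) →
        (∀ r s, Q (Polynomial.C r * s) = Polynomial.C r * Q s) →
        (∀ s, (Polynomial.C t - Polynomial.X) * Q s = Polynomial.C (s.eval t) - s) →
        F (S.d₁ ((u₁, u₂), (u₃, u₄))) = S.d₀ (F ((u₁, u₂), (u₃, u₄))) from
      fun u => H u.1.1 u.1.2 u.2.1 u.2.2 (divByMonicHom (Polynomial.monic_X_sub_C t)) _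
        (fun _ => rfl) (divByMonicHom_C_mul _) (divByMonicHom_X_sub_C t)
    intro u₁ u₂ u₃ u₄ Q F hF h₁ h₂
    rw [hF, hF, S.d₀_apply, S.d₁_apply]
    simp only [map_add, map_sub S.Λ, S.Λ_C_mul, S.Λ_mul_pol, h₁]
    refine Prod.ext (Prod.ext rfl rfl) (Prod.ext ?_ ?_) <;>
    simp only [map_sub Polynomial.C, map_mul]
    · linear_combination (Polynomial.C a * Polynomial.C (u₁.eval t)) * S.joinedPoly_mul_e -
        (Polynomial.C a * S.pol) * h₂ u₁
    · linear_combination (-Polynomial.C a * Polynomial.C (u₂.eval t)) * S.joinedPoly_mul_e +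
        (Polynomial.C a * S.pol) * h₂ u₂
  f_dχ u := map_zero _
  f_s := by
    suffices H : ∀ (u₁ u₂ u₃ u₄ : R[X]) (Q : R[X] →+ R[X])
        (F : (R[X] × R[X]) × (R[X] × R[X]) → (R[X] × R[X]) × (R[X] × R[X])),
        (∀ u, F u = ((Q u.1.1, Q u.1.2), (S.pol * Polynomial.C (S.Λ u.2.1) - u.2.1,
            S.pol * Polynomial.C (S.Λ u.2.2) - u.2.2))) →
        F (inv R[X] ((u₁, u₂), (u₃, u₄))) = inv R[X] (F ((u₁, u₂), (u₃, u₄))) from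
      fun u => H u.1.1 u.1.2 u.2.1 u.2.2 (divByMonicHom (Polynomial.monic_X_sub_C t)) _ fun _ => rfl
    intro u₁ u₂ u₃ u₄ Q F hF
    rw [hF, hF, inv_apply, inv_apply]
    refine Prod.ext (Prod.ext ?_ ?_) (Prod.ext ?_ ?_) <;> simp
    ring
  f_t _ := rfl

/-- The arrow corresponding to `χ⁰` is equivalent to the inclusion of the factorization of the arc
into its product with the row `(0, a)`. -/
def arrowEquiv [Nontrivial R] (hg : IsGradedRing g) (hb : b ∈ g 0 2) (ht : t ∈ g 0 2) :
    Cx.ArrowEquiv (Cx.singleHom ((((straightHom N (polyGrading g) (Polynomial.C a) Polynomial.X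
        (Polynomial.C b) (Polynomial.C t)).susp).shift (-1) (1 - N) (-1) (-N)).comap
        Polynomial.C w h₀ h₁))
      (((Cx.single (arcMF N g a b t)).toRow a 1 (-(N + 1))).shift (-2) 0) :=
  have hpol : S.pol ∈ polyGrading g 0 (2 * N - 2) :=
    mem_of_mem (hg.poly.U₂_mem (add_mem (C_mem_polyGrading ht) (X_mem_polyGrading hg))
      (hg.poly.mul_mem (X_mem_polyGrading hg) (C_mem_polyGrading hb))
      (hg.poly.mul_mem (C_mem_polyGrading ht) (X_mem_polyGrading hg)) (N + 1)) rfl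
        (by push_cast; ring)
  have heval : ∀ {j k} {s : R[X]}, s ∈ polyGrading g j k → s.eval t ∈ g j k := fun {j k s} hs =>
    map_mem_of_mem_polyGrading (Polynomial.evalRingHom t).toAddMonoidHom (g j k) (fun m r hr => by
      simpa using hg.mul_mem' hr (hg.pow_mem ht m) (by ring) (by ring)) hs
  have hΛ : ∀ {ε ε' j k j' k'} {s : R[X]}, s ∈ (MF.base (polyGrading g)).gr ε j k → ε = ε' →
      j = j' → k - (2 * N - 2) = k' → S.Λ s ∈ (MF.base g).gr ε' j' k' :=
    fun hs hε hj hk => MF.addHom_base_mem S.Λ (fun x hx => mem_of_mem (S.Λ_mem hx) hj hk) hs hε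
  have hev : ∀ {ε ε' j k j' k'} {s : R[X]}, s ∈ (MF.base (polyGrading g)).gr ε j k → ε = ε' →
      j = j' → k = k' → s.eval t ∈ (MF.base g).gr ε' j' k' :=
    fun hs hε hj hk => MF.addHom_base_mem (Polynomial.evalRingHom t).toAddMonoidHom
      (fun x hx => mem_of_mem (heval hx) hj hk) hs hε
  have hC : ∀ {ε ε' j k j' k'} {r : R}, r ∈ (MF.base g).gr ε j k → ε = ε' →
      j = j' → k = k' → Polynomial.C r ∈ (MF.base (polyGrading g)).gr ε' j' k' :=
    fun hr hε hj hk => MF.addHom_base_mem (Polynomial.C : R →+* R[X]).toAddMonoidHom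
      (fun x hx => mem_of_mem (C_mem_polyGrading hx) hj hk) hr hε
  have hC' : ∀ {ε ε' j k j' k'} {r : R}, r ∈ (MF.base g).gr ε j k → ε = ε' →
      j = j' → 2 * N - 2 + k = k' →
      S.pol * Polynomial.C r ∈ (MF.base (polyGrading g)).gr ε' j' k' :=
    fun hr hε hj hk => MF.mul_base_mem hg.poly hpol (hC hr hε hj rfl) rfl (zero_add _) hk
  have hQ : ∀ {ε ε' j k j' k'} {s : R[X]}, s ∈ (MF.base (polyGrading g)).gr ε j k → ε = ε' →
      j = j' → k - 2 = k' → divByMonicHom (Polynomial.monic_X_sub_C t) s ∈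
        (MF.base (polyGrading g)).gr ε' j' k' :=
    fun hs hε hj hk => MF.addHom_base_mem (divByMonicHom (Polynomial.monic_X_sub_C t))
      (fun x hx => mem_of_mem (divByMonic_mem hg (Polynomial.monic_X_sub_C t) (d := 1)
        (Polynomial.natDegree_X_sub_C t) (mem_of_mem (sub_mem (X_mem_polyGrading hg)
          (C_mem_polyGrading ht)) rfl (by norm_num)) hx) hj
          ((by push_cast; ring : _ = _).trans hk)) hs hε
  let M₀ : MF R[X] := ((straight₀ N (polyGrading g) (Polynomial.C a) Polynomial.X (Polynomial.C b)
    (Polynomial.C t)).susp).shift (-1) (1 - N)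
  let M₁ : MF R[X] := ((straight₁ N (polyGrading g) (Polynomial.C a) Polynomial.X (Polynomial.C b)
    (Polynomial.C t)).susp).shift (-1) (-N)
  let T : MF R := arcMF N g a b t
  { q₀ := S.q₀ h₀
    q₁ := S.q₁ h₁
    i₀ := S.i₀ h₀
    i₁ := S.i₁ h₁
    θ := S.θ h₀ h₁
    θ' := S.θ'
    q₀_gr := fun {ε i j k x} hx => Cx.IsHomogeneous.ite_bot_mem
      (S := M₀.gr ε j k) (S' := T.gr ε (j - -2) (k - 0)) (S.q₀ h₀).f.toAddMonoidHom id
      (fun u hu => ⟨hΛ hu.2.1 (by generalize ε = e; decide +revert) (by ring) (by ring), hΛ hu.2.2 (by generalize ε = e; decide +revert) (by ring)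
        (by ring)⟩) hx
    q₁_gr := fun {ε i j k x} hx =>
      ⟨Cx.IsHomogeneous.ite_bot_mem
          (S := M₁.gr ε j k) (S' := T.gr ε (j - -2) (k - 0)) ((AddMonoidHom.fst (R × R) (R × R)).comp
          (S.q₁ h₁).f.toAddMonoidHom) id
        (fun u hu => ⟨MF.add_base_mem (hΛ hu.2.1 (by generalize ε = e; decide +revert) (by ring) (by ring))
            (MF.mul_base_mem hg S.c_mem (hev hu.1.2 rfl rfl rfl) (by generalize ε = e; decide +revert) (by ring) (by ring)),
          hΛ hu.2.2 (by generalize ε = e; decide +revert) (by ring) (by ring)⟩) hx,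
      Cx.IsHomogeneous.ite_bot_mem
          (S := M₁.gr ε j k) (S' := T.gr (ε + 1) (j - -2 - 1) (k - 0 - (-(N + 1))))
          ((AddMonoidHom.snd (R × R) (R × R)).comp
          (S.q₁ h₁).f.toAddMonoidHom) id
        (fun u hu => ⟨hev hu.1.1 (by generalize ε = e; decide +revert) (by ring) (by ring),
          hev hu.1.2 (by generalize ε = e; decide +revert) (by ring) (by ring)⟩) hx⟩
    i₀_gr := fun {ε i j k x} hx => Cx.IsHomogeneous.ite_bot_mem
      (S := T.gr ε (j - -2) (k - 0)) (S' := M₀.gr ε j k) (S.i₀ h₀).f.toAddMonoidHom id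
      (fun x hx => ⟨⟨zero_mem _, zero_mem _⟩, ⟨hC' hx.1 (by generalize ε = e; decide +revert) (by ring) (by ring),
        hC' hx.2 (by generalize ε = e; decide +revert) (by ring) (by ring)⟩⟩) hx
    i₁_gr := fun {ε i j k x} hx => ite_pair_mem
      (A := T.gr ε (j - -2) (k - 0)) (B := T.gr (ε + 1) (j - -2 - 1) (k - 0 - (-(N + 1))))
      (C := M₁.gr ε j k) (fun x y => (S.i₁ h₁).f (x, y))
      (map_zero (S.i₁ h₁).f) (fun {x y} hx hy => ⟨⟨hC hy.1 (by generalize ε = e; decide +revert) (by ring) (by ring),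
          hC hy.2 (by generalize ε = e; decide +revert) (by ring) (by ring)⟩,
        ⟨hC' hx.1 (by generalize ε = e; decide +revert) (by ring) (by ring), hC' hx.2 (by generalize ε = e; decide +revert) (by ring) (by ring)⟩⟩)
      hx.1 hx.2
    θ_gr := fun {ε i j k x} hx => Cx.IsHomogeneous.ite_bot_mem
      (S := M₁.gr ε j k) (S' := M₀.gr ε j k) (S.θ h₀ h₁).f.toAddMonoidHom id
      (fun u hu => ⟨⟨hQ hu.1.1 (by generalize ε = e; decide +revert) (by ring) (by ring), hQ hu.1.2 (by generalize ε = e; decide +revert) (by ring)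
          (by ring)⟩,
        ⟨MF.sub_base_mem (hC' (hΛ hu.2.1 rfl rfl rfl) (by generalize ε = e; decide +revert) (by ring) (by ring))
            (MF.base_mem hu.2.1 (by generalize ε = e; decide +revert) (by ring) (by ring)),
          MF.sub_base_mem (hC' (hΛ hu.2.2 rfl rfl rfl) (by generalize ε = e; decide +revert) (by ring) (by ring))
            (MF.base_mem hu.2.2 (by generalize ε = e; decide +revert) (by ring) (by ring))⟩⟩) hx
    θ'_gr := fun {ε i j k x} hx => ite_pair_mem
      (A := T.gr ε (j - -2) (k - 0)) (B := T.gr (ε + 1) (j - -2 - 1) (k - 0 - (-(N + 1))))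
      (C := T.gr ε (j - -2) (k - 0)) (fun x y => S.θ'.f (x, y))
      (map_zero S.θ'.f) (fun {x y} hx hy => ⟨MF.add_base_mem
          (MF.mul_base_mem hg (sub_mem S.e_mem hg.one_mem) hx.1 (by generalize ε = e; decide +revert) (by ring) (by ring))
          (MF.mul_base_mem hg S.c_mem hy.2 (zmod_two_add_one_add_one _) (by ring) (by ring)),
        MF.mul_base_mem hg (sub_mem S.e_mem hg.one_mem) hx.2 (by generalize ε = e; decide +revert) (by ring) (by ring)⟩)
      hx.1 hx.2
    q_f := by
      refine Cx.Homotopic.of_eq ?_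
      suffices H : ∀ u : (R[X] × R[X]) × (R[X] × R[X]),
          (((S.Λ u.2.1 + S.c * ((Polynomial.C t - Polynomial.X) * u.1.2).eval t, S.Λ u.2.2),
            (((Polynomial.C t - Polynomial.X) * u.1.1).eval t,
              ((Polynomial.C t - Polynomial.X) * u.1.2).eval t)) : (R × R) × (R × R)) =
          ((S.Λ u.2.1, S.Λ u.2.2), (0, 0)) from H
      intro u
      simp
    f_i := by
      refine Cx.Homotopic.of_eq ?_
      suffices H : ∀ x : R × R,
          ((((Polynomial.C t - Polynomial.X) * 0, (Polynomial.C t - Polynomial.X) * 0),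
            (S.pol * Polynomial.C x.1, S.pol * Polynomial.C x.2)) :
              (R[X] × R[X]) × (R[X] × R[X])) =
          ((Polynomial.C 0, Polynomial.C 0), (S.pol * Polynomial.C x.1, S.pol * Polynomial.C x.2))
          from H
      intro x
      simp
    i_q₀ := by
      refine Cx.Homotopic.of_eq ?_
      suffices H : ∀ (u : (R[X] × R[X]) × (R[X] × R[X])) (Q : R[X] →+ R[X]),
          (∀ s, Q ((Polynomial.C t - Polynomial.X) * s) = -s) →
          (((0, 0), (S.pol * Polynomial.C (S.Λ u.2.1), S.pol * Polynomial.C (S.Λ u.2.2))) :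
            (R[X] × R[X]) × (R[X] × R[X])) =
          u + ((Q ((Polynomial.C t - Polynomial.X) * u.1.1),
            Q ((Polynomial.C t - Polynomial.X) * u.1.2)),
            (S.pol * Polynomial.C (S.Λ u.2.1) - u.2.1, S.pol * Polynomial.C (S.Λ u.2.2) - u.2.2))
          from fun u => H u (divByMonicHom (Polynomial.monic_X_sub_C t)) (divByMonicHom_mul t)
      intro u Q hQ
      rw [hQ, hQ]
      refine Prod.ext (Prod.ext ?_ ?_) (Prod.ext ?_ ?_) <;> simp
    i_q₁ := by
      refine Cx.Homotopic.of_eq ?_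
      suffices H : ∀ (u : (R[X] × R[X]) × (R[X] × R[X])) (Q : R[X] →+ R[X]),
          (∀ s, (Polynomial.C t - Polynomial.X) * Q s = Polynomial.C (s.eval t) - s) →
          (((Polynomial.C (u.1.1.eval t), Polynomial.C (u.1.2.eval t)),
            (S.pol * Polynomial.C (S.Λ u.2.1 + S.c * u.1.2.eval t),
              S.pol * Polynomial.C (S.Λ u.2.2))) : (R[X] × R[X]) × (R[X] × R[X])) =
          u + (((Polynomial.C t - Polynomial.X) * Q u.1.1,
            (Polynomial.C t - Polynomial.X) * Q u.1.2),
            (S.pol * Polynomial.C (S.Λ u.2.1) - u.2.1, S.pol * Polynomial.C (S.Λ u.2.2) - u.2.2))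
          from fun u => H u (divByMonicHom (Polynomial.monic_X_sub_C t)) (divByMonicHom_X_sub_C t)
      intro u Q hQ
      rw [hQ, hQ, map_add, map_mul, mul_add, ← mul_assoc, S.joinedPoly_mul_c]
      refine Prod.ext (Prod.ext ?_ ?_) (Prod.ext ?_ ?_) <;> simp
    q_i₀ := by
      refine Cx.Homotopic.of_eq ?_
      suffices H : ∀ x : R × R, ((S.Λ (S.pol * Polynomial.C x.1), S.Λ (S.pol * Polynomial.C x.2)) :
          R × R) = x + ((S.e - 1) * x.1 + S.c * 0, (S.e - 1) * x.2) from H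
      intro x
      rw [S.Λ_mul, S.Λ_mul, Polynomial.eval_C, Polynomial.eval_C]
      refine Prod.ext ?_ ?_ <;> simp <;> ring
    q_i₁ := by
      refine Cx.Homotopic.of_eq ?_
      suffices H : ∀ x : (R × R) × (R × R),
          (((S.Λ (S.pol * Polynomial.C x.1.1) + S.c * (Polynomial.C x.2.2).eval t,
              S.Λ (S.pol * Polynomial.C x.1.2)),
            ((Polynomial.C x.2.1).eval t, (Polynomial.C x.2.2).eval t)) : (R × R) × (R × R)) =
          x + (((S.e - 1) * x.1.1 + S.c * x.2.2, (S.e - 1) * x.1.2), (0, 0)) from H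
      intro x
      rw [S.Λ_mul, S.Λ_mul, Polynomial.eval_C, Polynomial.eval_C, Polynomial.eval_C,
        Polynomial.eval_C]
      refine Prod.ext (Prod.ext ?_ ?_) (Prod.ext ?_ ?_) <;> simp <;> ring }

end ArcSplitting

end Split

/-! ### The splittings -/

section Splittings

variable {R : Type} [CommRing R] {g : ℤ → ℤ → AddSubgroup R} {a b t : R}

/-- The splitting for `N = 0`. -/
def arcSplittingZero (hg : IsGradedRing g) : ArcSplitting 0 g a b t where
  Λ := 0
  e := 0
  c := 1
  Λ_C_mul r s := (mul_zero r).symm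
  Λ_mul s := (zero_mul _).symm
  joinedPoly_mul_e := by simp [joinedPoly, U₂]
  joinedPoly_mul_c := by simp [joinedPoly, U₂]
  e_add_c := by simp [powDiff]
  Λ_mem _ := zero_mem _
  e_mem := zero_mem _
  c_mem := by simpa using hg.one_mem

theorem joinedPoly_natDegree (n : ℕ) :
    (joinedPoly (n + 1) Polynomial.X (Polynomial.C b) (Polynomial.C t)).natDegree ≤ n :=
  (U₂_joined b t n).1

/-- The splitting for `N > 0`, when `-(N + 1)` is invertible. -/
def arcSplittingSucc [Nontrivial R] (hg : IsGradedRing g) (hb : b ∈ g 0 2) (ht : t ∈ g 0 2) (n : ℕ)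
    {u : R} (hu : u * -(n + 2) = 1) (hu' : u ∈ g 0 0) : ArcSplitting (n + 1) g a b t :=
  let ℓ : R[X] := joinedPoly (n + 1) Polynomial.X (Polynomial.C b) (Polynomial.C t)
  have hℓ : ℓ ∈ polyGrading g 0 (2 * n) :=
    mem_of_mem (hg.poly.U₂_mem (add_mem (C_mem_polyGrading ht) (X_mem_polyGrading hg))
      (hg.poly.mul_mem (X_mem_polyGrading hg) (C_mem_polyGrading hb))
      (hg.poly.mul_mem (C_mem_polyGrading ht) (X_mem_polyGrading hg)) (n + 2)) rfl
        (by push_cast; ring)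
  have hdeg : (Polynomial.C u * ℓ).natDegree ≤ n :=
    (Polynomial.natDegree_C_mul_le _ _).trans (joinedPoly_natDegree n)
  have hcoeff : (Polynomial.C u * ℓ).coeff n = 1 := by
    rw [Polynomial.coeff_C_mul]
    exact (congrArg (u * ·) (U₂_joined b t n).2).trans hu
  have hp : (Polynomial.C u * ℓ).Monic := Polynomial.monic_of_natDegree_le_of_coeff_eq_one n hdeg
    hcoeff
  have hd : (Polynomial.C u * ℓ).natDegree = n :=
    Polynomial.natDegree_eq_of_le_of_coeff_ne_zero hdeg (by rw [hcoeff]; exact one_ne_zero)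
  have hpg : Polynomial.C u * ℓ ∈ polyGrading g 0 (2 * n) :=
    hg.poly.mul_mem' (C_mem_polyGrading hu') hℓ (by ring) (by ring)
  { Λ := (AddMonoidHom.mulLeft u).comp
      ((Polynomial.evalRingHom t).toAddMonoidHom.comp (divByMonicHom hp))
    e := 1
    c := 0
    Λ_C_mul := fun r s => by
      change u * (divByMonicHom hp (Polynomial.C r * s)).eval t =
        r * (u * (divByMonicHom hp s).eval t)
      rw [divByMonicHom_C_mul, Polynomial.eval_mul, Polynomial.eval_C, mul_left_comm]
    Λ_mul := fun s => by
      have h : divByMonicHom hp (ℓ * s) = Polynomial.C (-(n + 2 : R)) * s := by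
        have h' : ℓ * s = Polynomial.C u * ℓ * (Polynomial.C (-(n + 2 : R)) * s) := by
          linear_combination -(ℓ * s) * (by rw [← map_mul, hu, map_one] :
            Polynomial.C u * Polynomial.C (-(n + 2 : R)) = 1)
        rw [h']
        exact Polynomial.mul_divByMonic_cancel_left _ hp
      change u * (divByMonicHom hp (ℓ * s)).eval t = 1 * s.eval t
      rw [h, Polynomial.eval_mul, Polynomial.eval_C, ← mul_assoc, hu]
    joinedPoly_mul_e := by rw [map_one, mul_one]
    joinedPoly_mul_c := by rw [map_zero, mul_zero]
    e_add_c := by ring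
    Λ_mem := fun {j k s} hs => by
      have h := divByMonic_mem hg hp hd hpg hs
      refine hg.mul_mem' hu' (map_mem_of_mem_polyGrading (Polynomial.evalRingHom t).toAddMonoidHom
        (g j (k - 2 * n)) (fun m r hr => ?_) h) (by ring) (by push_cast; ring)
      simpa using hg.mul_mem' hr (hg.pow_mem ht m) (by ring) (by ring)
    e_mem := hg.one_mem
    c_mem := zero_mem _ }

/-- The splitting over a polynomial ring. -/
def arcSplitting (N : ℕ) {P : Type} {a b t : PointRing P} (hb : b ∈ pointGrading P 0 2)
    (ht : t ∈ pointGrading P 0 2) : ArcSplitting N (pointGrading P) a b t :=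
  match N with
  | 0 => arcSplittingZero (isGradedRing_pointGrading P)
  | n + 1 => arcSplittingSucc (isGradedRing_pointGrading P) hb ht n
      (u := MvPolynomial.C (Polynomial.C (-(n + 2 : ℚ))⁻¹))
      (by
        have h : (-(n + 2 : ℚ)) ≠ 0 := by
          have : (0 : ℚ) < n + 2 := by positivity
          linarith
        have h' : (-(n + 2 : PointRing P)) = MvPolynomial.C (Polynomial.C (-(n + 2 : ℚ))) := by
          rw [show (-(n + 2 : ℚ)) = -((n + 2 : ℕ) : ℚ) by push_cast; ring, map_neg, map_neg,
            map_natCast, map_natCast]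
          push_cast
          ring
        rw [h', ← map_mul, ← map_mul, inv_mul_cancel₀ h, map_one, map_one])
      (C_C_mem _)

end Splittings

/-! ### Exclusion of the two variables on the joined strand -/

section Join

variable {A B S : Type} [CommRing A] [CommRing B] [CommRing S] {c : B →+* A} {v : A →+* B}
  {c' : S →+* B} {v' : B →+* S} {gA : ℤ → ℤ → AddSubgroup A} {gB : ℤ → ℤ → AddSubgroup B}
  {gS : ℤ → ℤ → AddSubgroup S} {δ : A} {δ' : B} {N : ℕ}

/-- Exclusion of two variables. -/
def MF.Elim.excludeTwo {M : MF A} {M' : MF B} {M'' : MF S} (E : MF.Elim c v δ 0 2 M M')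
    (E' : MF.Elim c' v' δ' 0 2 M' M'') (F : RingElim c v δ gA gB 0 2)
    (F' : RingElim c' v' δ' gB gS 0 2) (hM : M.IsHomogeneous gA N) (hM' : M'.IsHomogeneous gB N)
    {α β ε : A} {β' : B} (hβ : v β = β') (hε : v ε = δ') (hβg : β ∈ gA 2 (2 * N))
    (hεg : ε ∈ gA 0 2) (hw : c (M'.w + β' * δ') = M.w + β * ε + α * δ)
    (hw' : c' M''.w = M'.w + β' * δ') :
    MF.HEquiv (c.comp c') (RingHom.id S)
      ((M.row N β ε 2 (2 * N)).row N α δ 2 (2 * N)) M'' :=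
  (((E.row N 2 (2 * N) hβ hε).exclude (hM.row hβg (mem_of_mem hεg (by ring) (by ring))) F.ev_c F.ev_δ
    hw (by ring) (by ring)).restrict c' (fun _ => rfl) fun _ => rfl).trans
    (E'.exclude hM' F'.ev_c F'.ev_δ hw' (by ring) (by ring))

/-- Elimination of a variable in an arc. -/
def arcElim (F : RingElim c v δ gA gB 0 2) {a x₁ x₂ : A} {a' x₁' x₂' : B} (ha : v a = a')
    (h₁ : v x₁ = x₁') (h₂ : v x₂ = x₂') :
    MF.Elim c v δ 0 2 (arcMF N gA a x₁ x₂) (arcMF N gB a' x₁' x₂') :=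
  (MF.Elim.base F).row N 2 (2 * N) (by rw [map_mul, map_powDiff, ha, h₁, h₂])
    (by rw [map_sub, h₁, h₂])

/-- Elimination of a variable in `Γ₀`. -/
def parallelElim (F : RingElim c v δ gA gB 0 2) {a x₁ y₁ y₂ x₂ : A} {a' x₁' y₁' y₂' x₂' : B}
    (ha : v a = a') (h₁ : v x₁ = x₁') (h₁' : v y₁ = y₁') (h₂' : v y₂ = y₂') (h₂ : v x₂ = x₂') :
    MF.Elim c v δ 0 2 (parallelMF N gA a x₁ y₁ y₂ x₂) (parallelMF N gB a' x₁' y₁' y₂' x₂') :=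
  (arcElim F ha h₁' h₂).row N 2 (2 * N) (by rw [map_mul, map_powDiff, ha, h₁, h₂'])
    (by rw [map_sub, h₁, h₂'])

/-- Elimination of a variable in the contraction of `Γ₁`. -/
def contractedElim (F : RingElim c v δ gA gB 0 2) {a x₁ y₁ y₂ x₂ : A} {a' x₁' y₁' y₂' x₂' : B}
    (ha : v a = a') (h₁ : v x₁ = x₁') (h₁' : v y₁ = y₁') (h₂' : v y₂ = y₂') (h₂ : v x₂ = x₂') :
    MF.Elim c v δ 0 2 (contractedMF N gA a x₁ y₁ y₂ x₂) (contractedMF N gB a' x₁' y₁' y₂' x₂') :=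
  (((MF.Elim.base F).row N 2 (2 * N)
    (by rw [map_mul, map_U₁, map_add, map_add, map_mul, ha, h₁, h₁', h₂', h₂])
    (by rw [map_sub, map_add, map_add, h₁, h₁', h₂', h₂])).row N 2 (2 * N - 2)
    (by rw [map_mul, map_U₂, map_add, map_mul, map_mul, ha, h₁, h₁', h₂', h₂])
    (by rw [map_sub, map_mul, map_mul, h₁, h₁', h₂', h₂])).shift 0 (-1)

/-- The data for joining two pairs of ends of a crossing by arcs: the ring `B` is obtained from `A`
by identifying `yA` with `bA`, and the ring `S` from `B` by identifying `pB` with `xB`. -/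
structure Joining (c : B →+* A) (v : A →+* B) (c' : S →+* B) (v' : B →+* S)
    (gA : ℤ → ℤ → AddSubgroup A) (gB : ℤ → ℤ → AddSubgroup B) (gS : ℤ → ℤ → AddSubgroup S)
    (aA xA yA pA tA bA : A) (aB xB pB tB bB : B) (a x t b : S) : Prop where
  elim : RingElim c v (bA - yA) gA gB 0 2
  elim' : RingElim c' v' (pB - xB) gB gS 0 2
  grA : IsGradedRing gA
  grB : IsGradedRing gB
  grS : IsGradedRing gS
  c_a : c aB = aA
  c_x : c xB = xA
  c_p : c pB = pA
  c_t : c tB = tA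
  c_b : c bB = bA
  c'_a : c' a = aB
  c'_x : c' x = xB
  c'_t : c' t = tB
  c'_b : c' b = bB
  a_mem : a ∈ gS 2 0
  x_mem : x ∈ gS 0 2
  t_mem : t ∈ gS 0 2
  b_mem : b ∈ gS 0 2
  pB_mem : pB ∈ gB 0 2
  yA_mem : yA ∈ gA 0 2

namespace Joining

variable {aA xA yA pA tA bA : A} {aB xB pB tB bB : B} {a x t b : S}
  (J : Joining c v c' v' gA gB gS aA xA yA pA tA bA aB xB pB tB bB a x t b) (N : ℕ)

include J

theorem v_a : v aA = aB := by rw [← J.c_a, J.elim.ev_c]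
theorem v_x : v xA = xB := by rw [← J.c_x, J.elim.ev_c]
theorem v_p : v pA = pB := by rw [← J.c_p, J.elim.ev_c]
theorem v_t : v tA = tB := by rw [← J.c_t, J.elim.ev_c]
theorem v_b : v bA = bB := by rw [← J.c_b, J.elim.ev_c]
theorem v_y : v yA = bB := by
  rw [← J.v_b, eq_comm, ← sub_eq_zero, ← map_sub, J.elim.ev_δ]
theorem v'_a : v' aB = a := by rw [← J.c'_a, J.elim'.ev_c]
theorem v'_x : v' xB = x := by rw [← J.c'_x, J.elim'.ev_c]
theorem v'_t : v' tB = t := by rw [← J.c'_t, J.elim'.ev_c]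
theorem v'_b : v' bB = b := by rw [← J.c'_b, J.elim'.ev_c]
theorem v'_p : v' pB = x := by
  rw [← J.v'_x, ← sub_eq_zero, ← map_sub, J.elim'.ev_δ]
theorem aB_mem : aB ∈ gB 2 0 := by rw [← J.c'_a]; exact J.elim'.c_mem J.a_mem
theorem xB_mem : xB ∈ gB 0 2 := by rw [← J.c'_x]; exact J.elim'.c_mem J.x_mem
theorem tB_mem : tB ∈ gB 0 2 := by rw [← J.c'_t]; exact J.elim'.c_mem J.t_mem
theorem bB_mem : bB ∈ gB 0 2 := by rw [← J.c'_b]; exact J.elim'.c_mem J.b_mem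
theorem aA_mem : aA ∈ gA 2 0 := by rw [← J.c_a]; exact J.elim.c_mem J.aB_mem
theorem xA_mem : xA ∈ gA 0 2 := by rw [← J.c_x]; exact J.elim.c_mem J.xB_mem
theorem tA_mem : tA ∈ gA 0 2 := by rw [← J.c_t]; exact J.elim.c_mem J.tB_mem
theorem pA_mem : pA ∈ gA 0 2 := by rw [← J.c_p]; exact J.elim.c_mem J.pB_mem

end Joining

theorem parallelMF_w (N : ℕ) (gA : ℤ → ℤ → AddSubgroup A) (a x₁ y₁ y₂ x₂ : A) :
    (parallelMF N gA a x₁ y₁ y₂ x₂).w =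
      a * (x₁ ^ (N + 1) + y₁ ^ (N + 1) - x₂ ^ (N + 1) - y₂ ^ (N + 1)) := by
  simp only [parallelMF, arcMF, MF.row, MF.base, mul_assoc, powDiff_mul]
  ring

theorem contractedMF_w (N : ℕ) (gA : ℤ → ℤ → AddSubgroup A) (a x₁ y₁ y₂ x₂ : A) :
    (contractedMF N gA a x₁ y₁ y₂ x₂).w =
      a * (x₁ ^ (N + 1) + y₁ ^ (N + 1) - x₂ ^ (N + 1) - y₂ ^ (N + 1)) := by
  simp only [contractedMF, MF.row, MF.base, MF.shift, mul_assoc, U₁_mul, U₂_mul, psum2_eq]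
  ring

namespace Joining

variable {aA xA yA pA tA bA : A} {aB xB pB tB bB : B} {a x t b : S}
  (J : Joining c v c' v' gA gB gS aA xA yA pA tA bA aB xB pB tB bB a x t b) (N : ℕ)

/-- The elimination of the two variables in `Γ₀`. -/
def parallel : MF.HEquiv (c.comp c') (RingHom.id S)
    (((((parallelMF N gA aA xA yA pA tA).susp).shift (-1) (1 - N)).row N
      (aA * powDiff (N + 1) pA xA) (pA - xA) 2 (2 * N)).row N
      (aA * powDiff (N + 1) bA yA) (bA - yA) 2 (2 * N))
    (((parallelMF N gS a x b x t).susp).shift (-1) (1 - N)) :=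
  ((parallelElim J.elim J.v_a J.v_x J.v_y J.v_p J.v_t).susp.shift (-1) (1 - N)).excludeTwo
    ((parallelElim J.elim' J.v'_a J.v'_x J.v'_b J.v'_p J.v'_t).susp.shift (-1) (1 - N))
    J.elim J.elim' (((parallelMF_isHomogeneous J.grA N J.aA_mem J.xA_mem J.yA_mem J.pA_mem
      J.tA_mem).susp).shift _ _) (((parallelMF_isHomogeneous J.grB N J.aB_mem J.xB_mem J.bB_mem
      J.pB_mem J.tB_mem).susp).shift _ _)
    (by rw [map_mul, map_powDiff, J.v_a, J.v_p, J.v_x]) (by rw [map_sub, J.v_p, J.v_x])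
    (mul_powDiff_mem J.grA N J.aA_mem J.pA_mem J.xA_mem) (sub_mem J.pA_mem J.xA_mem)
    (by
      change c ((parallelMF N gB aB xB bB pB tB).w + _) = (parallelMF N gA aA xA yA pA tA).w + _ + _
      rw [parallelMF_w, parallelMF_w, mul_assoc, mul_assoc, mul_assoc, powDiff_mul, powDiff_mul,
        powDiff_mul]
      simp only [map_add, map_mul, map_sub, map_pow, J.c_a, J.c_x, J.c_b, J.c_p, J.c_t]
      ring)
    (by
      change c' (parallelMF N gS a x b x t).w = (parallelMF N gB aB xB bB pB tB).w + _
      rw [parallelMF_w, parallelMF_w, mul_assoc, powDiff_mul]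
      simp only [map_add, map_mul, map_sub, map_pow, J.c'_a, J.c'_x, J.c'_b, J.c'_t]
      ring)

/-- The elimination of the two variables in the contraction of `Γ₁`. -/
def contracted : MF.HEquiv (c.comp c') (RingHom.id S)
    (((((contractedMF N gA aA xA yA pA tA).susp).shift (-1) (-N)).row N
      (aA * powDiff (N + 1) pA xA) (pA - xA) 2 (2 * N)).row N
      (aA * powDiff (N + 1) bA yA) (bA - yA) 2 (2 * N))
    (((contractedMF N gS a x b x t).susp).shift (-1) (-N)) :=
  ((contractedElim J.elim J.v_a J.v_x J.v_y J.v_p J.v_t).susp.shift (-1) (-N)).excludeTwo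
    ((contractedElim J.elim' J.v'_a J.v'_x J.v'_b J.v'_p J.v'_t).susp.shift (-1) (-N))
    J.elim J.elim' (((contractedMF_isHomogeneous J.grA N J.aA_mem J.xA_mem J.yA_mem J.pA_mem
      J.tA_mem).susp).shift _ _) (((contractedMF_isHomogeneous J.grB N J.aB_mem J.xB_mem J.bB_mem
      J.pB_mem J.tB_mem).susp).shift _ _)
    (by rw [map_mul, map_powDiff, J.v_a, J.v_p, J.v_x]) (by rw [map_sub, J.v_p, J.v_x])
    (mul_powDiff_mem J.grA N J.aA_mem J.pA_mem J.xA_mem) (sub_mem J.pA_mem J.xA_mem)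
    (by
      change c ((contractedMF N gB aB xB bB pB tB).w + _) =
        (contractedMF N gA aA xA yA pA tA).w + _ + _
      rw [contractedMF_w, contractedMF_w, mul_assoc, mul_assoc, mul_assoc, powDiff_mul, powDiff_mul,
        powDiff_mul]
      simp only [map_add, map_mul, map_sub, map_pow, J.c_a, J.c_x, J.c_b, J.c_p, J.c_t]
      ring)
    (by
      change c' (contractedMF N gS a x b x t).w = (contractedMF N gB aB xB bB pB tB).w + _
      rw [contractedMF_w, contractedMF_w, mul_assoc, powDiff_mul]
      simp only [map_add, map_mul, map_sub, map_pow, J.c'_a, J.c'_x, J.c'_b, J.c'_t]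
      ring)

end Joining

end Join

/-! ### The arrow of a crossing with two pairs of ends joined -/

section Rows

variable {A : Type} [CommRing A]

/-- The tensor product with the factorizations of arcs from `x` to `p` and from `y` to `b`. -/
abbrev MF.joinRows (M : MF A) (N : ℕ) (a p x b y : A) : MF A :=
  (M.row N (a * powDiff (N + 1) p x) (p - x) 2 (2 * N)).row N
    (a * powDiff (N + 1) b y) (b - y) 2 (2 * N)

/-- The morphism of these tensor products. -/
abbrev MF.Hom.joinRows {M M' : MF A} (f : MF.Hom M M') (N : ℕ) (a p x b y : A) :
    MF.Hom (M.joinRows N a p x b y) (M'.joinRows N a p x b y) :=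
  (f.row N (a * powDiff (N + 1) p x) (p - x) 2 (2 * N)).row N
    (a * powDiff (N + 1) b y) (b - y) 2 (2 * N)

/-- The homotopy equivalence of these tensor products. -/
def MF.HEquiv.joinRows {M M' : MF A} (E : MF.HEquiv (RingHom.id A) (RingHom.id A) M M')
    (N : ℕ) (a p x b y : A) : MF.HEquiv (RingHom.id A) (RingHom.id A)
      (M.joinRows N a p x b y) (M'.joinRows N a p x b y) :=
  (E.row N (a * powDiff (N + 1) p x) (p - x) 2 (2 * N) rfl rfl rfl rfl).row N
    (a * powDiff (N + 1) b y) (b - y) 2 (2 * N) rfl rfl rfl rfl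

theorem contract_χ₀ (N : ℕ) (g : ℤ → ℤ → AddSubgroup A) (a x₁ y₁ y₂ x₂ : A)
    (u : (A × A) × (A × A)) : (contract N g a x₁ y₁ y₂ x₂).f ((χ₀ N g a x₁ y₁ y₂ x₂).f u) =
      jump₀ (a * twist (N + 1) x₁ y₁ y₂ x₂) x₁ x₂ u :=
  contract_expand N g a x₁ y₁ y₂ x₂ (jump₀ (a * twist (N + 1) x₁ y₁ y₂ x₂) x₁ x₂ u)

end Rows

theorem prodMap₄_jump₀ {R A : Type} [CommRing R] [CommRing A] (f : R →+* A) (k x₁ x₂ : R)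
    {k' x₁' x₂' : A} (hk : f k = k') (h₁ : f x₁ = x₁') (h₂ : f x₂ = x₂') (u) :
    prodMap₄ f (jump₀ k x₁ x₂ u) = jump₀ k' x₁' x₂' (prodMap₄ f u) := by
  subst hk h₁ h₂
  exact map_jump₀ f k x₁ x₂ u

section Join

variable {A B R : Type} [CommRing A] [CommRing B] [CommRing R] {c : B →+* A} {v : A →+* B}
  {c' : R[X] →+* B} {v' : B →+* R[X]} {gA : ℤ → ℤ → AddSubgroup A} {gB : ℤ → ℤ → AddSubgroup B}
  {g : ℤ → ℤ → AddSubgroup R}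
  {aA xA yA pA tA bA : A} {aB xB pB tB bB : B} {a t b : R}

namespace Joining

variable (J : Joining c v c' v' gA gB (polyGrading g) aA xA yA pA tA bA aB xB pB tB bB
  (Polynomial.C a) Polynomial.X (Polynomial.C t) (Polynomial.C b)) (N : ℕ)

/-- The factorization of `Γ₀` with two pairs of ends joined, straightened. -/
def straighten₀ : MF.HEquiv (c.comp c') (RingHom.id R[X])
    ((((parallelMF N gA aA xA yA pA tA).susp).shift (-1) (1 - N)).joinRows N aA pA xA bA yA)
    (((straight₀ N (polyGrading g) (Polynomial.C a) Polynomial.X (Polynomial.C b)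
      (Polynomial.C t)).susp).shift (-1) (1 - N)) :=
  (J.parallel N).trans (((parallelStraightenEquiv N J.grS J.a_mem J.x_mem J.b_mem
    J.t_mem).susp).shift (-1) (1 - N))

theorem straighten₀_c (u u' u'' u''' : (A × A) × (A × A)) :
    (J.straighten₀ N).c (((u, u'), (u'', u''')) : (((A × A) × (A × A)) × ((A × A) × (A × A))) ×
      (((A × A) × (A × A)) × ((A × A) × (A × A)))) =
    (parallelStraightenEquiv N J.grS J.a_mem J.x_mem J.b_mem J.t_mem).c
      (prodMap₄ v' (prodMap₄ v u)) := rfl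

variable [IsDomain A]

/-- The factorization of `Γ₁` with two pairs of ends joined, straightened. -/
def straighten₁ : MF.HEquiv (c.comp c') (RingHom.id R[X])
    ((((wideMF N gA aA xA yA pA tA).susp).shift (-1) (-N)).joinRows N aA pA xA bA yA)
    (((straight₁ N (polyGrading g) (Polynomial.C a) Polynomial.X (Polynomial.C b)
      (Polynomial.C t)).susp).shift (-1) (-N)) :=
  ((((((wideHEquiv N J.grA J.aA_mem J.xA_mem J.yA_mem J.pA_mem J.tA_mem).susp).shift
    (-1) (-N)).joinRows N aA pA xA bA yA).restrict (c.comp c') (fun _ => rfl) fun _ => rfl).trans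
    (J.contracted N)).trans
    (((contractedStraightenEquiv N J.grS J.x_mem).susp).shift (-1) (-N))

theorem straighten₁_c (u u' u'' u''' : (wideMF N gA aA xA yA pA tA).carrier) :
    (J.straighten₁ N).c (((u, u'), (u'', u''')) :
      ((wideMF N gA aA xA yA pA tA).carrier × (wideMF N gA aA xA yA pA tA).carrier) ×
      ((wideMF N gA aA xA yA pA tA).carrier × (wideMF N gA aA xA yA pA tA).carrier)) =
    (contractedStraightenEquiv (a := Polynomial.C a) (b := Polynomial.C b) (t := Polynomial.C t) N
      J.grS J.x_mem).c
      (prodMap₄ v' (prodMap₄ v ((contract N gA aA xA yA pA tA).f u))) := rfl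

theorem straighten_comm (u u' u'' u''' : (A × A) × (A × A)) :
    (J.straighten₁ N).c ((((χ₀ N gA aA xA yA pA tA).f u, (χ₀ N gA aA xA yA pA tA).f u'),
      ((χ₀ N gA aA xA yA pA tA).f u'', (χ₀ N gA aA xA yA pA tA).f u''')) :
      ((wideMF N gA aA xA yA pA tA).carrier × (wideMF N gA aA xA yA pA tA).carrier) ×
      ((wideMF N gA aA xA yA pA tA).carrier × (wideMF N gA aA xA yA pA tA).carrier)) =
    (straightHom N (polyGrading g) (Polynomial.C a) Polynomial.X (Polynomial.C b)
      (Polynomial.C t)).f ((J.straighten₀ N).c (((u, u'), (u'', u''')) :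
        (((A × A) × (A × A)) × ((A × A) × (A × A))) ×
        (((A × A) × (A × A)) × ((A × A) × (A × A))))) := by
  rw [J.straighten₁_c, J.straighten₀_c, contract_χ₀]
  rw [prodMap₄_jump₀ v _ _ _ (k' := aB * twist (N + 1) xB bB pB tB)
      (by rw [map_mul, map_twist, J.v_a, J.v_x, J.v_y, J.v_p, J.v_t]) J.v_x J.v_t,
    prodMap₄_jump₀ v' _ _ _ (k' := Polynomial.C a * twist (N + 1) Polynomial.X (Polynomial.C b)
      Polynomial.X (Polynomial.C t))
      (by rw [map_mul, map_twist, J.v'_a, J.v'_x, J.v'_b, J.v'_p, J.v'_t]) J.v'_x J.v'_t]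
  exact straighten_jump₀ N J.grS J.a_mem J.x_mem J.b_mem J.t_mem _

theorem straighten_comm' (x : ((((parallelMF N gA aA xA yA pA tA).susp).shift (-1)
      (1 - N)).joinRows N aA pA xA bA yA).carrier) :
    (J.straighten₁ N).c (((((χ₀ N gA aA xA yA pA tA).susp).shift (-1) (1 - N) (-1)
        (-N)).joinRows N aA pA xA bA yA).f x) =
    (((straightHom N (polyGrading g) (Polynomial.C a) Polynomial.X (Polynomial.C b)
        (Polynomial.C t)).susp).shift (-1) (1 - N) (-1) (-N)).f ((J.straighten₀ N).c x) :=
  J.straighten_comm N x.1.1 x.1.2 x.2.1 x.2.2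

/-- The arrow of the crossing with two pairs of ends joined is equivalent to the straightened
arrow. -/
def arrowEquiv {w : R} (h₀ : ((c.comp c').comp Polynomial.C) w =
      ((((parallelMF N gA aA xA yA pA tA).susp).shift (-1) (1 - N)).joinRows N aA pA xA bA yA).w)
    (h₁ : ((c.comp c').comp Polynomial.C) w =
      ((((wideMF N gA aA xA yA pA tA).susp).shift (-1) (-N)).joinRows N aA pA xA bA yA).w)
    (h₀' : Polynomial.C w = (straight₀ N (polyGrading g) (Polynomial.C a) Polynomial.X
      (Polynomial.C b) (Polynomial.C t)).w)
    (h₁' : Polynomial.C w = (straight₁ N (polyGrading g) (Polynomial.C a) Polynomial.X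
      (Polynomial.C b) (Polynomial.C t)).w) :
    Cx.ArrowEquiv (Cx.singleHom (((((χ₀ N gA aA xA yA pA tA).susp).shift (-1) (1 - N) (-1)
        (-N)).joinRows N aA pA xA bA yA).comap ((c.comp c').comp Polynomial.C) w h₀ h₁))
      (Cx.singleHom ((((straightHom N (polyGrading g) (Polynomial.C a) Polynomial.X
        (Polynomial.C b) (Polynomial.C t)).susp).shift (-1) (1 - N) (-1) (-N)).comap
        Polynomial.C w h₀' h₁')) :=
  Cx.ArrowEquiv.ofHEquiv
    ((J.straighten₀ N).restrict Polynomial.C (fun _ => rfl) fun _ => rfl)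
    ((J.straighten₁ N).restrict Polynomial.C (fun _ => rfl) fun _ => rfl)
    ((((χ₀ N gA aA xA yA pA tA).susp).shift (-1) (1 - N) (-1) (-N)).joinRows N aA pA xA bA yA)
    (((straightHom N (polyGrading g) (Polynomial.C a) Polynomial.X (Polynomial.C b)
        (Polynomial.C t)).susp).shift (-1) (1 - N) (-1) (-N))
    (J.straighten_comm' N) w h₀ h₁ h₀' h₁'

end Joining

end Join

/-! ### A negative crossing with two pairs of ends joined -/

/-- The inverse of an isomorphism. -/
def GrCx.Iso.symm {X Y : GrCx} (f : Iso X Y) : Iso Y X where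
  e := f.e.symm
  d := f.d_symm
  gr h := f.gr_symm h
  gr_symm h := f.gr h

theorem MF.joinRows_w {A : Type} [CommRing A] (M : MF A) (N : ℕ) (a p x b y : A) (r s : ℤ) :
    ((M.susp.shift r s).joinRows N a p x b y).w =
      M.w + a * (p ^ (N + 1) - x ^ (N + 1)) + a * (b ^ (N + 1) - y ^ (N + 1)) := by
  rw [← powDiff_mul, ← powDiff_mul, ← mul_assoc, ← mul_assoc]
  rfl

section Clasp

variable {A : Type} [CommRing A] (N : ℕ) (g : ℤ → ℤ → AddSubgroup A) (a x y p t b : A)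

/-- The complex of a negative crossing from `p` (left) and `t` (right) to `x` (left) and `y`
(right), together with arcs from `x` to `p` and from `y` to `b`. -/
abbrev joinedCx : Cx A :=
  Cx.twoTerm 0
    ((((parallelMF N g a x y p t).susp).shift (-1) (1 - N)).joinRows N a p x b y)
    ((((wideMF N g a x y p t).susp).shift (-1) (-N)).joinRows N a p x b y)
    ((((χ₀ N g a x y p t).susp).shift (-1) (1 - N) (-1) (-N)).joinRows N a p x b y)
    (congrArg (· + a * powDiff (N + 1) p x * (p - x) + a * powDiff (N + 1) b y * (b - y))
      (wideMF_w N g a x y p t))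

variable {N g a x y p t b}

/-- The tensor product of the complexes of the crossing and of the arcs. -/
def joinedCxIso (hg : IsGradedRing g) (ha : a ∈ g 2 0) (hx : x ∈ g 0 2) (hy : y ∈ g 0 2)
    (hp : p ∈ g 0 2) (ht : t ∈ g 0 2) : Cx.Iso (RingHom.id A)
      (((negativeCx N g a x y p t).tens (Cx.single (arcMF N g a p x))).tens
        (Cx.single (arcMF N g a b y))) (joinedCx N g a x y p t b) :=
  have h₀ := ((parallelMF_isHomogeneous hg N ha hx hy hp ht).susp.shift (-1) (1 - N))
  have h₁ := ((wideMF_isHomogeneous hg N ha hx hy hp ht).susp.shift (-1) (-N))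
  have hr := mul_powDiff_mem hg N ha hp hx
  have hd : p - x ∈ g (2 - 2) (2 * N + 2 - 2 * N) :=
    mem_of_mem (sub_mem hp hx) (by ring) (by ring)
  ((Cx.twoTermTens 0 (((χ₀ N g a x y p t).susp).shift (-1) (1 - N) (-1) (-N))
      (wideMF_w N g a x y p t) hg h₀ h₁ (a * powDiff (N + 1) p x) (p - x) 2 (2 * N)
      (congrArg (· + a * powDiff (N + 1) p x * (p - x)) (wideMF_w N g a x y p t))).tens
    (Cx.Iso.refl _)).trans
  (Cx.twoTermTens 0 _ _ hg (h₀.row hr hd) (h₁.row hr hd) (a * powDiff (N + 1) b y) (b - y) 2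
    (2 * N) _) fun _ => rfl

theorem joinedCx_isGradedModule (hg : IsGradedRing g) (ha : a ∈ g 2 0) (hx : x ∈ g 0 2)
    (hy : y ∈ g 0 2) (hp : p ∈ g 0 2) (ht : t ∈ g 0 2) (hb : b ∈ g 0 2) :
    (joinedCx N g a x y p t b).IsGradedModule g := by
  have hr := mul_powDiff_mem hg N ha hp hx
  have hd : p - x ∈ g (2 - 2) (2 * N + 2 - 2 * N) :=
    mem_of_mem (sub_mem hp hx) (by ring) (by ring)
  have hr' := mul_powDiff_mem hg N ha hb hy
  have hd' : b - y ∈ g (2 - 2) (2 * N + 2 - 2 * N) :=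
    mem_of_mem (sub_mem hb hy) (by ring) (by ring)
  have h₀ := (((parallelMF_isHomogeneous hg N ha hx hy hp ht).susp.shift (-1) (1 - N)).row hr
    hd).row hr' hd'
  have h₁ := (((wideMF_isHomogeneous hg N ha hx hy hp ht).susp.shift (-1) (-N)).row hr hd).row
    hr' hd'
  intro r j k ε i j' k' u hr hu
  exact ⟨Cx.IsHomogeneous.ite_bot_mem (LinearMap.lsmul A _ r).toAddMonoidHom id
      (fun _ => h₀.smul hr) hu.1,
    Cx.IsHomogeneous.ite_bot_mem (LinearMap.lsmul A _ r).toAddMonoidHom id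
      (fun _ => h₁.smul hr) hu.2⟩

end Clasp

theorem arcMF_w {A : Type} [CommRing A] (N : ℕ) (g : ℤ → ℤ → AddSubgroup A) (a x₁ x₂ : A) :
    (arcMF N g a x₁ x₂).w = a * (x₁ ^ (N + 1) - x₂ ^ (N + 1)) := by
  simp only [arcMF, MF.row, MF.base, mul_assoc, powDiff_mul, zero_add]

theorem C_potential {R : Type} [CommRing R] {g : ℤ → ℤ → AddSubgroup R}
    (N : ℕ) (a b t : R) :
    Polynomial.C (a * (b ^ (N + 1) - t ^ (N + 1))) = (straight₀ N
      (polyGrading g) (Polynomial.C a) Polynomial.X (Polynomial.C b) (Polynomial.C t)).w := by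
  change _ = (arcMF N _ _ _ _).w + _ * 0
  rw [arcMF_w, mul_zero, add_zero, map_mul, map_sub, map_pow, map_pow]

theorem C_potential' {R : Type} [CommRing R] {g : ℤ → ℤ → AddSubgroup R}
    (N : ℕ) (a b t : R) :
    Polynomial.C (a * (b ^ (N + 1) - t ^ (N + 1))) = (straight₁ N
      (polyGrading g) (Polynomial.C a) Polynomial.X (Polynomial.C b) (Polynomial.C t)).w :=
  (C_potential (g := g) N a b t).trans (by
    change _ + _ * 0 = _ + _ * 0
    rw [mul_zero, mul_zero])

namespace Joining

variable {A B R : Type} [CommRing A] [CommRing B] [CommRing R] {c : B →+* A} {v : A →+* B}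
  {c' : R[X] →+* B} {v' : B →+* R[X]} {gA : ℤ → ℤ → AddSubgroup A} {gB : ℤ → ℤ → AddSubgroup B}
  {g : ℤ → ℤ → AddSubgroup R} {aA xA yA pA tA bA : A} {aB xB pB tB bB : B} {a t b : R}
  (J : Joining c v c' v' gA gB (polyGrading g) aA xA yA pA tA bA aB xB pB tB bB
    (Polynomial.C a) Polynomial.X (Polynomial.C t) (Polynomial.C b)) (N : ℕ)

include J in
theorem map_potential : ((c.comp c').comp Polynomial.C) (a * (b ^ (N + 1) - t ^ (N + 1))) =
    ((((parallelMF N gA aA xA yA pA tA).susp).shift (-1) (1 - N)).joinRows N aA pA xA bA yA).w := by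
  rw [MF.joinRows_w, parallelMF_w]
  change c (c' (Polynomial.C (a * (b ^ (N + 1) - t ^ (N + 1))))) = _
  simp only [map_mul, map_sub, map_pow, J.c'_a, J.c'_b, J.c'_t, J.c_a, J.c_b, J.c_t]
  ring

include J in
theorem map_potential' : ((c.comp c').comp Polynomial.C) (a * (b ^ (N + 1) - t ^ (N + 1))) =
    ((((wideMF N gA aA xA yA pA tA).susp).shift (-1) (-N)).joinRows N aA pA xA bA yA).w := by
  rw [J.map_potential, MF.joinRows_w, MF.joinRows_w, wideMF_w]

/-- The complex of the crossing and the arcs as an arrow over `R`. -/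
abbrev arrow := Cx.singleHom (((((χ₀ N gA aA xA yA pA tA).susp).shift (-1) (1 - N) (-1)
  (-N)).joinRows N aA pA xA bA yA).comap ((c.comp c').comp Polynomial.C)
    (a * (b ^ (N + 1) - t ^ (N + 1))) (J.map_potential N) (J.map_potential' N))

/-- The cone of this arrow. -/
def coneIso {φ : R →+* A} (hφ : ∀ r, c (c' (Polynomial.C r)) = φ r) :
    Cx.Iso φ (Cx.cone (J.arrow N) rfl) (joinedCx N gA aA xA yA pA tA bA) :=
  (Cx.Iso.refl _).trans (Cx.coneTwoTerm _ _ _ _ (J.map_potential N) (J.map_potential' N) rfl) hφ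

/-- The homology of a tensor product with the complex of the crossing and the arcs. -/
def homotopyEquiv [Algebra ℚ[X] R] [Algebra ℚ[X] A] [IsDomain A] [Nontrivial R]
    (S : ArcSplitting N g a b t) (hg : IsGradedRing g) (hb : b ∈ g 0 2) (ht : t ∈ g 0 2)
    {φ : R →+* A} (hφ : ∀ r, c (c' (Polynomial.C r)) = φ r)
    (hφ' : ∀ r, φ (algebraMap ℚ[X] R r) = algebraMap ℚ[X] A r) {Y : Cx R} {Y' : Cx A}
    {L : List (Cx R)} {L' : List (Cx A)} (hL : ∀ P ∈ L, P.IsHomogeneous N)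
    (ctx : ∀ {K : Cx R}, Cx.Iso φ K (joinedCx N gA aA xA yA pA tA bA) →
      Cx.Iso φ (Cx.ctx Y L K) (Cx.ctx Y' L' (joinedCx N gA aA xA yA pA tA bA))) :
    GrCx.HomotopyEquiv (Cx.ctx Y' L' (joinedCx N gA aA xA yA pA tA bA)).H
      (GrCx.cone ((((Cx.single (arcMF N g a b t)).toRow a 1 (-(N + 1))).shift (-2) 0).ctx Y
        L).toHom.H) :=
  let I := (Cx.ctxCone Y (J.arrow N) rfl L hL).symm.trans (ctx (J.coneIso N hφ)) fun _ => rfl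
  ((((I.H hφ').symm.homotopyEquiv.trans (Cx.coneH _ _).homotopyEquiv)).trans
    ((J.arrowEquiv N (J.map_potential N) (J.map_potential' N) (C_potential N a b t)
      (C_potential' N a b t)).homotopyEquiv Y L)).trans
    ((S.arrowEquiv (C_potential N a b t) (C_potential' N a b t) hg hb ht).homotopyEquiv Y L)

end Joining

/-- The marked points of a stabilized diagram: the points of the diagram, and the upper right end of
the additional crossing, the bottom of the additional strand, and the upper left end of the
crossing. -/
theorem joining_points {P P' : Type} (e : Option (Option (Option P)) ≃ P') (b t : P) :
    Joining (renameHom (e ∘ some)) (evalPoint e (some (some b))) (polyIncl P) (polyEval P)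
      (pointGrading P') (pointGrading (Option (Option P))) (polyGrading (pointGrading P))
      (aVar P') (MvPolynomial.X (e (some (some none)))) (MvPolynomial.X (e none))
      (MvPolynomial.X (e (some none))) (MvPolynomial.X (e (some (some (some t)))))
      (MvPolynomial.X (e (some (some (some b))))) (aVar _) (MvPolynomial.X (some none))
      (MvPolynomial.X none) (MvPolynomial.X (some (some t))) (MvPolynomial.X (some (some b)))
      (Polynomial.C (aVar P)) Polynomial.X (Polynomial.C (MvPolynomial.X t))
      (Polynomial.C (MvPolynomial.X b)) where
  elim := ringElim_point e (some (some b))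
  elim' := ringElim_poly P
  grA := isGradedRing_pointGrading _
  grB := isGradedRing_pointGrading _
  grS := (isGradedRing_pointGrading P).poly
  c_a := renameHom_C _ _
  c_x := renameHom_X _ _
  c_p := renameHom_X _ _
  c_t := renameHom_X _ _
  c_b := renameHom_X _ _
  c'_a := (polyIncl_C _).trans (renameHom_C _ _)
  c'_x := polyIncl_X
  c'_t := (polyIncl_C _).trans (renameHom_X _ _)
  c'_b := (polyIncl_C _).trans (renameHom_X _ _)
  a_mem := C_mem_polyGrading aVar_mem
  x_mem := X_mem_polyGrading (isGradedRing_pointGrading P)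
  t_mem := C_mem_polyGrading (X_mem t)
  b_mem := C_mem_polyGrading (X_mem b)
  pB_mem := X_mem none
  yA_mem := X_mem _

theorem comp_polyIncl_C {P P' : Type} (e : Option (Option (Option P)) ≃ P') (x : PointRing P) :
    ((renameHom (e ∘ some)).comp (polyIncl P)).comp Polynomial.C x =
      renameHom (e ∘ some ∘ some ∘ some) x :=
  (congrArg (renameHom (e ∘ some)) (polyIncl_C x)).trans (MvPolynomial.rename_rename _ _ x)

namespace GrCx.Iso

/-- Composition. -/
def trans {X Y Z : GrCx} (f : Iso X Y) (g : Iso Y Z) : Iso X Z where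
  e := f.e.trans g.e
  d x := (congrArg g.e (f.d x)).trans (g.d _)
  gr h := g.gr (f.gr h)
  gr_symm h := f.gr_symm (g.gr_symm h)

/-- The shift of an isomorphism. -/
def shift {X Y : GrCx} (f : Iso X Y) (p q : ℤ) : Iso (X.shift p q) (Y.shift p q) where
  e := f.e
  d := f.d
  gr h := f.gr h
  gr_symm h := f.gr_symm h

end GrCx.Iso

namespace Cx

variable {R : Type} [CommRing R]

/-- Move a factor out of the last complex of a tensor product. -/
def ctxAssoc (Y P C : Cx R) :
    ∀ L, Iso (RingHom.id R) (ctx (P.tens Y) L C) (ctx Y L (C.tens P))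
  | [] => (assoc C P Y).symm
  | Q :: L => (Iso.refl Q).tens (ctxAssoc Y P C L)

theorem IsGradedModule.single {g : ℤ → ℤ → AddSubgroup R} {N : ℕ} {M : MF R}
    (h : M.IsHomogeneous g N) : (Cx.single M).IsGradedModule g := by
  intro r j k ε i j' k' x hr hx
  exact IsHomogeneous.ite_bot_mem (LinearMap.lsmul R M.carrier r).toAddMonoidHom id
    (fun _ => h.smul hr) hx

theorem IsGradedModule.ctx {g : ℤ → ℤ → AddSubgroup R} {Y C : Cx R}
    (h : (C.tens Y).IsGradedModule g) : ∀ L, (Cx.ctx Y L C).IsGradedModule g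
  | [] => h
  | P :: L => IsGradedModule.tens P (IsGradedModule.ctx h L)

variable [Algebra ℚ[X] R]

/-- The homology of the tensor product with the inclusion of `C` into its Koszul extension by
`(0, b)` is the map induced by the reduction modulo `b`. -/
def toRowConeIso {N : ℕ} {Y : Cx R} (hY : Y.IsHomogeneous N) (C : Cx R) (b : R) (p : ℤ)
    (L : List (Cx R)) (hC : (ctx Y L C).IsHomogeneous N) (hr : (ctx Y L C).IsRegular b p)
    (hw : (ctx Y L C).w = 0) (p' q' : ℤ) :
    GrCx.Iso (GrCx.cone (((C.toRow b (p - 1) (-(N + 1))).shift p' q').ctx Y L).toHom.H)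
      (GrCx.cone (((ctx Y L C).toQuot b).H.shift p' q')) :=
  GrCx.coneCongr _ _
    (((ctxShift Y C p' q' L).H fun _ => rfl).trans (shiftH _ p' q'))
    ((((ctxShift Y (C.row b (p - 1) (-(N + 1))) p' q' L).trans
      (shiftCongr p' q' (ctxRow Y hY C b (p - 1) (-(N + 1)) L)) fun _ => rfl).H fun _ => rfl).trans
      ((shiftH _ p' q').trans ((rowH hr hC hw).shift p' q')))
    fun c => by
      obtain ⟨x, hx, rfl⟩ := exists_hcls c
      have h : ∀ y (hy : (ctx Y L C).dmf y = 0) z, (ctxRow Y hY C b (p - 1) (-(N + 1)) L).e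
          (ctxMap Y (C.toRow b (p - 1) (-(N + 1))).f L y) = z → ∀ hz,
          (rowH hr hC hw).e (hcls _ z hz) = ((ctx Y L C).toQuot b).H.f (hcls _ y hy) := by
        intro y hy z hyz hz
        rw [← rowH_toRow hr hC hw]
        refine congrArg (rowH hr hC hw).e ?_
        rw [Hom.H_hcls]
        exact hcls_congr (hyz.symm.trans (ctxRow_toRow Y hY C b (p - 1) (-(N + 1)) L y))
      have hy : (ctx Y L C).dmf ((ctxShift Y C p' q' L).e x) = 0 :=
        ((ctxShift Y C p' q' L).dmf x).symm.trans
          ((congrArg (ctxShift Y C p' q' L).e hx).trans (map_zero _))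
      exact h _ hy _ (congrArg (ctxRow Y hY C b (p - 1) (-(N + 1)) L).e
        ((ctxShift_ctxMap Y p' q' (C.toRow b (p - 1) (-(N + 1))).f L x).symm.trans
          (congrArg (ctxShift Y (C.row b (p - 1) (-(N + 1))) p' q' L).e (LinearMap.congr_fun
            (SHom.ctx_f Y ((C.toRow b (p - 1) (-(N + 1))).shift p' q') L) x).symm))) _

end Cx

section Diagrams

variable (N : ℕ) {P : Type}

theorem diagramCx_append_cons (p : Piece P) (rest : List (Piece P)) :
    ∀ L : List (Piece P), diagramCx N (L ++ p :: rest) =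
      Cx.ctx (diagramCx N rest) (L.map (Piece.cx N)) (p.cx N)
  | [] => rfl
  | q :: L => congrArg (Cx.tens (q.cx N)) (diagramCx_append_cons p rest L)

theorem diagramCx_isGradedModule : ∀ L : List (Piece P),
    (diagramCx N L).IsGradedModule (pointGrading P)
  | [] => Cx.IsGradedModule.single (.base (isGradedRing_pointGrading P) N)
  | _ :: L => Cx.IsGradedModule.tens _ (diagramCx_isGradedModule L)

/-- Extension of scalars of a tensor product in which one factor is already extended. -/
def ctxBaseChange {Q : Type} (f : P → Q) (rest : List (Piece P)) {K : Cx (PointRing P)}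
    {K' : Cx (PointRing Q)} (hK : K'.IsGradedModule (pointGrading Q)) (I : Cx.Iso (renameHom f) K K') :
    ∀ L : List (Piece P), Cx.Iso (renameHom f) (Cx.ctx (diagramCx N rest) (L.map (Piece.cx N)) K)
      (Cx.ctx (diagramCx N (rest.map (Piece.map f))) ((L.map (Piece.map f)).map (Piece.cx N)) K')
  | [] => Cx.BaseChange.isoR (renameHom_mem f) (diagramBaseChange N f rest) I hK (isGradedRing_pointGrading P)
  | p :: L => Cx.BaseChange.isoL (renameHom_mem f) (p.baseChange N f) (ctxBaseChange f rest hK I L)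
      (Cx.IsGradedModule.ctx (Cx.IsGradedModule.tens _ (diagramCx_isGradedModule N _)) _)
      (isGradedRing_pointGrading P)

theorem isHomogeneous_of_mem_map (L : List (Piece P)) :
    ∀ C ∈ L.map (Piece.cx N), C.IsHomogeneous N := by
  intro C hC
  obtain ⟨p, -, rfl⟩ := List.mem_map.1 hC
  exact p.isHomogeneous N

/-- The graded complex of a diagram is regular with respect to `a`. -/
theorem diagramCx_isRegular (L : List (Piece P)) : (diagramCx N L).IsRegular (aVar P) 2 :=
  (diagramBaseChange N id L).B.isRegular (pointProjections P) (isGradedRing_pointGrading P)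
    aVar_mem aVar_mul_eq_zero

/-- The projections of the complex of a diagram to the homogeneous parts. -/
def diagramProjections (L : List (Piece P)) : Cx.Projections N (diagramCx N L) (aVar P) 2 :=
  (diagramBaseChange N id L).B.projections (pointProjections P) (isGradedRing_pointGrading P)
    (diagramCx_isHomogeneous N L) aVar_mem

end Diagrams

/-- The homology of a stabilized diagram. -/
def stabilizationEquiv (N : ℕ) {P P' : Type} (e : Option (Option (Option P)) ≃ P') (b t : P)
    (L rest : List (Piece P)) (hw : (diagramCx N (L ++ Piece.arc b t :: rest)).w = 0) :
    GrCx.HomotopyEquiv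
      (diagramCx N (L.map (Piece.map (e ∘ some ∘ some ∘ some)) ++
        Piece.crossing false (e (some (some none))) (e none) (e (some none))
          (e (some (some (some t)))) ::
        Piece.arc (e (some none)) (e (some (some none))) ::
        Piece.arc (e (some (some (some b)))) (e none) ::
        rest.map (Piece.map (e ∘ some ∘ some ∘ some)))).H
      (GrCx.cone (((diagramCx N (L ++ Piece.arc b t :: rest)).toQuot (aVar P)).H.shift (-2) 0)) := by
  have hL := diagramCx_isHomogeneous N (L ++ Piece.arc b t :: rest)
  have hr := diagramCx_isRegular N (L ++ Piece.arc b t :: rest)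
  rw [diagramCx_append_cons] at hw hL hr ⊢
  rw [diagramCx_append_cons]
  have hP' := isGradedRing_pointGrading P'
  let I := ((Cx.ctxAssoc _ _ _ _).trans (Cx.ctxAssoc _ _ _ _) fun _ => rfl).trans
    ((joinedCxIso (N := N) (b := MvPolynomial.X (e (some (some (some b))))) hP' aVar_mem
      (X_mem (e (some (some none)))) (X_mem (e none)) (X_mem (e (some none)))
      (X_mem (e (some (some (some t)))))).ctx (diagramCx N (rest.map (Piece.map
      (e ∘ some ∘ some ∘ some)))) ((L.map (Piece.map (e ∘ some ∘ some ∘ some))).map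
        (Piece.cx N))) fun _ => rfl
  refine (I.H fun _ => rfl).homotopyEquiv.trans ?_
  refine ((joining_points e b t).homotopyEquiv N (arcSplitting N (X_mem b) (X_mem t))
    (isGradedRing_pointGrading P) (X_mem b) (X_mem t) (comp_polyIncl_C e) (renameHom_C _)
    (isHomogeneous_of_mem_map N L) fun I => ctxBaseChange N _ rest (joinedCx_isGradedModule hP'
      aVar_mem (X_mem _) (X_mem _) (X_mem _) (X_mem _) (X_mem _)) I L).trans ?_
  exact (Cx.toRowConeIso (diagramCx_isHomogeneous N rest) _ _ 2 _ hL hr hw (-2) 0).homotopyEquiv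

/-! ### The potential of a closed braid -/

/-- The signed sum of the values of a function at the ends of a piece. -/
def Piece.weight {P G : Type} [AddCommGroup G] (V : P → G) : Piece P → G
  | .arc x₁ x₂ => V x₁ - V x₂
  | .crossing _ x₁ y₁ y₂ x₂ => V x₁ + V y₁ - V x₂ - V y₂

theorem Piece.weight_map {P Q G : Type} [AddCommGroup G] (V : Q → G) (f : P → Q) (p : Piece P) :
    (p.map f).weight V = p.weight (V ∘ f) := by
  cases p <;> rfl

theorem Piece.cx_w (N : ℕ) {P : Type} (p : Piece P) :
    (p.cx N).w = p.weight fun q => aVar P * MvPolynomial.X q ^ (N + 1) := by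
  match p with
  | .arc _ _ => exact (arcMF_w _ (pointGrading P) _ _ _).trans (mul_sub _ _ _)
  | .crossing true _ _ _ _ =>
    exact ((wideMF_w _ (pointGrading P) _ _ _ _ _).trans (parallelMF_w _ _ _ _ _ _ _)).trans
      (by simp only [weight]; ring)
  | .crossing false _ _ _ _ =>
    exact (parallelMF_w _ (pointGrading P) _ _ _ _ _).trans (by simp only [weight]; ring)

theorem diagramCx_w (N : ℕ) {P : Type} : ∀ L : List (Piece P), (diagramCx N L).w =
    (L.map (Piece.weight fun q => aVar P * MvPolynomial.X q ^ (N + 1))).sum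
  | [] => rfl
  | p :: L => congrArg₂ (· + ·) (p.cx_w N) (diagramCx_w N L)

namespace OpenBraid

/-- The ends of the interior edges cancel. -/
structure IsBalanced {m : ℕ} (B : OpenBraid m) : Prop where
  sum_weight : ∀ {G : Type} [AddCommGroup G] (V : B.Pt → G), (B.pieces.map (Piece.weight V)).sum =
    ∑ j, V (B.top j) - ∑ j, V (B.bot j)

theorem IsBalanced.cross {m : ℕ} {B : OpenBraid m} (h : B.IsBalanced) (i : Fin m) (pos : Bool) :
    (B.cross i pos).IsBalanced := by
  refine ⟨fun {G} _ (V : B.Pt ⊕ Bool → G) => ?_⟩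
  have hV : (B.pieces.map (Piece.weight V ∘ Piece.map Sum.inl)).sum =
      ∑ j, V (Sum.inl (B.top j)) - ∑ j, V (Sum.inl (B.bot j)) := by
    rw [show Piece.weight V ∘ Piece.map Sum.inl = Piece.weight (V ∘ Sum.inl) from
      funext (Piece.weight_map V Sum.inl)]
    exact h.sum_weight (V ∘ Sum.inl)
  have hne : i.castSucc ≠ i.succ := (Fin.castSucc_lt_succ).ne
  have key : ∀ a b : G, ∑ j, (if j = i.succ then a else if j = i.castSucc then b else
      V (Sum.inl (B.top j))) = a + b + (∑ j, V (Sum.inl (B.top j)) -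
        V (Sum.inl (B.top i.succ)) - V (Sum.inl (B.top i.castSucc))) := by
    intro a b
    rw [← Finset.add_sum_erase _ _ (Finset.mem_univ i.succ),
      ← Finset.add_sum_erase _ _ (Finset.mem_erase.2 ⟨hne, Finset.mem_univ i.castSucc⟩),
      ← Finset.add_sum_erase _ (fun j => V (Sum.inl (B.top j))) (Finset.mem_univ i.succ),
      ← Finset.add_sum_erase _ (fun j => V (Sum.inl (B.top j)))
        (Finset.mem_erase.2 ⟨hne, Finset.mem_univ i.castSucc⟩),
      if_pos rfl, if_neg hne, if_pos rfl, Finset.sum_congr rfl fun j hj => by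
        obtain ⟨h₁, h₂⟩ := Finset.mem_erase.1 hj
        rw [if_neg (Finset.mem_erase.1 h₂).1, if_neg h₁]]
    abel
  have htop : ∀ j, V ((B.cross i pos).top j) = if j = i.succ then V (Sum.inr true) else
      if j = i.castSucc then V (Sum.inr false) else V (Sum.inl (B.top j)) := fun j =>
    (apply_ite V _ _ _).trans (congrArg _ (apply_ite V _ _ _))
  change (List.map (Piece.weight V) ((B.pieces.map (Piece.map Sum.inl) ++ [Piece.crossing pos (Sum.inr true)
    (Sum.inr false) (Sum.inl (B.top i.succ)) (Sum.inl (B.top i.castSucc))] :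
      List (Piece (B.Pt ⊕ Bool))))).sum = ∑ j, V ((B.cross i pos).top j) - ∑ j, V (Sum.inl (B.bot j))
  rw [List.map_append, List.map_map, List.sum_append, hV, Finset.sum_congr rfl fun j _ => htop j,
    key]
  simp only [List.map_cons, List.map_nil, List.sum_singleton, Piece.weight]
  abel

theorem IsBalanced.closure_w {m : ℕ} {B : OpenBraid m} (h : B.IsBalanced) (N : ℕ) :
    (diagramCx N B.closure).w = 0 := by
  have hrev : ∀ f : Fin (m + 1) → PointRing B.Pt, ∑ j : Fin (m + 1), f j.rev = ∑ j, f j :=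
    Equiv.sum_comp Fin.revPerm
  rw [diagramCx_w, closure, List.map_append, List.sum_append, h.sum_weight, List.map_ofFn, List.sum_ofFn]
  simp only [Function.comp_apply, Piece.weight, Finset.sum_sub_distrib]
  rw [hrev fun j => aVar B.Pt * MvPolynomial.X (B.bot j) ^ (N + 1),
    hrev fun j => aVar B.Pt * MvPolynomial.X (B.top j) ^ (N + 1)]
  abel

end OpenBraid

theorem BraidWord.diagram_isBalanced {m : ℕ} (w : BraidWord m) : w.diagram.IsBalanced := by
  suffices H : ∀ (w : BraidWord m) (B : OpenBraid m), B.IsBalanced →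
      (w.foldl (fun B l => B.cross l.1 l.2) B).IsBalanced from
    H w _ ⟨fun {G} _ V => (sub_self _).symm⟩
  intro w
  induction w with
  | nil => exact fun B h => h
  | cons l w ih => exact fun B h => ih _ (h.cross l.1 l.2)

/-! ### Adding a strand -/

namespace OpenBraid

/-- `B'` is obtained from `B` by adding a strand on the left. -/
structure Extension {m : ℕ} (B : OpenBraid m) (B' : OpenBraid (m + 1)) where
  e : Option B.Pt ≃ B'.Pt
  bot : ∀ j, B'.bot j.castSucc = e (some (B.bot j))
  bot_last : B'.bot (Fin.last (m + 1)) = e none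
  top : ∀ j, B'.top j.castSucc = e (some (B.top j))
  top_last : B'.top (Fin.last (m + 1)) = e none
  pieces : B'.pieces = B.pieces.map (Piece.map (e ∘ some))

theorem map_map_piece {P Q S : Type} (f : P → Q) (g : Q → S) (L : List (Piece P)) :
    (L.map (Piece.map f)).map (Piece.map g) = L.map (Piece.map (g ∘ f)) := by
  rw [List.map_map]
  refine List.map_congr_left fun p _ => ?_
  cases p <;> rfl

/-- The trivial braid. -/
def Extension.trivial (m : ℕ) : Extension (OpenBraid.trivial m) (OpenBraid.trivial (m + 1)) where
  e := (finSuccEquivLast (n := m + 1)).symm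
  bot j := (finSuccEquivLast_symm_some j).symm
  bot_last := finSuccEquivLast_symm_none.symm
  top j := (finSuccEquivLast_symm_some j).symm
  top_last := finSuccEquivLast_symm_none.symm
  pieces := rfl

/-- A crossing of the old strands. -/
def Extension.cross {m : ℕ} {B : OpenBraid m} {B' : OpenBraid (m + 1)} (E : Extension B B')
    (i : Fin m) (pos : Bool) : Extension (B.cross i pos) (B'.cross i.castSucc pos) where
  e :=
    { toFun := fun p => p.elim (Sum.inl (E.e none)) (Sum.map (E.e ∘ some) id)
      invFun := Sum.elim (fun q => (E.e.symm q).map Sum.inl) fun c => some (Sum.inr c)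
      left_inv := by
        rintro (_ | q | c)
        · exact congrArg (Option.map Sum.inl) (E.e.symm_apply_apply none)
        · exact congrArg (Option.map Sum.inl) (E.e.symm_apply_apply (some q))
        · rfl
      right_inv := by
        rintro (q | c)
        · obtain ⟨q, rfl⟩ := E.e.surjective q
          refine (congrArg (fun o : Option B.Pt => (o.map Sum.inl).elim (Sum.inl (E.e none))
            (Sum.map (E.e ∘ some) id)) (E.e.symm_apply_apply q)).trans ?_
          cases q <;> rfl
        · rfl }
  bot j := congrArg Sum.inl (E.bot j)
  bot_last := congrArg Sum.inl E.bot_last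
  top j := by
    change (if j.castSucc = i.castSucc.succ then _ else if j.castSucc = i.castSucc.castSucc then _
      else Sum.inl (B'.top j.castSucc)) = Sum.map (E.e ∘ some) id (if j = i.succ then _ else
        if j = i.castSucc then _ else Sum.inl (B.top j))
    rw [E.top, Fin.succ_castSucc]
    simp only [Fin.castSucc_inj]
    split_ifs <;> rfl
  top_last := by
    change (if Fin.last _ = i.castSucc.succ then _ else if Fin.last _ = i.castSucc.castSucc then _
      else Sum.inl (B'.top (Fin.last _))) = _
    rw [Fin.succ_castSucc, if_neg (Fin.castSucc_lt_last _).ne', if_neg (Fin.castSucc_lt_last _).ne',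
      E.top_last]
    rfl
  pieces := by
    change B'.pieces.map (Piece.map Sum.inl) ++ [Piece.crossing pos _ _
      (Sum.inl (B'.top i.castSucc.succ)) (Sum.inl (B'.top i.castSucc.castSucc))] =
      (B.pieces.map (Piece.map Sum.inl) ++ [Piece.crossing pos (Sum.inr true) (Sum.inr false)
        (Sum.inl (B.top i.succ)) (Sum.inl (B.top i.castSucc))] : List (Piece (B.Pt ⊕ Bool))).map
        (Piece.map (Sum.map (E.e ∘ some) id))
    rw [Fin.succ_castSucc, E.top, E.top, E.pieces, List.map_append, map_map_piece, map_map_piece]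
    rfl

/-- Adding crossings of the old strands. -/
def Extension.foldl {m : ℕ} : ∀ (w : BraidWord m) {B : OpenBraid m} {B' : OpenBraid (m + 1)},
    Extension B B' → Extension (w.foldl (fun B l => B.cross l.1 l.2) B)
      ((w.map fun l => (l.1.castSucc, l.2)).foldl (fun B' l => B'.cross l.1 l.2) B')
  | [], _, _, E => E
  | l :: w, _, _, E => Extension.foldl w (E.cross l.1 l.2)

/-- Adding a strand to the diagram of a braid word. -/
def Extension.diagram {m : ℕ} (w : BraidWord m) : Extension w.diagram
    (BraidWord.diagram (w.map fun l => (l.1.castSucc, l.2))) :=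
  Extension.foldl w (Extension.trivial m)

/-- The marked points of the braid with an additional strand and an additional crossing. -/
def Extension.points {m : ℕ} {B : OpenBraid m} {B' : OpenBraid (m + 1)} (E : Extension B B') :
    Option (Option (Option B.Pt)) ≃ B'.Pt ⊕ Bool where
  toFun p := p.elim (Sum.inr false) fun p => p.elim (Sum.inl (E.e none)) fun p =>
    p.elim (Sum.inr true) fun q => Sum.inl (E.e (some q))
  invFun := Sum.elim (fun q => (E.e.symm q).elim (some none) fun q => some (some (some q)))
    fun c => if c then some (some none) else none
  left_inv := by rintro (_ | _ | _ | q) <;> simp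
  right_inv := by
    rintro (q | c)
    · obtain ⟨q, rfl⟩ := E.e.surjective q
      cases q <;> simp
    · cases c <;> rfl

theorem Extension.closure_cross {m : ℕ} {B : OpenBraid m} {B' : OpenBraid (m + 1)}
    (E : Extension B B') : (B'.cross (Fin.last m) false).closure =
      B.pieces.map (Piece.map (E.points ∘ some ∘ some ∘ some)) ++
        Piece.crossing false (E.points (some (some none))) (E.points none) (E.points (some none))
          (E.points (some (some (some (B.top (Fin.last m)))))) ::
        Piece.arc (E.points (some none)) (E.points (some (some none))) ::
        Piece.arc (E.points (some (some (some (B.bot (Fin.last m)))))) (E.points none) ::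
        (List.ofFn fun j : Fin m => Piece.arc (B.bot j.rev.castSucc) (B.top j.rev.castSucc)).map
          (Piece.map (E.points ∘ some ∘ some ∘ some)) := by
  let top : Fin (m + 2) → B'.Pt ⊕ Bool := fun j => if j = (Fin.last m).succ then Sum.inr true else
    if j = (Fin.last m).castSucc then Sum.inr false else Sum.inl (B'.top j)
  have htop : ∀ j, top j = if j = (Fin.last m).succ then Sum.inr true else
    if j = (Fin.last m).castSucc then Sum.inr false else Sum.inl (B'.top j) := fun _ => rfl
  change ((B'.pieces.map (Piece.map Sum.inl) ++ [Piece.crossing false (Sum.inr true)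
    (Sum.inr false) (Sum.inl (B'.top (Fin.last m).succ)) (Sum.inl (B'.top (Fin.last m).castSucc))] :
      List (Piece (B'.Pt ⊕ Bool))) ++ List.ofFn fun j : Fin (m + 2) =>
        Piece.arc (Sum.inl (B'.bot j.rev)) (top j.rev) : List (Piece (B'.Pt ⊕ Bool))) = _
  rw [E.pieces, map_map_piece, List.append_assoc, List.ofFn_succ, List.ofFn_succ,
    Fin.succ_last, E.top_last, E.top, List.map_ofFn]
  refine congrArg₂ (· ++ ·) rfl (congrArg₂ List.cons rfl (congrArg₂ List.cons ?_
    (congrArg₂ List.cons ?_ (congrArg List.ofFn (funext fun j => ?_)))))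
  · rw [Fin.rev_zero, E.bot_last, htop, Fin.succ_last, if_pos rfl]
    rfl
  · rw [Fin.rev_succ, Fin.rev_zero, E.bot, htop, Fin.succ_last,
      if_neg (Fin.castSucc_lt_last _).ne, if_pos rfl]
    rfl
  · have h : j.rev.castSucc.castSucc ≠ (Fin.last m).castSucc := fun h =>
      (Fin.castSucc_lt_last j.rev).ne (Fin.castSucc_injective _ h)
    rw [Fin.rev_succ, Fin.rev_succ, E.bot, htop, E.top, Fin.succ_last,
      if_neg (Fin.castSucc_lt_last _).ne, if_neg h]
    rfl

theorem closure_eq {m : ℕ} (B : OpenBraid m) : B.closure = B.pieces ++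
    Piece.arc (B.bot (Fin.last m)) (B.top (Fin.last m)) ::
      List.ofFn fun j : Fin m => Piece.arc (B.bot j.rev.castSucc) (B.top j.rev.castSucc) := by
  rw [closure, List.ofFn_succ, Fin.rev_zero]
  simp only [Fin.rev_succ]

end OpenBraid

theorem BraidWord.negStab_diagram {m : ℕ} (w : BraidWord m) : w.negStab.diagram =
    (BraidWord.diagram (w.map fun l => (l.1.castSucc, l.2))).cross (Fin.last m) false := by
  rw [negStab, diagram, List.foldl_append]
  rfl

/-- The homology of the closure of a negatively stabilized braid. -/
def BraidWord.negStabEquiv (N : ℕ) {m : ℕ} (w : BraidWord m) :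
    GrCx.HomotopyEquiv (w.negStab.homologyCx N) (GrCx.cone (w.π₀ N)) := by
  have h : w.negStab.homologyCx N = (diagramCx N (BraidWord.diagram
      (w.map fun l => (l.1.castSucc, l.2)) |>.cross (Fin.last m) false).closure).H :=
    congrArg (fun B : OpenBraid (m + 1) => (diagramCx N B.closure).H) w.negStab_diagram
  let E := OpenBraid.Extension.diagram w
  rw [h, E.closure_cross]
  suffices H : ∀ L, L = w.diagram.pieces ++ _ :: _ → (diagramCx N L).w = 0 →
      GrCx.HomotopyEquiv _ (GrCx.cone (((diagramCx N L).toQuot (aVar w.diagram.Pt)).H.shift (-2) 0))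
    from H _ w.diagram.closure_eq (w.diagram_isBalanced.closure_w N)
  rintro _ rfl hw
  exact stabilizationEquiv N E.points _ _ _ _ hw

end

end TransverseKR

theorem theorem1p4 (N m : ℕ) (w : TransverseKR.BraidWord m) :
    Nonempty (TransverseKR.GrCx.HomotopyEquiv (w.negStab.homologyCx N)
      (TransverseKR.GrCx.cone (w.π₀ N))) ∧
    ∃ (δ : (((w.reducedHomologyCx N).shift (-2) 0).Homology) →ₗ[Polynomial ℚ]
        (w.negStab.homologyCx N).Homology)
      (β : (w.negStab.homologyCx N).Homology →ₗ[Polynomial ℚ]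
        ((w.homologyCx N).shift (-2) 0).Homology),
      TransverseKR.GrCx.IsLongExact (w.π₀ N) δ β := by
  let P := TransverseKR.diagramProjections N w.diagram.closure
  refine ⟨⟨w.negStabEquiv N⟩, TransverseKR.GrCx.isLongExact_of_homotopyEquiv (w.π₀ N) ?_
    (P.H.shift (-2) 0) (P.quot.H.shift (-2) 0) ?_ (w.negStabEquiv N)⟩
  · intro ε i j k c hc
    obtain ⟨x, hx, hg, rfl⟩ := TransverseKR.Cx.mem_H_gr_iff.1 hc
    exact TransverseKR.Cx.mem_H_gr_iff.2 ⟨_, _, ⟨x, hg, rfl⟩, rfl⟩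
  · intro ε i j k c
    obtain ⟨x, hx, rfl⟩ := TransverseKR.Cx.exists_hcls c
    rfl
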